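/- **Setting.** Let $d\ge1$ be an integer and $\rho\in(0,2]$ with $\rho>\rho_c:=d/3$. Points of $\mathbb R^{d+1}$ are written $z=(z_0,z_1,\dots,z_d)$ with $z_0$ the time; $\|z\|_{\mathfrak s}=|z_0|^{1/\rho}+\sum_{i=1}^d|z_i|$, and $|k|_{\mathfrak s}=\rho k_0+\sum_{i=1}^d k_i$ for $k\in\mathbb N_0^{d+1}$. Let $K:\mathbb R^{d+1}\to\mathbb R$ be smooth on $\mathbb R^{d+1}\setminus\{0\}$, with $\sup_{z\neq0}|\partial^kK(z)|\,\|z\|_{\mathfrak s}^{d+|k|_{\mathfrak s}}<\infty$ for every multi-index $k$. Let $\varrho$ be a smooth compactly supported function with $\int\varrho=1$, $\varrho^\varepsilon(z)=\varepsilon^{-(\rho+d)}\varrho(\varepsilon^{-\rho}z_0,\varepsilon^{-1}z_1,\dots,\varepsilon^{-1}z_d)$, and $K^\varepsilon=K*\varrho^\varepsilon$. **Diagrams.** Let $\tau$ be a finite rooted tree that is a full binary tree (each node has $0$ or $2$ children) or an almost full one (the same, except for exactly one node, which has one child), and let $P$ be a partition of its leaves into pairs. $\Gamma=\Gamma(\tau,P)=(\mathscr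 V,\mathscr E)$ is the multigraph obtained by merging paired leaves, all edges being oriented towards the root, $e=(e_-,e_+)$. An edge that was adjacent to a leaf carries the kernel $K_e=K^\varepsilon$, the other edges carry $K_e=K$. For a subgraph $\gamma$ (a set of edges together with its end vertices), $\deg\gamma=(\rho+d)(|\mathscr V_\gamma|-1)-d|\mathscr E_\gamma|$. Assume that $\deg\Gamma\le0$ and that $\Gamma$ is connected and stays so when any one edge is removed. Fix an arbitrary total order on $\mathscr V$. A *divergent subdiagram* is a connected subgraph $\gamma\neq\Gamma$ with at least one edge and $\deg\gamma\le0$; it is *full* if it contains every edge of $\Gamma$ that joins two of its vertices. A *forest* is a set of divergent subdiagrams, any two of which are nested or vertex-disjoint; it is *full* if all its elements are. For $\gamma$ in a forest $\mathscr F$, its parent is the smallest element of $\mathscr F$ strictly containing $\gamma$, or $\Gamma$ if there is none. The children of $\Gamma$ in $\mathscr F$ are the maximal elements of $\mathscr F$. **Hepp sectors.** A Hepp tree $T$ is a binary tree with set of leaves $\mathscr V$, each inner node having exactly two offspring; $u\wedge v$ is the last common ancestor of two leaves. A scale assignment $\mathbf n$ maps the inner nodes of $T$ to $\mathbb N_0$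 and does not decrease from the root towards the leaves. Let $\Lambda\subset\mathbb R^{d+1}$ be bounded and $C$ a constant. Fix any map that associates with each configuration $z\in\Lambda^{\mathscr V}$ of distinct points a pair $\mathbf T=(T,\mathbf n)$ such that $$C^{-1}2^{-\mathbf n_{u\wedge v}}\le\|z_u-z_v\|_{\mathfrak s}\le C\,2^{-\mathbf n_{u\wedge v}}\qquad\text{for all }u\ne v .$$ The Hepp sector $D_{\mathbf T}$ is the set of configurations with which $\mathbf T$ is associated. **Safe and unsafe.** Contracting $\gamma$ reconnects to the first vertex of $\gamma$ (for the order on $\mathscr V$) all the half-edges that are attached to $\gamma$ without belonging to an edge of $\gamma$ (the *legs* of $\gamma$). For $\gamma\in\mathscr F$ let $\mathscr E^{\mathscr F}_\gamma$ be the edges of $\gamma$ that are in none of the smaller elements of $\mathscr F$, and $\partial\mathscr E^{\mathscr F}_\gamma$ the edges of the parent of $\gamma$ that are adjacent to $\gamma$ but not in $\gamma$. For an edge $e$ let $e^{\uparrow}$ be the last common ancestor in $T$ of the two ends that $e$ has once all the elements of $\mathscr F$ are contracted. Then $\gamma$ is *safe* in $\mathscr F$ if there are $e\in\partial\mathscr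 E^{\mathscr F}_\gamma$ and $e'\in\mathscr E^{\mathscr F}_\gamma$ such that $e^{\uparrow}$ equals $e'^{\uparrow}$ or descends from it (so that $\max_{e\in\partial\mathscr E^{\mathscr F}_\gamma}\mathbf n_{e^\uparrow}\ge\min_{e'\in\mathscr E^{\mathscr F}_\gamma}\mathbf n_{e'^\uparrow}$), and *unsafe* in $\mathscr F$ otherwise. A full forest is safe if all its elements are safe in it. Given a safe full forest $\mathscr F_{\mathrm s}$, its unsafe complement $\mathscr F_{\mathrm u}$ is the set of divergent subdiagrams $\gamma$ such that $\mathscr F_{\mathrm s}\cup\{\gamma\}$ is a full forest in which $\gamma$ is unsafe. **Renormalised integrand.** Consider functions $\Phi$ of the positions $y=(y_h)$ of all the half-edges $h$ of $\Gamma$. For fixed $z\in(\mathbb R^{d+1})^{\mathscr V}$ and a divergent $\gamma$ with first vertex $v$, let $\pi_\gamma y$ be obtained from $y$ by moving all the legs of $\gamma$ to $z_v$, and set $(\mathcal C^0_\gamma\Phi)(y)=\Phi(\pi_\gamma y)$ and $$(\hat{\mathscr C}_\gamma\Phi)(y)=\sum_{m}\ \prod_{h}\frac{(y_h-z_v)^{m_h}}{m_h!}\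 (\partial^m\Phi)(\pi_\gamma y),$$ the sum being over the families $m=(m_h)$ of multi-indices supported on the legs of $\gamma$ with $\deg\gamma+\sum_h|m_h|_{\mathfrak s}\le0$. Then $$\bigl(\mathscr W^K\hat{\mathscr R}_{[\mathscr F_{\mathrm s},\mathscr F_{\mathrm s}\cup\mathscr F_{\mathrm u}]}\Gamma\bigr)(z)$$ is the value, when each half-edge is at the position of the vertex to which it is attached, of the function obtained from $\Phi(y)=\prod_{e\in\mathscr E}K_e(y_{e_+}-y_{e_-})$ by applying, for all $\gamma\in\mathscr F_{\mathrm s}\cup\mathscr F_{\mathrm u}$ and each subdiagram before those it contains, the operators $-\mathcal C^0_\gamma$ if $\gamma\in\mathscr F_{\mathrm s}$ and $\mathrm{id}-\hat{\mathscr C}_\gamma$ if $\gamma\in\mathscr F_{\mathrm u}$. **Proposition.** For every $\varepsilon_0<1$ there is a constant $K_1>0$, depending only on $d$, $\rho$, the kernels (that is, on $K$ and $\varrho$), $\Lambda$, $C$ and $\varepsilon_0$, such that for all $(\tau,P)$ and $\Gamma=\Gamma(\tau,P)$ as above, all vertex orders, all families of Hepp sectors as above, all Hepp trees $T$ and all safe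 full forests $\mathscr F_{\mathrm s}$, with unsafe complement $\mathscr F_{\mathrm u}$: the number $\zeta$ of children of $\Gamma$ in $\mathscr F_{\mathrm s}$ having degree $0$ belongs to $\{0,1\}$, and for all $\varepsilon\in(0,\varepsilon_0]$ $$\sum_{\mathbf n}\ \sup_{z\in D_{(T,\mathbf n)}}\Bigl|\bigl(\mathscr W^K\hat{\mathscr R}_{[\mathscr F_{\mathrm s},\mathscr F_{\mathrm s}\cup\mathscr F_{\mathrm u}]}\Gamma\bigr)(z)\Bigr|\prod_{v\in T}2^{-(\rho+d)\mathbf n_v}\le\begin{cases}K_1^{|\mathscr E|}\,\varepsilon^{\deg\Gamma}\,(\log\varepsilon^{-1})^{\zeta}&\text{if }\deg\Gamma<0,\\[2pt]K_1^{|\mathscr E|}\,(\log\varepsilon^{-1})^{1+\zeta}&\text{if }\deg\Gamma=0.\end{cases}$$ Here the sum is over all scale assignments $\mathbf n$ of $T$, the product is over the inner nodes $v$ of $T$, and the supremum over an empty sector is $0$. -/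

import Mathlib

open scoped ContDiff

noncomputable section

/-! ### Partial derivatives and space-time kernels -/

/-- Partial derivative of `f` in the coordinate `a`. -/
def pderiv {ι : Type} [DecidableEq ι] (a : ι) (f : (ι → ℝ) → ℝ) : (ι → ℝ) → ℝ :=
  fun x => deriv (fun s => f (Function.update x a s)) (x a)

/-- The mixed partial derivative `∂^k f` for a multi-index `k` (the coordinates are taken in some
fixed order). -/
def mderiv {ι : Type} [Fintype ι] [DecidableEq ι] (k : ι → ℕ) (f : (ι → ℝ) → ℝ) :
    (ι → ℝ) → ℝ :=
  (Finset.univ : Finset ι).toList.foldr (fun a g => (pderiv a)^[k a] g) f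

/-- Space-time `ℝ^{d+1}`; the coordinate `0` is time. -/
abbrev Spacetime (d : ℕ) : Type := Fin (d + 1) → ℝ

/-- The fractional scaling `(ρ, 1, …, 1)`. -/
def scaling (ρ : ℝ) (d : ℕ) : Fin (d + 1) → ℝ := Fin.cons ρ (fun _ => 1)

/-- The scaled pseudonorm `|z_0|^{1/ρ} + ∑ |z_i|`. -/
def scaledNorm {d : ℕ} (ρ : ℝ) (z : Spacetime d) : ℝ :=
  |z 0| ^ (1 / ρ) + ∑ i : Fin d, |z i.succ|

/-- `K` is a kernel of degree `a`: it is smooth away from the origin and each of its derivatives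
satisfies the scaled bound `|∂^k K(z)| ≲ ‖z‖^{a - |k|}`. -/
structure IsSingularKernel {d : ℕ} (ρ a : ℝ) (K : Spacetime d → ℝ) : Prop where
  smooth : ContDiffOn ℝ ∞ K {0}ᶜ
  bound : ∀ k : Fin (d + 1) → ℕ, ∃ M : ℝ, ∀ z : Spacetime d, z ≠ 0 →
    |mderiv k K z| ≤ M * scaledNorm ρ z ^ (a - ∑ i, scaling ρ d i * (k i : ℝ))

/-- A mollifier: smooth, compactly supported, of integral one. -/
structure IsMollifier {d : ℕ} (ϱ : Spacetime d → ℝ) : Prop where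
  smooth : ContDiff ℝ ∞ ϱ
  compact : HasCompactSupport ϱ
  integral_one : ∫ z, ϱ z = 1

/-- The rescaled mollifier `ϱ^ε(t,x) = ε^{-(ρ+d)} ϱ(ε^{-ρ} t, ε^{-1} x)`. -/
def rescale {d : ℕ} (ρ ε : ℝ) (ϱ : Spacetime d → ℝ) : Spacetime d → ℝ :=
  fun z => ε ^ (-(ρ + d)) * ϱ (fun i => ε ^ (-scaling ρ d i) * z i)

/-- The mollified kernel `K^ε = K * ϱ^ε`. -/
def mollify {d : ℕ} (ρ ε : ℝ) (ϱ K : Spacetime d → ℝ) : Spacetime d → ℝ :=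
  fun z => ∫ w, K (z - w) * rescale ρ ε ϱ w

/-! ### Feynman diagrams -/

/-- The two types of edges: those carrying the bare kernel `K`, and those carrying `K^ε`. -/
inductive EdgeType
  | bare
  | mollified

/-- The degree of an edge type: both types have degree `-d`. -/
def EdgeType.degree (d : ℕ) : EdgeType → ℝ
  | .bare => -(d : ℝ)
  | .mollified => -(d : ℝ)

/-- The kernel attached to an edge type. -/
def EdgeType.kernel {d : ℕ} (ρ ε : ℝ) (ϱ K : Spacetime d → ℝ) : EdgeType → Spacetime d → ℝ
  | .bare => K
  | .mollified => mollify ρ ε ϱ K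

/-- A vacuum Feynman diagram: an oriented multigraph with a distinguished vertex and typed edges.
The edge `e` goes from `src e` (that is, `e_-`) to `tgt e` (that is, `e_+`). -/
structure FeynmanDiagram (V E : Type) where
  star : V
  src : E → V
  tgt : E → V
  type : E → EdgeType

namespace FeynmanDiagram

variable {V E : Type} [Fintype V] [LinearOrder V] [Fintype E] [DecidableEq E]

/-- The degree of the whole diagram. -/
def degree (ρ : ℝ) (d : ℕ) (Γ : FeynmanDiagram V E) : ℝ :=
  (ρ + d) * ((Fintype.card V : ℝ) - 1) + ∑ e, (Γ.type e).degree d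

/-! Subgraphs without isolated vertices are given by their sets of edges. -/

/-- The vertices of the subgraph with edge set `γ`. -/
def vertices (Γ : FeynmanDiagram V E) (γ : Finset E) : Finset V :=
  γ.image Γ.src ∪ γ.image Γ.tgt

/-- The degree of the subgraph with edge set `γ`. -/
def subdegree (ρ : ℝ) (d : ℕ) (Γ : FeynmanDiagram V E) (γ : Finset E) : ℝ :=
  (ρ + d) * (((Γ.vertices γ).card : ℝ) - 1) + ∑ e ∈ γ, (Γ.type e).degree d

/-- The adjacency relation given by the edges in `γ`. -/
def graph (Γ : FeynmanDiagram V E) (γ : Finset E) : SimpleGraph V :=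
  SimpleGraph.fromRel (fun u v => ∃ e ∈ γ, Γ.src e = u ∧ Γ.tgt e = v)

/-- `γ` is a connected subgraph with at least one edge. -/
def IsConnectedSubgraph (Γ : FeynmanDiagram V E) (γ : Finset E) : Prop :=
  γ.Nonempty ∧ ∀ u ∈ Γ.vertices γ, ∀ v ∈ Γ.vertices γ, (Γ.graph γ).Reachable u v

/-- The diagram is at least 2-connected: it is connected, and the removal of any single edge does
not disconnect it. -/
def IsTwoConnected (Γ : FeynmanDiagram V E) : Prop :=
  (Γ.graph Finset.univ).Connected ∧ ∀ e : E, (Γ.graph (Finset.univ.erase e)).Connected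

open Classical in
/-- The divergent subdiagrams: the proper connected subgraphs of degree at most zero. -/
def divergent (ρ : ℝ) (d : ℕ) (Γ : FeynmanDiagram V E) : Finset (Finset E) :=
  Finset.univ.filter fun γ =>
    γ ≠ Finset.univ ∧ Γ.IsConnectedSubgraph γ ∧ Γ.subdegree ρ d γ ≤ 0

/-- `γ` is full: it contains all the edges that join two of its vertices. -/
def IsFullSubgraph (Γ : FeynmanDiagram V E) (γ : Finset E) : Prop :=
  ∀ e : E, Γ.src e ∈ Γ.vertices γ → Γ.tgt e ∈ Γ.vertices γ → e ∈ γ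

/-- A forest: a set of divergent subdiagrams, any two of which are nested or vertex-disjoint. -/
def IsForest (ρ : ℝ) (d : ℕ) (Γ : FeynmanDiagram V E) (F : Finset (Finset E)) : Prop :=
  F ⊆ Γ.divergent ρ d ∧
    ∀ γ ∈ F, ∀ γ' ∈ F, γ ⊆ γ' ∨ γ' ⊆ γ ∨ Disjoint (Γ.vertices γ) (Γ.vertices γ')

/-- A full forest: a forest all of whose elements are full. -/
def IsFullForest (ρ : ℝ) (d : ℕ) (Γ : FeynmanDiagram V E) (F : Finset (Finset E)) : Prop :=
  Γ.IsForest ρ d F ∧ ∀ γ ∈ F, Γ.IsFullSubgraph γ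

/-- The parent of `γ` in the forest `F`: the smallest element of `F` strictly containing `γ`, or
the whole diagram if there is none (the intersection of an empty family is everything). -/
def parentIn (F : Finset (Finset E)) (γ : Finset E) : Finset E :=
  (F.filter fun γ' => γ ⊂ γ').inf id

/-- The edges of `γ` that do not belong to any of its children in `F`. -/
def ownEdges (F : Finset (Finset E)) (γ : Finset E) : Finset E :=
  γ \ (F.filter fun γ' => γ' ⊂ γ).sup id

/-- The edges of the parent of `γ` in `F` that are adjacent to `γ`, but not in `γ`. -/
def boundaryEdges (Γ : FeynmanDiagram V E) (F : Finset (Finset E)) (γ : Finset E) : Finset E :=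
  (parentIn F γ \ γ).filter fun e => Γ.src e ∈ Γ.vertices γ ∨ Γ.tgt e ∈ Γ.vertices γ

/-- The number of children of the whole diagram in `F` that have degree zero. -/
def zeta (ρ : ℝ) (d : ℕ) (Γ : FeynmanDiagram V E) (F : Finset (Finset E)) : ℕ :=
  Set.ncard {γ : Finset E | γ ∈ F ∧ (∀ γ' ∈ F, ¬ γ ⊂ γ') ∧ Γ.subdegree ρ d γ = 0}

/-- The first vertex of `γ`, for the chosen order on vertices. -/
def firstVertex (Γ : FeynmanDiagram V E) (γ : Finset E) : V :=
  if h : (Γ.vertices γ).Nonempty then (Γ.vertices γ).min' h else Γ.star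

/-- The vertex to which a half-edge is attached: `(e, false)` stands for the source end of `e`,
and `(e, true)` for its target end. -/
def attach (Γ : FeynmanDiagram V E) (h : E × Bool) : V :=
  if h.2 then Γ.tgt h.1 else Γ.src h.1

/-- The legs of `γ`: the half-edges that are attached to a vertex of `γ`, but do not belong to an
edge of `γ`. -/
def legs (Γ : FeynmanDiagram V E) (γ : Finset E) : Finset (E × Bool) :=
  Finset.univ.filter fun h => h.1 ∉ γ ∧ Γ.attach h ∈ Γ.vertices γ

/-- The vertex to which a half-edge is attached once all the elements of the forest `F` have been
contracted, each contraction reconnecting the legs of `γ` to the first vertex of `γ`. The elements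
of `F` having `h` as a leg form a chain, so that their union is the largest of them. -/
def contractedAttach (Γ : FeynmanDiagram V E) (F : Finset (Finset E)) (h : E × Bool) : V :=
  if (F.filter fun γ => h ∈ Γ.legs γ).Nonempty then
    Γ.firstVertex ((F.filter fun γ => h ∈ Γ.legs γ).sup id)
  else Γ.attach h

end FeynmanDiagram

/-! ### Hepp trees and Hepp sectors -/

/-- A binary tree with set of leaves `V`. An inner node is represented by the set of leaves that
descend from it; thus `A ⊆ B` means that `A` is a descendant of `B` or equal to it. The root is the
set of all leaves, and each inner node has exactly two offspring, each being a leaf or an inner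
node. -/
structure HeppTree (V : Type) [Fintype V] [DecidableEq V] where
  inner : Finset (Finset V)
  root_mem : Finset.univ ∈ inner
  laminar : ∀ A ∈ inner, ∀ B ∈ inner, A ⊆ B ∨ B ⊆ A ∨ Disjoint A B
  binary : ∀ A ∈ inner, ∃ B₁ B₂ : Finset V,
    Disjoint B₁ B₂ ∧ B₁ ∪ B₂ = A ∧
      (B₁ ∈ inner ∨ B₁.card = 1) ∧ (B₂ ∈ inner ∨ B₂.card = 1) ∧
      B₁.Nonempty ∧ B₂.Nonempty

namespace HeppTree

variable {V : Type} [Fintype V] [DecidableEq V]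

/-- The first common ancestor of two distinct leaves. -/
def lca (T : HeppTree V) (u v : V) : Finset V :=
  (T.inner.filter fun A => u ∈ A ∧ v ∈ A).inf id

/-- A scale assignment on `T`: a map from the inner nodes to `ℕ`, increasing from the root to the
leaves. -/
def Scales (T : HeppTree V) : Type :=
  {n : {A // A ∈ T.inner} → ℕ // ∀ A B, A.1 ⊆ B.1 → n B ≤ n A}

/-- The scale of the first common ancestor of two distinct leaves. -/
def scaleOf (T : HeppTree V) (n : T.Scales) (u v : V) : ℕ :=
  if h : T.lca u v ∈ T.inner then n.1 ⟨T.lca u v, h⟩ else 0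

end HeppTree

/-- A way of associating, with any configuration of distinct points of `Λ`, a Hepp tree and a scale
assignment such that the distance between two points is comparable, with constant `C`, to
`2^{-n}`, where `n` is the scale of their first common ancestor. -/
structure HeppAssignment {d : ℕ} (ρ : ℝ) (Λ : Set (Spacetime d)) (C : ℝ)
    (V : Type) [Fintype V] [DecidableEq V] where
  data : (V → Spacetime d) → Σ T : HeppTree V, T.Scales
  comparable : ∀ z : V → Spacetime d, (∀ v, z v ∈ Λ) → Function.Injective z →
    ∀ u v : V, u ≠ v →
      C⁻¹ * (2 : ℝ) ^ (-((data z).1.scaleOf (data z).2 u v : ℝ)) ≤ scaledNorm ρ (z u - z v) ∧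
      scaledNorm ρ (z u - z v) ≤ C * (2 : ℝ) ^ (-((data z).1.scaleOf (data z).2 u v : ℝ))

/-- The Hepp sector: the configurations of distinct points of `Λ` with which the tree `T` and the
scales `n` are associated. -/
def HeppAssignment.sector {d : ℕ} {ρ : ℝ} {Λ : Set (Spacetime d)} {C : ℝ}
    {V : Type} [Fintype V] [DecidableEq V] (H : HeppAssignment ρ Λ C V)
    (T : HeppTree V) (n : T.Scales) : Set (V → Spacetime d) :=
  {z | (∀ v, z v ∈ Λ) ∧ Function.Injective z ∧ H.data z = ⟨T, n⟩}

/-- The sum over the scale assignments `n` of `T` of the supremum over the Hepp sector `(T, n)` of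
the absolute value of the function `W`, weighted by the product of the `2^{-(ρ+d) n_v}`. -/
def heppSum {d : ℕ} {ρ : ℝ} {Λ : Set (Spacetime d)} {C : ℝ} {V : Type} [Fintype V]
    [DecidableEq V] (H : HeppAssignment ρ Λ C V) (T : HeppTree V)
    (W : (V → Spacetime d) → ℝ) : ENNReal :=
  ∑' n : T.Scales, (⨆ z ∈ H.sector T n, ENNReal.ofReal |W z|) *
    ENNReal.ofReal (∏ A : {A // A ∈ T.inner}, (2 : ℝ) ^ (-(ρ + d) * (n.1 A : ℝ)))

/-! ### Safe and unsafe forests, and the renormalised integrand -/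

namespace FeynmanDiagram

variable {V E : Type} [Fintype V] [LinearOrder V] [Fintype E] [DecidableEq E]

/-- The first common ancestor in `T` of the two ends that `e` has after the contraction of `F`. -/
def edgeNode (Γ : FeynmanDiagram V E) (T : HeppTree V) (F : Finset (Finset E)) (e : E) :
    Finset V :=
  T.lca (Γ.contractedAttach F (e, false)) (Γ.contractedAttach F (e, true))

/-- `γ` is safe in `F`: the largest scale of its boundary edges is at least the smallest scale of
its own edges. Scales are compared through the order of the tree `T`: the scale of `e` is at least
that of `e'` for all strictly increasing scale assignments when the node of `e` descends from that
of `e'`. -/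
def IsSafeIn (Γ : FeynmanDiagram V E) (T : HeppTree V) (F : Finset (Finset E)) (γ : Finset E) :
    Prop :=
  ∃ e ∈ Γ.boundaryEdges F γ, ∃ e' ∈ ownEdges F γ, Γ.edgeNode T F e ⊆ Γ.edgeNode T F e'

/-- A safe full forest. -/
def IsSafeForest (ρ : ℝ) (d : ℕ) (Γ : FeynmanDiagram V E) (T : HeppTree V)
    (F : Finset (Finset E)) : Prop :=
  Γ.IsFullForest ρ d F ∧ ∀ γ ∈ F, Γ.IsSafeIn T F γ

open Classical in
/-- The unsafe complement of `F`: the divergent subdiagrams that are unsafe for `F`. -/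
def unsafePart (ρ : ℝ) (d : ℕ) (Γ : FeynmanDiagram V E) (T : HeppTree V)
    (F : Finset (Finset E)) : Finset (Finset E) :=
  (Γ.divergent ρ d).filter fun γ =>
    Γ.IsFullForest ρ d (insert γ F) ∧ ¬ Γ.IsSafeIn T (insert γ F) γ

/-! The product of kernels is regarded as a function of the positions of all the half-edges, so
that contractions act on functions of these positions. -/

/-- Coordinates of the positions of all half-edges. -/
abbrev HalfEdgeCoord (E : Type) (d : ℕ) : Type := (E × Bool) × Fin (d + 1)

/-- The product over all edges of the kernels `K_{t(e)}(y_{e_+} - y_{e_-})`. -/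
def kernelProduct {d : ℕ} (Γ : FeynmanDiagram V E) (k : EdgeType → Spacetime d → ℝ) :
    (HalfEdgeCoord E d → ℝ) → ℝ :=
  fun y => ∏ e, k (Γ.type e) (fun i => y ((e, true), i) - y ((e, false), i))

/-- Move the legs of `γ` to the point `p`. -/
def moveLegs {d : ℕ} (Γ : FeynmanDiagram V E) (γ : Finset E) (p : Spacetime d)
    (y : HalfEdgeCoord E d → ℝ) : HalfEdgeCoord E d → ℝ :=
  fun a => if a.1 ∈ Γ.legs γ then p a.2 else y a

/-- The contraction of `γ` without decorations: the legs of `γ` are reconnected to its first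
vertex. -/
def contract {d : ℕ} (Γ : FeynmanDiagram V E) (z : V → Spacetime d) (γ : Finset E)
    (Φ : (HalfEdgeCoord E d → ℝ) → ℝ) : (HalfEdgeCoord E d → ℝ) → ℝ :=
  fun y => Φ (Γ.moveLegs γ (z (Γ.firstVertex γ)) y)

/-- The contraction of `γ` with decorations: the sum over all the edge decorations `m` supported on
the legs of `γ` that leave the decorated degree of `γ` nonpositive. A decoration differentiates the
kernel of the leg, and multiplies by the corresponding monomial centred at the first vertex of `γ`.
(The sign of the decorations of outgoing legs comes from the chain rule.) -/
def taylorContract {d : ℕ} (ρ : ℝ) (Γ : FeynmanDiagram V E) (z : V → Spacetime d) (γ : Finset E)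
    (Φ : (HalfEdgeCoord E d → ℝ) → ℝ) : (HalfEdgeCoord E d → ℝ) → ℝ :=
  fun y => ∑ᶠ m : {m : HalfEdgeCoord E d → ℕ //
      (∀ a, a.1 ∉ Γ.legs γ → m a = 0) ∧
        Γ.subdegree ρ d γ + ∑ a, scaling ρ d a.2 * (m a : ℝ) ≤ 0},
    (∏ a, (y a - z (Γ.firstVertex γ) a.2) ^ m.1 a / ((m.1 a).factorial : ℝ)) *
      mderiv m.1 Φ (Γ.moveLegs γ (z (Γ.firstVertex γ)) y)

/-- The integrand of the diagram renormalised on the forest interval `[Fs, Fs ∪ Fu]`: the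
subdiagrams in `Fs` are extracted by minus the contraction, those in `Fu` are renormalised by the
identity minus the decorated contraction. The operators are applied by decreasing size of the
subdiagrams, so that a subdiagram is treated before those that it contains. -/
def renormalisedIntegrand {d : ℕ} (ρ : ℝ) (Γ : FeynmanDiagram V E)
    (k : EdgeType → Spacetime d → ℝ) (Fs Fu : Finset (Finset E)) (z : V → Spacetime d) : ℝ :=
  ((Fs ∪ Fu).toList.insertionSort (fun γ γ' => γ'.card ≤ γ.card)).foldl
    (fun Φ γ => if γ ∈ Fs then -Γ.contract z γ Φ else Φ - Γ.taylorContract ρ z γ Φ)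
    (Γ.kernelProduct k)
    (fun a => z (Γ.attach a.1) a.2)

end FeynmanDiagram

/-! ### Binary trees and pairings -/

/-- A rooted tree with set of nodes `N`. -/
structure SymbolTree (N : Type) where
  root : N
  parent : N → N
  parent_root : parent root = root
  reaches_root : ∀ v, ∃ k : ℕ, parent^[k] v = root

namespace SymbolTree

variable {N : Type}

/-- The children of a node. -/
def children (τ : SymbolTree N) (v : N) : Set N := {w | w ≠ τ.root ∧ τ.parent w = v}

/-- A leaf is a node without children. -/
def IsLeaf (τ : SymbolTree N) (v : N) : Prop := τ.children v = ∅

/-- Full binary tree: each node has either two children or no child. -/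
def IsFull (τ : SymbolTree N) : Prop :=
  ∀ v, (τ.children v).ncard = 0 ∨ (τ.children v).ncard = 2

/-- Almost full binary tree: a full binary tree with one edge missing, that is, each node has two
children or no child, except for exactly one node that has one child. -/
def IsAlmostFull (τ : SymbolTree N) : Prop :=
  ∃ u, (τ.children u).ncard = 1 ∧
    ∀ v, v ≠ u → (τ.children v).ncard = 0 ∨ (τ.children v).ncard = 2

/-- A pairing of the leaves, given by the map exchanging the two elements of each block (and
leaving fixed the nodes that are not leaves). -/
structure Pairing (τ : SymbolTree N) where
  mate : N → N
  mate_mate : ∀ v, mate (mate v) = v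
  mate_ne_iff : ∀ v, mate v ≠ v ↔ τ.IsLeaf v

namespace Pairing

variable {τ : SymbolTree N}

/-- Two nodes are identified when they are equal or paired. -/
def setoid (P : τ.Pairing) : Setoid N where
  r v w := w = v ∨ w = P.mate v
  iseqv :=
    { refl := fun v => Or.inl rfl
      symm := by
        rintro v w (rfl | rfl)
        · exact Or.inl rfl
        · exact Or.inr (P.mate_mate v).symm
      trans := by
        rintro u v w (rfl | rfl) (rfl | rfl)
        · exact Or.inl rfl
        · exact Or.inr rfl
        · exact Or.inr rfl
        · exact Or.inl (P.mate_mate u) }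

/-- The vertices of the diagram: the nodes of the tree, the leaves of each block being merged. -/
def Vertex (P : τ.Pairing) : Type := Quotient P.setoid

instance [Fintype N] (P : τ.Pairing) : Fintype P.Vertex :=
  @Fintype.ofFinite _ (Quotient.finite P.setoid)

open Classical in
/-- The Feynman diagram obtained from a tree by merging paired leaves. There is one edge from each
node other than the root to its parent; it is of mollified type if the node is a leaf. -/
def diagram (P : τ.Pairing) : FeynmanDiagram P.Vertex {w : N // w ≠ τ.root} where
  star := Quotient.mk P.setoid τ.root
  src e := Quotient.mk P.setoid e.1
  tgt e := Quotient.mk P.setoid (τ.parent e.1)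
  type e := if τ.IsLeaf e.1 then .mollified else .bare

end Pairing

end SymbolTree

end

/-! Rigidity of paired trees. The edges meeting a vertex set can be counted by their targets (an
inner node has two children, with at most one exception) and by their sources (every node but the
root has one parent). For a full divergent `γ` this gives `4 deg γ = |γ| (3ρ - d) + (ρ + d) (w -
4)`, where `w` counts the entering edges, twice the leaving edges and some nonnegative defects.
Nonpositive degree requires `w < 4`, while two-connectedness and the path to the root require `w ≥
3`. Hence `w = 3` (`fullDivergent_counts`): the degree increases strictly with `|γ|` and exceeds
`-ρ`, so that Taylor polynomials stop at first order in space. The same count for `Γ` bounds `|E|`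
as soon as `deg Γ ≤ 0`, so that constants may depend on `|E|` in any way. It also gives `ζ ≤ 1`, and
shows that enough mollified edges lie outside the safe subdiagrams for `Γ` to converge below the
scale `ε` (`degree_add_mollified_pos`).

Pointwise bound. In a Hepp sector the kernel of an edge is controlled, with its derivatives, by the
length scale of the tree node of that edge. If `γ` is unsafe, the node `lowerNode` spanned by its
quotient lies strictly below the node `upperNode` of its closest leg. The legs thus see `γ` from far
away, and the Taylor remainder gains a power `α` of the ratio of the two scales, with `α + deg γ >
0`. Unsafe subdiagrams are nested or disjoint (`IsUnsafe.nested`) and their scale intervals are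
ordered along common legs, so that all the operators can be applied one after the other
(`exists_pointwise_bound`).

Power counting. Telescoping the scales along the tree, the bound times the volume of the sector
becomes a product over the nodes `A` of `2` to minus the increment at `A` times `powerCount`. This
exponent is distributed over the quotients of the elements of `Fs` and of `Γ` by their smaller
elements. A connected component of the part of a quotient inside `A` either has positive degree or
is itself unsafe, in which case its gain compensates its degree (`subBlock_gain`). A safe subdiagram
whose quotient lies in `A` is linked to another vertex of `A`, and its nonpositive degree is
absorbed in the component to which it belongs. The exponent is then at least `θ > 0` when `A` does
not contain the quotient of `Γ`. Otherwise it is at least `deg Γ`, and even `deg Γ + θ` unless `A`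
is the root or one node, determined by a child of `Γ` of degree zero
(`exists_child_of_powerCount_lt`).

Summation. With `x` the scale of the quotient of `Γ` and `ε = 2^(-N)`, the exponent `-deg Γ * x` is
cut off for `x > N` by the mollified edges. The sum over `x` peaks at `N`, which gives `ε^(deg Γ)`.
When `deg Γ = 0` it has instead a plateau of length `N`, hence one logarithm. The exceptional node
has no decay before `N` either and yields the factor `(log ε⁻¹)^ζ`. -/

set_option linter.unusedSectionVars false
set_option linter.unusedVariables false

noncomputable section

/-! ### Scaled bounds on partial derivatives -/

section Calculus

variable {ι : Type} [DecidableEq ι]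

/-- All iterated partial derivatives of `f` of order at most `n` are bounded on `D` by `B` divided
by the product of the scales `s` of the coordinates in which `f` is differentiated. -/
def DerivBound (D : Set (ι → ℝ)) (s : ι → ℝ) : ℕ → ℝ → ((ι → ℝ) → ℝ) → Prop
  | 0, B, f => ∀ y ∈ D, |f y| ≤ B
  | n + 1, B, f => (∀ y ∈ D, |f y| ≤ B) ∧ ∀ a, DerivBound D s n (B / s a) (pderiv a f)

namespace DerivBound

variable {D D' : Set (ι → ℝ)} {s s' : ι → ℝ} {n m : ℕ} {B B' : ℝ} {f g : (ι → ℝ) → ℝ}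

theorem bound (h : DerivBound D s n B f) : ∀ y ∈ D, |f y| ≤ B := by
  cases n with
  | zero => exact h
  | succ n => exact h.1

theorem mono_order (h : DerivBound D s n B f) (hm : m ≤ n) : DerivBound D s m B f := by
  induction m generalizing n B f with
  | zero => exact h.bound
  | succ m ih =>
    obtain ⟨n, rfl⟩ : ∃ k, n = k + 1 := ⟨n - 1, by omega⟩
    exact ⟨h.1, fun a => ih (h.2 a) (by omega)⟩

theorem mono_bound (hs : ∀ a, 0 < s a) (h : DerivBound D s n B f) (hB : B ≤ B') :
    DerivBound D s n B' f := by
  induction n generalizing B B' f with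
  | zero => exact fun y hy => (h y hy).trans hB
  | succ n ih =>
    exact ⟨fun y hy => (h.1 y hy).trans hB,
      fun a => ih (h.2 a) (div_le_div_of_nonneg_right hB (hs a).le)⟩

theorem mono_set (h : DerivBound D s n B f) (hD : D' ⊆ D) : DerivBound D' s n B f := by
  induction n generalizing B f with
  | zero => exact fun y hy => h y (hD hy)
  | succ n ih => exact ⟨fun y hy => h.1 y (hD hy), fun a => ih (h.2 a)⟩

theorem mono_scale (hs' : ∀ a, 0 < s' a) (hss : ∀ a, s' a ≤ s a) (hB : 0 ≤ B)
    (h : DerivBound D s n B f) : DerivBound D s' n B f := by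
  have hs : ∀ a, 0 < s a := fun a => (hs' a).trans_le (hss a)
  induction n generalizing B f with
  | zero => exact h
  | succ n ih =>
    refine ⟨h.1, fun a => ?_⟩
    have h1 : DerivBound D s' n (B / s a) (pderiv a f) := ih (div_nonneg hB (hs a).le) (h.2 a)
    exact h1.mono_bound hs' (div_le_div_of_nonneg_left hB (hs' a) (hss a))

end DerivBound

theorem pderiv_neg (f : (ι → ℝ) → ℝ) (a : ι) :
    pderiv a (fun y => -f y) = fun y => -pderiv a f y := by
  funext y
  exact deriv.fun_neg

theorem eventually_update_mem {D : Set (ι → ℝ)} (hD : IsOpen D) {y : ι → ℝ}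
    (hy : y ∈ D) (a : ι) : ∀ᶠ t in nhds (y a), Function.update y a t ∈ D := by
  have hc : Continuous fun t : ℝ => Function.update y a t :=
    continuous_const.update a continuous_id
  have : Function.update y a (y a) ∈ D := by simpa using hy
  exact hc.continuousAt.eventually_mem (hD.mem_nhds this)

theorem pderiv_eqOn {D : Set (ι → ℝ)} (hD : IsOpen D) {f g : (ι → ℝ) → ℝ}
    (h : Set.EqOn f g D) (a : ι) : Set.EqOn (pderiv a f) (pderiv a g) D := by
  intro y hy
  refine Filter.EventuallyEq.deriv_eq ?_
  filter_upwards [eventually_update_mem hD hy a] with t ht using h ht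

theorem DerivBound.congr {D : Set (ι → ℝ)} (hD : IsOpen D) {s : ι → ℝ} {n : ℕ} {B : ℝ}
    {f g : (ι → ℝ) → ℝ} (h : DerivBound D s n B f) (hfg : Set.EqOn g f D) :
    DerivBound D s n B g := by
  induction n generalizing B f g with
  | zero => intro y hy; rw [hfg hy]; exact h y hy
  | succ n ih =>
    exact ⟨fun y hy => by rw [hfg hy]; exact h.1 y hy, fun a => ih (h.2 a) (pderiv_eqOn hD hfg a)⟩

variable [Fintype ι]

theorem hasDerivAt_comp_update {f : (ι → ℝ) → ℝ} {y : ι → ℝ} (h : DifferentiableAt ℝ f y)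
    (a : ι) : HasDerivAt (fun t => f (Function.update y a t)) (fderiv ℝ f y (Pi.single a 1))
      (y a) := by
  have h1 : HasFDerivAt f (fderiv ℝ f y) (Function.update y a (y a)) := by
    simpa using h.hasFDerivAt
  exact h1.comp_hasDerivAt (y a) (hasDerivAt_update y a (y a))

theorem pderiv_eq_fderiv {f : (ι → ℝ) → ℝ} {y : ι → ℝ} (h : DifferentiableAt ℝ f y) (a : ι) :
    pderiv a f y = fderiv ℝ f y (Pi.single a 1) :=
  (hasDerivAt_comp_update h a).deriv

theorem fderiv_apply_eq_sum {f : (ι → ℝ) → ℝ} {y : ι → ℝ} (h : DifferentiableAt ℝ f y)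
    (u : ι → ℝ) : fderiv ℝ f y u = ∑ a, u a * pderiv a f y := by
  have : u = ∑ a, u a • (Pi.single a 1 : ι → ℝ) := by
    ext b; simp [Finset.sum_apply, Pi.single_apply]
  conv_lhs => rw [this]
  simp only [map_sum, map_smul, smul_eq_mul, pderiv_eq_fderiv h]

section Smooth

variable {D : Set (ι → ℝ)} (hD : IsOpen D) {f g : (ι → ℝ) → ℝ}
include hD

theorem ContDiffOn.differentiableAt_of_isOpen (hf : ContDiffOn ℝ ∞ f D) {y : ι → ℝ} (hy : y ∈ D) :
    DifferentiableAt ℝ f y :=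
  (hf.contDiffAt (hD.mem_nhds hy)).differentiableAt (by simp)

theorem ContDiffOn.pderiv (hf : ContDiffOn ℝ ∞ f D) (a : ι) :
    ContDiffOn ℝ ∞ (_root_.pderiv a f) D := by
  have h1 : ContDiffOn ℝ ∞ (fun y => fderiv ℝ f y (Pi.single a 1)) D :=
    (hf.fderiv_of_isOpen hD (by simp)).clm_apply contDiffOn_const
  exact h1.congr fun y hy => pderiv_eq_fderiv (hf.differentiableAt_of_isOpen hD hy) a

theorem pderiv_comm (hf : ContDiffOn ℝ ∞ f D) (a b : ι) :
    Set.EqOn (pderiv a (pderiv b f)) (pderiv b (pderiv a f)) D := by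
  have key : ∀ a b, ∀ y ∈ D, pderiv a (pderiv b f) y =
      fderiv ℝ (fderiv ℝ f) y (Pi.single a 1) (Pi.single b 1) := by
    intro a b y hy
    have h0 : Set.EqOn (pderiv b f) (fun y => fderiv ℝ f y (Pi.single b 1)) D :=
      fun y hy => pderiv_eq_fderiv (hf.differentiableAt_of_isOpen hD hy) b
    have h2 : DifferentiableAt ℝ (fderiv ℝ f) y :=
      ((hf.fderiv_of_isOpen (m := ∞) hD (by simp)).contDiffAt (hD.mem_nhds hy)).differentiableAt
        (by simp)
    rw [pderiv_eqOn hD h0 a hy, pderiv_eq_fderiv (h2.clm_apply (differentiableAt_const _))]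
    rw [fderiv_clm_apply h2 (differentiableAt_const _)]
    simp
  intro y hy
  rw [key a b y hy, key b a y hy]
  have := (hf.contDiffAt (hD.mem_nhds hy)).isSymmSndFDerivAt (by
    simp only [minSmoothness_of_isRCLikeNormedField]
    exact WithTop.coe_le_coe.2 (le_top : (2 : ℕ∞) ≤ ⊤))
  exact this.eq _ _

theorem pderiv_add_eqOn (hf : ContDiffOn ℝ ∞ f D) (hg : ContDiffOn ℝ ∞ g D) (a : ι) :
    Set.EqOn (pderiv a (fun y => f y + g y)) (fun y => pderiv a f y + pderiv a g y) D :=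
  fun y hy => ((hasDerivAt_comp_update (hf.differentiableAt_of_isOpen hD hy) a).differentiableAt.hasDerivAt.add
    (hasDerivAt_comp_update (hg.differentiableAt_of_isOpen hD hy) a).differentiableAt.hasDerivAt).deriv

theorem pderiv_sub_eqOn (hf : ContDiffOn ℝ ∞ f D) (hg : ContDiffOn ℝ ∞ g D) (a : ι) :
    Set.EqOn (pderiv a (fun y => f y - g y)) (fun y => pderiv a f y - pderiv a g y) D :=
  fun y hy => ((hasDerivAt_comp_update (hf.differentiableAt_of_isOpen hD hy) a).differentiableAt.hasDerivAt.sub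
    (hasDerivAt_comp_update (hg.differentiableAt_of_isOpen hD hy) a).differentiableAt.hasDerivAt).deriv

theorem pderiv_mul_eqOn (hf : ContDiffOn ℝ ∞ f D) (hg : ContDiffOn ℝ ∞ g D) (a : ι) :
    Set.EqOn (pderiv a (fun y => f y * g y))
      (fun y => pderiv a f y * g y + f y * pderiv a g y) D := by
  intro y hy
  have := ((hasDerivAt_comp_update (hf.differentiableAt_of_isOpen hD hy) a).differentiableAt.hasDerivAt.mul
    (hasDerivAt_comp_update (hg.differentiableAt_of_isOpen hD hy) a).differentiableAt.hasDerivAt).deriv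
  simp only [Function.update_eq_self] at this
  exact this

theorem pderiv_sum_eqOn {κ : Type} (S : Finset κ) {F : κ → (ι → ℝ) → ℝ}
    (hF : ∀ k ∈ S, ContDiffOn ℝ ∞ (F k) D) (a : ι) :
    Set.EqOn (pderiv a (fun y => ∑ k ∈ S, F k y)) (fun y => ∑ k ∈ S, pderiv a (F k) y) D :=
  fun y hy => (HasDerivAt.fun_sum fun k hk => (hasDerivAt_comp_update
    ((hF k hk).differentiableAt_of_isOpen hD hy) a).differentiableAt.hasDerivAt).deriv

end Smooth

namespace DerivBound

variable {D : Set (ι → ℝ)} {s : ι → ℝ} {n : ℕ} {B B₁ B₂ : ℝ} {f g : (ι → ℝ) → ℝ}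

omit [Fintype ι] in
theorem neg (h : DerivBound D s n B f) : DerivBound D s n B (fun y => -f y) := by
  induction n generalizing B f with
  | zero => intro y hy; rw [abs_neg]; exact h y hy
  | succ n ih =>
    refine ⟨fun y hy => by rw [abs_neg]; exact h.1 y hy, fun a => ?_⟩
    rw [pderiv_neg]; exact ih (h.2 a)

theorem add (hD : IsOpen D) (hf : ContDiffOn ℝ ∞ f D) (hg : ContDiffOn ℝ ∞ g D)
    (h₁ : DerivBound D s n B₁ f) (h₂ : DerivBound D s n B₂ g) :
    DerivBound D s n (B₁ + B₂) (fun y => f y + g y) := by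
  induction n generalizing B₁ B₂ f g with
  | zero => exact fun y hy => (abs_add_le _ _).trans (add_le_add (h₁ y hy) (h₂ y hy))
  | succ n ih =>
    refine ⟨fun y hy => (abs_add_le _ _).trans (add_le_add (h₁.1 y hy) (h₂.1 y hy)), fun a => ?_⟩
    rw [add_div]
    exact (ih (hf.pderiv hD a) (hg.pderiv hD a) (h₁.2 a) (h₂.2 a)).congr hD
      (pderiv_add_eqOn hD hf hg a)

theorem sub (hD : IsOpen D) (hf : ContDiffOn ℝ ∞ f D) (hg : ContDiffOn ℝ ∞ g D)
    (h₁ : DerivBound D s n B₁ f) (h₂ : DerivBound D s n B₂ g) :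
    DerivBound D s n (B₁ + B₂) (fun y => f y - g y) := by
  simpa only [sub_eq_add_neg] using h₁.add hD hf hg.neg h₂.neg

omit [Fintype ι] in
theorem zero (hB : 0 ≤ B) (hs : ∀ a, 0 < s a) : DerivBound D s n B (fun _ => 0) := by
  induction n generalizing B with
  | zero => intro y _; simpa using hB
  | succ n ih =>
    refine ⟨fun y _ => by simpa using hB, fun a => ?_⟩
    have : pderiv a (fun _ : ι → ℝ => (0 : ℝ)) = fun _ => 0 := by
      funext y; simp [pderiv]
    rw [this]; exact ih (div_nonneg hB (hs a).le)

omit [Fintype ι] in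
theorem const {c : ℝ} (hB : |c| ≤ B) (hs : ∀ a, 0 < s a) : DerivBound D s n B (fun _ => c) := by
  have hB0 : 0 ≤ B := (abs_nonneg c).trans hB
  cases n with
  | zero => exact fun _ _ => hB
  | succ n =>
    refine ⟨fun _ _ => hB, fun a => ?_⟩
    have : pderiv a (fun _ : ι → ℝ => c) = fun _ => 0 := by
      funext y; simp [pderiv]
    rw [this]; exact zero (div_nonneg hB0 (hs a).le) hs

theorem sum (hD : IsOpen D) {κ : Type} (S : Finset κ) {F : κ → (ι → ℝ) → ℝ} {b : κ → ℝ}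
    (hs : ∀ a, 0 < s a)
    (hF : ∀ k ∈ S, ContDiffOn ℝ ∞ (F k) D) (h : ∀ k ∈ S, DerivBound D s n (b k) (F k)) :
    DerivBound D s n (∑ k ∈ S, b k) (fun y => ∑ k ∈ S, F k y) := by
  classical
  induction S using Finset.induction_on with
  | empty => simpa using zero le_rfl hs
  | insert k S hk ih =>
    simp only [Finset.sum_insert hk]
    exact add hD (hF k (Finset.mem_insert_self k S))
      (ContDiffOn.sum fun j hj => hF j (Finset.mem_insert_of_mem hj))
      (h k (Finset.mem_insert_self k S)) (ih (fun j hj => hF j (Finset.mem_insert_of_mem hj))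
        (fun j hj => h j (Finset.mem_insert_of_mem hj)))

/-- Leibniz' rule turns each derivative into two terms of the same weight, both factors being
measured with the same scales; hence the factor `2 ^ n`. -/
theorem mul (hD : IsOpen D) (hs : ∀ a, 0 < s a) (hB₁ : 0 ≤ B₁) (hB₂ : 0 ≤ B₂)
    (hf : ContDiffOn ℝ ∞ f D) (hg : ContDiffOn ℝ ∞ g D)
    (h₁ : DerivBound D s n B₁ f) (h₂ : DerivBound D s n B₂ g) :
    DerivBound D s n (2 ^ n * (B₁ * B₂)) (fun y => f y * g y) := by
  have h0 : ∀ (n : ℕ), ∀ y ∈ D, |f y * g y| ≤ 2 ^ n * (B₁ * B₂) := by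
    intro n y hy
    rw [abs_mul]
    have : |f y| * |g y| ≤ B₁ * B₂ :=
      mul_le_mul (h₁.bound y hy) (h₂.bound y hy) (abs_nonneg _) hB₁
    exact this.trans (le_mul_of_one_le_left (mul_nonneg hB₁ hB₂) (one_le_pow₀ (by norm_num)))
  induction n generalizing B₁ B₂ f g with
  | zero => exact h0 0
  | succ n ih =>
    refine ⟨h0 (n + 1), fun a => ?_⟩
    have aux : ∀ {B₁ B₂ : ℝ} {f g : (ι → ℝ) → ℝ}, 0 ≤ B₁ → 0 ≤ B₂ → DerivBound D s n B₁ f →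
        DerivBound D s n B₂ g → ∀ (n : ℕ), ∀ y ∈ D, |f y * g y| ≤ 2 ^ n * (B₁ * B₂) := by
      intro B₁ B₂ f g hB₁ hB₂ h₁ h₂ n y hy
      rw [abs_mul]
      have : |f y| * |g y| ≤ B₁ * B₂ :=
        mul_le_mul (h₁.bound y hy) (h₂.bound y hy) (abs_nonneg _) hB₁
      exact this.trans (le_mul_of_one_le_left (mul_nonneg hB₁ hB₂) (one_le_pow₀ (by norm_num)))
    have hsa := hs a
    have e1 := ih (div_nonneg hB₁ hsa.le) hB₂ (hf.pderiv hD a) hg (h₁.2 a)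
      (h₂.mono_order (Nat.le_succ n))
      (aux (div_nonneg hB₁ hsa.le) hB₂ (h₁.2 a) (h₂.mono_order (Nat.le_succ n)))
    have e2 := ih hB₁ (div_nonneg hB₂ hsa.le) hf (hg.pderiv hD a) (h₁.mono_order (Nat.le_succ n))
      (h₂.2 a) (aux hB₁ (div_nonneg hB₂ hsa.le) (h₁.mono_order (Nat.le_succ n)) (h₂.2 a))
    have e3 := (e1.add hD ((hf.pderiv hD a).mul hg) (hf.mul (hg.pderiv hD a)) e2).congr hD
      (pderiv_mul_eqOn hD hf hg a)
    refine e3.mono_bound hs (le_of_eq ?_)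
    rw [pow_succ]; field_simp; ring

theorem prod (hD : IsOpen D) {κ : Type} (S : Finset κ) {F : κ → (ι → ℝ) → ℝ} {b : κ → ℝ}
    (hs : ∀ a, 0 < s a) (hb : ∀ k ∈ S, 0 ≤ b k)
    (hF : ∀ k ∈ S, ContDiffOn ℝ ∞ (F k) D) (h : ∀ k ∈ S, DerivBound D s n (b k) (F k)) :
    DerivBound D s n (∏ k ∈ S, (2 ^ n * b k)) (fun y => ∏ k ∈ S, F k y) := by
  classical
  induction S using Finset.induction_on with
  | empty => simpa using const (c := 1) (by simp) hs
  | insert k S hk ih =>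
    simp only [Finset.prod_insert hk]
    have := mul hD hs (hb k (Finset.mem_insert_self k S))
      (Finset.prod_nonneg fun j hj =>
        mul_nonneg (pow_nonneg zero_le_two n) (hb j (Finset.mem_insert_of_mem hj)))
      (hF k (Finset.mem_insert_self k S))
      (contDiffOn_prod fun j hj => hF j (Finset.mem_insert_of_mem hj))
      (h k (Finset.mem_insert_self k S)) (ih (fun j hj => hb j (Finset.mem_insert_of_mem hj))
        (fun j hj => hF j (Finset.mem_insert_of_mem hj))
        (fun j hj => h j (Finset.mem_insert_of_mem hj)))
    rwa [mul_assoc]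

end DerivBound

end Calculus

end
noncomputable section

/-! ### Taylor remainders -/

section Taylor

variable {ι : Type} [DecidableEq ι]

/-- Replace the coordinates in `L` by those of `p`. -/
def freeze (L : Finset ι) (p y : ι → ℝ) : ι → ℝ := fun a => if a ∈ L then p a else y a

theorem freeze_update_of_mem {L : Finset ι} {a : ι} (ha : a ∈ L) (p y : ι → ℝ) (t : ℝ) :
    freeze L p (Function.update y a t) = freeze L p y := by
  funext b
  simp only [freeze]
  split_ifs with h
  · rfl
  · have : b ≠ a := fun e => h (e ▸ ha)
    simp [this]

theorem freeze_update_of_notMem {L : Finset ι} {a : ι} (ha : a ∉ L) (p y : ι → ℝ) (t : ℝ) :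
    freeze L p (Function.update y a t) = Function.update (freeze L p y) a t := by
  funext b
  rcases eq_or_ne b a with rfl | h
  · simp [freeze, ha]
  · simp [freeze, h]

theorem pderiv_comp_freeze_of_mem {L : Finset ι} {a : ι} (ha : a ∈ L) (p : ι → ℝ)
    (f : (ι → ℝ) → ℝ) : pderiv a (fun y => f (freeze L p y)) = fun _ => 0 := by
  funext y
  simp [pderiv, freeze_update_of_mem ha]

theorem pderiv_comp_freeze_of_notMem {L : Finset ι} {a : ι} (ha : a ∉ L) (p : ι → ℝ)
    (f : (ι → ℝ) → ℝ) :
    pderiv a (fun y => f (freeze L p y)) = fun y => pderiv a f (freeze L p y) := by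
  funext y
  simp [pderiv, freeze_update_of_notMem ha, freeze, ha]

/-- The remainder of the Taylor expansion of `f` in the coordinates of `L` around `p`, of order
one in the coordinates of `L₁` and zero in the other ones. -/
def taylorRem (L L₁ : Finset ι) (p : ι → ℝ) (f : (ι → ℝ) → ℝ) : (ι → ℝ) → ℝ :=
  fun y => f y - f (freeze L p y) - ∑ b ∈ L₁, (y b - p b) * pderiv b f (freeze L p y)

theorem taylorRem_empty (L : Finset ι) (p : ι → ℝ) (f : (ι → ℝ) → ℝ) :
    taylorRem L ∅ p f = fun y => f y - f (freeze L p y) := by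
  funext y; simp [taylorRem]

variable [Fintype ι]

theorem contDiff_freeze (L : Finset ι) (p : ι → ℝ) : ContDiff ℝ ∞ (freeze L p) := by
  rw [contDiff_pi]
  intro a
  by_cases h : a ∈ L
  · simpa [freeze, h] using contDiff_const
  · simpa [freeze, h] using contDiff_apply ℝ ℝ a

theorem ContDiffOn.comp_freeze {D D' : Set (ι → ℝ)} {f : (ι → ℝ) → ℝ} (hf : ContDiffOn ℝ ∞ f D)
    {L : Finset ι} {p : ι → ℝ} (hD' : ∀ y ∈ D', freeze L p y ∈ D) :
    ContDiffOn ℝ ∞ (fun y => f (freeze L p y)) D' :=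
  hf.comp (contDiff_freeze L p).contDiffOn hD'

theorem DerivBound.comp_freeze {D D' : Set (ι → ℝ)} {s s' : ι → ℝ} {n : ℕ} {B : ℝ}
    {f : (ι → ℝ) → ℝ} {L : Finset ι} {p : ι → ℝ} (hs' : ∀ a, 0 < s' a) (hB : 0 ≤ B)
    (hss : ∀ a, a ∉ L → s' a = s a) (hD' : ∀ y ∈ D', freeze L p y ∈ D)
    (h : DerivBound D s n B f) : DerivBound D' s' n B (fun y => f (freeze L p y)) := by
  induction n generalizing B f with
  | zero => exact fun y hy => h _ (hD' y hy)
  | succ n ih =>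
    refine ⟨fun y hy => h.1 _ (hD' y hy), fun a => ?_⟩
    by_cases ha : a ∈ L
    · rw [pderiv_comp_freeze_of_mem ha]
      exact DerivBound.zero (div_nonneg hB (hs' a).le) hs'
    · rw [pderiv_comp_freeze_of_notMem ha, hss a ha]
      exact ih (div_nonneg hB (hss a ha ▸ (hs' a).le)) (h.2 a)

theorem contDiffOn_taylorRem {D D' : Set (ι → ℝ)} (hD : IsOpen D) (hDD : D' ⊆ D)
    {L L₁ : Finset ι} {p : ι → ℝ} (hπ : ∀ y ∈ D', freeze L p y ∈ D)
    {f : (ι → ℝ) → ℝ} (hf : ContDiffOn ℝ ∞ f D) : ContDiffOn ℝ ∞ (taylorRem L L₁ p f) D' := by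
  refine ((hf.mono hDD).sub (hf.comp_freeze hπ)).sub (ContDiffOn.sum fun b _ => ?_)
  exact ((contDiff_apply ℝ ℝ b).sub contDiff_const).contDiffOn.mul ((hf.pderiv hD b).comp_freeze hπ)

/-- Mean value inequality on the segment from the frozen point to `y`, along which only the
coordinates of `L` move. -/
theorem abs_le_of_pderiv_le {D : Set (ι → ℝ)} (hD : IsOpen D) {f : (ι → ℝ) → ℝ}
    (hf : ContDiffOn ℝ ∞ f D) {L : Finset ι} {p y : ι → ℝ} {M : ℝ}
    (hseg : segment ℝ (freeze L p y) y ⊆ D)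
    (hM : ∀ x ∈ D, ∑ a ∈ L, |y a - p a| * |pderiv a f x| ≤ M) :
    |f y - f (freeze L p y)| ≤ M := by
  set x₀ := freeze L p y with hx₀
  have hu : ∀ a, a ∉ L → (y - x₀) a = 0 := fun a ha => by simp [hx₀, freeze, ha]
  have hu' : ∀ a, a ∈ L → (y - x₀) a = y a - p a := fun a ha => by simp [hx₀, freeze, ha]
  have hmem : ∀ t : ℝ, t ∈ Set.Icc (0 : ℝ) 1 → x₀ + t • (y - x₀) ∈ D := by
    intro t ht
    apply hseg
    rw [segment_eq_image']
    exact ⟨t, ht, rfl⟩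
  have hder : ∀ t ∈ Set.Icc (0 : ℝ) 1, HasDerivWithinAt (fun t : ℝ => f (x₀ + t • (y - x₀)))
      (fderiv ℝ f (x₀ + t • (y - x₀)) (y - x₀)) (Set.Icc 0 1) t := by
    intro t ht
    have h1 : HasDerivAt (fun t : ℝ => x₀ + t • (y - x₀)) (y - x₀) t := by
      simpa using ((hasDerivAt_id t).smul_const (y - x₀)).const_add x₀
    exact ((hf.differentiableAt_of_isOpen hD (hmem t ht)).hasFDerivAt.comp_hasDerivAt t
      h1).hasDerivWithinAt
  have hbd : ∀ t ∈ Set.Ico (0 : ℝ) 1, ‖fderiv ℝ f (x₀ + t • (y - x₀)) (y - x₀)‖ ≤ M := by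
    intro t ht
    have hx := hmem t ⟨ht.1, ht.2.le⟩
    rw [fderiv_apply_eq_sum (hf.differentiableAt_of_isOpen hD hx), Real.norm_eq_abs]
    refine (Finset.abs_sum_le_sum_abs _ _).trans ((le_of_eq ?_).trans (hM _ hx))
    rw [← Finset.sum_subset (Finset.subset_univ L)]
    · exact Finset.sum_congr rfl fun a ha => by rw [abs_mul, hu' a ha]
    · intro a _ ha
      rw [hu a ha]; simp
  have := norm_image_sub_le_of_norm_deriv_le_segment_01' hder hbd
  simpa [Real.norm_eq_abs] using this

theorem pderiv_taylorRem_empty {D : Set (ι → ℝ)} (hD : IsOpen D) {L : Finset ι} {p : ι → ℝ}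
    (hπ : ∀ y ∈ D, freeze L p y ∈ D) {f : (ι → ℝ) → ℝ} (hf : ContDiffOn ℝ ∞ f D) (a : ι) :
    Set.EqOn (pderiv a (taylorRem L ∅ p f))
      (if a ∈ L then pderiv a f else taylorRem L ∅ p (pderiv a f)) D := by
  intro y hy
  rw [taylorRem_empty, pderiv_sub_eqOn hD hf (hf.comp_freeze hπ) a hy]
  split_ifs with ha
  · simp [pderiv_comp_freeze_of_mem ha]
  · simp [pderiv_comp_freeze_of_notMem ha, taylorRem_empty]

/-- Remainders are stable under differentiation. A direction of `L₁` removes the constant term and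
leaves a remainder of order zero. The other directions of `L` kill all that is subtracted. The
directions outside `L` commute with the expansion, because partial derivatives commute on `D`. -/
theorem pderiv_taylorRem {D D' : Set (ι → ℝ)} (hD : IsOpen D) (hD' : IsOpen D') (hDD : D' ⊆ D)
    {L L₁ : Finset ι}
    (hL : L₁ ⊆ L) {p : ι → ℝ}
    (hπ : ∀ y ∈ D', freeze L p y ∈ D) {f : (ι → ℝ) → ℝ} (hf : ContDiffOn ℝ ∞ f D) (a : ι) :
    Set.EqOn (pderiv a (taylorRem L L₁ p f))
      (if a ∈ L₁ then taylorRem L ∅ p (pderiv a f) else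
        if a ∈ L then pderiv a f else taylorRem L L₁ p (pderiv a f)) D' := by
  intro y hy
  have hsm : ∀ b ∈ L₁, ContDiffOn ℝ ∞ (fun y => (y b - p b) * pderiv b f (freeze L p y)) D' :=
    fun b _ => ((contDiff_apply ℝ ℝ b).sub contDiff_const).contDiffOn.mul
      ((hf.pderiv hD b).comp_freeze hπ)
  have h1 : pderiv a (taylorRem L L₁ p f) y = pderiv a (fun y => f y - f (freeze L p y)) y
      - ∑ b ∈ L₁, pderiv a (fun y => (y b - p b) * pderiv b f (freeze L p y)) y := by
    have := pderiv_sub_eqOn hD' ((hf.mono hDD).sub (hf.comp_freeze hπ)) (ContDiffOn.sum hsm) a hy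
    simp only at this
    rw [show taylorRem L L₁ p f = fun y => f y - f (freeze L p y) -
      ∑ b ∈ L₁, (y b - p b) * pderiv b f (freeze L p y) from rfl, this,
      pderiv_sum_eqOn hD' L₁ hsm a hy]
  have h2 : ∀ b ∈ L₁, pderiv a (fun y => (y b - p b) * pderiv b f (freeze L p y)) y =
      (if b = a then pderiv b f (freeze L p y) else 0) +
        (if a ∈ L then 0 else (y b - p b) * pderiv b (pderiv a f) (freeze L p y)) := by
    intro b hb
    have h3 := pderiv_mul_eqOn hD' (f := fun y => y b - p b)
      (g := fun y => pderiv b f (freeze L p y))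
      (((contDiff_apply ℝ ℝ b).sub contDiff_const).contDiffOn)
      ((hf.pderiv hD b).comp_freeze hπ) a hy
    simp only at h3
    rw [h3]
    congr 1
    · have : pderiv a (fun y : ι → ℝ => y b - p b) y = if b = a then 1 else 0 := by
        by_cases hba : b = a
        · subst hba; simp [pderiv]
        · simp [pderiv, hba]
      rw [this]; split_ifs <;> simp
    · split_ifs with ha
      · rw [pderiv_comp_freeze_of_mem ha]; simp
      · rw [pderiv_comp_freeze_of_notMem ha]
        simp only [pderiv_comm hD hf a b (hπ y hy)]
  rw [h1, Finset.sum_congr rfl h2, Finset.sum_add_distrib,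
    pderiv_sub_eqOn hD' (hf.mono hDD) (hf.comp_freeze hπ) a hy]
  by_cases ha1 : a ∈ L₁
  · have ha : a ∈ L := hL ha1
    simp [ha1, ha, pderiv_comp_freeze_of_mem ha, taylorRem_empty]
  · by_cases ha : a ∈ L
    · simp [ha1, ha, pderiv_comp_freeze_of_mem ha]
    · simp [ha1, ha, pderiv_comp_freeze_of_notMem ha, taylorRem]

variable {D : Set (ι → ℝ)} {L L₁ : Finset ι} {p : ι → ℝ} {s s' : ι → ℝ} {C g g₁ : ℝ}

/-- Gain from a Taylor remainder of order zero. -/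
theorem DerivBound.taylorRem_empty (hD : IsOpen D)
    (hstar : ∀ y ∈ D, segment ℝ (freeze L p y) y ⊆ D)
    (hs : ∀ a, 0 < s a) (hs' : ∀ a, 0 < s' a) (hss : ∀ a, s' a ≤ s a)
    (hsn : ∀ a, a ∉ L → s' a = s a) (hC : 0 ≤ C)
    (hclose : ∀ y ∈ D, ∀ a ∈ L, |y a - p a| ≤ C * s' a) (hg : 0 ≤ g)
    (hgain : ∀ a ∈ L, s' a / s a ≤ g) {n : ℕ} {B : ℝ} (hB : 0 ≤ B) {f : (ι → ℝ) → ℝ}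
    (hf : ContDiffOn ℝ ∞ f D) (h : DerivBound D s (n + 1) B f) :
    DerivBound D s' n ((1 + L.card * C) * (B * g)) (taylorRem L ∅ p f) := by
  have hπ : ∀ y ∈ D, freeze L p y ∈ D := fun y hy => hstar y hy (left_mem_segment ℝ _ _)
  have h1c : (1 : ℝ) ≤ 1 + L.card * C := by
    have : 0 ≤ (L.card : ℝ) * C := by positivity
    linarith
  have base : ∀ {n : ℕ} {B : ℝ} {f : (ι → ℝ) → ℝ}, 0 ≤ B → ContDiffOn ℝ ∞ f D →
      DerivBound D s (n + 1) B f → ∀ y ∈ D, |_root_.taylorRem L ∅ p f y| ≤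
        (1 + L.card * C) * (B * g) := by
    intro n B f hB hf h y hy
    rw [_root_.taylorRem_empty]
    refine abs_le_of_pderiv_le hD hf (hstar y hy) fun x hx => ?_
    have : ∑ a ∈ L, |y a - p a| * |pderiv a f x| ≤ ∑ a ∈ L, C * (B * g) := by
      refine Finset.sum_le_sum fun a ha => ?_
      have h1 : |pderiv a f x| ≤ B / s a := (h.2 a).bound x hx
      calc |y a - p a| * |pderiv a f x| ≤ (C * s' a) * (B / s a) :=
            mul_le_mul (hclose y hy a ha) h1 (abs_nonneg _) (mul_nonneg hC (hs' a).le)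
        _ = C * (B * (s' a / s a)) := by ring
        _ ≤ C * (B * g) := by gcongr; exact hgain a ha
    refine this.trans ?_
    rw [Finset.sum_const, nsmul_eq_mul]
    nlinarith [mul_nonneg hB hg]
  induction n generalizing B f with
  | zero => exact base hB hf h
  | succ n ih =>
    refine ⟨base hB hf h, fun a => ?_⟩
    have hBa : 0 ≤ B / s a := div_nonneg hB (hs a).le
    refine DerivBound.congr hD ?_ (pderiv_taylorRem_empty hD hπ hf a)
    split_ifs with ha
    -- Differentiating in a leg direction cancels the subtracted term and its gain. The factor `s' a
    -- / s a ≤ g` comes back from measuring the derivative at the smaller scale `s'`.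
    · refine ((((h.2 a).mono_order (Nat.le_succ n)).mono_scale hs' hss hBa)).mono_bound hs' ?_
      calc B / s a = B * (s' a / s a) / s' a := by field_simp [(hs' a).ne', (hs a).ne']
        _ ≤ 1 * (B * g) / s' a := by
          rw [one_mul]; have := hs' a; have := hgain a ha; gcongr
        _ ≤ _ := by
          have := hs' a
          gcongr
    · have := ih hBa (hf.pderiv hD a) (h.2 a)
      refine this.mono_bound hs' (le_of_eq ?_)
      rw [hsn a ha]; ring

/-- Gain from a Taylor remainder of order one. -/
theorem DerivBound.taylorRem (hD : IsOpen D) (hL : L₁ ⊆ L)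
    (hstar : ∀ y ∈ D, segment ℝ (freeze L p y) y ⊆ D)
    (hs : ∀ a, 0 < s a) (hs' : ∀ a, 0 < s' a) (hss : ∀ a, s' a ≤ s a)
    (hsn : ∀ a, a ∉ L → s' a = s a) (hC : 0 ≤ C)
    (hclose : ∀ y ∈ D, ∀ a ∈ L, |y a - p a| ≤ C * s' a) (hg : 0 ≤ g) (hg₁ : 0 ≤ g₁)
    (hgain₁ : L₁.Nonempty → ∀ a ∈ L, s' a / s a ≤ g₁) (hgg : L₁.Nonempty → g₁ * g₁ ≤ g)
    (hgain : ∀ a ∈ L, a ∉ L₁ → s' a / s a ≤ g) {n : ℕ} {B : ℝ} (hB : 0 ≤ B) {f : (ι → ℝ) → ℝ}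
    (hf : ContDiffOn ℝ ∞ f D) (h : DerivBound D s (n + 2) B f) :
    DerivBound D s' n ((1 + L.card * C) ^ 2 * (B * g)) (taylorRem L L₁ p f) := by
  have hπ : ∀ y ∈ D, freeze L p y ∈ D := fun y hy => hstar y hy (left_mem_segment ℝ _ _)
  have hLC : 0 ≤ (L.card : ℝ) * C := by positivity
  have h1c : (1 : ℝ) ≤ 1 + L.card * C := by linarith
  set c : ℝ := 1 + L.card * C with hc
  have hc0 : 0 ≤ c := by linarith
  -- In a direction of `L₁` one factor `g₁` comes from the remaining remainder of order zero and
  -- another from the change of scale. In the other directions of `L` the change of scale alone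
  -- gives `g`.
  have hleg : ∀ {n : ℕ} {B : ℝ} {f : (ι → ℝ) → ℝ}, 0 ≤ B → ContDiffOn ℝ ∞ f D →
      DerivBound D s (n + 2) B f → ∀ a ∈ L, DerivBound D s' n (c * (B * g) / s' a)
        (pderiv a (_root_.taylorRem L L₁ p f)) := by
    intro n B f hB hf h a ha
    have hBa : 0 ≤ B / s a := div_nonneg hB (hs a).le
    refine DerivBound.congr hD ?_ (pderiv_taylorRem hD hD subset_rfl hL hπ hf a)
    have hpos := hs' a
    split_ifs with ha1
    · have hne : L₁.Nonempty := ⟨a, ha1⟩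
      have := DerivBound.taylorRem_empty hD hstar hs hs' hss hsn hC hclose hg₁ (hgain₁ hne)
        hBa (hf.pderiv hD a) (h.2 a)
      refine this.mono_bound hs' ?_
      calc c * (B / s a * g₁) = c * (B * (s' a / s a * g₁)) / s' a := by
            field_simp [(hs' a).ne', (hs a).ne']
        _ ≤ c * (B * g) / s' a := by
          have : s' a / s a * g₁ ≤ g :=
            (mul_le_mul_of_nonneg_right (hgain₁ hne a ha) hg₁).trans (hgg hne)
          gcongr
    · refine (((h.2 a).mono_order (Nat.le_succ n)).mono_scale hs' hss hBa).mono_bound hs' ?_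
      calc B / s a = 1 * (B * (s' a / s a)) / s' a := by field_simp [(hs' a).ne', (hs a).ne']
        _ ≤ c * (B * g) / s' a := by
          have := hgain a ha ha1
          have h5 : 0 ≤ s' a / s a := div_nonneg hpos.le (hs a).le
          gcongr
  have base : ∀ {n : ℕ} {B : ℝ} {f : (ι → ℝ) → ℝ}, 0 ≤ B → ContDiffOn ℝ ∞ f D →
      DerivBound D s (n + 2) B f → ∀ y ∈ D, |_root_.taylorRem L L₁ p f y| ≤
        c ^ 2 * (B * g) := by
    intro n B f hB hf h y hy
    have hBg : 0 ≤ B * g := mul_nonneg hB hg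
    -- The remainder vanishes at the frozen point, so that the mean value inequality applied to the
    -- remainder itself converts `hleg` into a bound on its size.
    have h0 : _root_.taylorRem L L₁ p f (freeze L p y) = 0 := by
      have hff : freeze L p (freeze L p y) = freeze L p y := by
        funext a; simp only [freeze]; split_ifs <;> rfl
      simp only [_root_.taylorRem, hff, sub_self, zero_sub, neg_eq_zero]
      refine Finset.sum_eq_zero fun b hb => ?_
      simp [freeze, hL hb]
    have h1 := abs_le_of_pderiv_le hD (contDiffOn_taylorRem hD subset_rfl hπ hf (L₁ := L₁))
      (hstar y hy) (M := L.card * C * (c * (B * g))) (fun x hx => by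
        have : ∑ a ∈ L, |y a - p a| * |pderiv a (_root_.taylorRem L L₁ p f) x| ≤
            ∑ a ∈ L, C * (c * (B * g)) := by
          refine Finset.sum_le_sum fun a ha => ?_
          have h2 := (hleg hB hf h a ha).bound x hx
          have := hs' a
          calc _ ≤ (C * s' a) * (c * (B * g) / s' a) :=
                mul_le_mul (hclose y hy a ha) h2 (abs_nonneg _) (mul_nonneg hC (hs' a).le)
            _ = C * (c * (B * g)) := by field_simp
        refine this.trans (le_of_eq ?_)
        rw [Finset.sum_const, nsmul_eq_mul]; ring)
    rw [h0, sub_zero] at h1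
    refine h1.trans ?_
    have : L.card * C ≤ c := by rw [hc]; linarith
    calc L.card * C * (c * (B * g)) ≤ c * (c * (B * g)) := by gcongr
      _ = _ := by ring
  induction n generalizing B f with
  | zero => exact base hB hf h
  | succ n ih =>
    refine ⟨base hB hf h, fun a => ?_⟩
    by_cases ha : a ∈ L
    · refine ((hleg hB hf h a ha).mono_order (Nat.le_succ n)).mono_bound hs' ?_
      have := hs' a
      have : c ≤ c ^ 2 := by nlinarith
      gcongr
    · have hBa : 0 ≤ B / s a := div_nonneg hB (hs a).le
      have h3 := ih hBa (hf.pderiv hD a) (h.2 a)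
      refine DerivBound.congr hD (h3.mono_bound hs' (le_of_eq ?_)) ?_
      · rw [hsn a ha]; ring
      · have := pderiv_taylorRem hD hD subset_rfl hL hπ hf a
        rwa [if_neg (fun h => ha (hL h)), if_neg ha] at this

/-- A Taylor remainder is bounded term by term, without any gain. -/
theorem DerivBound.taylorRem_of_terms {D' : Set (ι → ℝ)} (hD : IsOpen D) (hD' : IsOpen D')
    (hDD : D' ⊆ D) (hL : L₁ ⊆ L)
    (hπ : ∀ y ∈ D', freeze L p y ∈ D)
    (hs' : ∀ a, 0 < s' a) (hss : ∀ a, s' a ≤ s a)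
    (hsn : ∀ a, a ∉ L → s' a = s a) (hC : 1 ≤ C)
    (hclose : ∀ y ∈ D', ∀ a ∈ L, |y a - p a| ≤ C * s' a)
    {n : ℕ} {B : ℝ} (hB : 0 ≤ B) {f : (ι → ℝ) → ℝ}
    (hf : ContDiffOn ℝ ∞ f D) (h : DerivBound D s (n + 1) B f) :
    DerivBound D' s' n ((2 + L₁.card * (2 ^ n * C)) * B) (_root_.taylorRem L L₁ p f) := by
  have hs : ∀ a, 0 < s a := fun a => (hs' a).trans_le (hss a)
  have hsm : ∀ b ∈ L₁, ContDiffOn ℝ ∞ (fun y => (y b - p b) * pderiv b f (freeze L p y)) D' :=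
    fun b _ => ((contDiff_apply ℝ ℝ b).sub contDiff_const).contDiffOn.mul
      ((hf.pderiv hD b).comp_freeze hπ)
  -- `1 ≤ C` is what makes the derivative `1` of the linear factor fit the bound `C * s' b / s' b`.
  have hlin : ∀ b ∈ L₁, DerivBound D' s' n (C * s' b) (fun y => y b - p b) := by
    intro b hb
    cases n with
    | zero => exact fun y hy => hclose y hy b (hL hb)
    | succ n =>
      refine ⟨fun y hy => hclose y hy b (hL hb), fun a => ?_⟩
      have : pderiv a (fun y : ι → ℝ => y b - p b) = fun _ => if b = a then 1 else 0 := by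
        funext y
        by_cases hba : b = a
        · subst hba; simp [pderiv]
        · simp [pderiv, hba]
      rw [this]
      refine DerivBound.const ?_ hs'
      have h1 := hs' a
      have h2 := hs' b
      split_ifs with hba
      · subst hba; rw [mul_div_assoc, div_self h1.ne']; simpa using hC
      · rw [abs_zero]; positivity
  have hterm : ∀ b ∈ L₁, DerivBound D' s' n (2 ^ n * C * B)
      (fun y => (y b - p b) * pderiv b f (freeze L p y)) := by
    intro b hb
    have h1 := hs' b
    have hBb : 0 ≤ B / s b := div_nonneg hB (hs b).le
    have := (hlin b hb).mul hD' hs' (by positivity) hBb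
      (((contDiff_apply ℝ ℝ b).sub contDiff_const).contDiffOn) ((hf.pderiv hD b).comp_freeze hπ)
      ((h.2 b).comp_freeze hs' hBb hsn hπ)
    refine this.mono_bound hs' ?_
    have h3 : s' b / s b ≤ 1 := div_le_one_of_le₀ (hss b) (hs b).le
    calc 2 ^ n * (C * s' b * (B / s b)) = 2 ^ n * C * B * (s' b / s b) := by ring
      _ ≤ 2 ^ n * C * B * 1 := by gcongr
      _ = _ := by ring
  have h0 : DerivBound D s n B f := h.mono_order (Nat.le_succ n)
  have h1 := ((h0.mono_set hDD).mono_scale hs' hss hB).sub hD' (hf.mono hDD)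
    (hf.comp_freeze hπ) (h0.comp_freeze hs' hB hsn hπ)
  have h2 := h1.sub hD' ((hf.mono hDD).sub (hf.comp_freeze hπ)) (ContDiffOn.sum hsm)
    (DerivBound.sum hD' L₁ hs' hsm hterm)
  refine h2.mono_bound hs' (le_of_eq ?_)
  rw [Finset.sum_const, nsmul_eq_mul]; ring

end Taylor

end
noncomputable section

/-! ### Bounds on the kernels -/

section IteratedDerivatives

variable {ι : Type} [DecidableEq ι]

/-- The iterated partial derivative along a list of coordinates. -/
def lderiv (l : List ι) (f : (ι → ℝ) → ℝ) : (ι → ℝ) → ℝ := l.foldr pderiv f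

theorem lderiv_cons (a : ι) (l : List ι) (f : (ι → ℝ) → ℝ) :
    lderiv (a :: l) f = pderiv a (lderiv l f) := rfl

theorem lderiv_append (l l' : List ι) (f : (ι → ℝ) → ℝ) :
    lderiv (l ++ l') f = lderiv l (lderiv l' f) := List.foldr_append

theorem lderiv_replicate (n : ℕ) (a : ι) (f : (ι → ℝ) → ℝ) :
    lderiv (List.replicate n a) f = (pderiv a)^[n] f := by
  induction n with
  | zero => rfl
  | succ n ih => rw [List.replicate_succ, lderiv_cons, ih, Function.iterate_succ_apply']

theorem DerivBound.of_lderiv {D : Set (ι → ℝ)} {s : ι → ℝ} {n : ℕ} {B : ℝ} {f : (ι → ℝ) → ℝ}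
    (h : ∀ l : List ι, l.length ≤ n → ∀ y ∈ D,
      |lderiv l f y| ≤ B * (l.map fun a => (s a)⁻¹).prod) : DerivBound D s n B f := by
  induction n generalizing B f with
  | zero => intro y hy; simpa [lderiv] using h [] le_rfl y hy
  | succ n ih =>
    refine ⟨fun y hy => by simpa [lderiv] using h [] (Nat.zero_le _) y hy, fun a => ?_⟩
    refine ih fun l hl y hy => ?_
    -- `DerivBound` differentiates in `a` first, so `a` is the last entry of the list.
    have := h (l ++ [a]) (by simpa using hl) y hy
    rw [lderiv_append] at this
    refine this.trans (le_of_eq ?_)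
    simp [div_eq_mul_inv]; ring

variable [Fintype ι]

theorem ContDiffOn.lderiv {D : Set (ι → ℝ)} (hD : IsOpen D) {f : (ι → ℝ) → ℝ}
    (hf : ContDiffOn ℝ ∞ f D) (l : List ι) : ContDiffOn ℝ ∞ (_root_.lderiv l f) D := by
  induction l with
  | nil => exact hf
  | cons a l ih => exact ih.pderiv hD a

theorem lderiv_perm {D : Set (ι → ℝ)} (hD : IsOpen D) {f : (ι → ℝ) → ℝ}
    (hf : ContDiffOn ℝ ∞ f D) {l l' : List ι} (h : l.Perm l') :
    Set.EqOn (lderiv l f) (lderiv l' f) D := by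
  induction h with
  | nil => exact fun _ _ => rfl
  | cons a _ ih => exact pderiv_eqOn hD ih a
  | swap a b l => exact pderiv_comm hD (hf.lderiv hD l) b a
  | trans _ _ ih₁ ih₂ => exact ih₁.trans ih₂

theorem mderiv_eq_lderiv (k : ι → ℕ) (f : (ι → ℝ) → ℝ) :
    mderiv k f = lderiv ((Finset.univ : Finset ι).toList.flatMap
      fun a => List.replicate (k a) a) f := by
  unfold mderiv
  induction (Finset.univ : Finset ι).toList with
  | nil => rfl
  | cons a L ih =>
    rw [List.foldr_cons, List.flatMap_cons, lderiv_append, lderiv_replicate, ih]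

theorem count_flatMap_replicate (k : ι → ℕ) (a : ι) :
    ((Finset.univ : Finset ι).toList.flatMap fun b => List.replicate (k b) b).count a = k a := by
  rw [List.count_flatMap]
  have : (List.count a ∘ fun b => List.replicate (k b) b) = fun b => if b = a then k a else 0 := by
    funext b
    simp only [Function.comp, List.count_replicate]
    by_cases h : b = a
    · subst h; simp
    · simp [h]
  rw [this, Finset.sum_map_toList]
  simp

/-- A list of coordinates is a permutation of the list attached to its multi-index of
multiplicities, and derivatives commute where the function is smooth. Bounds assumed for
multi-indices thereby become bounds for lists. -/
theorem mderiv_count_eqOn {D : Set (ι → ℝ)} (hD : IsOpen D) {f : (ι → ℝ) → ℝ}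
    (hf : ContDiffOn ℝ ∞ f D) (l : List ι) :
    Set.EqOn (mderiv (fun a => l.count a) f) (lderiv l f) D := by
  rw [mderiv_eq_lderiv]
  refine lderiv_perm hD hf ?_
  rw [List.perm_iff_count]
  intro a
  exact count_flatMap_replicate (fun a => l.count a) a

theorem sum_mul_count (s : ι → ℝ) (l : List ι) :
    ∑ a, s a * (l.count a : ℝ) = (l.map s).sum := by
  induction l with
  | nil => simp
  | cons b l ih =>
    simp only [List.count_cons, List.map_cons, List.sum_cons, ← ih]
    push_cast
    simp only [mul_add, Finset.sum_add_distrib]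
    rw [add_comm]
    congr 1
    simp

end IteratedDerivatives

/-! ### The anisotropic norm and its dilations. -/

section ScaledNorm

variable {d : ℕ} {ρ : ℝ}

theorem scaling_zero : scaling ρ d 0 = ρ := rfl

theorem scaling_succ (i : Fin d) : scaling ρ d i.succ = 1 := by simp [scaling]

theorem scaling_pos (hρ : 0 < ρ) (i : Fin (d + 1)) : 0 < scaling ρ d i := by
  refine Fin.cases ?_ (fun i => ?_) i
  · exact hρ
  · rw [scaling_succ]; exact one_pos

theorem scaledNorm_nonneg (z : Spacetime d) : 0 ≤ scaledNorm ρ z := by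
  unfold scaledNorm; positivity

theorem abs_zero_le_scaledNorm (z : Spacetime d) : |z 0| ^ (1 / ρ) ≤ scaledNorm ρ z :=
  le_add_of_nonneg_right (Finset.sum_nonneg fun _ _ => abs_nonneg _)

theorem abs_succ_le_scaledNorm (z : Spacetime d) (i : Fin d) : |z i.succ| ≤ scaledNorm ρ z :=
  (Finset.single_le_sum (f := fun i : Fin d => |z i.succ|) (fun _ _ => abs_nonneg _)
    (Finset.mem_univ i)).trans (le_add_of_nonneg_left (by positivity))

theorem abs_le_scaledNorm_rpow (hρ : 0 < ρ) (z : Spacetime d) (i : Fin (d + 1)) :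
    |z i| ≤ scaledNorm ρ z ^ scaling ρ d i := by
  refine Fin.cases ?_ (fun i => ?_) i
  · have := Real.rpow_le_rpow (by positivity) (abs_zero_le_scaledNorm (ρ := ρ) z) hρ.le
    rwa [← Real.rpow_mul (abs_nonneg _), one_div_mul_cancel hρ.ne', Real.rpow_one] at this
  · rw [scaling_succ, Real.rpow_one]; exact abs_succ_le_scaledNorm z i

theorem scaledNorm_pos (hρ : 0 < ρ) {z : Spacetime d} (hz : z ≠ 0) : 0 < scaledNorm ρ z := by
  rcases (scaledNorm_nonneg (ρ := ρ) z).lt_or_eq with h | h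
  · exact h
  · refine absurd (funext fun i => ?_) hz
    have := abs_le_scaledNorm_rpow hρ z i
    rw [← h, Real.zero_rpow (scaling_pos hρ i).ne'] at this
    simpa using abs_nonpos_iff.1 this

theorem continuous_scaledNorm (hρ : 0 < ρ) : Continuous (scaledNorm (d := d) ρ) := by
  unfold scaledNorm
  refine Continuous.add ?_ (by fun_prop)
  exact Continuous.rpow_const (by fun_prop) fun _ => Or.inr (by positivity)

/-- For `ρ < 1` the time part is a power larger than one of `|z 0|` and is not subadditive, hence a
quasi-triangle inequality. The constant comes from `|a + b| ≤ 2 max |a| |b|`. -/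
theorem scaledNorm_add_le (hρ : 0 < ρ) (z w : Spacetime d) :
    scaledNorm ρ (z + w) ≤ 2 ^ (1 / ρ) * (scaledNorm ρ z + scaledNorm ρ w) := by
  have hQ : (1 : ℝ) ≤ 2 ^ (1 / ρ) := Real.one_le_rpow (by norm_num) (by positivity)
  have h0 : |(z + w) 0| ^ (1 / ρ) ≤ 2 ^ (1 / ρ) * (|z 0| ^ (1 / ρ) + |w 0| ^ (1 / ρ)) := by
    have h1 : |(z + w) 0| ≤ 2 * max |z 0| |w 0| := by
      have := abs_add_le (z 0) (w 0)
      have := le_max_left |z 0| |w 0|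
      have := le_max_right |z 0| |w 0|
      simp only [Pi.add_apply]; linarith
    refine (Real.rpow_le_rpow (abs_nonneg _) h1 (by positivity)).trans ?_
    rw [Real.mul_rpow (by norm_num) (by positivity)]
    gcongr
    have a1 : 0 ≤ |z 0| ^ (1 / ρ) := by positivity
    have a2 : 0 ≤ |w 0| ^ (1 / ρ) := by positivity
    rcases max_choice |z 0| |w 0| with h | h <;> rw [h] <;> linarith
  have h1 : ∑ i : Fin d, |(z + w) i.succ| ≤
      2 ^ (1 / ρ) * (∑ i : Fin d, |z i.succ| + ∑ i : Fin d, |w i.succ|) := by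
    have : ∑ i : Fin d, |(z + w) i.succ| ≤ ∑ i : Fin d, |z i.succ| + ∑ i : Fin d, |w i.succ| := by
      rw [← Finset.sum_add_distrib]
      exact Finset.sum_le_sum fun i _ => abs_add_le _ _
    refine this.trans (le_mul_of_one_le_left (by positivity) hQ)
  unfold scaledNorm
  calc _ ≤ _ := add_le_add h0 h1
    _ = _ := by ring

/-- The anisotropic dilation. -/
def dilate (ρ ε : ℝ) (z : Spacetime d) : Spacetime d := fun i => ε ^ scaling ρ d i * z i

theorem scaledNorm_dilate (hρ : 0 < ρ) {ε : ℝ} (hε : 0 < ε) (z : Spacetime d) :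
    scaledNorm ρ (dilate ρ ε z) = ε * scaledNorm ρ z := by
  unfold scaledNorm dilate
  simp only [scaling_zero, scaling_succ, Real.rpow_one, abs_mul, abs_of_pos hε]
  rw [Real.mul_rpow (abs_nonneg _) (abs_nonneg _), abs_of_pos (Real.rpow_pos_of_pos hε _),
    ← Real.rpow_mul hε.le, mul_one_div_cancel hρ.ne', Real.rpow_one, mul_add, Finset.mul_sum]

theorem dilate_inv_dilate {ε : ℝ} (hε : 0 < ε) (z : Spacetime d) :
    dilate ρ ε⁻¹ (dilate ρ ε z) = z := by
  funext i
  unfold dilate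
  rw [Real.inv_rpow hε.le, inv_mul_cancel_left₀ (Real.rpow_pos_of_pos hε _).ne']

theorem dilate_ne_zero {ε : ℝ} (hε : 0 < ε) {z : Spacetime d} (hz : z ≠ 0) :
    dilate ρ ε z ≠ 0 := by
  intro h
  apply hz
  rw [← dilate_inv_dilate (ρ := ρ) hε z, h]
  funext i; simp [dilate]

theorem pderiv_comp_dilate {ε : ℝ} (hε : 0 < ε) (f : Spacetime d → ℝ) (a : Fin (d + 1)) :
    pderiv a (fun z => f (dilate ρ ε z)) =
      fun z => ε ^ scaling ρ d a * pderiv a f (dilate ρ ε z) := by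
  funext z
  unfold pderiv
  have h1 : (fun t => f (dilate ρ ε (Function.update z a t))) =
      fun t => (fun u => f (Function.update (dilate ρ ε z) a u)) (ε ^ scaling ρ d a * t) := by
    funext t
    congr 1
    funext b
    rcases eq_or_ne b a with rfl | h
    · simp [dilate]
    · simp [dilate, h]
  rw [h1]
  refine (deriv_comp_mul_left (ε ^ scaling ρ d a)
    (fun u => f (Function.update (dilate ρ ε z) a u)) (z a)).trans ?_
  simp [dilate]

theorem pderiv_const_mul {ι : Type} [DecidableEq ι] (c : ℝ) (f : (ι → ℝ) → ℝ) (a : ι) :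
    pderiv a (fun z => c * f z) = fun z => c * pderiv a f z := by
  funext z
  exact deriv_const_mul_field c

theorem lderiv_const_mul {ι : Type} [DecidableEq ι] (c : ℝ) (f : (ι → ℝ) → ℝ) (l : List ι) :
    lderiv l (fun z => c * f z) = fun z => c * lderiv l f z := by
  induction l with
  | nil => rfl
  | cons a l ih => rw [lderiv_cons, ih, pderiv_const_mul]; rfl

theorem lderiv_comp_dilate {ε : ℝ} (hε : 0 < ε) (f : Spacetime d → ℝ) (l : List (Fin (d + 1))) :
    lderiv l (fun z => f (dilate ρ ε z)) =
      fun z => ε ^ (l.map (scaling ρ d)).sum * lderiv l f (dilate ρ ε z) := by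
  induction l with
  | nil => funext z; simp [lderiv]
  | cons a l ih =>
    rw [lderiv_cons, ih, pderiv_const_mul, pderiv_comp_dilate hε]
    funext z
    rw [List.map_cons, List.sum_cons, add_comm (scaling ρ d a), Real.rpow_add hε, lderiv_cons,
      mul_assoc]

theorem contDiff_dilate (ε : ℝ) : ContDiff ℝ ∞ (dilate (d := d) ρ ε) := by
  unfold dilate
  fun_prop

theorem prod_inv_rpow_scaling {r : ℝ} (hr : 0 < r) (l : List (Fin (d + 1))) :
    (l.map fun a => (r ^ scaling ρ d a)⁻¹).prod = r ^ (-(l.map (scaling ρ d)).sum) := by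
  induction l with
  | nil => simp
  | cons a l ih =>
    rw [List.map_cons, List.prod_cons, ih, List.map_cons, List.sum_cons, neg_add,
      Real.rpow_add hr, Real.rpow_neg hr.le (scaling ρ d a)]

theorem sum_scaling_nonneg (hρ : 0 < ρ) (l : List (Fin (d + 1))) :
    0 ≤ (l.map (scaling ρ d)).sum := by
  refine List.sum_nonneg fun x hx => ?_
  obtain ⟨a, _, rfl⟩ := List.mem_map.1 hx
  exact (scaling_pos hρ a).le

end ScaledNorm

/-! ### Singular kernels: scale invariance and local integrability. -/

section KernelBounds

open MeasureTheory

variable {d : ℕ} {ρ : ℝ}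

/-- The function is smooth off the origin, and its derivatives satisfy the scaled bounds of a kernel
of degree `-d` with constants `M`. -/
structure HasKernelBound (ρ : ℝ) (M : List (Fin (d + 1)) → ℝ) (K : Spacetime d → ℝ) : Prop where
  smooth : ContDiffOn ℝ ∞ K {0}ᶜ
  bound : ∀ l z, z ≠ 0 →
    |lderiv l K z| ≤ M l * scaledNorm ρ z ^ (-(d : ℝ) - (l.map (scaling ρ d)).sum)

theorem IsSingularKernel.exists_hasKernelBound {K : Spacetime d → ℝ}
    (hK : IsSingularKernel ρ (-(d : ℝ)) K) : ∃ M, HasKernelBound ρ M K := by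
  choose M hM using fun l : List (Fin (d + 1)) => hK.bound (fun a => l.count a)
  refine ⟨M, hK.smooth, fun l z hz => ?_⟩
  have := hM l z hz
  rwa [mderiv_count_eqOn isOpen_compl_singleton hK.smooth l hz, sum_mul_count] at this

/-- The bounds of degree `-d` are scale invariant, with the very same constants. This is the source
of all the uniformity in `ε`. -/
theorem HasKernelBound.comp_dilate (hρ : 0 < ρ) {M : List (Fin (d + 1)) → ℝ} {K : Spacetime d → ℝ}
    (hK : HasKernelBound ρ M K) {ε : ℝ} (hε : 0 < ε) :
    HasKernelBound ρ M (fun z => ε ^ (d : ℝ) * K (dilate ρ ε z)) := by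
  refine ⟨contDiffOn_const.mul (hK.smooth.comp (contDiff_dilate ε).contDiffOn
    fun z hz => dilate_ne_zero hε hz), fun l z hz => ?_⟩
  rw [lderiv_const_mul, lderiv_comp_dilate hε]
  have h1 := hK.bound l _ (dilate_ne_zero (ρ := ρ) hε hz)
  have hN := scaledNorm_pos hρ hz
  rw [scaledNorm_dilate hρ hε, Real.mul_rpow hε.le hN.le] at h1
  rw [abs_mul, abs_mul, abs_of_pos (Real.rpow_pos_of_pos hε _),
    abs_of_pos (Real.rpow_pos_of_pos hε _)]
  calc _ ≤ ε ^ (d : ℝ) * (ε ^ (l.map (scaling ρ d)).sum * (M l *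
        (ε ^ (-(d : ℝ) - (l.map (scaling ρ d)).sum) *
          scaledNorm ρ z ^ (-(d : ℝ) - (l.map (scaling ρ d)).sum)))) := by gcongr
    _ = (ε ^ (d : ℝ) * (ε ^ (l.map (scaling ρ d)).sum *
          ε ^ (-(d : ℝ) - (l.map (scaling ρ d)).sum))) * (M l *
          scaledNorm ρ z ^ (-(d : ℝ) - (l.map (scaling ρ d)).sum)) := by ring
    _ = _ := by
      rw [← Real.rpow_add hε, ← Real.rpow_add hε]
      simp

theorem HasKernelBound.nonneg (hρ : 0 < ρ) {M : List (Fin (d + 1)) → ℝ} {K : Spacetime d → ℝ}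
    (hK : HasKernelBound ρ M K) (l : List (Fin (d + 1))) : 0 ≤ M l := by
  have h1 : (fun _ => 1 : Spacetime d) ≠ 0 := fun h => one_ne_zero (congrFun h 0)
  have := (abs_nonneg _).trans (hK.bound l _ h1)
  exact nonneg_of_mul_nonneg_left this (Real.rpow_pos_of_pos (scaledNorm_pos hρ h1) _)

/-- A product function dominating the kernels of degree `-d`. -/
def kernelMajorant (ρ : ℝ) (d : ℕ) (z : Spacetime d) : ℝ :=
  ∏ i, |z i| ^ (-(Fin.cons (min (1 / 2) (ρ / (2 * d)) * d / ρ)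
    (fun _ => 1 - min (1 / 2) (ρ / (2 * d))) : Fin (d + 1) → ℝ) i)

/-- The exponent `d` is shared out: `θ d` to the time part and `1 - θ` to each space coordinate, and
the norm is bounded below by each of these parts. The choice of `θ` makes every one-dimensional
exponent larger than `-1`, so that the majorant is locally integrable coordinate by coordinate. -/
theorem scaledNorm_rpow_le_kernelMajorant (hρ : 0 < ρ) (hd : 1 ≤ d) {z : Spacetime d}
    (hz : ∀ i, z i ≠ 0) : scaledNorm ρ z ^ (-(d : ℝ)) ≤ kernelMajorant ρ d z := by
  have hd' : (0 : ℝ) < d := by exact_mod_cast hd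
  unfold kernelMajorant
  set θ : ℝ := min (1 / 2) (ρ / (2 * d)) with hθ
  have hθ0 : 0 < θ := lt_min (by norm_num) (by positivity)
  have hθ1 : θ ≤ 1 / 2 := min_le_left _ _
  have hN : 0 < scaledNorm ρ z := scaledNorm_pos hρ fun h => hz 0 (by simp [h])
  rw [Fin.prod_univ_succ]
  simp only [Fin.cons_zero, Fin.cons_succ]
  have e : scaledNorm ρ z ^ (-(d : ℝ)) =
      scaledNorm ρ z ^ (-(θ * d)) * ∏ i : Fin d, scaledNorm ρ z ^ (-(1 - θ)) := by
    rw [Finset.prod_const, Finset.card_univ, Fintype.card_fin, ← Real.rpow_natCast,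
      ← Real.rpow_mul hN.le, ← Real.rpow_add hN]
    congr 1; ring
  rw [e]
  refine mul_le_mul ?_ ?_ (by positivity) (by positivity)
  · have h0 : 0 < |z 0| := abs_pos.2 (hz 0)
    have := Real.rpow_le_rpow_of_nonpos (by positivity) (abs_zero_le_scaledNorm (ρ := ρ) z)
      (z := -(θ * d)) (by nlinarith)
    refine this.trans (le_of_eq ?_)
    rw [← Real.rpow_mul h0.le]
    congr 1; field_simp
  · refine Finset.prod_le_prod (fun _ _ => by positivity) fun i _ => ?_
    exact Real.rpow_le_rpow_of_nonpos (abs_pos.2 (hz _)) (abs_succ_le_scaledNorm z i) (by linarith)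

theorem integrableOn_abs_rpow {r R : ℝ} (hr : -1 < r) :
    IntegrableOn (fun x : ℝ => |x| ^ r) (Set.Icc (-R) R) := by
  rcases lt_or_ge R 0 with hR | hR
  · rw [Set.Icc_eq_empty (by linarith)]; exact integrableOn_empty
  have h1 : IntervalIntegrable (fun x : ℝ => |x| ^ r) volume 0 R := by
    refine (intervalIntegral.intervalIntegrable_rpow' (a := 0) (b := R) hr).congr ?_
    intro x hx
    rw [Set.uIoc_of_le hR] at hx
    simp [abs_of_pos hx.1]
  have h2 : IntervalIntegrable (fun x : ℝ => |x| ^ r) volume (-R) 0 := by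
    have := (IntervalIntegrable.iff_comp_neg (f := fun x : ℝ => |x| ^ r)
      (by simp)).1 h1
    simpa using this.symm
  exact (intervalIntegrable_iff_integrableOn_Icc_of_le (by linarith)).1 (h2.trans h1)

theorem integrableOn_kernelMajorant (hρ : 0 < ρ) (hd : 1 ≤ d) (R : ℝ) :
    IntegrableOn (kernelMajorant ρ d) (Set.pi Set.univ fun _ => Set.Icc (-R) R) := by
  have hd' : (0 : ℝ) < d := by exact_mod_cast hd
  set θ : ℝ := min (1 / 2) (ρ / (2 * d)) with hθ
  have hθ0 : 0 < θ := lt_min (by norm_num) (by positivity)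
  have hθ2 : θ ≤ ρ / (2 * d) := min_le_right _ _
  unfold IntegrableOn
  rw [volume_pi, Measure.restrict_pi_pi]
  refine Integrable.fintype_prod (f := fun i x => |x| ^ (-(Fin.cons (θ * d / ρ)
    (fun _ => 1 - θ) : Fin (d + 1) → ℝ) i)) fun i => ?_
  refine integrableOn_abs_rpow ?_
  refine Fin.cases ?_ (fun i => ?_) i
  · simp only [Fin.cons_zero]
    have : θ * d / ρ ≤ ρ / (2 * d) * d / ρ := by gcongr
    have h2 : ρ / (2 * d) * d / ρ = 1 / 2 := by field_simp
    linarith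
  · simp only [Fin.cons_succ]; linarith

theorem ae_forall_ne_zero : ∀ᵐ z : Spacetime d, ∀ i, z i ≠ 0 := by
  rw [ae_all_iff]
  intro i
  have := Measure.pi_hyperplane (fun _ : Fin (d + 1) => (volume : Measure ℝ)) i 0
  rw [ae_iff]
  simpa [volume_pi] using this

theorem ContinuousOn.aestronglyMeasurable_compl_zero {K : Spacetime d → ℝ}
    (hK : ContinuousOn K {0}ᶜ) : AEStronglyMeasurable K volume := by
  have h1 : AEStronglyMeasurable K (volume.restrict ({0}ᶜ : Set (Spacetime d))) :=
    hK.aestronglyMeasurable (measurableSet_singleton _).compl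
  rwa [Measure.restrict_eq_self_of_ae_mem] at h1
  filter_upwards [ae_forall_ne_zero (d := d)] with z hz h
  exact hz 0 (by rw [Set.mem_singleton_iff.1 h]; rfl)

theorem HasKernelBound.integrableOn (hρ : 0 < ρ) (hd : 1 ≤ d) {M : List (Fin (d + 1)) → ℝ}
    {K : Spacetime d → ℝ} (hK : HasKernelBound ρ M K) (R : ℝ) :
    IntegrableOn K (Set.pi Set.univ fun _ => Set.Icc (-R) R) := by
  refine ((integrableOn_kernelMajorant hρ hd R).const_mul (M [])).mono'
    hK.smooth.continuousOn.aestronglyMeasurable_compl_zero.restrict ?_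
  refine ae_restrict_of_ae ?_
  filter_upwards [ae_forall_ne_zero (d := d)] with z hz
  have := hK.bound [] z (fun h => hz 0 (by simp [h]))
  simp only [List.map_nil, List.sum_nil, sub_zero] at this
  exact this.trans (mul_le_mul_of_nonneg_left (scaledNorm_rpow_le_kernelMajorant hρ hd hz)
    (hK.nonneg hρ []))

theorem HasKernelBound.locallyIntegrable (hρ : 0 < ρ) (hd : 1 ≤ d) {M : List (Fin (d + 1)) → ℝ}
    {K : Spacetime d → ℝ} (hK : HasKernelBound ρ M K) : LocallyIntegrable K volume := by
  rw [locallyIntegrable_iff]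
  intro S hS
  obtain ⟨R, hR⟩ := hS.isBounded.subset_closedBall 0
  refine (hK.integrableOn hρ hd R).mono_set fun z hz i _ => ?_
  have := (norm_le_pi_norm z i).trans (mem_closedBall_zero_iff.1 (hR hz))
  exact abs_le.1 this

end KernelBounds

end
noncomputable section

/-! ### Mollified kernels, uniformly in the size of the mollifier. -/

section Mollification

open MeasureTheory

variable {d : ℕ} {ρ : ℝ}

/-- The convolution of a kernel with a test function, with the kernel translated. -/
def mollifyOne (ϱ K : Spacetime d → ℝ) : Spacetime d → ℝ := fun z => ∫ w, K (z - w) * ϱ w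

theorem mollifyOne_eq_convolution (ϱ K : Spacetime d → ℝ) :
    mollifyOne ϱ K = convolution K ϱ (ContinuousLinearMap.mul ℝ ℝ) volume := by
  funext z
  rw [convolution_def, mollifyOne,
    ← integral_sub_left_eq_self (fun w => (ContinuousLinearMap.mul ℝ ℝ (K w)) (ϱ (z - w))) volume z]
  simp

theorem HasCompactSupport.pderiv {ϱ : Spacetime d → ℝ} (hc : HasCompactSupport ϱ)
    (hϱ : ContDiff ℝ ∞ ϱ) (a : Fin (d + 1)) : HasCompactSupport (_root_.pderiv a ϱ) := by
  have : _root_.pderiv a ϱ = fun y => fderiv ℝ ϱ y (Pi.single a 1) := by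
    funext y
    exact pderiv_eq_fderiv (hϱ.differentiable (by simp) y) a
  rw [this]
  exact (hc.fderiv ℝ).comp_left (g := fun T : (Spacetime d) →L[ℝ] ℝ => T (Pi.single a 1)) rfl

theorem pderiv_convolution {ϱ K : Spacetime d → ℝ} (hc : HasCompactSupport ϱ)
    (hϱ : ContDiff ℝ ∞ ϱ) (hK : LocallyIntegrable K volume) (a : Fin (d + 1)) :
    pderiv a (convolution K ϱ (ContinuousLinearMap.mul ℝ ℝ) volume) =
      convolution K (pderiv a ϱ) (ContinuousLinearMap.mul ℝ ℝ) volume := by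
  funext x
  have h1 := hc.hasFDerivAt_convolution_right (ContinuousLinearMap.mul ℝ ℝ) hK
    (hϱ.of_le (by simp)) x
  rw [pderiv_eq_fderiv h1.differentiableAt, h1.fderiv,
    convolution_precompR_apply _ hK (hc.fderiv ℝ) (hϱ.continuous_fderiv (by simp))]
  congr 1
  funext y
  exact (pderiv_eq_fderiv (hϱ.differentiable (by simp) y) a).symm

theorem lderiv_convolution {ϱ K : Spacetime d → ℝ} (hc : HasCompactSupport ϱ)
    (hϱ : ContDiff ℝ ∞ ϱ) (hK : LocallyIntegrable K volume) (l : List (Fin (d + 1))) :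
    (HasCompactSupport (lderiv l ϱ) ∧ ContDiff ℝ ∞ (lderiv l ϱ)) ∧
    lderiv l (convolution K ϱ (ContinuousLinearMap.mul ℝ ℝ) volume) =
      convolution K (lderiv l ϱ) (ContinuousLinearMap.mul ℝ ℝ) volume := by
  induction l with
  | nil => exact ⟨⟨hc, hϱ⟩, rfl⟩
  | cons a l ih =>
    obtain ⟨⟨h1, h2⟩, h3⟩ := ih
    refine ⟨⟨h1.pderiv h2 a, ?_⟩, ?_⟩
    · have := (contDiffOn_univ.2 h2).pderiv isOpen_univ a
      exact contDiffOn_univ.1 this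
    · rw [lderiv_cons, h3, pderiv_convolution h1 h2 hK, lderiv_cons]

/-- Off the support of `ϱ` the singularity of `G` is never met. When `x a` varies in a small closed
ball, `G` and its derivative are evaluated on a compact set avoiding the origin, which provides the
domination needed to differentiate under the integral. -/
theorem pderiv_mollifyOne_eqOn {ϱ G : Spacetime d → ℝ} (hc : HasCompactSupport ϱ)
    (hϱ : Continuous ϱ) (hG : ContDiffOn ℝ ∞ G {0}ᶜ) (a : Fin (d + 1)) :
    Set.EqOn (pderiv a (mollifyOne ϱ G)) (mollifyOne ϱ (pderiv a G)) (tsupport ϱ)ᶜ := by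
  intro x hx
  have hopen : IsOpen (tsupport ϱ)ᶜ := (isClosed_tsupport ϱ).isOpen_compl
  obtain ⟨δ, hδ, hball⟩ := Metric.nhds_basis_closedBall.eventually_iff.1
    (eventually_update_mem hopen hx a)
  set s : Set ℝ := Metric.closedBall (x a) δ with hs
  have hsn : s ∈ nhds (x a) := Metric.closedBall_mem_nhds _ hδ
  have hϱi : Integrable ϱ volume := hϱ.integrable_of_hasCompactSupport hc
  have hne : ∀ t ∈ s, ∀ w ∈ tsupport ϱ, Function.update x a t - w ∈ ({0}ᶜ : Set (Spacetime d)) := by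
    intro t ht w hw h0
    have : Function.update x a t = w := sub_eq_zero.1 h0
    exact hball ht (this ▸ hw)
  have hbd : ∀ G : Spacetime d → ℝ, ContinuousOn G {0}ᶜ → ∃ C : ℝ, ∀ t ∈ s, ∀ w,
      |G (Function.update x a t - w) * ϱ w| ≤ C * |ϱ w| := by
    intro G hG
    have hcomp : IsCompact (s ×ˢ tsupport ϱ) := (isCompact_closedBall _ _).prod hc
    have hcont : ContinuousOn (fun q : ℝ × Spacetime d => G (Function.update x a q.1 - q.2))
        (s ×ˢ tsupport ϱ) := by
      have hcq : Continuous fun q : ℝ × Spacetime d => Function.update x a q.1 - q.2 := by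
        refine Continuous.sub ?_ continuous_snd
        exact (continuous_const (y := x)).update a continuous_fst
      exact hG.comp hcq.continuousOn fun q hq => hne q.1 hq.1 q.2 hq.2
    obtain ⟨C, hC⟩ := hcomp.exists_bound_of_continuousOn hcont
    refine ⟨C, fun t ht w => ?_⟩
    by_cases hw : w ∈ tsupport ϱ
    · rw [abs_mul]
      exact mul_le_mul_of_nonneg_right (hC (t, w) ⟨ht, hw⟩) (abs_nonneg _)
    · rw [image_eq_zero_of_notMem_tsupport hw]; simp
  have hmeas : ∀ G : Spacetime d → ℝ, ContinuousOn G {0}ᶜ → ∀ c : Spacetime d,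
      AEStronglyMeasurable (fun w => G (c - w) * ϱ w) volume := fun G hG c =>
    (hG.aestronglyMeasurable_compl_zero.comp_quasiMeasurePreserving
      (quasiMeasurePreserving_sub_left volume c)).mul hϱ.aestronglyMeasurable
  have hG' : ContDiffOn ℝ ∞ (pderiv a G) {0}ᶜ := hG.pderiv isOpen_compl_singleton a
  obtain ⟨C₀, hC₀⟩ := hbd G hG.continuousOn
  obtain ⟨C₁, hC₁⟩ := hbd _ hG'.continuousOn
  have key := hasDerivAt_integral_of_dominated_loc_of_deriv_le (μ := volume) (𝕜 := ℝ)
    (F := fun t w => G (Function.update x a t - w) * ϱ w) (x₀ := x a) (s := s)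
    (F' := fun t w => pderiv a G (Function.update x a t - w) * ϱ w)
    (bound := fun w => C₁ * |ϱ w|) hsn
    (Filter.Eventually.of_forall fun t => hmeas G hG.continuousOn _)
    ((hϱi.abs.const_mul C₀).mono' (hmeas G hG.continuousOn _)
      (Filter.Eventually.of_forall fun w => hC₀ _ (mem_of_mem_nhds hsn) w))
    (hmeas _ hG'.continuousOn _)
    (Filter.Eventually.of_forall fun w t ht => hC₁ t ht w) (hϱi.abs.const_mul C₁)
    (Filter.Eventually.of_forall fun w t ht => by
      by_cases hw : w ∈ tsupport ϱ
      · refine HasDerivAt.mul_const ?_ _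
        have h1 := (hasDerivAt_comp_update
          (hG.differentiableAt_of_isOpen isOpen_compl_singleton (hne t ht w hw)) a)
        rw [← pderiv_eq_fderiv
          (hG.differentiableAt_of_isOpen isOpen_compl_singleton (hne t ht w hw)) a] at h1
        have e0 : (Function.update x a t - w) a = t - w a := by simp
        rw [e0] at h1
        have h2 := h1.comp_sub_const (x := t) (a := w a)
        refine h2.congr_of_eventuallyEq (Filter.Eventually.of_forall fun u => ?_)
        simp only
        congr 1
        funext b
        rcases eq_or_ne b a with rfl | hb
        · simp
        · simp [hb]
      · simp only [image_eq_zero_of_notMem_tsupport hw, mul_zero]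
        exact hasDerivAt_const _ _)
  have := key.2.deriv
  simpa [pderiv, mollifyOne] using this

theorem lderiv_mollifyOne_eqOn {ϱ G : Spacetime d → ℝ} (hc : HasCompactSupport ϱ)
    (hϱ : Continuous ϱ) (hG : ContDiffOn ℝ ∞ G {0}ᶜ) (l : List (Fin (d + 1))) :
    Set.EqOn (lderiv l (mollifyOne ϱ G)) (mollifyOne ϱ (lderiv l G)) (tsupport ϱ)ᶜ := by
  induction l with
  | nil => exact fun _ _ => rfl
  | cons a l ih =>
    exact (pderiv_eqOn (isClosed_tsupport ϱ).isOpen_compl ih a).trans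
      (pderiv_mollifyOne_eqOn hc hϱ (hG.lderiv isOpen_compl_singleton l) a)

/-- In the change of variables `w ↦ dilate ρ ε w` the Jacobian `ε ^ (ρ + d)` cancels the
normalisation of the rescaled mollifier. The case of general `ε` is thus reduced to mollification at
scale one of a rescaled kernel. -/
theorem mollify_eq (hρ : 0 < ρ) {ε : ℝ} (hε : 0 < ε) {ϱ K : Spacetime d → ℝ}
    (hK : ContinuousOn K {0}ᶜ) (hϱ : Continuous ϱ) :
    mollify ρ ε ϱ K = fun z => ε ^ (-(d : ℝ)) *
      mollifyOne ϱ (fun z => ε ^ (d : ℝ) * K (dilate ρ ε z)) (dilate ρ ε⁻¹ z) := by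
  funext z
  set D : Fin (d + 1) → ℝ := fun i => ε ^ scaling ρ d i with hD
  have hdet : (Matrix.diagonal D).det = ε ^ (ρ + d) := by
    rw [Matrix.det_diagonal, Fin.prod_univ_succ]
    simp [hD, scaling_zero, scaling_succ, Real.rpow_add hε]
  have hpos : 0 < ε ^ (ρ + d) := Real.rpow_pos_of_pos hε _
  have hdet0 : (Matrix.diagonal D).det ≠ 0 := by rw [hdet]; exact hpos.ne'
  have hmap := Real.smul_map_diagonal_volume_pi hdet0
  have hfun : (⇑(Matrix.toLin' (Matrix.diagonal D)) : Spacetime d → Spacetime d) = dilate ρ ε := by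
    funext w i
    simp [Matrix.toLin'_apply, Matrix.mulVec_diagonal, dilate, hD]
  rw [hfun, hdet, abs_of_pos hpos] at hmap
  have hcont : Continuous (dilate (d := d) ρ ε) := (contDiff_dilate ε).continuous
  set f : Spacetime d → ℝ := fun w => K (z - w) * rescale ρ ε ϱ w with hf
  have hfm : AEStronglyMeasurable f volume := by
    refine (hK.aestronglyMeasurable_compl_zero.comp_quasiMeasurePreserving
      (quasiMeasurePreserving_sub_left volume z)).mul (Continuous.aestronglyMeasurable ?_)
    unfold rescale
    fun_prop
  have hfm' : AEStronglyMeasurable f (Measure.map (dilate ρ ε) volume) := by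
    have h1 : volume.map (dilate (d := d) ρ ε) ≪ volume := by
      conv_rhs => rw [← hmap]
      refine Measure.AbsolutelyContinuous.smul_right
        Measure.AbsolutelyContinuous.rfl ?_
      simpa using hpos
    exact hfm.mono_ac h1
  have h2 : ∫ w, f w = ε ^ (ρ + d) * ∫ w, f (dilate ρ ε w) := by
    conv_lhs => rw [← hmap]
    rw [integral_smul_measure, integral_map hcont.aemeasurable hfm',
      ENNReal.toReal_ofReal hpos.le, smul_eq_mul]
  change ∫ w, f w = _
  rw [h2, mollifyOne, ← integral_const_mul, ← integral_const_mul]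
  congr 1
  funext w
  have e1 : dilate ρ ε (dilate ρ ε⁻¹ z - w) = z - dilate ρ ε w := by
    funext i
    simp only [dilate, Pi.sub_apply, mul_sub, Real.inv_rpow hε.le]
    rw [mul_inv_cancel_left₀ (Real.rpow_pos_of_pos hε _).ne']
  have e2 : rescale ρ ε ϱ (dilate ρ ε w) = ε ^ (-(ρ + d)) * ϱ w := by
    unfold rescale
    congr 2
    funext i
    simp only [dilate]
    rw [Real.rpow_neg hε.le, inv_mul_cancel_left₀ (Real.rpow_pos_of_pos hε _).ne']
  simp only [hf]
  rw [e1, e2, Real.rpow_neg hε.le, Real.rpow_neg hε.le]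
  have h3 : 0 < ε ^ (d : ℝ) := Real.rpow_pos_of_pos hε _
  field_simp

/-- Bounds on a kernel mollified at scale one, near the origin and at infinity. -/
theorem exists_mollifyOne_bound (hρ : 0 < ρ) (hd : 1 ≤ d) {ϱ : Spacetime d → ℝ}
    (hϱ : IsMollifier ϱ) (M : List (Fin (d + 1)) → ℝ) (l : List (Fin (d + 1))) :
    ∃ M' : ℝ, 0 ≤ M' ∧ ∀ K, HasKernelBound ρ M K → ∀ x : Spacetime d, x ≠ 0 →
      |lderiv l (mollifyOne ϱ K) x| ≤ M' * scaledNorm ρ x ^ (-(l.map (scaling ρ d)).sum) ∧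
      |lderiv l (mollifyOne ϱ K) x| ≤
        M' * scaledNorm ρ x ^ (-(d : ℝ) - (l.map (scaling ρ d)).sum) := by
  classical
  set σ := (l.map (scaling ρ d)).sum with hσ
  have hσ0 : 0 ≤ σ := sum_scaling_nonneg hρ l
  have hd0 : (0 : ℝ) ≤ d := Nat.cast_nonneg d
  obtain ⟨R', hR'⟩ := (hϱ.compact : IsCompact (tsupport ϱ)).exists_bound_of_continuousOn
    (continuous_scaledNorm (d := d) hρ).continuousOn
  set R : ℝ := max R' 1 with hR
  have hR1 : 1 ≤ R := le_max_right _ _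
  have hsupp : ∀ w ∈ tsupport ϱ, scaledNorm ρ w ≤ R := fun w hw =>
    (le_abs_self _).trans ((hR' w hw).trans (le_max_left _ _))
  set Q : ℝ := 2 ^ (1 / ρ) with hQ
  have hQ1 : 1 ≤ Q := Real.one_le_rpow (by norm_num) (by positivity)
  -- Beyond `R₁`, translating by a point of the support leaves the norm at least `scaledNorm ρ x /
  -- (2 * Q)`, by the quasi-triangle inequality.
  set R₁ : ℝ := 2 * Q * R with hR₁
  have hR₁1 : 1 ≤ R₁ := by nlinarith
  have hR₁R : R < R₁ := by nlinarith
  -- near the origin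
  set g := lderiv l ϱ with hg
  have hlg : HasCompactSupport g ∧ ContDiff ℝ ∞ g :=
    (lderiv_convolution hϱ.compact hϱ.smooth (K := fun _ => 0) (locallyIntegrable_const 0) l).1
  obtain ⟨G₀, hG₀⟩ := hlg.1.exists_bound_of_continuous hlg.2.continuous
  have hG₀0 : 0 ≤ G₀ := (norm_nonneg _).trans (hG₀ 0)
  obtain ⟨S, hS⟩ := (hlg.1 : IsCompact (tsupport g)).isBounded.subset_closedBall 0
  -- Half-side of a box containing every `w` with `x - w` in the support of the differentiated
  -- mollifier, when `x` has norm at most `R₁`; the maximum takes care of the time and the space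
  -- coordinates.
  set R₂ : ℝ := max (R₁ ^ ρ) R₁ + S with hR₂
  set I₀ : ℝ := ∫ w in (Set.pi Set.univ fun _ => Set.Icc (-R₂) R₂), |M []| * kernelMajorant ρ d w * G₀
    with hI₀
  have hmaj0 : ∀ w, 0 ≤ kernelMajorant ρ d w := fun w => Finset.prod_nonneg fun _ _ => by positivity
  have hI₀0 : 0 ≤ I₀ := integral_nonneg fun w => by have := hmaj0 w; positivity
  -- All the derivatives are put on `ϱ`, so that only the local integrability of `K` enters.
  have near : ∀ K, HasKernelBound ρ M K → ∀ x, scaledNorm ρ x ≤ R₁ →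
      |lderiv l (mollifyOne ϱ K) x| ≤ I₀ := by
    intro K hK x hx
    rw [mollifyOne_eq_convolution, (lderiv_convolution hϱ.compact hϱ.smooth
      (hK.locallyIntegrable hρ hd) l).2, convolution_def (ContinuousLinearMap.mul ℝ ℝ), hI₀, ← integral_indicator
      (MeasurableSet.univ_pi fun _ => measurableSet_Icc)]
    rw [← Real.norm_eq_abs]
    refine norm_integral_le_of_norm_le ?_ ?_
    · rw [integrable_indicator_iff (MeasurableSet.univ_pi fun _ => measurableSet_Icc)]
      exact ((integrableOn_kernelMajorant hρ hd R₂).const_mul |M []|).mul_const G₀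
    · filter_upwards [ae_forall_ne_zero (d := d)] with w hw
      by_cases hgw : x - w ∈ tsupport g
      · have hmem : w ∈ Set.pi Set.univ fun _ : Fin (d + 1) => Set.Icc (-R₂) R₂ := by
          intro i _
          have h1 : |(x - w) i| ≤ S :=
            (norm_le_pi_norm (x - w) i).trans (mem_closedBall_zero_iff.1 (hS hgw))
          have h2 : |x i| ≤ max (R₁ ^ ρ) R₁ := by
            refine (abs_le_scaledNorm_rpow hρ x i).trans ?_
            refine (Real.rpow_le_rpow (scaledNorm_nonneg x) hx (scaling_pos hρ i).le).trans ?_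
            refine Fin.cases ?_ (fun i => ?_) i
            · exact le_max_left _ _
            · rw [scaling_succ, Real.rpow_one]; exact le_max_right _ _
          simp only [Pi.sub_apply] at h1
          rw [Set.mem_Icc, ← abs_le]
          calc |w i| = |x i - (x i - w i)| := by ring_nf
            _ ≤ |x i| + |x i - w i| := abs_sub _ _
            _ ≤ R₂ := add_le_add h2 h1
        rw [Set.indicator_of_mem hmem]
        have hK0 := hK.bound [] w (fun h => hw 0 (by simp [h]))
        simp only [List.map_nil, List.sum_nil, sub_zero] at hK0
        simp only [ContinuousLinearMap.mul_apply', norm_mul]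
        refine mul_le_mul ?_ (hG₀ _) (norm_nonneg _) (by have := hmaj0 w; positivity)
        refine (hK0 : |K w| ≤ _).trans ?_
        rw [abs_of_nonneg (hK.nonneg hρ [])]
        exact mul_le_mul_of_nonneg_left (scaledNorm_rpow_le_kernelMajorant hρ hd hw)
          (hK.nonneg hρ [])
      · rw [← hg, image_eq_zero_of_notMem_tsupport hgw]
        simp only [map_zero, norm_zero]
        exact Set.indicator_nonneg (fun w _ => by have := hmaj0 w; positivity) _
  -- far from the origin
  have hϱc : Continuous ϱ := hϱ.smooth.continuous
  have hϱi : Integrable ϱ volume := hϱc.integrable_of_hasCompactSupport hϱ.compact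
  set J : ℝ := ∫ w, |ϱ w| with hJ
  have hJ0 : 0 ≤ J := integral_nonneg fun _ => abs_nonneg _
  have hpow : ∀ τ : ℝ, 0 ≤ τ → ∀ u : ℝ, 0 < u → u ≤ R₁ → 1 ≤ R₁ ^ τ * u ^ (-τ) := by
    intro τ hτ u hu hu1
    rw [Real.rpow_neg hu.le, ← div_eq_mul_inv, ← Real.div_rpow (by linarith) hu.le]
    exact Real.one_le_rpow ((one_le_div hu).2 hu1) hτ
  -- All the derivatives are put on `K`, which here is evaluated far from its singularity.
  have far : ∀ K, HasKernelBound ρ M K → ∀ x, R₁ < scaledNorm ρ x →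
      |lderiv l (mollifyOne ϱ K) x| ≤
        |M l| * (2 * Q) ^ (d + σ) * J * scaledNorm ρ x ^ (-(d : ℝ) - σ) := by
    intro K hK x hx
    have hxs : x ∈ (tsupport ϱ)ᶜ := fun h => by linarith [hsupp x h]
    rw [lderiv_mollifyOne_eqOn hϱ.compact hϱc hK.smooth l hxs, mollifyOne]
    have hN0 : 0 < scaledNorm ρ x := by linarith
    have : |M l| * (2 * Q) ^ (d + σ) * J * scaledNorm ρ x ^ (-(d : ℝ) - σ) =
        ∫ w, |M l| * (2 * Q) ^ (d + σ) * scaledNorm ρ x ^ (-(d : ℝ) - σ) * |ϱ w| := by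
      rw [integral_const_mul]; ring
    rw [this, ← Real.norm_eq_abs]
    refine norm_integral_le_of_norm_le (hϱi.abs.const_mul _) (Filter.Eventually.of_forall fun w => ?_)
    rw [norm_mul, Real.norm_eq_abs, Real.norm_eq_abs]
    by_cases hw : w ∈ tsupport ϱ
    · refine mul_le_mul_of_nonneg_right ?_ (abs_nonneg _)
      have h1 : scaledNorm ρ x ≤ Q * (scaledNorm ρ (x - w) + scaledNorm ρ w) := by
        have := scaledNorm_add_le hρ (x - w) w
        rwa [sub_add_cancel] at this
      have h2 := hsupp w hw
      have h3 : scaledNorm ρ x / (2 * Q) ≤ scaledNorm ρ (x - w) := by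
        rw [div_le_iff₀ (by positivity)]
        nlinarith
      have h4 : 0 < scaledNorm ρ (x - w) := lt_of_lt_of_le (by positivity) h3
      have hne : x - w ≠ 0 := fun h => by simp [sub_eq_zero.1 h] at hxs; exact hxs hw
      refine (hK.bound l _ hne).trans ?_
      rw [abs_of_nonneg (hK.nonneg hρ l), mul_assoc]
      refine mul_le_mul_of_nonneg_left ?_ (hK.nonneg hρ l)
      have h5 := Real.rpow_le_rpow_of_nonpos (by positivity) h3 (z := -(d : ℝ) - σ) (by linarith)
      refine h5.trans (le_of_eq ?_)
      rw [Real.div_rpow hN0.le (by positivity), div_eq_inv_mul,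
        show -(d : ℝ) - σ = -(d + σ) by ring, Real.rpow_neg (x := 2 * Q) (by positivity), inv_inv]
    · rw [image_eq_zero_of_notMem_tsupport hw]; simp
  refine ⟨I₀ * R₁ ^ (d + σ) + |M l| * (2 * Q) ^ (d + σ) * J, by positivity, fun K hK x hx => ?_⟩
  have hN0 : 0 < scaledNorm ρ x := scaledNorm_pos hρ hx
  have hA : 0 ≤ I₀ * R₁ ^ (d + σ) := by positivity
  have hB : 0 ≤ |M l| * (2 * Q) ^ (d + σ) * J := by positivity
  rcases le_or_gt (scaledNorm ρ x) R₁ with h | h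
  · have h1 := near K hK x h
    -- Within radius `R₁`, a negative power of the norm is bounded below, so that the constant bound
    -- `I₀` is also a bound by any such power.
    have gen : ∀ τ : ℝ, 0 ≤ τ → τ ≤ d + σ → I₀ ≤ (I₀ * R₁ ^ (d + σ) +
        |M l| * (2 * Q) ^ (d + σ) * J) * scaledNorm ρ x ^ (-τ) := by
      intro τ hτ hτ'
      calc I₀ = I₀ * 1 := by ring
        _ ≤ I₀ * (R₁ ^ τ * scaledNorm ρ x ^ (-τ)) := by gcongr; exact hpow τ hτ _ hN0 h
        _ ≤ I₀ * (R₁ ^ (d + σ) * scaledNorm ρ x ^ (-τ)) := by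
          have := Real.rpow_le_rpow_of_exponent_le hR₁1 hτ'
          gcongr
        _ ≤ _ := by
          rw [← mul_assoc]
          have : 0 ≤ scaledNorm ρ x ^ (-τ) := by positivity
          nlinarith
    refine ⟨h1.trans (gen σ hσ0 (by linarith)), h1.trans ?_⟩
    have := gen (d + σ) (by positivity) le_rfl
    rwa [neg_add, ← sub_eq_add_neg] at this
  · have h1 := far K hK x h
    have h2 : |lderiv l (mollifyOne ϱ K) x| ≤ (I₀ * R₁ ^ (d + σ) +
        |M l| * (2 * Q) ^ (d + σ) * J) * scaledNorm ρ x ^ (-(d : ℝ) - σ) := by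
      refine h1.trans ?_
      gcongr
      linarith
    refine ⟨h2.trans ?_, h2⟩
    gcongr
    · linarith
    · linarith

/-- The bounds satisfied by the two types of kernels at distance at least `c * r` from the origin,
uniformly in the mollification parameter. -/
theorem exists_kernel_derivBound (hρ : 0 < ρ) (hd : 1 ≤ d) {K ϱ : Spacetime d → ℝ}
    (hK : IsSingularKernel ρ (-(d : ℝ)) K) (hϱ : IsMollifier ϱ) {c : ℝ} (hc : 0 < c) (n : ℕ) :
    ∃ M : ℝ, 1 ≤ M ∧ ∀ r : ℝ, 0 < r → ∀ ε : ℝ, 0 < ε → ∀ t : EdgeType,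
      DerivBound {x | c * r ≤ scaledNorm ρ x} (fun i => r ^ scaling ρ d i) n
        (M * match t with
          | .bare => r ^ (-(d : ℝ))
          | .mollified => min (r ^ (-(d : ℝ))) (ε ^ (-(d : ℝ)))) (t.kernel ρ ε ϱ K) := by
  classical
  obtain ⟨M₀, hM₀⟩ := hK.exists_hasKernelBound
  choose M₁ hM₁0 hM₁ using exists_mollifyOne_bound hρ hd hϱ M₀
  have hfin := List.finite_length_le (Fin (d + 1)) n
  obtain ⟨A, hA⟩ := (hfin.image fun l => (|M₀ l| + M₁ l) *
    (c ^ (-(l.map (scaling ρ d)).sum) + c ^ (-(d : ℝ) - (l.map (scaling ρ d)).sum))).bddAbove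
  refine ⟨max A 1, le_max_right _ _, fun r hr ε hε t => ?_⟩
  have hd0 : (0 : ℝ) ≤ d := Nat.cast_nonneg d
  have hAl : ∀ l : List (Fin (d + 1)), l.length ≤ n → (|M₀ l| + M₁ l) *
    (c ^ (-(l.map (scaling ρ d)).sum) + c ^ (-(d : ℝ) - (l.map (scaling ρ d)).sum)) ≤ max A 1 :=
    fun l hl => (hA ⟨l, hl, rfl⟩).trans (le_max_left _ _)
  have step : ∀ l : List (Fin (d + 1)), l.length ≤ n → ∀ y : Spacetime d, c * r ≤ scaledNorm ρ y →
      ∀ m : ℝ, 0 ≤ m → m ≤ |M₀ l| + M₁ l →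
      m * scaledNorm ρ y ^ (-(l.map (scaling ρ d)).sum) ≤
        max A 1 * r ^ (-(l.map (scaling ρ d)).sum) ∧
      m * scaledNorm ρ y ^ (-(d : ℝ) - (l.map (scaling ρ d)).sum) ≤
        max A 1 * r ^ (-(d : ℝ)) * r ^ (-(l.map (scaling ρ d)).sum) := by
    intro l hl y hy m hm hm'
    have hσ0 := sum_scaling_nonneg (d := d) hρ l
    set σ := (l.map (scaling ρ d)).sum
    have hm0 : 0 ≤ |M₀ l| + M₁ l := hm.trans hm'
    have e1 := Real.rpow_le_rpow_of_nonpos (mul_pos hc hr) hy (z := -σ) (by linarith)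
    have e2 := Real.rpow_le_rpow_of_nonpos (mul_pos hc hr) hy (z := -(d : ℝ) - σ) (by linarith)
    rw [Real.mul_rpow hc.le hr.le] at e1 e2
    have c1 : 0 ≤ c ^ (-σ) := by positivity
    have c2 : 0 ≤ c ^ (-(d : ℝ) - σ) := by positivity
    have c3 : 0 ≤ scaledNorm ρ y ^ (-σ) := Real.rpow_nonneg (scaledNorm_nonneg _) _
    have c4 : 0 ≤ scaledNorm ρ y ^ (-(d : ℝ) - σ) := Real.rpow_nonneg (scaledNorm_nonneg _) _
    constructor
    · calc _ ≤ (|M₀ l| + M₁ l) * (c ^ (-σ) * r ^ (-σ)) := by gcongr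
        _ ≤ ((|M₀ l| + M₁ l) * (c ^ (-σ) + c ^ (-(d : ℝ) - σ))) * r ^ (-σ) := by
          rw [← mul_assoc]; gcongr; linarith
        _ ≤ _ := by have := hAl l hl; gcongr
    · rw [mul_assoc, ← Real.rpow_add hr, ← sub_eq_add_neg]
      calc _ ≤ (|M₀ l| + M₁ l) * (c ^ (-(d : ℝ) - σ) * r ^ (-(d : ℝ) - σ)) := by gcongr
        _ ≤ ((|M₀ l| + M₁ l) * (c ^ (-σ) + c ^ (-(d : ℝ) - σ))) * r ^ (-(d : ℝ) - σ) := by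
          rw [← mul_assoc]; gcongr; linarith
        _ ≤ _ := by have := hAl l hl; gcongr
  refine DerivBound.of_lderiv fun l hl y hy => ?_
  rw [prod_inv_rpow_scaling hr]
  have hy' : c * r ≤ scaledNorm ρ y := hy
  have hy0 : y ≠ 0 := by
    rintro rfl
    have h0 : scaledNorm ρ (0 : Spacetime d) = 0 := by
      simp [scaledNorm, Real.zero_rpow, hρ.ne']
    rw [h0] at hy'
    exact absurd hy' (not_le.2 (mul_pos hc hr))
  cases t with
  | bare =>
    refine (hM₀.bound l y hy0).trans ?_
    exact (step l hl y hy _ (hM₀.nonneg hρ l) ((le_abs_self _).trans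
      (le_add_of_nonneg_right (hM₁0 l)))).2
  | mollified =>
    have hstep := step l hl y hy _ (hM₁0 l) (le_add_of_nonneg_left (abs_nonneg _))
    have hN := scaledNorm_pos hρ hy0
    -- The rescaled kernel satisfies the bounds of `K` with the constants `M₀`, so `M₁` does not
    -- depend on `ε`. Of the two estimates, the one without `d` leaves the prefactor `ε ^ (-d)` and
    -- the other one cancels it.
    have hd1 := hM₁ l _ (hM₀.comp_dilate hρ hε) (dilate ρ ε⁻¹ y)
      (dilate_ne_zero (inv_pos.2 hε) hy0)
    have e : lderiv l (EdgeType.mollified.kernel ρ ε ϱ K) y = ε ^ (-(d : ℝ)) *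
        (ε ^ (-(l.map (scaling ρ d)).sum) * lderiv l (mollifyOne ϱ
          (fun z => ε ^ (d : ℝ) * K (dilate ρ ε z))) (dilate ρ ε⁻¹ y)) := by
      change lderiv l (mollify ρ ε ϱ K) y = _
      rw [mollify_eq hρ hε hM₀.smooth.continuousOn hϱ.smooth.continuous, lderiv_const_mul,
        lderiv_comp_dilate (inv_pos.2 hε), Real.rpow_neg hε.le (List.sum _), Real.inv_rpow hε.le]
    rw [e, abs_mul, abs_mul, abs_of_pos (Real.rpow_pos_of_pos hε _),
      abs_of_pos (Real.rpow_pos_of_pos hε _)]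
    rw [scaledNorm_dilate hρ (inv_pos.2 hε), Real.mul_rpow (inv_pos.2 hε).le hN.le,
      Real.mul_rpow (inv_pos.2 hε).le hN.le] at hd1
    set σ := (l.map (scaling ρ d)).sum
    have hi : ∀ τ : ℝ, ε⁻¹ ^ τ = ε ^ (-τ) := fun τ => by
      rw [Real.inv_rpow hε.le, Real.rpow_neg hε.le]
    rw [hi, hi] at hd1
    have hr' : 0 ≤ r ^ (-σ) := by positivity
    rw [mul_min_of_nonneg _ _ (by positivity), min_mul_of_nonneg _ _ hr']
    refine le_min ?_ ?_
    · refine le_trans ?_ hstep.2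
      calc _ ≤ ε ^ (-(d : ℝ)) * (ε ^ (-σ) * (M₁ l * (ε ^ (-(-(d : ℝ) - σ)) *
            scaledNorm ρ y ^ (-(d : ℝ) - σ)))) := by gcongr; exact hd1.2
        _ = (ε ^ (-(d : ℝ)) * (ε ^ (-σ) * ε ^ (-(-(d : ℝ) - σ)))) * (M₁ l *
            scaledNorm ρ y ^ (-(d : ℝ) - σ)) := by ring
        _ = _ := by
          rw [← Real.rpow_add hε, ← Real.rpow_add hε]
          simp
    · calc _ ≤ ε ^ (-(d : ℝ)) * (ε ^ (-σ) * (M₁ l * (ε ^ (-(-σ)) *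
            scaledNorm ρ y ^ (-σ)))) := by gcongr; exact hd1.1
        _ = ε ^ (-(d : ℝ)) * ((ε ^ (-σ) * ε ^ (-(-σ))) * (M₁ l * scaledNorm ρ y ^ (-σ))) := by ring
        _ = ε ^ (-(d : ℝ)) * (M₁ l * scaledNorm ρ y ^ (-σ)) := by
          rw [← Real.rpow_add hε]; simp
        _ ≤ ε ^ (-(d : ℝ)) * (max A 1 * r ^ (-σ)) :=
          mul_le_mul_of_nonneg_left hstep.1 (by positivity)
        _ = _ := by ring

theorem contDiffOn_kernel (hρ : 0 < ρ) (hd : 1 ≤ d) {K ϱ : Spacetime d → ℝ}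
    (hK : IsSingularKernel ρ (-(d : ℝ)) K) (hϱ : IsMollifier ϱ) {ε : ℝ} (hε : 0 < ε)
    (t : EdgeType) : ContDiffOn ℝ ∞ (t.kernel ρ ε ϱ K) {0}ᶜ := by
  cases t with
  | bare => exact hK.smooth
  | mollified =>
    obtain ⟨M₀, hM₀⟩ := hK.exists_hasKernelBound
    change ContDiffOn ℝ ∞ (mollify ρ ε ϱ K) _
    rw [mollify_eq hρ hε hM₀.smooth.continuousOn hϱ.smooth.continuous, mollifyOne_eq_convolution]
    have h := ((hM₀.comp_dilate hρ hε).locallyIntegrable hρ hd)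
    have h2 := HasCompactSupport.contDiff_convolution_right (𝕜 := ℝ) (n := ⊤)
      (ContinuousLinearMap.mul ℝ ℝ) hϱ.compact h hϱ.smooth
    exact (ContDiff.mul (𝕜 := ℝ) contDiff_const
      (ContDiff.comp (𝕜 := ℝ) h2 (contDiff_dilate (ρ := ρ) ε⁻¹))).contDiffOn

end Mollification

end
noncomputable section

/-! ### Edge counting in diagrams obtained from binary trees -/

namespace FeynmanDiagram

variable {V E : Type} [Fintype V] [LinearOrder V] [Fintype E] [DecidableEq E]

/-- The edges joining two vertices of `S`. -/
def inducedEdges (Γ : FeynmanDiagram V E) (S : Finset V) : Finset E :=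
  Finset.univ.filter fun e => Γ.src e ∈ S ∧ Γ.tgt e ∈ S

/-- The edges entering `S`. -/
def inEdges (Γ : FeynmanDiagram V E) (S : Finset V) : Finset E :=
  Finset.univ.filter fun e => Γ.src e ∉ S ∧ Γ.tgt e ∈ S

/-- The edges leaving `S`. -/
def outEdges (Γ : FeynmanDiagram V E) (S : Finset V) : Finset E :=
  Finset.univ.filter fun e => Γ.src e ∈ S ∧ Γ.tgt e ∉ S

variable {Γ : FeynmanDiagram V E} {γ : Finset E} {S : Finset V}

theorem src_mem_vertices {e : E} (he : e ∈ γ) : Γ.src e ∈ Γ.vertices γ :=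
  Finset.mem_union_left _ (Finset.mem_image_of_mem _ he)

theorem tgt_mem_vertices {e : E} (he : e ∈ γ) : Γ.tgt e ∈ Γ.vertices γ :=
  Finset.mem_union_right _ (Finset.mem_image_of_mem _ he)

theorem mem_vertices {v : V} : v ∈ Γ.vertices γ ↔ ∃ e ∈ γ, Γ.src e = v ∨ Γ.tgt e = v := by
  simp only [vertices, Finset.mem_union, Finset.mem_image]
  constructor
  · rintro (⟨e, he, h⟩ | ⟨e, he, h⟩)
    · exact ⟨e, he, Or.inl h⟩
    · exact ⟨e, he, Or.inr h⟩
  · rintro ⟨e, he, h | h⟩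
    · exact Or.inl ⟨e, he, h⟩
    · exact Or.inr ⟨e, he, h⟩

theorem IsFullSubgraph.inducedEdges_vertices (h : Γ.IsFullSubgraph γ) :
    Γ.inducedEdges (Γ.vertices γ) = γ := by
  ext e
  simp only [inducedEdges, Finset.mem_filter, Finset.mem_univ, true_and]
  exact ⟨fun he => h e he.1 he.2, fun he => ⟨src_mem_vertices he, tgt_mem_vertices he⟩⟩

theorem exists_crossing {δ : Finset E} (hc : (Γ.graph δ).Connected) (hS : S.Nonempty)
    (hS' : S ≠ Finset.univ) : ∃ e ∈ δ, e ∈ Γ.inEdges S ∪ Γ.outEdges S := by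
  obtain ⟨s, hs⟩ := hS
  obtain ⟨t, ht⟩ : ∃ t, t ∉ S := by
    by_contra! h
    exact hS' (Finset.eq_univ_iff_forall.2 h)
  obtain ⟨w⟩ := hc.preconnected s t
  obtain ⟨D, _, h1, h2⟩ := w.exists_boundary_dart (S := (S : Set V)) hs ht
  have hadj := D.adj
  simp only [graph, SimpleGraph.fromRel_adj] at hadj
  obtain ⟨_, ⟨e, he, h3, h4⟩ | ⟨e, he, h3, h4⟩⟩ := hadj
  · refine ⟨e, he, Finset.mem_union_right _ ?_⟩
    simp only [outEdges, Finset.mem_filter, Finset.mem_univ, true_and, h3, h4]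
    exact ⟨h1, h2⟩
  · refine ⟨e, he, Finset.mem_union_left _ ?_⟩
    simp only [inEdges, Finset.mem_filter, Finset.mem_univ, true_and, h3, h4]
    exact ⟨h2, h1⟩

/-- Connectedness gives one edge across the boundary of `S`; the diagram without that edge is still
connected and gives another. -/
theorem two_le_card_in_add_card_out (hc : Γ.IsTwoConnected) (hS : S.Nonempty)
    (hS' : S ≠ Finset.univ) : 2 ≤ (Γ.inEdges S).card + (Γ.outEdges S).card := by
  obtain ⟨e₀, _, h0⟩ := exists_crossing hc.1 hS hS'
  obtain ⟨e₁, h1', h1⟩ := exists_crossing (hc.2 e₀) hS hS'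
  have hne : e₁ ≠ e₀ := Finset.ne_of_mem_erase h1'
  have : 1 < (Γ.inEdges S ∪ Γ.outEdges S).card := Finset.one_lt_card.2 ⟨e₁, h1, e₀, h0, hne⟩
  exact (Nat.succ_le_of_lt this).trans (Finset.card_union_le _ _)

theorem mem_divergent {ρ : ℝ} {d : ℕ} : γ ∈ Γ.divergent ρ d ↔
    γ ≠ Finset.univ ∧ Γ.IsConnectedSubgraph γ ∧ Γ.subdegree ρ d γ ≤ 0 := by
  simp [divergent]

theorem subdegree_eq (ρ : ℝ) (d : ℕ) : Γ.subdegree ρ d γ =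
    (ρ + d) * ((Γ.vertices γ).card - 1) - d * γ.card := by
  have : ∀ t : EdgeType, t.degree d = -(d : ℝ) := fun t => by cases t <;> rfl
  simp only [subdegree, this, Finset.sum_const, nsmul_eq_mul]
  ring

theorem degree_eq (ρ : ℝ) (d : ℕ) : Γ.degree ρ d =
    (ρ + d) * ((Fintype.card V : ℝ) - 1) - d * Fintype.card E := by
  have : ∀ t : EdgeType, t.degree d = -(d : ℝ) := fun t => by cases t <;> rfl
  simp only [degree, this, Finset.sum_const, nsmul_eq_mul, Finset.card_univ]
  ring

/-- The subdiagrams considered by full forests. -/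
def IsFullDivergent (ρ : ℝ) (d : ℕ) (Γ : FeynmanDiagram V E) (γ : Finset E) : Prop :=
  γ ∈ Γ.divergent ρ d ∧ Γ.IsFullSubgraph γ

theorem IsFullDivergent.vertices_ne_univ {ρ : ℝ} {d : ℕ} (h : Γ.IsFullDivergent ρ d γ) :
    Γ.vertices γ ≠ Finset.univ := by
  intro hu
  refine (mem_divergent.1 h.1).1 (Finset.eq_univ_iff_forall.2 fun e => h.2 e ?_ ?_) <;>
    rw [hu] <;> exact Finset.mem_univ _

theorem IsFullDivergent.nonempty {ρ : ℝ} {d : ℕ} (h : Γ.IsFullDivergent ρ d γ) : γ.Nonempty :=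
  (mem_divergent.1 h.1).2.1.1

theorem IsFullDivergent.vertices_nonempty {ρ : ℝ} {d : ℕ} (h : Γ.IsFullDivergent ρ d γ) :
    (Γ.vertices γ).Nonempty := by
  obtain ⟨e, he⟩ := h.nonempty
  exact ⟨_, src_mem_vertices he⟩

end FeynmanDiagram

/-! ### Counting nodes, leaves and edges of paired trees. -/

namespace SymbolTree

variable {N : Type} [Fintype N] [DecidableEq N] {τ : SymbolTree N}

/-- The number of children of a node. -/
def numChildren (τ : SymbolTree N) (v : N) : ℕ :=
  (Finset.univ.filter fun w => w ≠ τ.root ∧ τ.parent w = v).card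

theorem ncard_children (v : N) : (τ.children v).ncard = τ.numChildren v := by
  rw [numChildren, ← Set.ncard_coe_finset]
  congr 1
  ext w; simp [children]

theorem isLeaf_iff {v : N} : τ.IsLeaf v ↔ τ.numChildren v = 0 := by
  rw [IsLeaf, ← ncard_children, Set.ncard_eq_zero (Set.toFinite _)]

/-- The path from `x` to the root has a last node before `Q` first fails. -/
theorem exists_step {Q : N → Prop} {x : N} (hx : Q x) (hr : ¬ Q τ.root) :
    ∃ w, w ≠ τ.root ∧ Q w ∧ ¬ Q (τ.parent w) := by
  classical
  obtain ⟨k, hk⟩ := τ.reaches_root x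
  have hex : ∃ k, ¬ Q (τ.parent^[k] x) := ⟨k, by rwa [hk]⟩
  set m := Nat.find hex with hm
  have h1 : ¬ Q (τ.parent^[m] x) := Nat.find_spec hex
  have hm0 : m ≠ 0 := fun h => by rw [h] at h1; exact h1 hx
  obtain ⟨j, hj⟩ := Nat.exists_eq_succ_of_ne_zero hm0
  have h2 : Q (τ.parent^[j] x) := by
    by_contra h
    exact Nat.find_min hex (m := j) (by omega) h
  refine ⟨τ.parent^[j] x, fun h => hr (h ▸ h2), h2, ?_⟩
  rwa [hj, Function.iterate_succ_apply'] at h1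

theorem parent_ne_self {w : N} (hw : w ≠ τ.root) : τ.parent w ≠ w := by
  intro h
  obtain ⟨w', _, h1, h2⟩ := τ.exists_step (Q := fun y => y = w) rfl (fun h => hw h.symm)
  exact h2 (h1 ▸ h)

theorem not_isLeaf_parent {w : N} (hw : w ≠ τ.root) : ¬ τ.IsLeaf (τ.parent w) := by
  intro h
  have : w ∈ τ.children (τ.parent w) := ⟨hw, rfl⟩
  rw [IsLeaf] at h
  rw [h] at this
  exact this

/-- A set `X` that is empty for a full tree, and reduced to the node with one child for an almost
full one, gives both cases the same identity. -/
theorem exists_exceptional (hτ : τ.IsFull ∨ τ.IsAlmostFull) :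
    ∃ X : Finset N, X.card ≤ 1 ∧ ∀ v, ¬ τ.IsLeaf v →
      τ.numChildren v + (if v ∈ X then 1 else 0) = 2 := by
  rcases hτ with h | ⟨u, hu, h⟩
  · refine ⟨∅, by simp, fun v hv => ?_⟩
    rw [isLeaf_iff] at hv
    have := h v
    rw [ncard_children] at this
    simp; omega
  · refine ⟨{u}, by simp, fun v hv => ?_⟩
    rw [isLeaf_iff] at hv
    rw [ncard_children] at hu
    by_cases hvu : v = u
    · subst hvu; simp [hu]
    · have := h v hvu
      rw [ncard_children] at this
      simp [hvu]; omega

namespace Pairing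

variable (P : τ.Pairing) [LinearOrder P.Vertex]

/-- The vertex of the diagram given by a node. -/
def node (x : N) : P.Vertex := Quotient.mk P.setoid x

theorem node_eq_node {x y : N} : P.node x = P.node y ↔ y = x ∨ y = P.mate x := Quotient.eq (r := P.setoid)

theorem exists_node (v : P.Vertex) : ∃ x, P.node x = v := Quotient.exists_rep v

theorem src_diagram (e : {w : N // w ≠ τ.root}) : P.diagram.src e = P.node e.1 := rfl

theorem tgt_diagram (e : {w : N // w ≠ τ.root}) : P.diagram.tgt e = P.node (τ.parent e.1) := rfl

theorem mate_eq_self {x : N} (hx : ¬ τ.IsLeaf x) : P.mate x = x := by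
  by_contra h
  exact hx ((P.mate_ne_iff x).1 h)

theorem isLeaf_mate {x : N} (hx : τ.IsLeaf x) : τ.IsLeaf (P.mate x) := by
  rw [← P.mate_ne_iff, P.mate_mate]
  exact ((P.mate_ne_iff x).2 hx).symm

/-- The target of an edge is an inner node, merged with no other node, and a node other than the
root is not its own parent. -/
theorem src_ne_tgt (e : {w : N // w ≠ τ.root}) : P.diagram.src e ≠ P.diagram.tgt e := by
  rw [src_diagram, tgt_diagram]
  intro h
  rw [eq_comm, node_eq_node, P.mate_eq_self (not_isLeaf_parent e.2), or_self] at h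
  exact parent_ne_self e.2 h.symm

open Classical in
/-- The inner nodes in a set of vertices. -/
def innerNodes (S : Finset P.Vertex) : Finset N :=
  Finset.univ.filter fun x => P.node x ∈ S ∧ ¬ τ.IsLeaf x

open Classical in
/-- The leaves in a set of vertices. -/
def leafNodes (S : Finset P.Vertex) : Finset N :=
  Finset.univ.filter fun x => P.node x ∈ S ∧ τ.IsLeaf x

/-- A vertex is either a single inner node or a pair of leaves. -/
theorem two_mul_card (S : Finset P.Vertex) :
    2 * S.card = 2 * (P.innerNodes S).card + (P.leafNodes S).card := by
  classical
  have h1 : ∀ T : Finset N, (∀ x ∈ T, P.node x ∈ S) →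
      T.card = ∑ v ∈ S, (T.filter fun x => P.node x = v).card := fun T hT =>
    Finset.card_eq_sum_card_fiberwise hT
  rw [h1 (P.innerNodes S) (fun x hx => (Finset.mem_filter.1 hx).2.1),
    h1 (P.leafNodes S) (fun x hx => (Finset.mem_filter.1 hx).2.1), Finset.mul_sum,
    ← Finset.sum_add_distrib, mul_comm, ← smul_eq_mul, ← Finset.sum_const]
  refine Finset.sum_congr rfl fun v hv => ?_
  obtain ⟨x, rfl⟩ := P.exists_node v
  by_cases hx : τ.IsLeaf x
  · have e1 : (P.innerNodes S).filter (fun y => P.node y = P.node x) = ∅ := by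
      refine Finset.filter_eq_empty_iff.2 fun y hy hyx => ?_
      rw [eq_comm, node_eq_node] at hyx
      have hy' := (Finset.mem_filter.1 hy).2.2
      rcases hyx with rfl | rfl
      · exact hy' hx
      · exact hy' (P.isLeaf_mate hx)
    have e2 : (P.leafNodes S).filter (fun y => P.node y = P.node x) = {x, P.mate x} := by
      ext y
      simp only [leafNodes, Finset.mem_filter, Finset.mem_univ, true_and, Finset.mem_insert,
        Finset.mem_singleton]
      constructor
      · rintro ⟨_, h⟩
        rw [eq_comm, node_eq_node] at h
        exact h
      · intro h
        have h' : P.node y = P.node x := by rw [eq_comm, node_eq_node]; exact h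
        refine ⟨⟨h' ▸ hv, ?_⟩, h'⟩
        rcases h with rfl | rfl
        · exact hx
        · exact P.isLeaf_mate hx
    rw [e1, e2, Finset.card_pair ((P.mate_ne_iff x).2 hx).symm]
    simp
  · have e1 : (P.innerNodes S).filter (fun y => P.node y = P.node x) = {x} := by
      ext y
      simp only [innerNodes, Finset.mem_filter, Finset.mem_univ, true_and, Finset.mem_singleton]
      constructor
      · rintro ⟨_, h⟩
        rw [eq_comm, node_eq_node, P.mate_eq_self hx, or_self] at h
        exact h
      · rintro rfl
        exact ⟨⟨hv, hx⟩, rfl⟩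
    have e2 : (P.leafNodes S).filter (fun y => P.node y = P.node x) = ∅ := by
      refine Finset.filter_eq_empty_iff.2 fun y hy hyx => ?_
      rw [eq_comm, node_eq_node, P.mate_eq_self hx, or_self] at hyx
      exact hx (hyx ▸ (Finset.mem_filter.1 hy).2.2)
    rw [e1, e2]
    simp

theorem card_filter_subtype (p : N → Prop) [DecidablePred p] :
    (Finset.univ.filter fun e : {w : N // w ≠ τ.root} => p e.1).card =
      (Finset.univ.filter fun w => w ≠ τ.root ∧ p w).card := by
  rw [← Finset.card_map (Function.Embedding.subtype _)]
  congr 1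
  ext w
  simp only [Finset.mem_map, Finset.mem_filter, Finset.mem_univ, true_and,
    Function.Embedding.subtype_apply, Subtype.exists, exists_and_right, exists_eq_right]
  constructor
  · rintro ⟨h, hp⟩; exact ⟨h, hp⟩
  · rintro ⟨h, hp⟩; exact ⟨h, hp⟩

/-- Edges counted by their targets: those ending in `S` are the children of the inner nodes of `S`,
two per node up to the defect `X`. -/
theorem card_induced_add_in {X : Finset N}
    (hX : ∀ v, ¬ τ.IsLeaf v → τ.numChildren v + (if v ∈ X then 1 else 0) = 2)
    (S : Finset P.Vertex) :
    (P.diagram.inducedEdges S).card + (P.diagram.inEdges S).card + (P.innerNodes S ∩ X).card =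
      2 * (P.innerNodes S).card := by
  classical
  have h1 : (P.diagram.inducedEdges S).card + (P.diagram.inEdges S).card =
      (Finset.univ.filter fun e : {w : N // w ≠ τ.root} => P.node (τ.parent e.1) ∈ S).card := by
    rw [FeynmanDiagram.inducedEdges, FeynmanDiagram.inEdges, ← Finset.card_union_of_disjoint]
    · congr 1
      ext e
      rw [Finset.mem_union, Finset.mem_filter, Finset.mem_filter, Finset.mem_filter, tgt_diagram]
      tauto
    · rw [Finset.disjoint_filter]
      tauto
  rw [h1, card_filter_subtype (fun w => P.node (τ.parent w) ∈ S)]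
  have h2 : (Finset.univ.filter fun w => w ≠ τ.root ∧ P.node (τ.parent w) ∈ S).card =
      ∑ v ∈ P.innerNodes S, τ.numChildren v := by
    rw [Finset.card_eq_sum_card_fiberwise (f := τ.parent) (t := P.innerNodes S)]
    · refine Finset.sum_congr rfl fun v hv => ?_
      rw [numChildren, Finset.filter_filter]
      congr 1
      ext w
      simp only [Finset.mem_filter, Finset.mem_univ, true_and]
      constructor
      · rintro ⟨⟨h, _⟩, h'⟩; exact ⟨h, h'⟩
      · rintro ⟨h, h'⟩
        exact ⟨⟨h, h' ▸ (Finset.mem_filter.1 hv).2.1⟩, h'⟩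
    · intro w hw
      have hw' := (Finset.mem_filter.1 (Finset.mem_coe.1 hw)).2
      exact Finset.mem_coe.2 (Finset.mem_filter.2 ⟨Finset.mem_univ _, hw'.2,
        not_isLeaf_parent hw'.1⟩)
  rw [h2, ← Finset.filter_mem_eq_inter, Finset.card_filter, ← Finset.sum_add_distrib,
    Finset.sum_congr rfl fun v hv => hX v (Finset.mem_filter.1 hv).2.2]
  simp [mul_comm]

/-- Edges counted by their sources: each node other than the root carries exactly one edge to its
parent. -/
theorem card_induced_add_out (S : Finset P.Vertex) :
    (P.diagram.inducedEdges S).card + (P.diagram.outEdges S).card +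
      (if P.node τ.root ∈ S then 1 else 0) = (P.innerNodes S).card + (P.leafNodes S).card := by
  classical
  have h1 : (P.diagram.inducedEdges S).card + (P.diagram.outEdges S).card =
      (Finset.univ.filter fun e : {w : N // w ≠ τ.root} => P.node e.1 ∈ S).card := by
    rw [FeynmanDiagram.inducedEdges, FeynmanDiagram.outEdges, ← Finset.card_union_of_disjoint]
    · congr 1
      ext e
      rw [Finset.mem_union, Finset.mem_filter, Finset.mem_filter, Finset.mem_filter, src_diagram]
      tauto
    · rw [Finset.disjoint_filter]
      tauto
  have h2 : (P.innerNodes S).card + (P.leafNodes S).card =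
      (Finset.univ.filter fun w => P.node w ∈ S).card := by
    rw [innerNodes, leafNodes, ← Finset.card_union_of_disjoint]
    · congr 1
      ext e
      simp only [Finset.mem_union, Finset.mem_filter, Finset.mem_univ, true_and]
      tauto
    · rw [Finset.disjoint_filter]
      tauto
  rw [h1, h2, card_filter_subtype (fun w => P.node w ∈ S)]
  have h3 : (Finset.univ.filter fun w => P.node w ∈ S) =
      (Finset.univ.filter fun w => w ≠ τ.root ∧ P.node w ∈ S) ∪
        (Finset.univ.filter fun w => w = τ.root ∧ P.node w ∈ S) := by
    ext w
    simp only [Finset.mem_union, Finset.mem_filter, Finset.mem_univ, true_and]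
    tauto
  rw [h3, Finset.card_union_of_disjoint (by rw [Finset.disjoint_filter]; tauto)]
  congr 1
  split_ifs with h
  · rw [eq_comm, Finset.card_eq_one]
    refine ⟨τ.root, ?_⟩
    ext w
    simp only [Finset.mem_filter, Finset.mem_univ, true_and, Finset.mem_singleton]
    constructor
    · exact fun h => h.1
    · rintro rfl; exact ⟨rfl, h⟩
  · rw [eq_comm, Finset.card_eq_zero]
    refine Finset.filter_eq_empty_iff.2 ?_
    rintro w _ ⟨rfl, h'⟩
    exact h h'

/-- Eliminating the numbers of inner nodes and of leaves from the three counts expresses `4 |S|` as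
`3` times the number of internal edges plus nonnegative terms. The coefficient `3ρ - d`, positive
above the critical value, is what remains of the internal edges. -/
theorem four_mul_degree (ρ : ℝ) (d : ℕ) {X : Finset N}
    (hX : ∀ v, ¬ τ.IsLeaf v → τ.numChildren v + (if v ∈ X then 1 else 0) = 2)
    (S : Finset P.Vertex) :
    4 * ((ρ + d) * S.card - d * (P.diagram.inducedEdges S).card) =
      (P.diagram.inducedEdges S).card * (3 * ρ - d) + (ρ + d) *
        (((P.diagram.inEdges S).card + (P.innerNodes S ∩ X).card +
          2 * (P.diagram.outEdges S).card + 2 * (if P.node τ.root ∈ S then 1 else 0) : ℕ) : ℝ) := by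
  have h1 := P.card_induced_add_in hX S
  have h2 := P.card_induced_add_out S
  have h3 := P.two_mul_card S
  set r : ℕ := if P.node τ.root ∈ S then 1 else 0
  have h1' : ((P.diagram.inducedEdges S).card : ℝ) + (P.diagram.inEdges S).card +
    (P.innerNodes S ∩ X).card = 2 * (P.innerNodes S).card := by exact_mod_cast h1
  have h2' : ((P.diagram.inducedEdges S).card : ℝ) + (P.diagram.outEdges S).card + r =
    (P.innerNodes S).card + (P.leafNodes S).card := by exact_mod_cast h2
  have h3' : 2 * (S.card : ℝ) = 2 * (P.innerNodes S).card + (P.leafNodes S).card := by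
    exact_mod_cast h3
  push_cast
  have : 4 * (S.card : ℝ) = 3 * (P.diagram.inducedEdges S).card + (P.diagram.inEdges S).card +
    (P.innerNodes S ∩ X).card + 2 * (P.diagram.outEdges S).card + 2 * r := by linarith
  linear_combination (ρ + d) * this

/-! ### Rigidity of divergent subdiagrams and its consequences for the whole diagram. -/

section Divergent

variable {P} {ρ : ℝ} {d : ℕ} (hρ0 : 0 < ρ) (hρc : (d : ℝ) / 3 < ρ)
  (hc : P.diagram.IsTwoConnected)
include hρ0 hρc hc

/-- Let `w` be the bracket of `four_mul_degree`. Nonpositive degree with at least one edge gives `w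
< 4`, which excludes the root from `S`. Then an edge leaves `S` on the way to the root, and together
with the two boundary edges given by two-connectedness this yields `w ≥ 3`. The value `w = 3` leaves
a single possibility for each term. -/
theorem fullDivergent_counts {X : Finset N}
    (hX : ∀ v, ¬ τ.IsLeaf v → τ.numChildren v + (if v ∈ X then 1 else 0) = 2)
    {γ : Finset {w : N // w ≠ τ.root}}
    (hγ : P.diagram.IsFullDivergent ρ d γ) :
    2 * (P.innerNodes (P.diagram.vertices γ)).card = γ.card + 1 ∧
    2 * (P.leafNodes (P.diagram.vertices γ)).card = γ.card + 1 ∧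
    P.node τ.root ∉ P.diagram.vertices γ ∧
    (P.diagram.outEdges (P.diagram.vertices γ)).card = 1 ∧
    4 * P.diagram.subdegree ρ d γ = γ.card * (3 * ρ - d) - (ρ + d) := by
  set S := P.diagram.vertices γ with hS
  have h1 := P.card_induced_add_in hX S
  have h2 := P.card_induced_add_out S
  have h4 := P.four_mul_degree ρ d hX S
  have hind : P.diagram.inducedEdges S = γ := hγ.2.inducedEdges_vertices
  have h5 := FeynmanDiagram.two_le_card_in_add_card_out hc hγ.vertices_nonempty hγ.vertices_ne_univ
  rw [← hS] at h5
  have hsub := (FeynmanDiagram.mem_divergent.1 hγ.1).2.2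
  rw [FeynmanDiagram.subdegree_eq, ← hS] at hsub
  have hpos : 1 ≤ γ.card := hγ.nonempty.card_pos
  have hpos' : (1 : ℝ) ≤ γ.card := by exact_mod_cast hpos
  have h3ρ : 0 < 3 * ρ - d := by linarith
  have hd0 : (0 : ℝ) ≤ d := Nat.cast_nonneg d
  rw [hind] at h1 h2 h4
  set w : ℕ := (P.diagram.inEdges S).card + (P.innerNodes S ∩ X).card +
          2 * (P.diagram.outEdges S).card + 2 * (if P.node τ.root ∈ S then 1 else 0) with hw
  have hw4 : w < 4 := by
    by_contra! h
    have : (4 : ℝ) ≤ w := by exact_mod_cast h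
    nlinarith
  have hroot : P.node τ.root ∉ S := by
    intro h
    simp only [h, if_true] at hw
    omega
  -- Climbing from any node of `S` to the root, which is outside `S`, crosses the boundary outwards.
  have hout : 1 ≤ (P.diagram.outEdges S).card := by
    obtain ⟨v, hv⟩ := hγ.vertices_nonempty
    obtain ⟨x, rfl⟩ := P.exists_node v
    obtain ⟨y, hy0, hy1, hy2⟩ := τ.exists_step (Q := fun x => P.node x ∈ S) hv hroot
    exact Finset.card_pos.2 ⟨⟨y, hy0⟩, Finset.mem_filter.2 ⟨Finset.mem_univ _, hy1, hy2⟩⟩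
  simp only [hroot, if_false] at hw h2
  have hw3 : w = 3 := by omega
  refine ⟨by omega, by omega, hroot, by omega, ?_⟩
  rw [FeynmanDiagram.subdegree_eq, ← hS]
  rw [hw3] at h4
  push_cast at h4
  linarith

theorem four_mul_subdegree (hτ : τ.IsFull ∨ τ.IsAlmostFull) {γ : Finset {w : N // w ≠ τ.root}}
    (hγ : P.diagram.IsFullDivergent ρ d γ) :
    4 * P.diagram.subdegree ρ d γ = γ.card * (3 * ρ - d) - (ρ + d) := by
  obtain ⟨X, _, hX⟩ := τ.exists_exceptional hτ
  exact (fullDivergent_counts hρ0 hρc hc hX hγ).2.2.2.2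

omit hρ0 hρc hc in
theorem root_not_isLeaf (P : τ.Pairing) : ¬ τ.IsLeaf τ.root := by
  intro h
  have hne := (P.mate_ne_iff τ.root).2 h
  obtain ⟨w, hw, _, h2⟩ := τ.exists_step (Q := fun x => x ≠ τ.root) hne (fun h => h rfl)
  have : w ∈ τ.children τ.root := ⟨hw, not_not.1 h2⟩
  rw [IsLeaf] at h
  rw [h] at this
  exact this

omit hρ0 hρc hc in
theorem whole_counts {X : Finset N}
    (hX : ∀ v, ¬ τ.IsLeaf v → τ.numChildren v + (if v ∈ X then 1 else 0) = 2) :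
    4 * P.diagram.degree ρ d = Fintype.card {w : N // w ≠ τ.root} * (3 * ρ - d) +
      (ρ + d) * ((P.innerNodes Finset.univ ∩ X).card - 2) ∧
    Fintype.card {w : N // w ≠ τ.root} + (P.innerNodes Finset.univ ∩ X).card =
      2 * (P.innerNodes Finset.univ).card ∧
    Fintype.card {w : N // w ≠ τ.root} + 1 =
      (P.innerNodes Finset.univ).card + (P.leafNodes Finset.univ).card := by
  have h1 := P.card_induced_add_in hX Finset.univ
  have h2 := P.card_induced_add_out Finset.univ
  have h4 := P.four_mul_degree ρ d hX Finset.univ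
  have e1 : P.diagram.inducedEdges Finset.univ = Finset.univ := by
    simp [FeynmanDiagram.inducedEdges]
  have e2 : P.diagram.inEdges Finset.univ = ∅ := by simp [FeynmanDiagram.inEdges]
  have e3 : P.diagram.outEdges Finset.univ = ∅ := by simp [FeynmanDiagram.outEdges]
  simp only [e1, e2, e3, Finset.card_empty, Finset.mem_univ, if_true, Finset.card_univ] at h1 h2 h4
  refine ⟨?_, by omega, by omega⟩
  rw [FeynmanDiagram.degree_eq]
  push_cast at h4
  linarith

omit hc in
-- With nonpositive degree, `|E| (3ρ - d)` is at most `2 (ρ + d)`. Diagrams therefore have bounded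
-- size, and constants need no control in terms of `|E|`.
theorem card_edges_le (hτ : τ.IsFull ∨ τ.IsAlmostFull) (hdeg : P.diagram.degree ρ d ≤ 0) :
    (Fintype.card {w : N // w ≠ τ.root} : ℝ) ≤ 2 * (ρ + d) / (3 * ρ - d) := by
  obtain ⟨X, _, hX⟩ := τ.exists_exceptional hτ
  have h := (whole_counts (P := P) (ρ := ρ) (d := d) hX).1
  have h3ρ : 0 < 3 * ρ - d := by linarith
  have hd0 : (0 : ℝ) ≤ d := Nat.cast_nonneg d
  rw [le_div_iff₀ h3ρ]
  have : (0 : ℝ) ≤ (P.innerNodes Finset.univ ∩ X).card := Nat.cast_nonneg _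
  nlinarith

/-- Two distinct maximal elements of degree zero would be disjoint with `(ρ + d) / (3ρ - d)` edges
each. Together with the edge leaving one of them, they exceed the number of edges allowed by `deg Γ
≤ 0`. -/
theorem zeta_le_one (hτ : τ.IsFull ∨ τ.IsAlmostFull) (hdeg : P.diagram.degree ρ d ≤ 0)
    {F : Finset (Finset {w : N // w ≠ τ.root})} (hF : P.diagram.IsFullForest ρ d F) :
    P.diagram.zeta ρ d F ≤ 1 := by
  obtain ⟨X, _, hX⟩ := τ.exists_exceptional hτ
  rw [FeynmanDiagram.zeta, Set.ncard_le_one (Set.toFinite _)]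
  rintro γ₁ ⟨h1, hm1, hz1⟩ γ₂ ⟨h2, hm2, hz2⟩
  by_contra hne
  have hdis : Disjoint (P.diagram.vertices γ₁) (P.diagram.vertices γ₂) := by
    rcases hF.1.2 γ₁ h1 γ₂ h2 with h | h | h
    · exact absurd (lt_of_le_of_ne h hne) (hm1 γ₂ h2)
    · exact absurd (lt_of_le_of_ne h (Ne.symm hne)) (hm2 γ₁ h1)
    · exact h
  have hd1 : P.diagram.IsFullDivergent ρ d γ₁ := ⟨hF.1.1 h1, hF.2 _ h1⟩
  have hd2 : P.diagram.IsFullDivergent ρ d γ₂ := ⟨hF.1.1 h2, hF.2 _ h2⟩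
  obtain ⟨_, _, _, hout, e1⟩ := fullDivergent_counts hρ0 hρc hc hX hd1
  obtain ⟨_, _, _, _, e2⟩ := fullDivergent_counts hρ0 hρc hc hX hd2
  have hw := (whole_counts (P := P) (ρ := ρ) (d := d) hX).1
  obtain ⟨e, he⟩ : (P.diagram.outEdges (P.diagram.vertices γ₁)).Nonempty :=
    Finset.card_pos.1 (by omega)
  have he' := (Finset.mem_filter.1 he).2
  have hdisγ : Disjoint γ₁ γ₂ := Finset.disjoint_left.2 fun x hx1 hx2 =>
    Finset.disjoint_left.1 hdis (FeynmanDiagram.src_mem_vertices hx1)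
      (FeynmanDiagram.src_mem_vertices hx2)
  have hne1 : e ∉ γ₁ ∪ γ₂ := by
    rw [Finset.mem_union]
    rintro (h | h)
    · exact he'.2 (FeynmanDiagram.tgt_mem_vertices h)
    · exact Finset.disjoint_left.1 hdis he'.1 (FeynmanDiagram.src_mem_vertices h)
  have hcard : γ₁.card + γ₂.card + 1 ≤ Fintype.card {w : N // w ≠ τ.root} := by
    rw [← Finset.card_union_of_disjoint hdisγ, ← Finset.card_insert_of_notMem hne1]
    exact Finset.card_le_univ _
  have hcard' : (γ₁.card : ℝ) + γ₂.card + 1 ≤ Fintype.card {w : N // w ≠ τ.root} := by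
    exact_mod_cast hcard
  have h3ρ : 0 < 3 * ρ - d := by linarith
  have hd0 : (0 : ℝ) ≤ d := Nat.cast_nonneg d
  have : (0 : ℝ) ≤ (P.innerNodes Finset.univ ∩ X).card := Nat.cast_nonneg _
  rw [hz1] at e1
  rw [hz2] at e2
  nlinarith

open Classical in
/-- The mollified edges outside of disjoint divergent subdiagrams suffice to make the whole diagram
superficially convergent once they are regularised. -/
theorem degree_add_mollified_pos (hd : 1 ≤ d) (hρ2 : ρ ≤ 2) (hτ : τ.IsFull ∨ τ.IsAlmostFull)
    {F : Finset (Finset {w : N // w ≠ τ.root})}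
    (hF : ∀ γ ∈ F, P.diagram.IsFullDivergent ρ d γ)
    (hdis : ∀ γ ∈ F, ∀ γ' ∈ F, γ ≠ γ' → Disjoint (P.diagram.vertices γ) (P.diagram.vertices γ')) :
    0 < P.diagram.degree ρ d + d * (Finset.univ.filter fun e : {w : N // w ≠ τ.root} =>
      P.diagram.type e = .mollified ∧ ∀ γ ∈ F, e ∉ γ).card := by
  obtain ⟨X, hX1, hX⟩ := τ.exists_exceptional hτ
  obtain ⟨hdeg, hE1, hE2⟩ := whole_counts (P := P) (ρ := ρ) (d := d) hX
  have hcounts := fun γ hγ => fullDivergent_counts hρ0 hρc hc hX (hF γ hγ)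
  set x := (P.innerNodes Finset.univ ∩ X).card with hx
  have hx1 : x ≤ 1 := (Finset.card_le_card Finset.inter_subset_right).trans hX1
  set M := (Finset.univ.filter fun e : {w : N // w ≠ τ.root} =>
      P.diagram.type e = .mollified ∧ ∀ γ ∈ F, e ∉ γ) with hM
  have htype : ∀ e : {w : N // w ≠ τ.root}, P.diagram.type e = .mollified ↔ τ.IsLeaf e.1 := by
    intro e
    simp only [diagram]
    split_ifs with h <;> simp [h]
  -- The root is an inner node that belongs to no divergent subdiagram, whence the additional `1`.
  have hinner : 1 + ∑ γ ∈ F, (P.innerNodes (P.diagram.vertices γ)).card ≤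
      (P.innerNodes Finset.univ).card := by
    have hpd : (F : Set (Finset _)).PairwiseDisjoint
        (fun γ => P.innerNodes (P.diagram.vertices γ)) := by
      intro γ hγ γ' hγ' hne
      refine Finset.disjoint_left.2 fun y hy hy' => ?_
      exact Finset.disjoint_left.1 (hdis γ hγ γ' hγ' hne) (Finset.mem_filter.1 hy).2.1
        (Finset.mem_filter.1 hy').2.1
    rw [← Finset.card_biUnion hpd, add_comm, ← Finset.card_insert_of_notMem (a := τ.root)]
    · refine Finset.card_le_card fun y hy => ?_
      rcases Finset.mem_insert.1 hy with rfl | hy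
      · exact Finset.mem_filter.2 ⟨Finset.mem_univ _, Finset.mem_univ _, root_not_isLeaf P⟩
      · obtain ⟨γ, _, h⟩ := Finset.mem_biUnion.1 hy
        exact Finset.mem_filter.2 ⟨Finset.mem_univ _, Finset.mem_univ _,
          (Finset.mem_filter.1 h).2.2⟩
    · intro h
      obtain ⟨γ, hγ, h⟩ := Finset.mem_biUnion.1 h
      exact (hcounts γ hγ).2.2.1 (Finset.mem_filter.1 h).2.1
  -- A leaf whose edge lies in no element of `F` contributes to `M`; any other leaf is a node of the
  -- subdiagram containing its edge.
  have hleaf : (P.leafNodes Finset.univ).card ≤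
      M.card + ∑ γ ∈ F, (P.leafNodes (P.diagram.vertices γ)).card := by
    refine le_trans ?_ (add_le_add_right Finset.card_biUnion_le _)
    rw [← Finset.card_map (Function.Embedding.subtype _) (s := M)]
    refine le_trans (Finset.card_le_card fun y hy => ?_) (Finset.card_union_le _ _)
    have hy' := (Finset.mem_filter.1 hy).2.2
    have hyr : y ≠ τ.root := fun h => root_not_isLeaf P (h ▸ hy')
    by_cases h : ∀ γ ∈ F, (⟨y, hyr⟩ : {w : N // w ≠ τ.root}) ∉ γ
    · refine Finset.mem_union_left _ (Finset.mem_map.2 ⟨⟨y, hyr⟩, ?_, rfl⟩)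
      exact Finset.mem_filter.2 ⟨Finset.mem_univ _, (htype _).2 hy', h⟩
    · push Not at h
      obtain ⟨γ, hγ, h⟩ := h
      refine Finset.mem_union_right _ (Finset.mem_biUnion.2 ⟨γ, hγ, ?_⟩)
      exact Finset.mem_filter.2 ⟨Finset.mem_univ _,
        FeynmanDiagram.src_mem_vertices (Γ := P.diagram) h, hy'⟩
  have hsum : ∑ γ ∈ F, (P.leafNodes (P.diagram.vertices γ)).card =
      ∑ γ ∈ F, (P.innerNodes (P.diagram.vertices γ)).card :=
    Finset.sum_congr rfl fun γ hγ => by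
      have := hcounts γ hγ
      omega
  -- Inside each `γ` leaves and inner nodes are equally numerous, while in the whole tree leaves
  -- plus `x` exceed inner nodes by one. With the root left over, at least `2 - x` mollified edges
  -- are outside.
  have hMx : 2 ≤ M.card + x := by omega
  have hE : 1 ≤ Fintype.card {w : N // w ≠ τ.root} := by omega
  have hMx' : (2 : ℝ) ≤ M.card + x := by exact_mod_cast hMx
  have hx1' : (x : ℝ) ≤ 1 := by exact_mod_cast hx1
  have hE' : (1 : ℝ) ≤ Fintype.card {w : N // w ≠ τ.root} := by exact_mod_cast hE
  have h3ρ : 0 < 3 * ρ - d := by linarith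
  have hd1 : (1 : ℝ) ≤ d := by exact_mod_cast hd
  have h1 : 0 < (Fintype.card {w : N // w ≠ τ.root} : ℝ) * (3 * ρ - d) := by positivity
  have h2 : (d : ℝ) * (2 - x) ≤ d * M.card := by
    apply mul_le_mul_of_nonneg_left _ (by linarith); linarith
  -- Each of the `2 - x` edges brings `d` against a deficit of `(ρ + d) / 4`, and `3d > ρ` because
  -- `d ≥ 1` and `ρ ≤ 2`.
  have h3 : 0 ≤ (2 - (x : ℝ)) * (3 * d - ρ) := mul_nonneg (by linarith) (by linarith)
  nlinarith

end Divergent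

end Pairing

end SymbolTree

end
noncomputable section

/-! ### Hepp trees -/

namespace HeppTree

variable {V : Type} [Fintype V] [DecidableEq V] (T : HeppTree V)

/-- The smallest inner node from which all the elements of `S` descend. -/
def hull (S : Finset V) : Finset V := (T.inner.filter fun A => S ⊆ A).inf id

variable {T} {S A B : Finset V} {u v w : V}

theorem subset_hull : S ⊆ T.hull S := by
  have : S ≤ (T.inner.filter fun A => S ⊆ A).inf id :=
    Finset.le_inf fun A hA => (Finset.mem_filter.1 hA).2
  exact this

theorem hull_subset (hA : A ∈ T.inner) (h : S ⊆ A) : T.hull S ⊆ A := by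
  have : (T.inner.filter fun A => S ⊆ A).inf id ≤ id A :=
    Finset.inf_le (Finset.mem_filter.2 ⟨hA, h⟩)
  exact this

theorem hull_mem (hS : S.Nonempty) : T.hull S ∈ T.inner := by
  obtain ⟨A, hA, hmin⟩ := Finset.exists_min_image (T.inner.filter fun A => S ⊆ A) Finset.card
    ⟨Finset.univ, Finset.mem_filter.2 ⟨T.root_mem, Finset.subset_univ _⟩⟩
  obtain ⟨hA1, hA2⟩ := Finset.mem_filter.1 hA
  suffices h : T.hull S = A by rwa [h]
  refine Finset.Subset.antisymm (hull_subset hA1 hA2) ?_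
  have : A ≤ (T.inner.filter fun A => S ⊆ A).inf id := by
    refine Finset.le_inf fun B hB => ?_
    obtain ⟨hB1, hB2⟩ := Finset.mem_filter.1 hB
    rcases T.laminar A hA1 B hB1 with h | h | h
    · exact h
    · exact (Finset.eq_of_subset_of_card_le h (hmin B hB)).symm.subset
    · obtain ⟨x, hx⟩ := hS
      exact absurd (hB2 hx) (Finset.disjoint_left.1 h (hA2 hx))
  exact this

theorem lca_eq_hull : T.lca u v = T.hull {u, v} := by
  unfold lca hull
  congr 1
  ext A
  simp [Finset.insert_subset_iff]

theorem lca_comm : T.lca u v = T.lca v u := by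
  rw [lca_eq_hull, lca_eq_hull, Finset.pair_comm]

theorem lca_mem : T.lca u v ∈ T.inner := by
  rw [lca_eq_hull]; exact hull_mem ⟨u, by simp⟩

theorem left_mem_lca : u ∈ T.lca u v := by
  rw [lca_eq_hull]; exact subset_hull (by simp)

theorem right_mem_lca : v ∈ T.lca u v := by
  rw [lca_eq_hull]; exact subset_hull (by simp)

theorem lca_subset (hA : A ∈ T.inner) (hu : u ∈ A) (hv : v ∈ A) : T.lca u v ⊆ A := by
  rw [lca_eq_hull]
  exact hull_subset hA (by simp [Finset.insert_subset_iff, hu, hv])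

theorem subset_or_subset (hA : A ∈ T.inner) (hB : B ∈ T.inner) (hu : u ∈ A) (hu' : u ∈ B) :
    A ⊆ B ∨ B ⊆ A := by
  rcases T.laminar A hA B hB with h | h | h
  · exact Or.inl h
  · exact Or.inr h
  · exact absurd hu' (Finset.disjoint_left.1 h hu)

theorem subset_lca_of_notMem (hA : A ∈ T.inner) (hu : u ∈ A) (hw : w ∉ A) :
    A ⊂ T.lca u w := by
  rcases subset_or_subset hA (lca_mem (T := T) (u := u) (v := w)) hu left_mem_lca with h | h
  · exact Finset.ssubset_iff_subset_ne.2 ⟨h, fun e => hw (e ▸ right_mem_lca)⟩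
  · exact absurd (h right_mem_lca) hw

/-- The two offspring of an inner node. -/
theorem exists_offspring (hA : A ∈ T.inner) : ∃ B₁ B₂ : Finset V, Disjoint B₁ B₂ ∧ B₁ ∪ B₂ = A ∧
    B₁.Nonempty ∧ B₂.Nonempty ∧ (B₁ ∈ T.inner ∨ B₁.card = 1) ∧ (B₂ ∈ T.inner ∨ B₂.card = 1) ∧
    (∀ B ∈ T.inner, B ⊂ A → B ⊆ B₁ ∨ B ⊆ B₂) ∧
    ∀ u ∈ B₁, ∀ v ∈ B₂, T.lca u v = A := by
  obtain ⟨B₁, B₂, hdis, hun, h1, h2, hne1, hne2⟩ := T.binary A hA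
  -- A smaller inner node that meets both offspring contains each of them, hence `A`, which is
  -- absurd.
  have half : ∀ B₁ B₂ : Finset V, Disjoint B₁ B₂ → B₁ ∪ B₂ = A →
      (B₁ ∈ T.inner ∨ B₁.card = 1) → ∀ B ∈ T.inner, B ⊂ A → (∃ x ∈ B, x ∈ B₁) →
      (∃ x ∈ B, x ∈ B₂) → B₁ ⊆ B := by
    rintro B₁ B₂ hdis hun h1 B hB hBA ⟨x, hx, hx1⟩ ⟨y, hy, hy2⟩
    rcases h1 with h1 | h1
    · rcases subset_or_subset hB h1 hx hx1 with h | h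
      · exact absurd hy2 (Finset.disjoint_left.1 hdis (h hy))
      · exact h
    · obtain ⟨z, rfl⟩ := Finset.card_eq_one.1 h1
      rw [Finset.mem_singleton] at hx1
      subst hx1
      simpa using hx
  have hsplit : ∀ B ∈ T.inner, B ⊂ A → B ⊆ B₁ ∨ B ⊆ B₂ := by
    intro B hB hBA
    by_contra! hcon
    obtain ⟨⟨x, hx, hx1⟩, ⟨y, hy, hy2⟩⟩ := (by
      simpa only [Finset.not_subset] using hcon : (∃ x ∈ B, x ∉ B₁) ∧ ∃ x ∈ B, x ∉ B₂)
    have hx2 : x ∈ B₂ := (Finset.mem_union.1 (hun ▸ hBA.1 hx : x ∈ B₁ ∪ B₂)).resolve_left hx1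
    have hy1 : y ∈ B₁ := (Finset.mem_union.1 (hun ▸ hBA.1 hy : y ∈ B₁ ∪ B₂)).resolve_right hy2
    have e1 := half B₁ B₂ hdis hun h1 B hB hBA ⟨y, hy, hy1⟩ ⟨x, hx, hx2⟩
    have e2 := half B₂ B₁ hdis.symm (Finset.union_comm B₁ B₂ ▸ hun) h2 B hB hBA ⟨x, hx, hx2⟩
      ⟨y, hy, hy1⟩
    exact hBA.2 (hun ▸ Finset.union_subset e1 e2)
  refine ⟨B₁, B₂, hdis, hun, hne1, hne2, h1, h2, hsplit, fun u hu v hv => ?_⟩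
  have huA : u ∈ A := hun ▸ Finset.mem_union_left _ hu
  have hvA : v ∈ A := hun ▸ Finset.mem_union_right _ hv
  by_contra hne
  have hss : T.lca u v ⊂ A := Finset.ssubset_iff_subset_ne.2 ⟨lca_subset hA huA hvA, hne⟩
  rcases hsplit _ lca_mem hss with h | h
  · exact Finset.disjoint_left.1 hdis (h right_mem_lca) hv
  · exact Finset.disjoint_left.1 hdis hu (h left_mem_lca)

/-- The offspring of the last common ancestor of two distinct leaves separate them. -/
theorem exists_branches (huv : u ≠ v) : ∃ B₁ B₂ : Finset V, u ∈ B₁ ∧ v ∈ B₂ ∧ Disjoint B₁ B₂ ∧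
    (∀ B ∈ T.inner, B ⊂ T.lca u v → B ⊆ B₁ ∨ B ⊆ B₂) ∧
    ∀ x ∈ B₁, ∀ y ∈ B₂, T.lca x y = T.lca u v := by
  obtain ⟨B₁, B₂, hdis, hun, hne1, hne2, h1, h2, hsplit, hlca⟩ :=
    exists_offspring (T := T) (lca_mem (u := u) (v := v))
  have hu : u ∈ B₁ ∪ B₂ := hun ▸ left_mem_lca
  have hv : v ∈ B₁ ∪ B₂ := hun ▸ right_mem_lca
  have hnot : ∀ B, (B ∈ T.inner ∨ B.card = 1) → B ⊂ T.lca u v → u ∈ B → v ∉ B := by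
    intro B hB hBs huB hvB
    rcases hB with hB | hB
    · exact hBs.2 (lca_subset hB huB hvB)
    · obtain ⟨z, rfl⟩ := Finset.card_eq_one.1 hB
      rw [Finset.mem_singleton] at huB hvB
      exact huv (huB.trans hvB.symm)
  have hs1 : B₁ ⊂ T.lca u v := by
    refine Finset.ssubset_iff_subset_ne.2 ⟨hun ▸ Finset.subset_union_left, fun e => ?_⟩
    obtain ⟨x, hx⟩ := hne2
    exact Finset.disjoint_left.1 hdis (e ▸ hun ▸ Finset.mem_union_right _ hx) hx
  have hs2 : B₂ ⊂ T.lca u v := by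
    refine Finset.ssubset_iff_subset_ne.2 ⟨hun ▸ Finset.subset_union_right, fun e => ?_⟩
    obtain ⟨x, hx⟩ := hne1
    exact Finset.disjoint_left.1 hdis hx (e ▸ hun ▸ Finset.mem_union_left _ hx)
  rcases Finset.mem_union.1 hu with hu | hu
  · exact ⟨B₁, B₂, hu, (Finset.mem_union.1 hv).resolve_left (hnot _ h1 hs1 hu), hdis, hsplit, hlca⟩
  · refine ⟨B₂, B₁, hu, (Finset.mem_union.1 hv).resolve_right (hnot _ h2 hs2 hu), hdis.symm,
      fun B hB hBs => (hsplit B hB hBs).symm, fun x hx y hy => ?_⟩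
    rw [lca_comm]; exact hlca y hy x hx

/-- A binary tree with `k` leaves has `k - 1` inner nodes. This inequality is what compares the
volume factors, one per inner node, with the vertices of the diagram. -/
theorem card_le_card_inner (hA : A ∈ T.inner) :
    A.card ≤ (T.inner.filter fun B => B ⊆ A).card + 1 := by
  induction hn : A.card using Nat.strong_induction_on generalizing A with
  | _ n ih =>
    subst hn
    obtain ⟨B₁, B₂, hdis, hun, hne1, hne2, h1, h2, hsplit, _⟩ := exists_offspring hA
    have hcard : B₁.card + B₂.card = A.card := by rw [← hun, Finset.card_union_of_disjoint hdis]
    have c1 := hne1.card_pos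
    have c2 := hne2.card_pos
    have k : ∀ B, (B ∈ T.inner ∨ B.card = 1) → B.card < A.card →
        B.card ≤ (T.inner.filter fun C => C ⊆ B).card + 1 := by
      rintro B (hB | hB) hlt
      · exact ih _ hlt hB rfl
      · omega
    have k1 := k B₁ h1 (by omega)
    have k2 := k B₂ h2 (by omega)
    have hnot : ∀ B, B.card < A.card → A ∉ T.inner.filter fun C => C ⊆ B := by
      intro B hB h
      have := Finset.card_le_card (Finset.mem_filter.1 h).2
      omega
    have hd' : Disjoint (T.inner.filter fun C => C ⊆ B₁) (T.inner.filter fun C => C ⊆ B₂) := by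
      refine Finset.disjoint_left.2 fun C hC1 hC2 => ?_
      obtain ⟨hC, hC1⟩ := Finset.mem_filter.1 hC1
      have hC2 := (Finset.mem_filter.1 hC2).2
      obtain ⟨_, _, _, hun', ⟨x, hx⟩, _⟩ := exists_offspring hC
      have hx' : x ∈ C := hun' ▸ Finset.mem_union_left _ hx
      exact Finset.disjoint_left.1 hdis (hC1 hx') (hC2 hx')
    have : insert A ((T.inner.filter fun C => C ⊆ B₁) ∪ (T.inner.filter fun C => C ⊆ B₂)) ⊆
        T.inner.filter fun B => B ⊆ A := by
      intro C hC
      rw [Finset.mem_insert, Finset.mem_union, Finset.mem_filter, Finset.mem_filter] at hC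
      rw [Finset.mem_filter]
      rcases hC with rfl | ⟨hC, h⟩ | ⟨hC, h⟩
      · exact ⟨hA, subset_rfl⟩
      · exact ⟨hC, h.trans (hun ▸ Finset.subset_union_left)⟩
      · exact ⟨hC, h.trans (hun ▸ Finset.subset_union_right)⟩
    have hle := Finset.card_le_card this
    rw [Finset.card_insert_of_notMem, Finset.card_union_of_disjoint hd'] at hle
    · omega
    · rw [Finset.mem_union, not_or]
      exact ⟨hnot B₁ (by omega), hnot B₂ (by omega)⟩

theorem nonempty_of_mem (hA : A ∈ T.inner) : A.Nonempty := by
  obtain ⟨_, _, _, hun, ⟨x, hx⟩, _⟩ := exists_offspring hA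
  exact ⟨x, hun ▸ Finset.mem_union_left _ hx⟩

theorem one_lt_card_of_mem (hA : A ∈ T.inner) : 1 < A.card := by
  obtain ⟨B₁, B₂, hdis, hun, hne1, hne2, _⟩ := exists_offspring hA
  rw [← hun, Finset.card_union_of_disjoint hdis]
  have := hne1.card_pos
  have := hne2.card_pos
  omega

/-- The scale of a set of leaves, which is zero unless it is an inner node. -/
def scale (n : T.Scales) (A : Finset V) : ℕ := if h : A ∈ T.inner then n.1 ⟨A, h⟩ else 0

theorem scale_of_mem (n : T.Scales) (hA : A ∈ T.inner) : scale n A = n.1 ⟨A, hA⟩ := by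
  simp [scale, hA]

theorem scale_anti (n : T.Scales) (hA : A ∈ T.inner) (hB : B ∈ T.inner) (h : A ⊆ B) :
    scale n B ≤ scale n A := by
  rw [scale_of_mem n hA, scale_of_mem n hB]; exact n.2 _ _ h

variable (T) in
/-- The inner node immediately above `A`. -/
def above (A : Finset V) : Finset V := (T.inner.filter fun B => A ⊂ B).inf id

theorem above_spec (hA : A ∈ T.inner) (hne : A ≠ Finset.univ) :
    T.above A ∈ T.inner ∧ A ⊂ T.above A ∧ ∀ B ∈ T.inner, A ⊂ B → T.above A ⊆ B := by
  have hle : ∀ B ∈ T.inner, A ⊂ B → T.above A ⊆ B := fun B hB h => by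
    have : (T.inner.filter fun B => A ⊂ B).inf id ≤ id B :=
      Finset.inf_le (Finset.mem_filter.2 ⟨hB, h⟩)
    exact this
  obtain ⟨C, hC, hmin⟩ := Finset.exists_min_image (T.inner.filter fun B => A ⊂ B) Finset.card
    ⟨Finset.univ, Finset.mem_filter.2 ⟨T.root_mem,
      Finset.ssubset_iff_subset_ne.2 ⟨Finset.subset_univ _, hne⟩⟩⟩
  obtain ⟨hC1, hC2⟩ := Finset.mem_filter.1 hC
  have heq : T.above A = C := by
    refine Finset.Subset.antisymm (hle C hC1 hC2) ?_
    have : C ≤ (T.inner.filter fun B => A ⊂ B).inf id := by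
      refine Finset.le_inf fun B hB => ?_
      obtain ⟨hB1, hB2⟩ := Finset.mem_filter.1 hB
      obtain ⟨x, hx⟩ := nonempty_of_mem hA
      rcases subset_or_subset hC1 hB1 (hC2.1 hx) (hB2.1 hx) with h | h
      · exact h
      · exact (Finset.eq_of_subset_of_card_le h (hmin B hB)).symm.subset
    exact this
  exact ⟨heq ▸ hC1, heq ▸ hC2, hle⟩

/-- The increment of the scale from the node above `A` to `A`. -/
def increment (n : T.Scales) (A : Finset V) : ℕ :=
  if A = Finset.univ then scale n A else scale n A - scale n (T.above A)

/-- Telescoping along the path from `A` to the root, by induction on the number of leaves outside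
`A`. Monotonicity of the scales makes the truncated subtractions exact. -/
theorem scale_eq_sum_increment (n : T.Scales) (hA : A ∈ T.inner) :
    scale n A = ∑ B ∈ T.inner.filter (fun B => A ⊆ B), increment n B := by
  induction hk : Fintype.card V - A.card using Nat.strong_induction_on generalizing A with
  | _ k ih =>
    subst hk
    by_cases hne : A = Finset.univ
    · have : T.inner.filter (fun B => A ⊆ B) = {A} := by
        ext B
        rw [Finset.mem_filter, Finset.mem_singleton]
        constructor
        · rintro ⟨_, h⟩
          rw [hne, Finset.univ_subset_iff] at h
          rw [h, hne]
        · rintro rfl; exact ⟨hA, subset_rfl⟩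
      rw [this, Finset.sum_singleton, increment, if_pos hne]
    · obtain ⟨h1, h2, h3⟩ := above_spec hA hne
      have hset : T.inner.filter (fun B => A ⊆ B) =
          insert A (T.inner.filter fun B => T.above A ⊆ B) := by
        ext B
        rw [Finset.mem_filter, Finset.mem_insert, Finset.mem_filter]
        constructor
        · rintro ⟨hB, h⟩
          by_cases e : B = A
          · exact Or.inl e
          · exact Or.inr ⟨hB, h3 B hB (Finset.ssubset_iff_subset_ne.2 ⟨h, Ne.symm e⟩)⟩
        · rintro (rfl | ⟨hB, h⟩)
          · exact ⟨hA, subset_rfl⟩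
          · exact ⟨hB, h2.1.trans h⟩
      have hnot : A ∉ T.inner.filter fun B => T.above A ⊆ B := fun h =>
        h2.2 (Finset.mem_filter.1 h).2
      have hlt : Fintype.card V - (T.above A).card < Fintype.card V - A.card := by
        have e1 := Finset.card_lt_card h2
        have e2 := Finset.card_le_univ (T.above A)
        omega
      rw [hset, Finset.sum_insert hnot, ← ih _ hlt h1 rfl, increment, if_neg hne]
      have := scale_anti n hA h1 h2.1
      omega

end HeppTree

end
noncomputable section

/-! ### Forests, quotients and unsafe subdiagrams -/

namespace FeynmanDiagram

variable {V E : Type} [Fintype V] [LinearOrder V] [Fintype E] [DecidableEq E]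

/-- Connected full subgraphs. -/
structure IsBlock (Γ : FeynmanDiagram V E) (c : Finset E) : Prop where
  connected : Γ.IsConnectedSubgraph c
  full : Γ.IsFullSubgraph c

/-- `c` is nested with, or disjoint from, all the elements of `F`. -/
def IsCompatible (Γ : FeynmanDiagram V E) (F : Finset (Finset E)) (c : Finset E) : Prop :=
  ∀ f ∈ F, f ⊆ c ∨ c ⊆ f ∨ Disjoint (Γ.vertices f) (Γ.vertices c)

/-- A laminar family of blocks. -/
structure IsLaminar (Γ : FeynmanDiagram V E) (F : Finset (Finset E)) : Prop where
  block : ∀ f ∈ F, Γ.IsBlock f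
  compatible : ∀ f ∈ F, Γ.IsCompatible F f

variable {Γ : FeynmanDiagram V E} {F : Finset (Finset E)} {c f γ : Finset E} {u v : V}

theorem IsFullForest.isLaminar {ρ : ℝ} {d : ℕ} (hF : Γ.IsFullForest ρ d F) : Γ.IsLaminar F :=
  ⟨fun f hf => ⟨(mem_divergent.1 (hF.1.1 hf)).2.1, hF.2 f hf⟩, fun f hf g hg => hF.1.2 g hg f hf⟩

theorem vertices_mono (h : f ⊆ c) : Γ.vertices f ⊆ Γ.vertices c :=
  Finset.union_subset_union (Finset.image_subset_image h) (Finset.image_subset_image h)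

theorem IsBlock.subset_of_vertices (hc : Γ.IsBlock c) (h : Γ.vertices f ⊆ Γ.vertices c) :
    f ⊆ c := fun e he => hc.full e (h (src_mem_vertices he)) (h (tgt_mem_vertices he))

theorem IsBlock.vertices_nonempty (hc : Γ.IsBlock c) : (Γ.vertices c).Nonempty := by
  obtain ⟨e, he⟩ := hc.connected.1
  exact ⟨_, src_mem_vertices he⟩

theorem IsBlock.firstVertex_mem (hc : Γ.IsBlock c) : Γ.firstVertex c ∈ Γ.vertices c := by
  rw [firstVertex, dif_pos hc.vertices_nonempty]
  exact Finset.min'_mem _ _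

theorem firstVertex_le (hv : v ∈ Γ.vertices c) : Γ.firstVertex c ≤ v := by
  rw [firstVertex, dif_pos ⟨v, hv⟩]
  exact Finset.min'_le _ _ hv

theorem firstVertex_eq (hf : Γ.IsBlock f) (h : f ⊆ c) (hv : Γ.firstVertex c ∈ Γ.vertices f) :
    Γ.firstVertex c = Γ.firstVertex f :=
  le_antisymm (firstVertex_le (vertices_mono h hf.firstVertex_mem)) (firstVertex_le hv)

theorem mem_legs {h : E × Bool} : h ∈ Γ.legs γ ↔ h.1 ∉ γ ∧ Γ.attach h ∈ Γ.vertices γ := by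
  simp [legs]

theorem attach_mem_vertices {e : E} (he : e ∈ c) (b : Bool) :
    Γ.attach (e, b) ∈ Γ.vertices c := by
  cases b
  · exact src_mem_vertices he
  · exact tgt_mem_vertices he

theorem IsBlock.mem_of_attach (hc : Γ.IsBlock c) {e : E} {b : Bool}
    (h1 : Γ.attach (e, b) ∈ Γ.vertices c) (h2 : Γ.attach (e, !b) ∈ Γ.vertices c) : e ∈ c := by
  cases b
  · exact hc.full e h1 h2
  · exact hc.full e h2 h1

theorem IsConnectedSubgraph.exists_crossing (hc : Γ.IsConnectedSubgraph c) {S : Finset V}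
    (hu : u ∈ Γ.vertices c) (huS : u ∈ S) (hv : v ∈ Γ.vertices c) (hvS : v ∉ S) :
    ∃ e ∈ c, ∃ b : Bool, Γ.attach (e, b) ∈ S ∧ Γ.attach (e, !b) ∉ S := by
  obtain ⟨w⟩ := hc.2 u hu v hv
  obtain ⟨D, _, h1, h2⟩ := w.exists_boundary_dart (S := (S : Set V)) huS hvS
  have hadj := D.adj
  simp only [graph, SimpleGraph.fromRel_adj] at hadj
  obtain ⟨_, ⟨e, he, h3, h4⟩ | ⟨e, he, h3, h4⟩⟩ := hadj
  · refine ⟨e, he, false, ?_, ?_⟩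
    · simpa [attach, h3] using h1
    · simpa [attach, h4] using h2
  · refine ⟨e, he, true, ?_, ?_⟩
    · simpa [attach, h4] using h1
    · simpa [attach, h3] using h2

theorem exists_max_of_chain {G : Finset (Finset E)} (hG : G.Nonempty)
    (hc : ∀ a ∈ G, ∀ b ∈ G, a ⊆ b ∨ b ⊆ a) : G.sup id ∈ G ∧ ∀ a ∈ G, a ⊆ G.sup id := by
  obtain ⟨m, hm, hmax⟩ := Finset.exists_max_image G Finset.card hG
  have h : ∀ a ∈ G, a ⊆ m := fun a ha => by
    rcases hc a ha m hm with h | h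
    · exact h
    · exact (Finset.eq_of_subset_of_card_le h (hmax a ha)).symm.subset
  have : G.sup id = m :=
    le_antisymm (Finset.sup_le fun a ha => h a ha) (Finset.le_sup (f := id) hm)
  rw [this]
  exact ⟨hm, h⟩

/-- The vertex of the quotient of `c` by the smaller elements of `F` represented by `v`. -/
def rep (Γ : FeynmanDiagram V E) (F : Finset (Finset E)) (c : Finset E) (v : V) : V :=
  if (F.filter fun f => f ⊂ c ∧ v ∈ Γ.vertices f).Nonempty then
    Γ.firstVertex ((F.filter fun f => f ⊂ c ∧ v ∈ Γ.vertices f).sup id)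
  else v

/-- The vertices of the quotient of `c` by the smaller elements of `F`. -/
def quot (Γ : FeynmanDiagram V E) (F : Finset (Finset E)) (c : Finset E) : Finset V :=
  (Γ.vertices c).filter fun v => ∀ f ∈ F, f ⊂ c → v ∈ Γ.vertices f → v = Γ.firstVertex f

theorem mem_quot : v ∈ Γ.quot F c ↔ v ∈ Γ.vertices c ∧
    ∀ f ∈ F, f ⊂ c → v ∈ Γ.vertices f → v = Γ.firstVertex f := by
  simp [quot]

/-- By laminarity the elements of `F` strictly inside `c` that contain `v` form a chain, so the
supremum in `rep` is the largest of them. -/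
theorem IsLaminar.rep_cases (hF : Γ.IsLaminar F) (c : Finset E) (v : V) :
    ((∀ f ∈ F, f ⊂ c → v ∉ Γ.vertices f) ∧ Γ.rep F c v = v) ∨
    ∃ m ∈ F, m ⊂ c ∧ v ∈ Γ.vertices m ∧ Γ.rep F c v = Γ.firstVertex m ∧
      ∀ f ∈ F, f ⊂ c → v ∈ Γ.vertices f → f ⊆ m := by
  by_cases hne : (F.filter fun f => f ⊂ c ∧ v ∈ Γ.vertices f).Nonempty
  · right
    obtain ⟨h1, h2⟩ := exists_max_of_chain hne (fun a ha b hb => by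
      obtain ⟨ha1, ha2, ha3⟩ := Finset.mem_filter.1 ha
      obtain ⟨hb1, hb2, hb3⟩ := Finset.mem_filter.1 hb
      rcases hF.compatible b hb1 a ha1 with h | h | h
      · exact Or.inl h
      · exact Or.inr h
      · exact absurd hb3 (Finset.disjoint_left.1 h ha3))
    obtain ⟨h3, h4, h5⟩ := Finset.mem_filter.1 h1
    refine ⟨_, h3, h4, h5, by rw [rep, if_pos hne], fun f hf hfc hv => ?_⟩
    exact h2 f (Finset.mem_filter.2 ⟨hf, hfc, hv⟩)
  · left
    refine ⟨fun f hf hfc hv => hne ⟨f, Finset.mem_filter.2 ⟨hf, hfc, hv⟩⟩, by rw [rep, if_neg hne]⟩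

theorem IsLaminar.rep_mem_quot (hF : Γ.IsLaminar F) (hv : v ∈ Γ.vertices c) :
    Γ.rep F c v ∈ Γ.quot F c := by
  rw [mem_quot]
  rcases hF.rep_cases c v with ⟨h1, h2⟩ | ⟨m, hm, hmc, hvm, h2, h3⟩
  · rw [h2]
    exact ⟨hv, fun f hf hfc hvf => absurd hvf (h1 f hf hfc)⟩
  · rw [h2]
    have hw := (hF.block m hm).firstVertex_mem
    refine ⟨vertices_mono hmc.1 hw, fun f hf hfc hwf => ?_⟩
    rcases hF.compatible m hm f hf with h | h | h
    · exact firstVertex_eq (hF.block f hf) h hwf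
    · rw [Finset.Subset.antisymm h (h3 f hf hfc (vertices_mono h hvm))]
    · exact absurd hw (Finset.disjoint_left.1 h hwf)

theorem IsLaminar.rep_of_mem_quot (hF : Γ.IsLaminar F) (hv : v ∈ Γ.quot F c) :
    Γ.rep F c v = v := by
  rw [mem_quot] at hv
  rcases hF.rep_cases c v with ⟨h1, h2⟩ | ⟨m, hm, hmc, hvm, h2, h3⟩
  · exact h2
  · rw [h2]; exact (hv.2 m hm hmc hvm).symm

theorem IsLaminar.rep_eq_firstVertex (hF : Γ.IsLaminar F) {m : Finset E} (hm : m ∈ F)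
    (hmc : m ⊂ c) (hmax : ∀ f ∈ F, f ⊂ c → ¬ m ⊂ f) (hv : v ∈ Γ.vertices m) :
    Γ.rep F c v = Γ.firstVertex m := by
  rcases hF.rep_cases c v with ⟨h1, h2⟩ | ⟨m', hm', hmc', hvm, h2, h3⟩
  · exact absurd hv (h1 m hm hmc)
  · have := h3 m hm hmc hv
    rw [h2]
    by_contra hne
    exact hmax m' hm' hmc' (Finset.ssubset_iff_subset_ne.2 ⟨this, fun e => hne (by rw [e])⟩)

theorem IsLaminar.rep_congr (hF : Γ.IsLaminar F) (hf : f ∈ F) (hfc : f ⊂ c)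
    (hu : u ∈ Γ.vertices f) (hv : v ∈ Γ.vertices f) : Γ.rep F c u = Γ.rep F c v := by
  rcases hF.rep_cases c u with ⟨h1, h2⟩ | ⟨m, hm, hmc, hum, h2, h3⟩
  · exact absurd hu (h1 f hf hfc)
  rcases hF.rep_cases c v with ⟨h1', h2'⟩ | ⟨m', hm', hmc', hvm', h2', h3'⟩
  · exact absurd hv (h1' f hf hfc)
  have e1 := h3 f hf hfc hu
  have e2 := h3' f hf hfc hv
  have : m = m' := Finset.Subset.antisymm (h3' m hm hmc (vertices_mono e1 hv))
    (h3 m' hm' hmc' (vertices_mono e2 hu))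
  rw [h2, h2', this]

theorem contractedAttach_eq_rep {h : E × Bool}
    (hh : ∀ f ∈ F, h ∈ Γ.legs f ↔ f ⊂ c ∧ Γ.attach h ∈ Γ.vertices f) :
    Γ.contractedAttach F h = Γ.rep F c (Γ.attach h) := by
  unfold contractedAttach rep
  rw [Finset.filter_congr hh]

theorem mem_ownEdges {e : E} : e ∈ ownEdges F c ↔ e ∈ c ∧ ∀ f ∈ F, f ⊂ c → e ∉ f := by
  simp only [ownEdges, Finset.mem_sdiff, Finset.mem_sup, Finset.mem_filter, id, not_exists,
    not_and, and_imp]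

/-- The elements of `F` that have an own edge of `c` as a leg are all strictly inside `c`.
Contracting all of `F` therefore acts on own edges as passing to the quotient of `c`. -/
theorem contractedAttach_own (hcc : Γ.IsCompatible F c) {e : E} (he : e ∈ ownEdges F c)
    (b : Bool) : Γ.contractedAttach F (e, b) = Γ.rep F c (Γ.attach (e, b)) := by
  obtain ⟨hec, hef⟩ := mem_ownEdges.1 he
  refine contractedAttach_eq_rep fun f hf => ?_
  rw [mem_legs]
  constructor
  · rintro ⟨h1, h2⟩
    refine ⟨?_, h2⟩
    rcases hcc f hf with h | h | h
    · exact Finset.ssubset_iff_subset_ne.2 ⟨h, fun e' => h1 (e' ▸ hec)⟩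
    · exact absurd (h hec) h1
    · exact absurd (attach_mem_vertices hec b) (Finset.disjoint_left.1 h h2)
  · rintro ⟨h1, h2⟩
    exact ⟨hef f hf h1, h2⟩

/-- `h` is a leg of `γ` whose edge belongs to all the elements of `F` strictly containing `γ`. -/
def IsAliveLeg (Γ : FeynmanDiagram V E) (F : Finset (Finset E)) (γ : Finset E) (h : E × Bool) :
    Prop := h ∈ Γ.legs γ ∧ ∀ f ∈ F, γ ⊂ f → h.1 ∈ f

theorem IsAliveLeg.mem_legs_iff (hcc : Γ.IsCompatible F γ) (hγ : γ ∉ F) {h : E × Bool}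
    (hh : Γ.IsAliveLeg F γ h) (hf : f ∈ F) :
    h ∈ Γ.legs f ↔ f ⊂ γ ∧ Γ.attach h ∈ Γ.vertices f := by
  obtain ⟨h1, h2⟩ := mem_legs.1 hh.1
  rw [mem_legs]
  have hne : f ≠ γ := fun e => hγ (e ▸ hf)
  constructor
  · rintro ⟨h3, h4⟩
    refine ⟨?_, h4⟩
    rcases hcc f hf with h | h | h
    · exact Finset.ssubset_iff_subset_ne.2 ⟨h, hne⟩
    · exact absurd (hh.2 f hf (Finset.ssubset_iff_subset_ne.2 ⟨h, hne.symm⟩)) h3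
    · exact absurd h2 (Finset.disjoint_left.1 h h4)
  · rintro ⟨h3, h4⟩
    exact ⟨fun h => h1 (h3.1 h), h4⟩

theorem IsAliveLeg.contractedAttach_mem (hF : Γ.IsLaminar F) (hcc : Γ.IsCompatible F γ)
    (hγ : γ ∉ F) {h : E × Bool} (hh : Γ.IsAliveLeg F γ h) :
    Γ.contractedAttach F h ∈ Γ.quot F γ := by
  rw [contractedAttach_eq_rep fun f hf => hh.mem_legs_iff hcc hγ hf]
  exact hF.rep_mem_quot (mem_legs.1 hh.1).2

section Quotient

variable (hF : Γ.IsLaminar F) (hc : Γ.IsBlock c) (hcc : Γ.IsCompatible F c)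

include hF hcc in
theorem contractedAttach_own_mem {e : E} (he : e ∈ ownEdges F c) (b : Bool) :
    Γ.contractedAttach F (e, b) ∈ Γ.quot F c := by
  rw [contractedAttach_own hcc he]
  exact hF.rep_mem_quot (attach_mem_vertices (mem_ownEdges.1 he).1 b)

include hc in
theorem firstVertex_mem_quot (hF : Γ.IsLaminar F) : Γ.firstVertex c ∈ Γ.quot F c := by
  rw [mem_quot]
  exact ⟨hc.firstVertex_mem, fun f hf hfc hv => firstVertex_eq (hF.block f hf) hfc.1 hv⟩

theorem quot_subset : Γ.quot F c ⊆ Γ.vertices c := Finset.filter_subset _ _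

include hF in
-- If both ends had the same representative, they would lie in one element of `F` strictly inside
-- `c`, which by fullness would contain the edge.
theorem contractedAttach_own_ne (hloop : ∀ e, Γ.src e ≠ Γ.tgt e) (hcc : Γ.IsCompatible F c)
    {e : E} (he : e ∈ ownEdges F c) :
    Γ.contractedAttach F (e, false) ≠ Γ.contractedAttach F (e, true) := by
  rw [contractedAttach_own hcc he, contractedAttach_own hcc he]
  obtain ⟨hec, hef⟩ := mem_ownEdges.1 he
  intro heq
  rcases hF.rep_cases c (Γ.attach (e, false)) with ⟨h1, h2⟩ | ⟨m, hm, hmc, hum, h2, h3⟩ <;>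
  rcases hF.rep_cases c (Γ.attach (e, true)) with ⟨h1', h2'⟩ | ⟨m', hm', hmc', hum', h2', h3'⟩
  · rw [h2, h2'] at heq
    exact hloop e heq
  · rw [h2, h2'] at heq
    exact h1 m' hm' hmc' (heq ▸ (hF.block m' hm').firstVertex_mem)
  · rw [h2, h2'] at heq
    exact h1' m hm hmc (heq ▸ (hF.block m hm).firstVertex_mem)
  · rw [h2, h2'] at heq
    have e1 := (hF.block m hm).firstVertex_mem
    have e2 := (hF.block m' hm').firstVertex_mem
    rcases hF.compatible m hm m' hm' with h | h | h
    · exact hef m hm hmc ((hF.block m hm).full e hum (vertices_mono h hum'))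
    · exact hef m' hm' hmc' ((hF.block m' hm').full e (vertices_mono h hum) hum')
    · exact Finset.disjoint_left.1 h e2 (heq ▸ e1)

include hF hc hcc in
/-- The quotient of a block is connected. -/
theorem exists_own_crossing {S : Finset V} (hS : ∃ u ∈ Γ.quot F c, u ∈ S)
    (hS' : ∃ v ∈ Γ.quot F c, v ∉ S) : ∃ e ∈ ownEdges F c, ∃ b : Bool,
      Γ.contractedAttach F (e, b) ∈ S ∧ Γ.contractedAttach F (e, !b) ∉ S := by
  obtain ⟨u, hu, huS⟩ := hS
  obtain ⟨v, hv, hvS⟩ := hS'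
  obtain ⟨e, he, b, h1, h2⟩ := hc.connected.exists_crossing (u := u) (v := v)
    (S := Finset.univ.filter fun x => Γ.rep F c x ∈ S) (quot_subset hu)
    (by simp [hF.rep_of_mem_quot hu, huS]) (quot_subset hv) (by simp [hF.rep_of_mem_quot hv, hvS])
  simp only [Finset.mem_filter, Finset.mem_univ, true_and] at h1 h2
  have hown : e ∈ ownEdges F c := by
    rw [mem_ownEdges]
    refine ⟨he, fun f hf hfc hef => h2 ?_⟩
    rwa [hF.rep_congr hf hfc (attach_mem_vertices hef (!b)) (attach_mem_vertices hef b)]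
  refine ⟨e, hown, b, ?_, ?_⟩
  · rwa [contractedAttach_own hcc hown]
  · rwa [contractedAttach_own hcc hown]

include hF hc in
-- If the quotient were a single point, either every edge of `c` would be a loop, or one element of
-- `F` strictly inside `c` would have all the vertices of `c`, hence contain `c`.
theorem exists_ne_firstVertex_mem_quot (hloop : ∀ e, Γ.src e ≠ Γ.tgt e) :
    ∃ v ∈ Γ.quot F c, v ≠ Γ.firstVertex c := by
  by_contra! hcon
  have hall : ∀ v ∈ Γ.vertices c, Γ.rep F c v = Γ.firstVertex c := fun v hv =>
    hcon _ (hF.rep_mem_quot hv)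
  rcases hF.rep_cases c (Γ.firstVertex c) with ⟨h1, h2⟩ | ⟨m, hm, hmc, hum, h2, h3⟩
  · obtain ⟨e, he⟩ := hc.connected.1
    have key : ∀ b, Γ.attach (e, b) = Γ.firstVertex c := fun b => by
      rcases hF.rep_cases c (Γ.attach (e, b)) with ⟨h4, h5⟩ | ⟨m, hm, hmc, hum, h5, h6⟩
      · rw [← h5, hall _ (attach_mem_vertices he b)]
      · exfalso
        rw [hall _ (attach_mem_vertices he b)] at h5
        exact h1 m hm hmc (h5 ▸ (hF.block m hm).firstVertex_mem)
    exact hloop e ((key false).trans (key true).symm)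
  · refine hmc.2 ((hF.block m hm).subset_of_vertices fun v hv => ?_)
    rcases hF.rep_cases c v with ⟨h4, h5⟩ | ⟨m', hm', hmc', hum', h5, h6⟩
    · rw [← h5, hall v hv]; exact hum
    · rw [hall v hv] at h5
      exact vertices_mono (h3 m' hm' hmc' (h5 ▸ (hF.block m' hm').firstVertex_mem)) hum'

include hF hc in
theorem one_lt_card_quot (hloop : ∀ e, Γ.src e ≠ Γ.tgt e) : 1 < (Γ.quot F c).card := by
  obtain ⟨v, hv, hne⟩ := exists_ne_firstVertex_mem_quot hF hc hloop
  exact Finset.one_lt_card.2 ⟨v, hv, _, firstVertex_mem_quot hc hF, hne⟩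

theorem lca_eq_edgeNode (T : HeppTree V) (e : E) (b : Bool) :
    T.lca (Γ.contractedAttach F (e, b)) (Γ.contractedAttach F (e, !b)) = Γ.edgeNode T F e := by
  cases b
  · rfl
  · exact HeppTree.lca_comm

/-- The smallest inner node of `T` above the quotient of `c`. -/
def lowerNode (Γ : FeynmanDiagram V E) (T : HeppTree V) (F : Finset (Finset E)) (c : Finset E) :
    Finset V := T.hull (Γ.quot F c)

variable {T : HeppTree V}

include hc in
theorem lowerNode_mem (hF : Γ.IsLaminar F) : Γ.lowerNode T F c ∈ T.inner :=
  HeppTree.hull_mem ⟨_, firstVertex_mem_quot hc hF⟩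

theorem quot_subset_lowerNode : Γ.quot F c ⊆ Γ.lowerNode T F c := HeppTree.subset_hull

include hF hcc in
theorem edgeNode_subset_lowerNode (hc : Γ.IsBlock c) {e : E} (he : e ∈ ownEdges F c) :
    Γ.edgeNode T F e ⊆ Γ.lowerNode T F c :=
  HeppTree.lca_subset (lowerNode_mem hc hF)
    (quot_subset_lowerNode (contractedAttach_own_mem hF hcc he _))
    (quot_subset_lowerNode (contractedAttach_own_mem hF hcc he _))

include hF hc hcc in
-- The quotient meets both branches below its hull and is connected, so some own edge goes from one
-- branch to the other; its node is the hull. The smallest scale of the own edges is thus that of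
-- `lowerNode`.
theorem exists_edgeNode_eq_lowerNode (hloop : ∀ e, Γ.src e ≠ Γ.tgt e) :
    ∃ e ∈ ownEdges F c, Γ.edgeNode T F e = Γ.lowerNode T F c := by
  obtain ⟨B₁, B₂, hdis, hun, hne1, hne2, h1, h2, -, hlca⟩ :=
    HeppTree.exists_offspring (lowerNode_mem (T := T) hc hF)
  have hcard := one_lt_card_quot hF hc hloop
  have hnot : ∀ B B' : Finset V, Disjoint B B' → B ∪ B' = Γ.lowerNode T F c → B'.Nonempty →
      (B ∈ T.inner ∨ B.card = 1) → ¬ Γ.quot F c ⊆ B := by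
    rintro B B' hdis hun ⟨x, hx⟩ (hB | hB) hsub
    · have hx' : x ∈ Γ.lowerNode T F c := hun ▸ Finset.mem_union_right _ hx
      exact Finset.disjoint_left.1 hdis (HeppTree.hull_subset hB hsub hx') hx
    · have := Finset.card_le_card hsub
      omega
  obtain ⟨u, hu, huB⟩ := Finset.not_subset.1 (hnot B₂ B₁ hdis.symm
    (Finset.union_comm B₁ B₂ ▸ hun) hne1 h2)
  obtain ⟨v, hv, hvB⟩ := Finset.not_subset.1 (hnot B₁ B₂ hdis hun hne2 h1)
  have hmem : ∀ x ∈ Γ.quot F c, x ∈ B₁ ∪ B₂ := fun x hx => hun ▸ quot_subset_lowerNode hx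
  obtain ⟨e, he, b, h3, h4⟩ := exists_own_crossing hF hc hcc (S := B₁)
    ⟨u, hu, (Finset.mem_union.1 (hmem u hu)).resolve_right huB⟩ ⟨v, hv, hvB⟩
  refine ⟨e, he, ?_⟩
  rw [← lca_eq_edgeNode T e b]
  exact hlca _ h3 _ ((Finset.mem_union.1
    (hmem _ (contractedAttach_own_mem hF hcc he _))).resolve_left h4)

end Quotient

/-! ### Safety expressed through contractions by `F` alone. -/

section Insert

variable (hF : Γ.IsLaminar F) (hγ : Γ.IsBlock γ) (hcc : Γ.IsCompatible F γ) (hγF : γ ∉ F)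

theorem mem_boundaryEdges_insert {e : E} :
    e ∈ Γ.boundaryEdges (insert γ F) γ ↔ ∃ b : Bool, Γ.IsAliveLeg F γ (e, b) := by
  have hp : e ∈ parentIn (insert γ F) γ ↔ ∀ f ∈ F, γ ⊂ f → e ∈ f := by
    unfold parentIn
    rw [Finset.mem_inf]
    simp only [Finset.mem_filter, Finset.mem_insert, id, and_imp]
    constructor
    · exact fun h f hf hγf => h f (Or.inr hf) hγf
    · rintro h f (rfl | hf) hγf
      · exact absurd hγf (ssubset_irrefl _)
      · exact h f hf hγf
  simp only [boundaryEdges, Finset.mem_filter, Finset.mem_sdiff, hp, IsAliveLeg, mem_legs,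
    Bool.exists_bool, attach]
  simp
  tauto

theorem ownEdges_insert : ownEdges (insert γ F) γ = ownEdges F γ := by
  ext e
  rw [mem_ownEdges, mem_ownEdges]
  simp only [Finset.mem_insert, forall_eq_or_imp, ssubset_irrefl, false_imp_iff, true_and]

include hγF hcc in
theorem IsAliveLeg.contractedAttach_insert {h : E × Bool} (hh : Γ.IsAliveLeg F γ h) :
    Γ.contractedAttach (insert γ F) h = Γ.firstVertex γ := by
  have hmem : γ ∈ (insert γ F).filter fun f => h ∈ Γ.legs f :=
    Finset.mem_filter.2 ⟨Finset.mem_insert_self _ _, hh.1⟩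
  rw [contractedAttach, if_pos ⟨γ, hmem⟩]
  congr 1
  refine le_antisymm (Finset.sup_le fun f hf => ?_) (Finset.le_sup (f := id) hmem)
  obtain ⟨hf1, hf2⟩ := Finset.mem_filter.1 hf
  rcases Finset.mem_insert.1 hf1 with rfl | hf1
  · exact le_rfl
  · exact ((hh.mem_legs_iff hcc hγF hf1).1 hf2).1.1

theorem contractedAttach_insert_of_notMem {h : E × Bool} (hh : h ∉ Γ.legs γ) :
    Γ.contractedAttach (insert γ F) h = Γ.contractedAttach F h := by
  unfold contractedAttach
  rw [Finset.filter_insert, if_neg hh]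

include hγ in
theorem IsAliveLeg.flip_notMem {e : E} {b : Bool} (hh : Γ.IsAliveLeg F γ (e, b)) :
    (e, !b) ∉ Γ.legs γ := by
  intro h
  exact (mem_legs.1 h).1 (hγ.mem_of_attach (mem_legs.1 hh.1).2 (mem_legs.1 h).2)

variable {T : HeppTree V}

include hγ hcc hγF in
-- Inserting `γ` only changes where the legs of `γ` are attached, namely at its first vertex. Own
-- edges of `γ`, and the far ends of its legs, see the contraction by `F` only.
theorem isSafeIn_insert_iff : Γ.IsSafeIn T (insert γ F) γ ↔
    ∃ e b, Γ.IsAliveLeg F γ (e, b) ∧ ∃ e' ∈ ownEdges F γ,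
      T.lca (Γ.firstVertex γ) (Γ.contractedAttach F (e, !b)) ⊆ Γ.edgeNode T F e' := by
  unfold IsSafeIn
  have hown : ∀ e' ∈ ownEdges F γ, Γ.edgeNode T (insert γ F) e' = Γ.edgeNode T F e' := by
    intro e' he'
    have : ∀ b, (e', b) ∉ Γ.legs γ := fun b h => (mem_legs.1 h).1 (mem_ownEdges.1 he').1
    rw [edgeNode, contractedAttach_insert_of_notMem (this _),
      contractedAttach_insert_of_notMem (this _), edgeNode]
  have hbd : ∀ e b, Γ.IsAliveLeg F γ (e, b) → Γ.edgeNode T (insert γ F) e =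
      T.lca (Γ.firstVertex γ) (Γ.contractedAttach F (e, !b)) := by
    intro e b h
    rw [← lca_eq_edgeNode T e b, h.contractedAttach_insert hcc hγF,
      contractedAttach_insert_of_notMem (h.flip_notMem hγ)]
  simp only [mem_boundaryEdges_insert, ownEdges_insert]
  constructor
  · rintro ⟨e, ⟨b, h⟩, e', he', hs⟩
    exact ⟨e, b, h, e', he', by rwa [← hbd e b h, ← hown e' he']⟩
  · rintro ⟨e, b, h, e', he', hs⟩
    exact ⟨e, ⟨b, h⟩, e', he', by rwa [hbd e b h, hown e' he']⟩

include hγ hcc hγF in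
theorem exists_alive_of_isSafeIn (h : Γ.IsSafeIn T (insert γ F) γ) :
    ∃ e b, Γ.IsAliveLeg F γ (e, b) ∧ ∃ e' ∈ ownEdges F γ,
      Γ.contractedAttach F (e, !b) ∈ Γ.edgeNode T F e' := by
  obtain ⟨e, b, h1, e', h2, h3⟩ := (isSafeIn_insert_iff hγ hcc hγF).1 h
  exact ⟨e, b, h1, e', h2, h3 HeppTree.right_mem_lca⟩

include hF hγ hcc hγF in
-- Some own edge has `lowerNode` as its node. A far end of a leg lying in it would give that leg a
-- node below this edge, and `γ` would be safe. Unsafe subdiagrams are therefore clusters from which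
-- all their legs depart.
theorem notMem_lowerNode_of_not_isSafeIn (hloop : ∀ e, Γ.src e ≠ Γ.tgt e)
    (h : ¬ Γ.IsSafeIn T (insert γ F) γ) {e : E} {b : Bool} (hh : Γ.IsAliveLeg F γ (e, b)) :
    Γ.contractedAttach F (e, !b) ∉ Γ.lowerNode T F γ := by
  intro hmem
  obtain ⟨e', he', heq⟩ := exists_edgeNode_eq_lowerNode (T := T) hF hγ hcc hloop
  refine h ((isSafeIn_insert_iff hγ hcc hγF).2 ⟨e, b, hh, e', he', ?_⟩)
  rw [heq]
  exact HeppTree.lca_subset (lowerNode_mem hγ hF)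
    (quot_subset_lowerNode (firstVertex_mem_quot hγ hF)) hmem

end Insert

/-- The elements of the unsafe complement, stripped of degrees. -/
structure IsUnsafe (Γ : FeynmanDiagram V E) (T : HeppTree V) (F : Finset (Finset E))
    (γ : Finset E) : Prop where
  block : Γ.IsBlock γ
  compatible : Γ.IsCompatible F γ
  notMem : γ ∉ F
  unsafe_insert : ¬ Γ.IsSafeIn T (insert γ F) γ

section Unsafe

variable {T : HeppTree V} (hF : Γ.IsLaminar F) (hloop : ∀ e, Γ.src e ≠ Γ.tgt e)
  {γ₁ γ₂ : Finset E}

theorem isUnsafe_of_mem_unsafePart {ρ : ℝ} {d : ℕ} (hF : Γ.IsSafeForest ρ d T F)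
    (hγ : γ ∈ Γ.unsafePart ρ d T F) : Γ.IsUnsafe T F γ := by
  simp only [unsafePart, Finset.mem_filter] at hγ
  obtain ⟨h1, h2, h3⟩ := hγ
  have hins := Finset.mem_insert_self γ F
  refine ⟨h2.isLaminar.block γ hins, fun f hf => h2.isLaminar.compatible γ hins f
    (Finset.mem_insert_of_mem hf), fun hmem => h3 ?_, h3⟩
  rw [Finset.insert_eq_of_mem hmem]
  exact hF.2 γ hmem

include hF hloop

theorem IsUnsafe.notMem_lowerNode (hγ : Γ.IsUnsafe T F γ) {e : E} {b : Bool}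
    (hh : Γ.IsAliveLeg F γ (e, b)) : Γ.contractedAttach F (e, !b) ∉ Γ.lowerNode T F γ :=
  notMem_lowerNode_of_not_isSafeIn hF hγ.block hγ.compatible hγ.notMem hloop hγ.unsafe_insert hh

theorem IsUnsafe.mem_lowerNode (hγ : Γ.IsUnsafe T F γ) {h : E × Bool}
    (hh : Γ.IsAliveLeg F γ h) : Γ.contractedAttach F h ∈ Γ.lowerNode T F γ :=
  quot_subset_lowerNode (hh.contractedAttach_mem hF hγ.compatible hγ.notMem)

theorem IsUnsafe.lowerNode_ssubset (hγ : Γ.IsUnsafe T F γ) {e : E} {b : Bool}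
    (hh : Γ.IsAliveLeg F γ (e, b)) : Γ.lowerNode T F γ ⊂ Γ.edgeNode T F e := by
  rw [← lca_eq_edgeNode T e b]
  exact HeppTree.subset_lca_of_notMem (lowerNode_mem hγ.block hF) (hγ.mem_lowerNode hF hloop hh)
    (hγ.notMem_lowerNode hF hloop hh)

/-- As `γ₁` is connected, meets `γ₂` and is not contained in it, one of its edges leaves `γ₂`. That
edge is an own edge of `γ₁` and a leg of `γ₂`, so its far end lies in the node of `γ₁` but not in
that of `γ₂`. -/
theorem IsUnsafe.nested_aux (h₁ : Γ.IsUnsafe T F γ₁) (h₂ : Γ.IsUnsafe T F γ₂) {x : V}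
    (hx₁ : x ∈ Γ.vertices γ₁) (hx₂ : x ∈ Γ.vertices γ₂) (hn₁ : ¬ γ₁ ⊆ γ₂) (hn₂ : ¬ γ₂ ⊆ γ₁) :
    ¬ Γ.lowerNode T F γ₁ ⊆ Γ.lowerNode T F γ₂ := by
  intro hsub
  obtain ⟨y, hy₁, hy₂⟩ := Finset.not_subset.1 fun h => hn₁ (h₂.block.subset_of_vertices h)
  obtain ⟨e, he, b, h3, h4⟩ := h₁.block.connected.exists_crossing hx₁ hx₂ hy₁ hy₂
  have he₂ : e ∉ γ₂ := fun h => h4 (attach_mem_vertices h _)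
  have halive : Γ.IsAliveLeg F γ₂ (e, b) := by
    refine ⟨mem_legs.2 ⟨he₂, h3⟩, fun f hf hγf => ?_⟩
    rcases h₁.compatible f hf with h | h | h
    · exact absurd (hγf.1.trans h) hn₂
    · exact h he
    · exact absurd hx₁ (Finset.disjoint_left.1 h (vertices_mono hγf.1 hx₂))
  have hown : e ∈ ownEdges F γ₁ := by
    refine mem_ownEdges.2 ⟨he, fun f hf hfγ hef => ?_⟩
    rcases h₂.compatible f hf with h | h | h
    · exact he₂ (h hef)
    · exact hn₂ (h.trans hfγ.1)
    · exact Finset.disjoint_left.1 h (attach_mem_vertices hef b) h3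
  exact h₂.notMem_lowerNode hF hloop halive
    (hsub (quot_subset_lowerNode (contractedAttach_own_mem hF h₁.compatible hown _)))

/-- Unsafe subdiagrams are nested or disjoint. -/
theorem IsUnsafe.nested (h₁ : Γ.IsUnsafe T F γ₁) (h₂ : Γ.IsUnsafe T F γ₂) :
    γ₁ ⊆ γ₂ ∨ γ₂ ⊆ γ₁ ∨ Disjoint (Γ.vertices γ₁) (Γ.vertices γ₂) := by
  by_contra! hcon
  obtain ⟨hn₁, hn₂, hdis⟩ := hcon
  obtain ⟨x, hx₁, hx₂⟩ := Finset.not_disjoint_iff.1 hdis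
  -- The same elements of `F` around `x` lie below `γ₁` and below `γ₂`. The two nodes thus share the
  -- representative of `x` and are comparable in the tree, so that `nested_aux` applies one way or
  -- the other.
  have hrep : Γ.rep F γ₁ x = Γ.rep F γ₂ x := by
    have key : ∀ {γ₁ γ₂ : Finset E}, Γ.IsUnsafe T F γ₁ → Γ.IsUnsafe T F γ₂ → x ∈ Γ.vertices γ₂ →
        ¬ γ₂ ⊆ γ₁ → ∀ f ∈ F, f ⊂ γ₁ ∧ x ∈ Γ.vertices f → f ⊂ γ₂ ∧ x ∈ Γ.vertices f := by
      rintro γ₁ γ₂ h₁ h₂ hx₂ hn f hf ⟨hf1, hxf⟩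
      refine ⟨?_, hxf⟩
      rcases h₂.compatible f hf with h | h | h
      · exact Finset.ssubset_iff_subset_ne.2 ⟨h, fun e => h₂.notMem (e ▸ hf)⟩
      · exact absurd (h.trans hf1.1) hn
      · exact absurd hx₂ (Finset.disjoint_left.1 h hxf)
    unfold rep
    rw [Finset.filter_congr fun f hf => ⟨key h₁ h₂ hx₂ hn₂ f hf, key h₂ h₁ hx₁ hn₁ f hf⟩]
  have hm₁ := quot_subset_lowerNode (T := T) (hF.rep_mem_quot (c := γ₁) hx₁)
  have hm₂ := quot_subset_lowerNode (T := T) (hF.rep_mem_quot (c := γ₂) hx₂)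
  rw [hrep] at hm₁
  rcases HeppTree.subset_or_subset (lowerNode_mem h₁.block hF) (lowerNode_mem h₂.block hF) hm₁ hm₂
    with h | h
  · exact h₁.nested_aux hF hloop h₂ hx₁ hx₂ hn₁ hn₂ h
  · exact h₂.nested_aux hF hloop h₁ hx₂ hx₁ hn₂ hn₁ h

/-- Two nested unsafe subdiagrams with a common leg that belongs to no safe subdiagram. -/
theorem IsUnsafe.of_ssubset (h₁ : Γ.IsUnsafe T F γ₁) (h₂ : Γ.IsUnsafe T F γ₂) (hs : γ₁ ⊂ γ₂)
    {h : E × Bool} (hh₁ : Γ.IsAliveLeg F γ₁ h) (hh₂ : h ∈ Γ.legs γ₂) :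
    Γ.lowerNode T F γ₁ ⊆ Γ.lowerNode T F γ₂ ∧ ∃ e b, Γ.IsAliveLeg F γ₁ (e, b) ∧
      Γ.edgeNode T F e ⊆ Γ.lowerNode T F γ₂ := by
  -- The common leg prevents any element of `F` from lying between `γ₁` and `γ₂`.
  have hno : ∀ f ∈ F, γ₁ ⊂ f → ¬ f ⊆ γ₂ := fun f hf h1 h2 =>
    (mem_legs.1 hh₂).1 (h2 (hh₁.2 f hf h1))
  have halive₂ : Γ.IsAliveLeg F γ₂ h := ⟨hh₂, fun f hf h => hh₁.2 f hf (hs.trans h)⟩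
  obtain ⟨x, hx⟩ := h₁.block.vertices_nonempty
  obtain ⟨y, hy₂, hy₁⟩ := Finset.not_subset.1 fun h => hs.2 (h₁.block.subset_of_vertices h)
  -- An edge of `γ₂` leaving `γ₁`: it is an alive leg of `γ₁` and an own edge of `γ₂`, and it
  -- separates the scales of the two subdiagrams.
  obtain ⟨e, he, b, h3, h4⟩ := h₂.block.connected.exists_crossing (vertices_mono hs.1 hx) hx
    hy₂ hy₁
  have he₁ : e ∉ γ₁ := fun h => h4 (attach_mem_vertices h _)
  have halive : Γ.IsAliveLeg F γ₁ (e, b) := by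
    refine ⟨mem_legs.2 ⟨he₁, h3⟩, fun f hf hγf => ?_⟩
    rcases h₂.compatible f hf with h | h | h
    · exact absurd h (hno f hf hγf)
    · exact h he
    · exact absurd (vertices_mono hs.1 h3) (Finset.disjoint_left.1 h (vertices_mono hγf.1 h3))
  have hown : e ∈ ownEdges F γ₂ := by
    refine mem_ownEdges.2 ⟨he, fun f hf hfγ hef => ?_⟩
    rcases h₁.compatible f hf with h | h | h
    · exact he₁ (h hef)
    · exact hno f hf (Finset.ssubset_iff_subset_ne.2 ⟨h, fun e' => h₁.notMem (e' ▸ hf)⟩) hfγ.1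
    · exact Finset.disjoint_left.1 h (attach_mem_vertices hef b) h3
  have hsub : Γ.lowerNode T F γ₁ ⊆ Γ.lowerNode T F γ₂ := by
    rcases HeppTree.subset_or_subset (lowerNode_mem h₁.block hF) (lowerNode_mem h₂.block hF)
      (h₁.mem_lowerNode hF hloop hh₁) (h₂.mem_lowerNode hF hloop halive₂) with h' | h'
    · exact h'
    · exact absurd (h' (quot_subset_lowerNode (contractedAttach_own_mem hF h₂.compatible hown _)))
        (h₁.notMem_lowerNode hF hloop halive)
  refine ⟨hsub, e, b, halive, ?_⟩
  exact edgeNode_subset_lowerNode hF h₂.compatible h₂.block hown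

/-- The smallest node of the boundary edges of `γ`. -/
def upperNode (Γ : FeynmanDiagram V E) (T : HeppTree V) (F : Finset (Finset E)) (γ : Finset E) :
    Finset V :=
  ((Γ.boundaryEdges (insert γ F) γ).image (Γ.edgeNode T F)).inf id

omit hF hloop in
theorem isBlock_univ (hE : (Finset.univ : Finset E).Nonempty)
    (hconn : (Γ.graph Finset.univ).Connected) : Γ.IsBlock Finset.univ :=
  ⟨⟨hE, fun u _ v _ => hconn.preconnected u v⟩, fun e _ _ => Finset.mem_univ e⟩

omit hF hloop in
theorem vertices_univ (hE : (Finset.univ : Finset E).Nonempty)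
    (hconn : (Γ.graph Finset.univ).Connected) : Γ.vertices Finset.univ = Finset.univ := by
  refine Finset.eq_univ_iff_forall.2 fun v => ?_
  by_contra hv
  obtain ⟨e, he⟩ := hE
  have hu := src_mem_vertices (Γ := Γ) he
  obtain ⟨e', -, h⟩ := FeynmanDiagram.exists_crossing hconn (S := Γ.vertices Finset.univ)
    ⟨_, hu⟩ (fun h => hv (h ▸ Finset.mem_univ v))
  have h1 := src_mem_vertices (Γ := Γ) (Finset.mem_univ e')
  have h2 := tgt_mem_vertices (Γ := Γ) (Finset.mem_univ e')
  simp only [inEdges, outEdges, Finset.mem_union, Finset.mem_filter] at h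
  tauto

omit hloop in
-- The smallest element of `F ∪ {univ}` strictly containing `γ` is connected, so one of its edges
-- leaves `γ`; this edge belongs to all the larger elements as well.
theorem exists_aliveLeg (hconn : (Γ.graph Finset.univ).Connected) (hγ : Γ.IsBlock γ)
    (hγu : γ ≠ Finset.univ) : ∃ e b, Γ.IsAliveLeg F γ (e, b) := by
  have hE : (Finset.univ : Finset E).Nonempty := by
    obtain ⟨e, _⟩ := hγ.connected.1
    exact ⟨e, Finset.mem_univ e⟩
  have hmem : Finset.univ ∈ (insert Finset.univ F).filter fun f => γ ⊂ f :=
    Finset.mem_filter.2 ⟨Finset.mem_insert_self _ _, Finset.ssubset_univ_iff.2 hγu⟩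
  obtain ⟨p, hp, hmin⟩ := Finset.exists_min_image _ Finset.card ⟨_, hmem⟩
  obtain ⟨hp1, hp2⟩ := Finset.mem_filter.1 hp
  have hpb : Γ.IsBlock p := by
    rcases Finset.mem_insert.1 hp1 with rfl | h
    · exact isBlock_univ hE hconn
    · exact hF.block p h
  obtain ⟨x, hx⟩ := hγ.vertices_nonempty
  obtain ⟨y, hy₂, hy₁⟩ := Finset.not_subset.1 fun h => hp2.2 (hγ.subset_of_vertices h)
  obtain ⟨e, he, b, h3, h4⟩ := hpb.connected.exists_crossing (vertices_mono hp2.1 hx) hx hy₂ hy₁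
  refine ⟨e, b, mem_legs.2 ⟨fun h => h4 (attach_mem_vertices h _), h3⟩, fun f hf hγf => ?_⟩
  have hfm := hmin f (Finset.mem_filter.2 ⟨Finset.mem_insert_of_mem hf, hγf⟩)
  rcases Finset.mem_insert.1 hp1 with rfl | h
  · have : f = Finset.univ := by
      rw [Finset.card_univ] at hfm
      exact Finset.card_eq_iff_eq_univ f |>.1 (le_antisymm (Finset.card_le_univ f) hfm)
    rw [this]; exact Finset.mem_univ _
  · rcases hF.compatible p h f hf with h' | h' | h'
    · rw [Finset.eq_of_subset_of_card_le h' hfm]; exact he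
    · exact h' he
    · exact absurd (vertices_mono hp2.1 hx) (Finset.disjoint_left.1 h' (vertices_mono hγf.1 hx))

/-- The upper node of an unsafe subdiagram is the node of one of its boundary edges, and lies
below the nodes of all of them. -/
theorem IsUnsafe.upperNode_spec (hconn : (Γ.graph Finset.univ).Connected)
    (hγ : Γ.IsUnsafe T F γ) (hγu : γ ≠ Finset.univ) :
    Γ.upperNode T F γ ∈ T.inner ∧ Γ.lowerNode T F γ ⊂ Γ.upperNode T F γ ∧
    (∃ e b, Γ.IsAliveLeg F γ (e, b) ∧ Γ.edgeNode T F e = Γ.upperNode T F γ) ∧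
    ∀ e b, Γ.IsAliveLeg F γ (e, b) → Γ.upperNode T F γ ⊆ Γ.edgeNode T F e := by
  obtain ⟨e₀, b₀, h₀⟩ := exists_aliveLeg hF hconn hγ.block hγu
  obtain ⟨e, he, hmin⟩ := Finset.exists_min_image (Γ.boundaryEdges (insert γ F) γ)
    (fun e => (Γ.edgeNode T F e).card) ⟨e₀, mem_boundaryEdges_insert.2 ⟨b₀, h₀⟩⟩
  have hle : ∀ e' ∈ Γ.boundaryEdges (insert γ F) γ, Γ.edgeNode T F e ⊆ Γ.edgeNode T F e' := by
    intro e' he'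
    obtain ⟨b, hb⟩ := mem_boundaryEdges_insert.1 he
    obtain ⟨b', hb'⟩ := mem_boundaryEdges_insert.1 he'
    have i1 := hγ.lowerNode_ssubset hF hloop hb
    have i2 := hγ.lowerNode_ssubset hF hloop hb'
    have hv := quot_subset_lowerNode (T := T) (firstVertex_mem_quot hγ.block hF)
    rcases HeppTree.subset_or_subset (T := T) (A := Γ.edgeNode T F e) (B := Γ.edgeNode T F e')
      HeppTree.lca_mem HeppTree.lca_mem (i1.1 hv) (i2.1 hv) with h | h
    · exact h
    · exact (Finset.eq_of_subset_of_card_le h (hmin e' he')).symm.subset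
  have heq : Γ.upperNode T F γ = Γ.edgeNode T F e := by
    refine le_antisymm (Finset.inf_le (f := id) (Finset.mem_image_of_mem _ he)) ?_
    refine Finset.le_inf fun A hA => ?_
    obtain ⟨e', he', rfl⟩ := Finset.mem_image.1 hA
    exact hle e' he'
  obtain ⟨b, hb⟩ := mem_boundaryEdges_insert.1 he
  rw [heq]
  exact ⟨HeppTree.lca_mem, hγ.lowerNode_ssubset hF hloop hb, ⟨e, b, hb, rfl⟩,
    fun e' b' h' => hle e' (mem_boundaryEdges_insert.2 ⟨b', h'⟩)⟩

end Unsafe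

end FeynmanDiagram

end
noncomputable section

/-! ### Taylor remainders on regions close to a configuration -/

section BoxRegion

variable {H V : Type} [Fintype H] [DecidableEq H] {d : ℕ} {ρ κ : ℝ}

/-- The positions such that the `h`-th point is close to some `z u` with `u ∈ U h`, at scale
`r h`. -/
def boxRegion (ρ κ : ℝ) (z : V → Spacetime d) (U : H → Set V) (r : H → ℝ) :
    Set (H × Fin (d + 1) → ℝ) :=
  {y | ∀ h, ∃ u ∈ U h, ∀ i, |y (h, i) - z u i| < κ * r h ^ scaling ρ d i}

/-- The scales of the coordinates of a family of points of scales `r`. -/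
def coordScale (ρ : ℝ) (d : ℕ) (r : H → ℝ) : H × Fin (d + 1) → ℝ :=
  fun a => r a.1 ^ scaling ρ d a.2

theorem isOpen_boxRegion (z : V → Spacetime d) (U : H → Set V) (r : H → ℝ) :
    IsOpen (boxRegion ρ κ z U r) := by
  have : boxRegion ρ κ z U r = ⋂ h, ⋃ u ∈ U h, ⋂ i,
      {y | |y (h, i) - z u i| < κ * r h ^ scaling ρ d i} := by
    ext y; simp [boxRegion]
  rw [this]
  refine isOpen_iInter_of_finite fun h => isOpen_biUnion fun u _ => isOpen_iInter_of_finite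
    fun i => isOpen_lt ?_ continuous_const
  fun_prop

theorem coordScale_pos {r : H → ℝ} (hr : ∀ h, 0 < r h) (a : H × Fin (d + 1)) :
    0 < coordScale ρ d r a := Real.rpow_pos_of_pos (hr _) _

theorem min_one_le_scaling (i : Fin (d + 1)) : min 1 ρ ≤ scaling ρ d i := by
  refine Fin.cases ?_ (fun i => ?_) i
  · exact min_le_right _ _
  · rw [scaling_succ]; exact min_le_left _ _

theorem scaling_le_two (hρ2 : ρ ≤ 2) (i : Fin (d + 1)) : scaling ρ d i ≤ 2 := by
  refine Fin.cases ?_ (fun i => ?_) i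
  · exact hρ2
  · rw [scaling_succ]; norm_num

variable {z : V → Spacetime d} {U U' : H → Set V} {r r' : H → ℝ} {S : Finset H} {v : V}

theorem boxRegion_subset (hρ0 : 0 < ρ) (hκ : 0 < κ) (hr' : ∀ h, 0 < r' h)
    (hrr : ∀ h, r' h ≤ r h) (hU : ∀ h, U' h ⊆ U h) :
    boxRegion ρ κ z U' r' ⊆ boxRegion ρ κ z U r := by
  intro y hy h
  obtain ⟨u, hu, hi⟩ := hy h
  refine ⟨u, hU h hu, fun i => (hi i).trans_le ?_⟩
  have := scaling_pos (d := d) hρ0 i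
  have := hr' h
  have := hrr h
  gcongr

theorem freeze_mem_boxRegion (hκ : 0 < κ) (hr : ∀ h, 0 < r h) (hv : ∀ h ∈ S, v ∈ U h)
    {y : H × Fin (d + 1) → ℝ}
    (hy : ∀ h, h ∉ S → ∃ u ∈ U h, ∀ i, |y (h, i) - z u i| < κ * r h ^ scaling ρ d i) :
    freeze (S ×ˢ Finset.univ) (fun a => z v a.2) y ∈ boxRegion ρ κ z U r := by
  intro h
  by_cases hh : h ∈ S
  · refine ⟨v, hv h hh, fun i => ?_⟩
    have := hr h
    simp only [freeze, Finset.mem_product, hh, Finset.mem_univ, and_self, if_true, sub_self,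
      abs_zero]
    positivity
  · obtain ⟨u, hu, hi⟩ := hy h hh
    refine ⟨u, hu, fun i => ?_⟩
    simpa [freeze, hh] using hi i

/-- Taylor remainders gain a power of the ratio of the scales. -/
theorem exists_taylorRem_box_const (hρ0 : 0 < ρ) (hρ2 : ρ ≤ 2) (hκ : 0 < κ) (hκ1 : κ ≤ 1) {C : ℝ}
    (hC : 1 ≤ C) (d n m : ℕ) : ∃ A : ℝ, 1 ≤ A ∧ ∀ (H V : Type) [Fintype H] [DecidableEq H],
    Fintype.card H ≤ m → ∀ (z : V → Spacetime d) (U U' : H → Set V) (r r' : H → ℝ) (S : Finset H)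
      (v : V) (g₁ : ℝ) (b : Bool), 0 < g₁ → g₁ ≤ 1 → (∀ h, 0 < r' h) → (∀ h, 0 < r h) →
      (∀ h, h ∉ S → r' h = r h ∧ U' h = U h) → (∀ h ∈ S, r' h ≤ g₁ * r h) →
      (∀ h ∈ S, U' h ⊆ U h) → (∀ h ∈ S, v ∈ U h) →
      (∀ h ∈ S, ∀ u ∈ U' h, ∀ i, |z u i - z v i| ≤ (C * r' h) ^ scaling ρ d i) →
      (b = true → 1 < ρ) → ∀ n' ≤ n, ∀ B : ℝ, 0 ≤ B → ∀ f : (H × Fin (d + 1) → ℝ) → ℝ,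
      ContDiffOn ℝ ∞ f (boxRegion ρ κ z U r) →
      DerivBound (boxRegion ρ κ z U r) (coordScale ρ d r) (n' + 2) B f →
      DerivBound (boxRegion ρ κ z U' r') (coordScale ρ d r') n'
        (A * (B * g₁ ^ (if b then ρ else min 1 ρ)))
        (taylorRem (S ×ˢ Finset.univ) (if b then S ×ˢ (Finset.univ.erase 0) else ∅)
          (fun a => z v a.2) f) := by
  -- A leg is within `κ r' ^ s` of some `z u`, itself within `(C r') ^ s` of `z v`; as `s ≤ 2`, `κ ≤
  -- 1` and `C ≥ 1`, the sum is at most `C' r' ^ s`.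
  set C' : ℝ := C ^ 2 + 1 with hC'
  have hC'1 : 1 ≤ C' := by nlinarith
  have hC'0 : 0 < C' := by linarith
  set μ : ℝ := min 1 ρ with hμ
  have hμ0 : 0 < μ := lt_min one_pos hρ0
  have hκC : 0 < κ / C' := by positivity
  have hκC1 : κ / C' ≤ 1 := by rw [div_le_one hC'0]; linarith
  -- Threshold for the ratio of scales, below which the boxes of size `C' r'` around `z v` fit in
  -- those of size `κ r`.
  set g₀ : ℝ := (κ / C') ^ (1 / μ) with hg₀
  have hg₀0 : 0 < g₀ := Real.rpow_pos_of_pos hκC _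
  have hg₀1 : g₀ ≤ 1 := Real.rpow_le_one hκC.le hκC1 (by positivity)
  set ℓ : ℝ := ((m * (d + 1) : ℕ) : ℝ) with hℓ
  have hℓ0 : 0 ≤ ℓ := Nat.cast_nonneg _
  -- The first term serves ratios below the threshold. The second serves ratios above it, where the
  -- gain is bounded below by `g₀ ^ 2`, its exponent being at most `2`.
  refine ⟨(1 + ℓ * C') ^ 2 + (2 + ℓ * (2 ^ n * C')) * (g₀ ^ (2 : ℝ))⁻¹, ?_, ?_⟩
  · have : 0 ≤ (2 + ℓ * (2 ^ n * C')) * (g₀ ^ (2 : ℝ))⁻¹ := by positivity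
    have : 1 ≤ (1 + ℓ * C') ^ 2 := by
      have : 0 ≤ ℓ * C' := by positivity
      nlinarith
    linarith
  have hnn1 : 0 ≤ (1 + ℓ * C') ^ 2 := by positivity
  have hnn2 : 0 ≤ (2 + ℓ * (2 ^ n * C')) * (g₀ ^ (2 : ℝ))⁻¹ := by positivity
  have hnn3 : 0 ≤ 2 + ℓ * (2 ^ n * C') := by positivity
  intro H V _ _ hcard z U U' r r' S v g₁ b hg₁ hg₁1 hr' hr hout hrg hUU hv hclose hb n' hn' B hB f
    hf hder
  set δ : ℝ := if b then ρ else μ with hδ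
  have hδ0 : 0 < δ := by rw [hδ]; split_ifs <;> assumption
  have hδ2 : δ ≤ 2 := by
    rw [hδ]; split_ifs
    · exact hρ2
    · exact (min_le_right _ _).trans hρ2
  set L : Finset (H × Fin (d + 1)) := S ×ˢ Finset.univ with hL
  set L₁ : Finset (H × Fin (d + 1)) := if b then S ×ˢ (Finset.univ.erase 0) else ∅ with hL₁
  have hL₁L : L₁ ⊆ L := by
    rw [hL₁]; split_ifs
    · exact Finset.product_subset_product_right (Finset.subset_univ _)
    · exact Finset.empty_subset _
  have hmemL : ∀ a, a ∈ L ↔ a.1 ∈ S := fun a => by simp [hL]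
  have hrr : ∀ h, r' h ≤ r h := fun h => by
    by_cases hh : h ∈ S
    · refine (hrg h hh).trans ?_
      have := hr h
      nlinarith
    · exact (hout h hh).1.le
  have hUU' : ∀ h, U' h ⊆ U h := fun h => by
    by_cases hh : h ∈ S
    · exact hUU h hh
    · exact (hout h hh).2.subset
  have hs := coordScale_pos (ρ := ρ) (d := d) hr
  have hs' := coordScale_pos (ρ := ρ) (d := d) hr'
  have hss : ∀ a, coordScale ρ d r' a ≤ coordScale ρ d r a := fun a =>
    Real.rpow_le_rpow (hr' _).le (hrr _) (scaling_pos hρ0 _).le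
  have hsn : ∀ a, a ∉ L → coordScale ρ d r' a = coordScale ρ d r a := fun a ha => by
    rw [hmemL] at ha
    rw [coordScale, (hout _ ha).1, coordScale]
  have hratio : ∀ a ∈ L, coordScale ρ d r' a / coordScale ρ d r a ≤ g₁ ^ scaling ρ d a.2 := by
    intro a ha
    rw [hmemL] at ha
    rw [div_le_iff₀ (hs a), coordScale, coordScale, ← Real.mul_rpow hg₁.le (hr _).le]
    exact Real.rpow_le_rpow (hr' _).le (hrg _ ha) (scaling_pos hρ0 _).le
  have hLcard : (L.card : ℝ) ≤ ℓ := by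
    rw [hℓ, Nat.cast_le, hL, Finset.card_product, Finset.card_univ, Fintype.card_fin]
    exact Nat.mul_le_mul_right _ ((Finset.card_le_univ S).trans hcard)
  have hL₁card : (L₁.card : ℝ) ≤ ℓ :=
    le_trans (Nat.cast_le.2 (Finset.card_le_card hL₁L)) hLcard
  have hclose' : ∀ y ∈ boxRegion ρ κ z U' r', ∀ a ∈ L,
      |y a - z v a.2| < C' * coordScale ρ d r' a := by
    intro y hy a ha
    rw [hmemL] at ha
    obtain ⟨u, hu, hi⟩ := hy a.1
    have h1 := hclose a.1 ha u hu a.2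
    rw [Real.mul_rpow (by linarith) (hr' _).le] at h1
    have h2 : C ^ scaling ρ d a.2 ≤ C ^ 2 := by
      rw [← Real.rpow_two]
      exact Real.rpow_le_rpow_of_exponent_le hC (scaling_le_two hρ2 _)
    have h3 := hi a.2
    have h4 : 0 < r' a.1 ^ scaling ρ d a.2 := hs' a
    have h5 := abs_sub_le (y a) (z u a.2) (z v a.2)
    rw [coordScale]
    calc |y a - z v a.2| ≤ |y a - z u a.2| + |z u a.2 - z v a.2| := h5
      _ < κ * r' a.1 ^ scaling ρ d a.2 + C ^ scaling ρ d a.2 * r' a.1 ^ scaling ρ d a.2 := by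
        exact add_lt_add_of_lt_of_le h3 h1
      _ ≤ C' * r' a.1 ^ scaling ρ d a.2 := by rw [hC']; nlinarith
  have hDD := boxRegion_subset (z := z) hρ0 hκ hr' hrr hUU'
  have hBg : 0 ≤ B * g₁ ^ δ := by positivity
  by_cases hsep : g₁ ≤ g₀
  · have hsmall : ∀ i : Fin (d + 1), C' * g₁ ^ scaling ρ d i ≤ κ := by
      intro i
      have h1 : g₁ ^ scaling ρ d i ≤ g₁ ^ μ :=
        Real.rpow_le_rpow_of_exponent_ge hg₁ hg₁1 (min_one_le_scaling i)
      have h2 : g₁ ^ μ ≤ κ / C' := by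
        refine (Real.rpow_le_rpow hg₁.le hsep hμ0.le).trans ?_
        rw [hg₀, ← Real.rpow_mul hκC.le, one_div_mul_cancel hμ0.ne', Real.rpow_one]
      rw [le_div_iff₀ hC'0] at h2
      nlinarith
    -- A union of boxes need not be star-shaped. `D` replaces the boxes of the legs by single boxes
    -- centred at `z v`, and lies between the new region and the old one.
    set D : Set (H × Fin (d + 1) → ℝ) := {y | (∀ h, h ∉ S → ∃ u ∈ U' h, ∀ i,
      |y (h, i) - z u i| < κ * r' h ^ scaling ρ d i) ∧
      ∀ a ∈ L, |y a - z v a.2| < C' * coordScale ρ d r' a} with hD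
    have hDopen : IsOpen D := by
      have : D = (⋂ h, ⋂ (_ : h ∉ S), ⋃ u ∈ U' h, ⋂ i,
          {y | |y (h, i) - z u i| < κ * r' h ^ scaling ρ d i}) ∩ ⋂ a, ⋂ (_ : a ∈ L),
          {y | |y a - z v a.2| < C' * coordScale ρ d r' a} := by
        ext y; simp [hD]
      rw [this]
      refine (isOpen_iInter_of_finite fun h => isOpen_iInter_of_finite fun _ =>
        isOpen_biUnion fun u _ => isOpen_iInter_of_finite fun i => isOpen_lt ?_
          continuous_const).inter (isOpen_iInter_of_finite fun a => isOpen_iInter_of_finite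
          fun _ => isOpen_lt ?_ continuous_const) <;> fun_prop
    have hD1 : boxRegion ρ κ z U' r' ⊆ D := fun y hy =>
      ⟨fun h _ => hy h, fun a ha => hclose' y hy a ha⟩
    have hD2 : D ⊆ boxRegion ρ κ z U r := by
      rintro y ⟨hy1, hy2⟩ h
      by_cases hh : h ∈ S
      · refine ⟨v, hv h hh, fun i => ?_⟩
        have h1 := hy2 (h, i) ((hmemL _).2 hh)
        have h2 := hratio (h, i) ((hmemL _).2 hh)
        rw [div_le_iff₀ (hs _)] at h2
        calc |y (h, i) - z v i| < C' * coordScale ρ d r' (h, i) := h1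
          _ ≤ C' * (g₁ ^ scaling ρ d i * coordScale ρ d r (h, i)) := by gcongr
          _ = C' * g₁ ^ scaling ρ d i * coordScale ρ d r (h, i) := by ring
          _ ≤ κ * coordScale ρ d r (h, i) :=
            mul_le_mul_of_nonneg_right (hsmall i) (hs _).le
      · obtain ⟨u, hu, hi⟩ := hy1 h hh
        rw [(hout h hh).1] at hi
        exact ⟨u, (hout h hh).2 ▸ hu, hi⟩
    have hstar : ∀ y ∈ D, segment ℝ (freeze L (fun a => z v a.2) y) y ⊆ D := by
      rintro y ⟨hy1, hy2⟩ x ⟨s, t, hs0, ht0, hst, rfl⟩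
      refine ⟨fun h hh => ?_, fun a ha => ?_⟩
      · obtain ⟨u, hu, hi⟩ := hy1 h hh
        refine ⟨u, hu, fun i => ?_⟩
        have hnot : (h, i) ∉ L := by rwa [hmemL]
        have : (s • freeze L (fun a => z v a.2) y + t • y) (h, i) = y (h, i) := by
          simp only [freeze, Pi.add_apply, Pi.smul_apply, smul_eq_mul, if_neg hnot]
          rw [← add_mul, hst, one_mul]
        rw [this]; exact hi i
      · have h1 : (s • freeze L (fun a => z v a.2) y + t • y) a - z v a.2 =
            t * (y a - z v a.2) := by
          simp only [freeze, Pi.add_apply, Pi.smul_apply, smul_eq_mul, if_pos ha]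
          rw [show s = 1 - t by linarith]; ring
        rw [h1, abs_mul, abs_of_nonneg ht0]
        have ht1 : t ≤ 1 := by linarith
        have := hy2 a ha
        have := abs_nonneg (y a - z v a.2)
        nlinarith
    have key := DerivBound.taylorRem hDopen hL₁L hstar hs hs' hss hsn hC'0.le
      (fun y hy a ha => (hy.2 a ha).le) (Real.rpow_nonneg hg₁.le δ) hg₁.le
      (g := g₁ ^ δ) (g₁ := g₁) ?_ ?_ ?_ hB (hf.mono hD2) (hder.mono_set hD2)
    · refine (key.mono_set hD1).mono_bound hs' ?_
      refine mul_le_mul_of_nonneg_right ?_ hBg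
      have h1 : (1 + (L.card : ℝ) * C') ^ 2 ≤ (1 + ℓ * C') ^ 2 := by
        have := mul_le_mul_of_nonneg_right hLcard hC'0.le
        have h0 := mul_nonneg (Nat.cast_nonneg (α := ℝ) L.card) hC'0.le
        exact pow_le_pow_left₀ (by linarith) (by linarith) 2
      linarith
    · rintro ⟨x, hx⟩ a ha
      have hbt : b = true := by
        by_contra hne
        rw [Bool.not_eq_true] at hne
        simp [hL₁, hne] at hx
      have h1ρ := hb hbt
      refine (hratio a ha).trans ?_
      conv_rhs => rw [← Real.rpow_one g₁]
      refine Real.rpow_le_rpow_of_exponent_ge hg₁ hg₁1 ?_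
      have := min_one_le_scaling (ρ := ρ) a.2
      rwa [min_eq_left h1ρ.le] at this
    · rintro -
      rw [← pow_two, ← Real.rpow_two]
      exact Real.rpow_le_rpow_of_exponent_ge hg₁ hg₁1 hδ2
    · intro a ha ha₁
      refine (hratio a ha).trans (Real.rpow_le_rpow_of_exponent_ge hg₁ hg₁1 ?_)
      cases hbb : b with
      | false =>
        rw [hδ, hbb, if_neg Bool.false_ne_true]
        exact min_one_le_scaling _
      | true =>
        have h0 : a.2 = 0 := by
          by_contra h0
          refine ha₁ ?_
          rw [hL₁, hbb, if_pos rfl, Finset.mem_product, Finset.mem_erase]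
          exact ⟨(hmemL a).1 ha, h0, Finset.mem_univ _⟩
        rw [h0, scaling_zero, hδ, hbb, if_pos rfl]
  -- The scales are comparable, so no genuine gain is needed and the terms of the expansion are
  -- bounded one by one.
  · rw [not_le] at hsep
    have hπ : ∀ y ∈ boxRegion ρ κ z U' r', freeze L (fun a => z v a.2) y ∈ boxRegion ρ κ z U r :=
      fun y hy => freeze_mem_boxRegion hκ hr hv fun h hh => by
        obtain ⟨u, hu, hi⟩ := hy h
        rw [(hout h hh).1] at hi
        exact ⟨u, (hout h hh).2 ▸ hu, hi⟩
    have key := DerivBound.taylorRem_of_terms (isOpen_boxRegion z U r) (isOpen_boxRegion z U' r')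
      hDD hL₁L hπ hs' hss hsn hC'1 (fun y hy a ha => (hclose' y hy a ha).le) hB hf
      (hder.mono_order (Nat.le_succ _))
    refine key.mono_bound hs' ?_
    have h1 : 1 ≤ (g₀ ^ (2 : ℝ))⁻¹ * g₁ ^ δ := by
      rw [← div_eq_inv_mul, one_le_div (by positivity)]
      calc g₀ ^ (2 : ℝ) ≤ g₁ ^ (2 : ℝ) := Real.rpow_le_rpow hg₀0.le hsep.le (by norm_num)
        _ ≤ g₁ ^ δ := Real.rpow_le_rpow_of_exponent_ge hg₁ hg₁1 hδ2
    have h2 : (2 + (L₁.card : ℝ) * (2 ^ n' * C')) ≤ 2 + ℓ * (2 ^ n * C') := by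
      gcongr
      norm_num
    calc (2 + (L₁.card : ℝ) * (2 ^ n' * C')) * B ≤ (2 + ℓ * (2 ^ n * C')) * B := by gcongr
      _ ≤ (2 + ℓ * (2 ^ n * C')) * B * ((g₀ ^ (2 : ℝ))⁻¹ * g₁ ^ δ) := by
        refine le_mul_of_one_le_right (by positivity) h1
      _ = (2 + ℓ * (2 ^ n * C')) * (g₀ ^ (2 : ℝ))⁻¹ * (B * g₁ ^ δ) := by ring
      _ ≤ _ := by
        refine mul_le_mul_of_nonneg_right ?_ hBg
        linarith

end BoxRegion

/-! ### The product of kernels -/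

section Kernels

open FeynmanDiagram

variable {E : Type} [Fintype E] [DecidableEq E] {d : ℕ} {ρ : ℝ}

/-- The difference of the positions of the two ends of an edge. -/
def edgeDiff (e : E) (y : HalfEdgeCoord E d → ℝ) : Spacetime d :=
  fun i => y ((e, true), i) - y ((e, false), i)

theorem pderiv_comp_edgeDiff (e : E) (f : Spacetime d → ℝ) (a : HalfEdgeCoord E d) :
    pderiv a (fun y => f (edgeDiff e y)) =
      if a.1.1 = e then (if a.1.2 then fun y => pderiv a.2 f (edgeDiff e y)
        else fun y => -pderiv a.2 f (edgeDiff e y)) else fun _ => 0 := by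
  obtain ⟨⟨e', b⟩, i⟩ := a
  funext y
  split_ifs with h1 h2
  · simp only at h1 h2
    subst h1 h2
    have : ∀ s, edgeDiff e' (Function.update y ((e', true), i) s) =
        Function.update (edgeDiff e' y) i (s - y ((e', false), i)) := by
      intro s; funext j
      by_cases hj : j = i
      · subst hj; simp [edgeDiff]
      · simp [edgeDiff, hj]
    simp only [pderiv, this]
    exact deriv_comp_sub_const (f := fun s => f (Function.update (edgeDiff e' y) i s)) _ _
  · simp only [Bool.not_eq_true] at h1 h2
    subst h1 h2
    have : ∀ s, edgeDiff e' (Function.update y ((e', false), i) s) =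
        Function.update (edgeDiff e' y) i (y ((e', true), i) - s) := by
      intro s; funext j
      by_cases hj : j = i
      · subst hj; simp [edgeDiff]
      · simp [edgeDiff, hj]
    simp only [pderiv, this]
    exact deriv_comp_const_sub (f := fun s => f (Function.update (edgeDiff e' y) i s)) _ _
  · have : ∀ s, edgeDiff e (Function.update y ((e', b), i) s) = edgeDiff e y := by
      intro s; funext j
      simp only at h1
      simp [edgeDiff, Ne.symm h1]
    simp only [pderiv, this, deriv_const]

theorem DerivBound.comp_edgeDiff {e : E} {D : Set (Spacetime d)} {D' : Set (HalfEdgeCoord E d → ℝ)}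
    {s : Fin (d + 1) → ℝ} {s' : HalfEdgeCoord E d → ℝ} (hs' : ∀ a, 0 < s' a)
    (hss : ∀ b i, s' ((e, b), i) = s i) (hD : ∀ y ∈ D', edgeDiff e y ∈ D) {n : ℕ} {B : ℝ}
    (hB : 0 ≤ B) {f : Spacetime d → ℝ} (h : DerivBound D s n B f) :
    DerivBound D' s' n B (fun y => f (edgeDiff e y)) := by
  induction n generalizing B f with
  | zero => exact fun y hy => h _ (hD y hy)
  | succ n ih =>
    refine ⟨fun y hy => h.1 _ (hD y hy), fun a => ?_⟩
    have hBa : 0 ≤ B / s' a := div_nonneg hB (hs' a).le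
    rw [pderiv_comp_edgeDiff]
    split_ifs with h1 h2
    · have : s' a = s a.2 := by rw [← hss a.1.2 a.2, ← h1]
      rw [this] at hBa ⊢
      exact ih hBa (h.2 a.2)
    · have : s' a = s a.2 := by rw [← hss a.1.2 a.2, ← h1]
      rw [this] at hBa ⊢
      exact (ih hBa (h.2 a.2)).neg
    · exact DerivBound.zero hBa hs'

theorem contDiff_edgeDiff (e : E) : ContDiff ℝ ∞ (edgeDiff (d := d) e) := by
  rw [contDiff_pi]
  intro i
  exact (contDiff_apply ℝ ℝ _).sub (contDiff_apply ℝ ℝ _)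

/-- There is a size of boxes for which points of boxes around well separated points remain well
separated. -/
theorem exists_box_separation (hρ : 0 < ρ) (d : ℕ) {C : ℝ} (hC : 0 < C) : ∃ κ c : ℝ, 0 < κ ∧
    κ ≤ 1 ∧ 0 < c ∧ ∀ r : ℝ, 0 < r → ∀ x w : Spacetime d, C⁻¹ * r ≤ scaledNorm ρ x →
      (∀ i, |x i - w i| ≤ 2 * κ * r ^ scaling ρ d i) → c * r ≤ scaledNorm ρ w := by
  have hQ : (0 : ℝ) < 2 ^ (1 / ρ) := by positivity
  -- `κ` is so small that moving both ends inside their boxes changes the norm by less than half of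
  -- `C⁻¹ * r`, after the loss in the quasi-triangle inequality.
  have hev : ∀ᶠ κ in nhdsWithin (0 : ℝ) (Set.Ioi 0),
      (2 * κ) ^ (1 / ρ) + d * (2 * κ) < C⁻¹ / (2 * 2 ^ (1 / ρ)) := by
    have hc : ContinuousAt (fun κ : ℝ => (2 * κ) ^ (1 / ρ) + d * (2 * κ)) 0 := by
      refine ContinuousAt.add (ContinuousAt.rpow_const (by fun_prop) ?_) (by fun_prop)
      right; positivity
    refine (hc.tendsto.mono_left nhdsWithin_le_nhds).eventually_lt_const ?_
    have : (2 * (0 : ℝ)) ^ (1 / ρ) = 0 := by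
      rw [mul_zero, Real.zero_rpow (by positivity)]
    rw [this]
    simp only [mul_zero, add_zero]
    positivity
  have hev1 : ∀ᶠ κ in nhdsWithin (0 : ℝ) (Set.Ioi 0), κ < 1 :=
    nhdsWithin_le_nhds (eventually_lt_nhds one_pos)
  obtain ⟨κ, ⟨hκ2, hκ1⟩, hκ0⟩ := ((hev.and hev1).and self_mem_nhdsWithin).exists
  have hκ0 : 0 < κ := hκ0
  refine ⟨κ, C⁻¹ / (2 * 2 ^ (1 / ρ)), hκ0, hκ1.le, by positivity, fun r hr x w hx hxw => ?_⟩
  have h1 := scaledNorm_add_le hρ w (x - w)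
  rw [add_sub_cancel] at h1
  have h2 : scaledNorm ρ (x - w) ≤ ((2 * κ) ^ (1 / ρ) + d * (2 * κ)) * r := by
    have e0 : |(x - w) 0| ^ (1 / ρ) ≤ (2 * κ) ^ (1 / ρ) * r := by
      have := Real.rpow_le_rpow (abs_nonneg _) (hxw 0) (by positivity : 0 ≤ 1 / ρ)
      rw [Real.mul_rpow (by positivity) (by positivity), scaling_zero, ← Real.rpow_mul hr.le,
        mul_one_div_cancel hρ.ne', Real.rpow_one] at this
      exact this
    have e1 : ∑ i : Fin d, |(x - w) i.succ| ≤ d * (2 * κ * r) := by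
      have : ∑ i : Fin d, |(x - w) i.succ| ≤ ∑ _i : Fin d, 2 * κ * r := by
        refine Finset.sum_le_sum fun i _ => ?_
        have := hxw i.succ
        rwa [scaling_succ, Real.rpow_one] at this
      simpa using this
    unfold scaledNorm
    linarith
  have h3 : 2 ^ (1 / ρ) * scaledNorm ρ (x - w) ≤ C⁻¹ / 2 * r := by
    calc 2 ^ (1 / ρ) * scaledNorm ρ (x - w)
        ≤ 2 ^ (1 / ρ) * (C⁻¹ / (2 * 2 ^ (1 / ρ)) * r) := by
          refine mul_le_mul_of_nonneg_left (h2.trans ?_) hQ.le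
          exact mul_le_mul_of_nonneg_right hκ2.le hr.le
      _ = C⁻¹ / 2 * r := by field_simp
  have h4 : C⁻¹ / 2 * r ≤ 2 ^ (1 / ρ) * scaledNorm ρ w := by
    rw [mul_add] at h1
    linarith
  calc C⁻¹ / (2 * 2 ^ (1 / ρ)) * r = C⁻¹ / 2 * r / 2 ^ (1 / ρ) := by field_simp
    _ ≤ scaledNorm ρ w := by rw [div_le_iff₀ hQ]; linarith

/-- The bound of the kernel of an edge at scale `r`. -/
def edgeBound (d : ℕ) (ε r : ℝ) : EdgeType → ℝ
  | .bare => r ^ (-(d : ℝ))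
  | .mollified => min (r ^ (-(d : ℝ))) (ε ^ (-(d : ℝ)))

theorem edgeBound_nonneg {ε r : ℝ} (hε : 0 < ε) (hr : 0 < r) (t : EdgeType) :
    0 ≤ edgeBound d ε r t := by
  cases t
  · exact (Real.rpow_pos_of_pos hr _).le
  · exact le_min (Real.rpow_pos_of_pos hr _).le (Real.rpow_pos_of_pos hε _).le

/-- The product of the kernels is bounded on regions where the two ends of each edge `e` are at
distance at least `c * r e`. -/
theorem exists_kernelProduct_bound (hρ : 0 < ρ) (hd : 1 ≤ d) {K ϱ : Spacetime d → ℝ}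
    (hK : IsSingularKernel ρ (-(d : ℝ)) K) (hϱ : IsMollifier ϱ) {c : ℝ} (hc : 0 < c) (n m : ℕ) :
    ∃ M : ℝ, 1 ≤ M ∧ ∀ (V E : Type) [Fintype E] [DecidableEq E] (Γ : FeynmanDiagram V E),
      Fintype.card E ≤ m → ∀ (ε : ℝ), 0 < ε → ∀ r : E → ℝ, (∀ e, 0 < r e) →
      ∀ D : Set (HalfEdgeCoord E d → ℝ), IsOpen D →
      (∀ y ∈ D, ∀ e, c * r e ≤ scaledNorm ρ (edgeDiff e y)) →
      ContDiffOn ℝ ∞ (Γ.kernelProduct (EdgeType.kernel ρ ε ϱ K)) D ∧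
      DerivBound D (fun a => r a.1.1 ^ scaling ρ d a.2) n
        (M * ∏ e, edgeBound d ε (r e) (Γ.type e))
        (Γ.kernelProduct (EdgeType.kernel ρ ε ϱ K)) := by
  obtain ⟨M, hM1, hM⟩ := exists_kernel_derivBound hρ hd hK hϱ hc n
  have h2M : 1 ≤ 2 ^ n * M := by
    have : (1 : ℝ) ≤ 2 ^ n := one_le_pow₀ (by norm_num)
    nlinarith
  refine ⟨(2 ^ n * M) ^ m, one_le_pow₀ h2M, ?_⟩
  intro V E _ _ Γ hm ε hε r hr D hD hsep
  have hs' : ∀ a : HalfEdgeCoord E d, 0 < r a.1.1 ^ scaling ρ d a.2 := fun a =>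
    Real.rpow_pos_of_pos (hr _) _
  have hne : ∀ e, ∀ y ∈ D, edgeDiff e y ∈ ({0}ᶜ : Set (Spacetime d)) := by
    intro e y hy h0
    rw [Set.mem_singleton_iff] at h0
    have h1 := hsep y hy e
    have h2 : scaledNorm ρ (0 : Spacetime d) = 0 := by
      simp [scaledNorm, Real.zero_rpow, hρ.ne']
    rw [h0, h2] at h1
    have := mul_pos hc (hr e)
    linarith
  have hsm : ∀ e ∈ Finset.univ, ContDiffOn ℝ ∞
      (fun y => (Γ.type e).kernel ρ ε ϱ K (edgeDiff e y)) D := fun e _ =>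
    (contDiffOn_kernel hρ hd hK hϱ hε _).comp (contDiff_edgeDiff e).contDiffOn (hne e)
  have hb : ∀ e ∈ (Finset.univ : Finset E), 0 ≤ M * edgeBound d ε (r e) (Γ.type e) := fun e _ =>
    mul_nonneg (by linarith) (edgeBound_nonneg hε (hr e) _)
  refine ⟨contDiffOn_prod hsm, ?_⟩
  have key := DerivBound.prod hD Finset.univ hs' hb hsm (n := n) fun e he => by
    refine DerivBound.comp_edgeDiff (D := {x | c * r e ≤ scaledNorm ρ x})
      (s := fun i => r e ^ scaling ρ d i) hs' (fun _ _ => rfl) (fun y hy => hsep y hy e)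
      (hb e he) ?_
    have := hM (r e) (hr e) ε hε (Γ.type e)
    cases ht : Γ.type e <;> rw [ht] at this <;> exact this
  refine DerivBound.mono_bound hs' key ?_
  simp_rw [← mul_assoc]
  rw [Finset.prod_mul_distrib, Finset.prod_const, Finset.card_univ]
  refine mul_le_mul_of_nonneg_right (pow_le_pow_right₀ h2M hm)
    (Finset.prod_nonneg fun e _ => edgeBound_nonneg hε (hr e) _)

end Kernels

/-! ### Decorated contractions as Taylor expansions -/

namespace FeynmanDiagram

variable {V E : Type} [Fintype V] [LinearOrder V] [Fintype E] [DecidableEq E]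
  {Γ : FeynmanDiagram V E} {γ : Finset E} {d : ℕ} {ρ : ℝ}

theorem moveLegs_eq_freeze (z : V → Spacetime d) :
    Γ.moveLegs γ (z (Γ.firstVertex γ)) =
      freeze (Γ.legs γ ×ˢ Finset.univ) (fun a => z (Γ.firstVertex γ) a.2) := by
  funext y a
  simp [moveLegs, freeze]

theorem mderiv_zero {ι : Type} [Fintype ι] [DecidableEq ι] (f : (ι → ℝ) → ℝ) :
    mderiv 0 f = f := by
  unfold mderiv
  induction (Finset.univ : Finset ι).toList with
  | nil => rfl
  | cons a L ih => rw [List.foldr_cons, ih]; rfl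

theorem mderiv_single {ι : Type} [Fintype ι] [DecidableEq ι] (b : ι) (f : (ι → ℝ) → ℝ) :
    mderiv (Pi.single b 1) f = pderiv b f := by
  unfold mderiv
  have key : ∀ L : List ι, L.Nodup →
      L.foldr (fun a g => (pderiv a)^[(Pi.single b 1 : ι → ℕ) a] g) f =
        if b ∈ L then pderiv b f else f := by
    intro L hL
    induction L with
    | nil => simp
    | cons a L ih =>
      rw [List.nodup_cons] at hL
      rw [List.foldr_cons, ih hL.2]
      by_cases hab : a = b
      · subst hab; simp [hL.1]
      · simp [Ne.symm hab]
  rw [key _ (Finset.nodup_toList _)]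
  simp

/-- Whether the decorated contraction of `γ` includes the terms of first order. -/
def hasLinearTerms (ρ : ℝ) (d : ℕ) (Γ : FeynmanDiagram V E) (γ : Finset E) : Bool :=
  decide (Γ.subdegree ρ d γ + 1 ≤ 0)

/-- Since `-ρ < deg γ` and `ρ ≤ 2`, a time derivative, which costs `ρ`, is never allowed. A space
derivative is allowed only if `deg γ + 1 ≤ 0`, which entails `ρ > 1`; combined with any other
derivative it costs at least `2`, too much. The decorations are thus `0` and possibly single space
derivatives on the legs. -/
theorem sub_taylorContract_eq (hρ0 : 0 < ρ) (hρ2 : ρ ≤ 2) (hdeg : Γ.subdegree ρ d γ ≤ 0)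
    (hdeg' : -ρ < Γ.subdegree ρ d γ) (z : V → Spacetime d) (Φ : (HalfEdgeCoord E d → ℝ) → ℝ) :
    Φ - Γ.taylorContract ρ z γ Φ = taylorRem (Γ.legs γ ×ˢ Finset.univ)
      (if Γ.hasLinearTerms ρ d γ then Γ.legs γ ×ˢ (Finset.univ.erase 0) else ∅)
      (fun a => z (Γ.firstVertex γ) a.2) Φ := by
  set L₁ : Finset (HalfEdgeCoord E d) :=
    if Γ.hasLinearTerms ρ d γ then Γ.legs γ ×ˢ (Finset.univ.erase 0) else ∅ with hL₁
  have hscale : ∀ b ∈ L₁, b.1 ∈ Γ.legs γ ∧ scaling ρ d b.2 = 1 ∧ Γ.subdegree ρ d γ + 1 ≤ 0 := by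
    intro b hb
    rw [hL₁] at hb
    split_ifs at hb with h
    · rw [Finset.mem_product, Finset.mem_erase] at hb
      obtain ⟨j, hj⟩ := Fin.exists_succ_eq.2 hb.2.1
      exact ⟨hb.1, by rw [← hj, scaling_succ], by simpa [hasLinearTerms] using h⟩
    · simp at hb
  funext y
  rw [Pi.sub_apply, taylorContract, taylorRem, sub_sub]
  congr 1
  let T := {m : HalfEdgeCoord E d → ℕ // (∀ a, a.1 ∉ Γ.legs γ → m a = 0) ∧
        Γ.subdegree ρ d γ + ∑ a, scaling ρ d a.2 * (m a : ℝ) ≤ 0}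
  let φ : Option {b // b ∈ L₁} → T := fun o => match o with
    | none => ⟨0, fun _ _ => rfl, by simpa using hdeg⟩
    | some b => ⟨Pi.single b.1 1, fun a ha => by
        refine Pi.single_eq_of_ne (fun h => ha ?_) _
        rw [h]; exact (hscale b.1 b.2).1, by
        obtain ⟨_, h2, h3⟩ := hscale b.1 b.2
        rw [Finset.sum_eq_single b.1 (fun a _ hab => by simp [Pi.single_eq_of_ne hab])
          (fun h => absurd (Finset.mem_univ _) h)]
        simpa [h2] using h3⟩
  have hinj : Function.Injective φ := by
    rintro (_ | b) (_ | b') h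
    · rfl
    · have := congrFun (congrArg Subtype.val h) b'.1
      simp [φ] at this
    · have := congrFun (congrArg Subtype.val h) b.1
      simp [φ] at this
    · have := congrFun (congrArg Subtype.val h) b.1
      simp only [φ, Pi.single_eq_same] at this
      have hbb : b.1 = b'.1 := by
        by_contra hne
        rw [Pi.single_eq_of_ne hne] at this
        exact one_ne_zero this
      rw [Subtype.ext hbb]
  have hsurj : Function.Surjective φ := by
    rintro ⟨m, hm1, hm2⟩
    by_cases hm : m = 0
    · subst hm; exact ⟨none, rfl⟩
    obtain ⟨b, hb⟩ := Function.ne_iff.1 hm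
    rw [Pi.zero_apply] at hb
    have hb1 : 1 ≤ m b := Nat.one_le_iff_ne_zero.2 hb
    have hnn : ∀ a : HalfEdgeCoord E d, 0 ≤ scaling ρ d a.2 * (m a : ℝ) := fun a =>
      mul_nonneg (scaling_pos hρ0 _).le (Nat.cast_nonneg _)
    have hbleg : b.1 ∈ Γ.legs γ := by
      by_contra h
      exact hb (hm1 b h)
    have hge : scaling ρ d b.2 * (m b : ℝ) ≤ ∑ a, scaling ρ d a.2 * (m a : ℝ) :=
      Finset.single_le_sum (f := fun a : HalfEdgeCoord E d => scaling ρ d a.2 * (m a : ℝ))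
        (fun a _ => hnn a) (Finset.mem_univ b)
    have hb1' : (1 : ℝ) ≤ m b := by exact_mod_cast hb1
    have h0 : b.2 ≠ 0 := by
      intro h0
      rw [h0, scaling_zero] at hge
      nlinarith
    have hsc : scaling ρ d b.2 = 1 := by
      obtain ⟨j, hj⟩ := Fin.exists_succ_eq.2 h0
      rw [← hj, scaling_succ]
    rw [hsc, one_mul] at hge
    have hlin : Γ.subdegree ρ d γ + 1 ≤ 0 := by linarith
    have hbL : b ∈ L₁ := by
      rw [hL₁, if_pos (by simpa [hasLinearTerms] using hlin)]
      exact Finset.mem_product.2 ⟨hbleg, Finset.mem_erase.2 ⟨h0, Finset.mem_univ _⟩⟩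
    have h1ρ : 1 < ρ := by linarith
    refine ⟨some ⟨b, hbL⟩, Subtype.ext ?_⟩
    funext a
    simp only [φ]
    by_cases hab : a = b
    · subst hab
      rw [Pi.single_eq_same]
      have : (m a : ℝ) < 2 := by linarith
      have : m a < 2 := by exact_mod_cast this
      omega
    · rw [Pi.single_eq_of_ne hab]
      by_contra hne
      have ha1 : (1 : ℝ) ≤ m a := by
        exact_mod_cast Nat.one_le_iff_ne_zero.2 (Ne.symm hne)
      have hpair := Finset.sum_le_sum_of_subset_of_nonneg (Finset.subset_univ {a, b})
        (f := fun a : HalfEdgeCoord E d => scaling ρ d a.2 * (m a : ℝ)) (fun a _ _ => hnn a)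
      rw [Finset.sum_pair hab, hsc, one_mul] at hpair
      have h1a : 1 ≤ scaling ρ d a.2 := by
        have := min_one_le_scaling (ρ := ρ) a.2
        rwa [min_eq_left h1ρ.le] at this
      nlinarith
  rw [← finsum_eq_of_bijective (f := fun o => (∏ a, (y a - z (Γ.firstVertex γ) a.2) ^ (φ o).1 a /
      (((φ o).1 a).factorial : ℝ)) * mderiv (φ o).1 Φ (Γ.moveLegs γ (z (Γ.firstVertex γ)) y))
      φ ⟨hinj, hsurj⟩ (fun o => rfl), finsum_eq_sum_of_fintype, Fintype.sum_option]
  have hnone : (φ none).1 = 0 := rfl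
  have hsome : ∀ b, (φ (some b)).1 = Pi.single b.1 1 := fun _ => rfl
  simp only [hnone, hsome, mderiv_zero, mderiv_single, moveLegs_eq_freeze]
  congr 1
  · simp
  · rw [← Finset.sum_coe_sort L₁]
    refine Finset.sum_congr rfl fun b _ => ?_
    congr 1
    rw [Finset.prod_eq_single b.1]
    · simp
    · intro a _ hab; simp [Pi.single_eq_of_ne hab]
    · intro h; exact absurd (Finset.mem_univ _) h

end FeynmanDiagram

end
noncomputable section

/-! ### Pointwise bound of the renormalised integrand -/

namespace HeppTree

variable {V : Type} [Fintype V] [DecidableEq V] {T : HeppTree V} {A B : Finset V}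

/-- The length scale of a node. -/
def radius (n : T.Scales) (A : Finset V) : ℝ := (2 : ℝ) ^ (-(scale n A : ℝ))

theorem radius_pos (n : T.Scales) (A : Finset V) : 0 < radius n A :=
  Real.rpow_pos_of_pos two_pos _

theorem radius_le_one (n : T.Scales) (A : Finset V) : radius n A ≤ 1 :=
  Real.rpow_le_one_of_one_le_of_nonpos one_le_two (neg_nonpos.2 (Nat.cast_nonneg _))

theorem radius_mono (n : T.Scales) (hA : A ∈ T.inner) (hB : B ∈ T.inner) (h : A ⊆ B) :
    radius n A ≤ radius n B :=
  Real.rpow_le_rpow_of_exponent_le one_le_two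
    (neg_le_neg (Nat.cast_le.2 (scale_anti n hA hB h)))

end HeppTree

/-- The distances in `z` are comparable with those prescribed by `n`. -/
def HeppTree.IsComparable {V : Type} [Fintype V] [DecidableEq V] {T : HeppTree V} (n : T.Scales)
    {d : ℕ} (ρ C : ℝ) (z : V → Spacetime d) : Prop :=
  ∀ u v, u ≠ v → C⁻¹ * HeppTree.radius n (T.lca u v) ≤ scaledNorm ρ (z u - z v) ∧
    scaledNorm ρ (z u - z v) ≤ C * HeppTree.radius n (T.lca u v)

namespace FeynmanDiagram

open HeppTree

variable {V E : Type} [Fintype V] [LinearOrder V] [Fintype E] [DecidableEq E]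
  {Γ : FeynmanDiagram V E} {F : Finset (Finset E)} {d : ℕ} {ρ : ℝ}

theorem IsLaminar.exists_mem_ownEdges (hF : Γ.IsLaminar F)
    (hconn : (Γ.graph Finset.univ).Connected) (e : E) :
    ∃ c ∈ insert Finset.univ F, Γ.IsBlock c ∧ Γ.IsCompatible F c ∧ e ∈ ownEdges F c := by
  obtain ⟨c, hc, hmin⟩ := Finset.exists_min_image ((insert Finset.univ F).filter fun c => e ∈ c)
    Finset.card ⟨Finset.univ, by simp⟩
  obtain ⟨hc1, hc2⟩ := Finset.mem_filter.1 hc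
  have hown : e ∈ ownEdges F c := by
    refine mem_ownEdges.2 ⟨hc2, fun f hf hfc hef => ?_⟩
    have := hmin f (Finset.mem_filter.2 ⟨Finset.mem_insert_of_mem hf, hef⟩)
    exact absurd (Finset.card_lt_card hfc) (not_lt.2 this)
  refine ⟨c, hc1, ?_⟩
  rcases Finset.mem_insert.1 hc1 with rfl | h
  · exact ⟨isBlock_univ ⟨e, Finset.mem_univ e⟩ hconn, fun f _ => Or.inl (Finset.subset_univ _), hown⟩
  · exact ⟨hF.block c h, hF.compatible c h, hown⟩

/-- The exponent gained by the renormalisation of `γ`. -/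
def gainExponent (ρ : ℝ) (d : ℕ) (Γ : FeynmanDiagram V E) (γ : Finset E) : ℝ :=
  if Γ.hasLinearTerms ρ d γ then ρ else min 1 ρ

theorem gainExponent_pos (hρ0 : 0 < ρ) (γ : Finset E) : 0 < Γ.gainExponent ρ d γ := by
  unfold gainExponent
  split_ifs
  · exact hρ0
  · exact lt_min one_pos hρ0

/-- With linear terms the gain `ρ` beats the degree by assumption. Without them `deg γ > -1` as
well, so that `min 1 ρ` suffices. -/
theorem gainExponent_add_pos {γ : Finset E} (h : -ρ < Γ.subdegree ρ d γ) :
    0 < Γ.gainExponent ρ d γ + Γ.subdegree ρ d γ := by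
  unfold gainExponent
  split_ifs with h1
  · linarith
  · simp only [hasLinearTerms, decide_eq_true_eq] at h1
    rcases min_choice 1 ρ with h2 | h2 <;> rw [h2] <;> linarith

/-- The factor gained by the renormalisation of `γ`. -/
def gain (ρ : ℝ) (d : ℕ) (Γ : FeynmanDiagram V E) {T : HeppTree V} (n : T.Scales)
    (F : Finset (Finset E)) (γ : Finset E) : ℝ :=
  (radius n (Γ.lowerNode T F γ) / radius n (Γ.upperNode T F γ)) ^ Γ.gainExponent ρ d γ

theorem gain_nonneg {T : HeppTree V} (n : T.Scales) (γ : Finset E) : 0 ≤ Γ.gain ρ d n F γ :=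
  Real.rpow_nonneg (div_nonneg (radius_pos _ _).le (radius_pos _ _).le) _

/-- Lists of subdiagrams in which each element comes after those that contain it. -/
structure IsProcessed (F Fu : Finset (Finset E)) (Q : List (Finset E)) : Prop where
  nodup : Q.Nodup
  sorted : Q.Pairwise fun γ γ' => γ'.card ≤ γ.card
  mem : ∀ q ∈ Q, q ∈ F ∪ Fu
  upward : ∀ q ∈ Q, ∀ f ∈ F ∪ Fu, q ⊂ f → f ∈ Q

theorem IsProcessed.of_append {Fu : Finset (Finset E)} {Q : List (Finset E)} {γ : Finset E}
    (h : IsProcessed F Fu (Q ++ [γ])) : IsProcessed F Fu Q ∧ γ ∈ F ∪ Fu ∧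
      (∀ q ∈ Q, q ≠ γ ∧ γ.card ≤ q.card) ∧ ∀ f ∈ F ∪ Fu, γ ⊂ f → f ∈ Q := by
  have hnd := List.nodup_append.1 h.nodup
  have hso := List.pairwise_append.1 h.sorted
  have hcard : ∀ q ∈ Q, q ≠ γ ∧ γ.card ≤ q.card := fun q hq =>
    ⟨fun e => hnd.2.2 q hq γ (by simp) e, hso.2.2 q hq γ (by simp)⟩
  refine ⟨⟨hnd.1, hso.1, fun q hq => h.mem q (by simp [hq]), fun q hq f hf hqf => ?_⟩,
    h.mem γ (by simp), hcard, fun f hf hγf => ?_⟩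
  · rcases List.mem_append.1 (h.upward q (by simp [hq]) f hf hqf) with h' | h'
    · exact h'
    · rw [List.mem_singleton] at h'
      subst h'
      exact absurd (Finset.card_lt_card hqf) (not_lt.2 (hcard q hq).2)
  · rcases List.mem_append.1 (h.upward γ (by simp) f hf hγf) with h' | h'
    · exact h'
    · rw [List.mem_singleton] at h'
      exact absurd h'.symm hγf.ne

/-! ### Location of the half-edges while the operators are applied. -/

section Sector

variable {T : HeppTree V} (hF : Γ.IsLaminar F) (hloop : ∀ e, Γ.src e ≠ Γ.tgt e)
  (hconn : (Γ.graph Finset.univ).Connected)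

/-- The leg `h` has been attached to the first vertex of some element of `F`. -/
def IsDead (Γ : FeynmanDiagram V E) (F : Finset (Finset E)) (Q : List (Finset E))
    (h : E × Bool) : Prop := ∃ c ∈ Q, c ∈ F ∧ h ∈ Γ.legs c

/-- The regions in which the half-edges are located once the subdiagrams in `Q` have been
processed. -/
def IsAdmissible (Γ : FeynmanDiagram V E) {T : HeppTree V} (n : T.Scales)
    (F Fu : Finset (Finset E)) (Br : E × Bool → Finset V) (Q : List (Finset E))
    (U : E × Bool → Set V) (r : E × Bool → ℝ) : Prop :=
  ∀ h, (Γ.IsDead F Q h → U h = Set.univ) ∧ (¬ Γ.IsDead F Q h →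
    (U h = Br h ∧ r h = radius n (Γ.edgeNode T F h.1)) ∨
    ∃ γ ∈ Q, γ ∈ Fu ∧ h ∈ Γ.legs γ ∧ U h = Γ.lowerNode T F γ ∧
      r h = radius n (Γ.lowerNode T F γ))

/-- The two branches of the tree separated by the node of each edge. -/
structure IsBranching (Γ : FeynmanDiagram V E) (T : HeppTree V) (F : Finset (Finset E))
    (Br : E × Bool → Finset V) : Prop where
  mem : ∀ h, Γ.contractedAttach F h ∈ Br h
  subset : ∀ h : E × Bool, ∀ A ∈ T.inner, A ⊂ Γ.edgeNode T F h.1 → Γ.contractedAttach F h ∈ A →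
    A ⊆ Br h
  lca : ∀ e, ∀ x ∈ Br (e, false), ∀ y ∈ Br (e, true), T.lca x y = Γ.edgeNode T F e
  disjoint : ∀ e, Disjoint (Br (e, false)) (Br (e, true))

include hF hloop hconn in
theorem exists_isBranching (T : HeppTree V) : ∃ Br, Γ.IsBranching T F Br := by
  have hne : ∀ e, Γ.contractedAttach F (e, false) ≠ Γ.contractedAttach F (e, true) := fun e => by
    obtain ⟨c, -, -, hcc, he⟩ := hF.exists_mem_ownEdges hconn e
    exact contractedAttach_own_ne hF hloop hcc he
  choose B₁ B₂ h1 h2 h3 h4 h5 using fun e => exists_branches (T := T) (hne e)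
  refine ⟨fun h => if h.2 then B₂ h.1 else B₁ h.1, ?_, ?_, ?_, ?_⟩
  · rintro ⟨e, b⟩
    cases b
    · exact h1 e
    · exact h2 e
  · rintro ⟨e, b⟩ A hA hAe hm
    cases b
    · rcases h4 e A hA hAe with h | h
      · exact h
      · exact absurd (h hm) (Finset.disjoint_left.1 (h3 e) (h1 e))
    · rcases h4 e A hA hAe with h | h
      · exact absurd (h2 e) (Finset.disjoint_left.1 (h3 e) (h hm))
      · exact h
  · exact fun e x hx y hy => h5 e x hx y hy
  · exact fun e => h3 e

variable {n : T.Scales} {Fu : Finset (Finset E)} {Br : E × Bool → Finset V}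
  (hFu : ∀ γ ∈ Fu, Γ.IsUnsafe T F γ) (hBr : Γ.IsBranching T F Br)
  {Q : List (Finset E)} {U : E × Bool → Set V} {r : E × Bool → ℝ} {h : E × Bool}
  {γ c : Finset E}

include hF hloop hFu hBr in
-- A leg of `c` that no larger safe element has moved is contracted by `F` to the first vertex of
-- `c`. This point lies in the branch of its edge and in the node of any unsafe subdiagram that has
-- moved the leg. The contraction of `c` thus stays in the domain of the bounds.
theorem IsAdmissible.firstVertex_mem (hadm : Γ.IsAdmissible n F Fu Br Q U r) (hc : c ∈ F)
    (hQ : ∀ q ∈ Q, q ≠ c ∧ c.card ≤ q.card) (hQ' : ∀ f ∈ F ∪ Fu, c ⊂ f → f ∈ Q)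
    (hh : h ∈ Γ.legs c) : Γ.firstVertex c ∈ U h := by
  by_cases hd : Γ.IsDead F Q h
  · rw [(hadm h).1 hd]; trivial
  have hnot : ∀ f ∈ F, c ⊂ f → h ∉ Γ.legs f := fun f hf hcf hl =>
    hd ⟨f, hQ' f (Finset.mem_union_left _ hf) hcf, hf, hl⟩
  have hhc := (mem_legs.1 hh).2
  have hca : Γ.contractedAttach F h = Γ.firstVertex c := by
    have hmem : c ∈ F.filter fun f => h ∈ Γ.legs f := Finset.mem_filter.2 ⟨hc, hh⟩
    rw [contractedAttach, if_pos ⟨c, hmem⟩]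
    congr 1
    refine le_antisymm (Finset.sup_le fun f hf => ?_) (Finset.le_sup (f := id) hmem)
    obtain ⟨hf1, hf2⟩ := Finset.mem_filter.1 hf
    rcases hF.compatible c hc f hf1 with h' | h' | h'
    · exact h'
    · by_cases e : c = f
      · exact e.symm.subset
      · exact absurd hf2 (hnot f hf1 (Finset.ssubset_iff_subset_ne.2 ⟨h', e⟩))
    · exact absurd hhc (Finset.disjoint_left.1 h' (mem_legs.1 hf2).2)
  rw [← hca]
  rcases (hadm h).2 hd with ⟨h1, -⟩ | ⟨γ, hγ, hγu, hl, h1, -⟩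
  · rw [h1]; exact hBr.mem h
  · rw [h1]
    have hun := hFu γ hγu
    obtain ⟨hne, hcard⟩ := hQ γ hγ
    have hcγ : c ⊂ γ := by
      rcases hun.compatible c hc with h' | h' | h'
      · exact Finset.ssubset_iff_subset_ne.2 ⟨h', hne.symm⟩
      · exact absurd (Finset.eq_of_subset_of_card_le h' hcard) hne
      · exact absurd (mem_legs.1 hl).2 (Finset.disjoint_left.1 h' hhc)
    refine hun.mem_lowerNode hF hloop ⟨hl, fun f hf hγf => ?_⟩
    by_contra hef
    exact hnot f hf (hcγ.trans hγf)
      (mem_legs.2 ⟨hef, vertices_mono (hcγ.trans hγf).1 hhc⟩)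

include hF hloop hFu hBr hconn in
-- Either the leg still ranges over its branch at the scale of its edge, or a larger unsafe `γ'` has
-- been expanded before. In the latter case the upper node of `γ` lies below the lower node of `γ'`,
-- so that successive gains concern disjoint ranges of scales.
theorem IsAdmissible.alive (hadm : Γ.IsAdmissible n F Fu Br Q U r) (hγ : γ ∈ Fu)
    (hγu : γ ≠ Finset.univ)
    (hQ : ∀ q ∈ Q, q ≠ γ ∧ γ.card ≤ q.card) (hQ' : ∀ f ∈ F ∪ Fu, γ ⊂ f → f ∈ Q)
    (hh : h ∈ Γ.legs γ) (hd : ¬ Γ.IsDead F Q h) :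
    (Γ.lowerNode T F γ : Set V) ⊆ U h ∧ radius n (Γ.upperNode T F γ) ≤ r h := by
  have hun := hFu γ hγ
  have hhγ := (mem_legs.1 hh).2
  have halive : Γ.IsAliveLeg F γ h := ⟨hh, fun f hf hγf => by
    by_contra hef
    exact hd ⟨f, hQ' f (Finset.mem_union_left _ hf) hγf, hf,
      mem_legs.2 ⟨hef, vertices_mono hγf.1 hhγ⟩⟩⟩
  obtain ⟨hJ, -, -, hJmin⟩ := hun.upperNode_spec hF hloop hconn hγu
  rcases (hadm h).2 hd with ⟨h1, h2⟩ | ⟨γ', hγ', hγ'u, hl, h1, h2⟩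
  · rw [h1, h2]
    refine ⟨Finset.coe_subset.2 (hBr.subset h _ (lowerNode_mem hun.block hF)
      (hun.lowerNode_ssubset hF hloop halive) (hun.mem_lowerNode hF hloop halive)), ?_⟩
    exact radius_mono n hJ lca_mem (hJmin h.1 h.2 halive)
  · rw [h1, h2]
    obtain ⟨hne, hcard⟩ := hQ γ' hγ'
    have hun' := hFu γ' hγ'u
    have hss : γ ⊂ γ' := by
      rcases hun.nested hF hloop hun' with h' | h' | h'
      · exact Finset.ssubset_iff_subset_ne.2 ⟨h', hne.symm⟩
      · exact absurd (Finset.eq_of_subset_of_card_le h' hcard) hne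
      · exact absurd (mem_legs.1 hl).2 (Finset.disjoint_left.1 h' hhγ)
    obtain ⟨h3, e, b, h4, h5⟩ := hun.of_ssubset hF hloop hun' hss halive hl
    exact ⟨Finset.coe_subset.2 h3, radius_mono n hJ (lowerNode_mem hun'.block hF)
      ((hJmin e b h4).trans h5)⟩

include hF hloop hFu hBr in
-- Once all of `F` has been processed, a half-edge that is still alive is a leg of no element of
-- `F`, and its contracted position is its vertex. The configuration itself is therefore an
-- admissible point of evaluation.
theorem IsAdmissible.attach_mem (hadm : Γ.IsAdmissible n F Fu Br Q U r)
    (hQ : ∀ f ∈ F, f ∈ Q) (h : E × Bool) : Γ.attach h ∈ U h := by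
  by_cases hd : Γ.IsDead F Q h
  · rw [(hadm h).1 hd]; trivial
  have hnot : ∀ f ∈ F, h ∉ Γ.legs f := fun f hf hl => hd ⟨f, hQ f hf, hf, hl⟩
  have hca : Γ.contractedAttach F h = Γ.attach h := by
    rw [contractedAttach, if_neg]
    rintro ⟨f, hf⟩
    exact hnot f (Finset.mem_filter.1 hf).1 (Finset.mem_filter.1 hf).2
  rw [← hca]
  rcases (hadm h).2 hd with ⟨h1, -⟩ | ⟨γ, hγ, hγu, hl, h1, -⟩
  · rw [h1]; exact hBr.mem h
  · rw [h1]
    refine (hFu γ hγu).mem_lowerNode hF hloop ⟨hl, fun f hf hγf => ?_⟩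
    by_contra hef
    exact hnot f hf (mem_legs.2 ⟨hef, vertices_mono hγf.1 (mem_legs.1 hl).2⟩)

end Sector

open Classical in
/-- The scales of the half-edges, those of the dead ones being arbitrary. -/
def legScale (Γ : FeynmanDiagram V E) (F : Finset (Finset E)) (Q : List (Finset E))
    (r R : E × Bool → ℝ) (h : E × Bool) : ℝ := if Γ.IsDead F Q h then R h else r h

theorem IsComparable_close {T : HeppTree V} {n : T.Scales} {C : ℝ} (hρ0 : 0 < ρ)
    (hC : 1 ≤ C)
    {z : V → Spacetime d} (hz : HeppTree.IsComparable n ρ C z) {u v : V} {x : ℝ} (hx : 0 < x)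
    (h : u ≠ v → radius n (T.lca u v) ≤ x) (i : Fin (d + 1)) :
    |z u i - z v i| ≤ (C * x) ^ scaling ρ d i := by
  by_cases huv : u = v
  · subst huv
    rw [sub_self, abs_zero]
    positivity
  · have h1 := abs_le_scaledNorm_rpow hρ0 (z u - z v) i
    refine h1.trans (Real.rpow_le_rpow (scaledNorm_nonneg _) ((hz u v huv).2.trans ?_)
      (scaling_pos hρ0 i).le)
    exact mul_le_mul_of_nonneg_left (h huv) (by linarith)

/-- Pointwise bound of the renormalised integrand on Hepp sectors. -/
theorem exists_pointwise_bound (hρ0 : 0 < ρ) (hρ2 : ρ ≤ 2) (hd : 1 ≤ d) {K ϱ : Spacetime d → ℝ}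
    (hK : IsSingularKernel ρ (-(d : ℝ)) K) (hϱ : IsMollifier ϱ) {C : ℝ} (hC : 1 ≤ C) (m : ℕ) :
    ∃ B : ℝ, 1 ≤ B ∧ ∀ (V E : Type) [Fintype V] [LinearOrder V] [Fintype E] [DecidableEq E]
      (Γ : FeynmanDiagram V E), Fintype.card E ≤ m → (∀ e, Γ.src e ≠ Γ.tgt e) →
      (Γ.graph Finset.univ).Connected → ∀ (T : HeppTree V) (F : Finset (Finset E)),
      Γ.IsSafeForest ρ d T F →
      (∀ γ ∈ Γ.unsafePart ρ d T F, -ρ < Γ.subdegree ρ d γ) →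
      ∀ (n : T.Scales) (z : V → Spacetime d), HeppTree.IsComparable n ρ C z → ∀ ε : ℝ, 0 < ε →
      |Γ.renormalisedIntegrand ρ (EdgeType.kernel ρ ε ϱ K) F (Γ.unsafePart ρ d T F) z| ≤
        B * ((∏ e, edgeBound d ε (radius n (Γ.edgeNode T F e)) (Γ.type e)) *
          ∏ γ ∈ Γ.unsafePart ρ d T F, Γ.gain ρ d n F γ) := by
  classical
  have hC0 : 0 < C := by linarith
  obtain ⟨κ, c, hκ, hκ1, hc, hsep⟩ := exists_box_separation hρ0 d hC0
  -- `N` bounds the number of subdiagrams. Each operator consumes at most two derivatives, hence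
  -- kernels are controlled up to order `2 * N`.
  set N : ℕ := 2 ^ m with hN
  obtain ⟨A, hA1, hA⟩ := exists_taylorRem_box_const hρ0 hρ2 hκ hκ1 hC d (2 * N) (m * 2)
  obtain ⟨M, hM1, hM⟩ := exists_kernelProduct_bound hρ0 hd hK hϱ hc (2 * N) m
  refine ⟨A ^ N * M, by nlinarith [one_le_pow₀ hA1 (n := N)], ?_⟩
  intro V E _ _ _ _ Γ hm hloop hconn T F hsafe hdeg n z hz ε hε
  have hF := hsafe.1.isLaminar
  set Fu := Γ.unsafePart ρ d T F with hFudef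
  have hFu : ∀ γ ∈ Fu, Γ.IsUnsafe T F γ := fun γ hγ => isUnsafe_of_mem_unsafePart hsafe hγ
  have hFudiv : ∀ γ ∈ Fu, γ ∈ Γ.divergent ρ d := fun γ hγ => by
    simp only [hFudef, unsafePart, Finset.mem_filter] at hγ; exact hγ.1
  obtain ⟨Br, hBr⟩ := exists_isBranching hF hloop hconn T
  set b : ℝ := ∏ e, edgeBound d ε (radius n (Γ.edgeNode T F e)) (Γ.type e) with hb
  have hb0 : 0 ≤ b := Finset.prod_nonneg fun e _ => edgeBound_nonneg hε (radius_pos _ _) _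
  let G : Finset E → ℝ := fun γ => if γ ∈ F then 1 else Γ.gain ρ d n F γ
  have hG : ∀ γ, 0 ≤ G γ := fun γ => by
    simp only [G]; split_ifs
    · exact zero_le_one
    · exact gain_nonneg _ _
  let step : ((HalfEdgeCoord E d → ℝ) → ℝ) → Finset E → ((HalfEdgeCoord E d → ℝ) → ℝ) :=
    fun Φ γ => if γ ∈ F then -Γ.contract z γ Φ else Φ - Γ.taylorContract ρ z γ Φ
  set Φ₀ := Γ.kernelProduct (EdgeType.kernel ρ ε ϱ K) with hΦ₀
  have hprodnn : ∀ Q : List (Finset E), 0 ≤ (Q.map G).prod := fun Q =>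
    List.prod_nonneg fun x hx => by
      obtain ⟨γ, _, rfl⟩ := List.mem_map.1 hx
      exact hG γ
  -- The function no longer depends on the dead coordinates, so the bounds hold whatever scales `R ≥
  -- 1` are assigned to them. This freedom is needed at the later expansions.
  have main : ∀ Q : List (Finset E), IsProcessed F Fu Q → Q.length ≤ N →
      ∃ (U : E × Bool → Set V) (r : E × Bool → ℝ), Γ.IsAdmissible n F Fu Br Q U r ∧
        (∀ h, 0 < r h) ∧ ∀ R : E × Bool → ℝ, (∀ h, 1 ≤ R h) →
          ContDiffOn ℝ ∞ (Q.foldl step Φ₀) (boxRegion ρ κ z U (Γ.legScale F Q r R)) ∧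
          DerivBound (boxRegion ρ κ z U (Γ.legScale F Q r R))
            (coordScale ρ d (Γ.legScale F Q r R)) (2 * (N - Q.length))
            (A ^ Q.length * (M * b * (Q.map G).prod)) (Q.foldl step Φ₀) := by
    intro Q
    induction Q using List.reverseRecOn with
    | nil =>
      intro _ _
      have hdead : ∀ h, ¬ Γ.IsDead F [] h := by rintro h ⟨_, h', _⟩; simp at h'
      refine ⟨fun h => Br h, fun h => radius n (Γ.edgeNode T F h.1),
        fun h => ⟨fun h' => absurd h' (hdead h), fun _ => Or.inl ⟨rfl, rfl⟩⟩,
        fun h => radius_pos _ _, fun R _ => ?_⟩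
      have hleg : Γ.legScale F [] (fun h => radius n (Γ.edgeNode T F h.1)) R =
          fun h => radius n (Γ.edgeNode T F h.1) := by
        funext h; rw [legScale, if_neg (hdead h)]
      rw [hleg]
      have key := hM V E Γ hm ε hε (fun e => radius n (Γ.edgeNode T F e))
        (fun e => radius_pos _ _)
        (boxRegion ρ κ z (fun h => (Br h : Set V)) fun h => radius n (Γ.edgeNode T F h.1))
        (isOpen_boxRegion _ _ _) ?_
      · refine ⟨key.1, ?_⟩
        simp only [List.length_nil, Nat.sub_zero, pow_zero, one_mul, List.map_nil, List.prod_nil,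
          mul_one]
        exact key.2
      · intro y hy e
        obtain ⟨u, hu, hui⟩ := hy (e, false)
        obtain ⟨v, hv, hvi⟩ := hy (e, true)
        -- The ends of `e` are near vertices of the two disjoint branches below its node, whose
        -- distance is comparable with the radius of that node.
        have huv : v ≠ u := fun e' =>
          Finset.disjoint_left.1 (hBr.disjoint e) (Finset.mem_coe.1 hu) (e' ▸ Finset.mem_coe.1 hv)
        have h1 := (hz v u huv).1
        rw [lca_comm, hBr.lca e u hu v hv] at h1
        refine hsep _ (radius_pos _ _) (z v - z u) _ h1 fun i => ?_
        have h2 := hui i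
        have h3 := hvi i
        have e1 : (z v - z u) i - edgeDiff e y i =
            (y ((e, false), i) - z u i) - (y ((e, true), i) - z v i) := by
          simp only [edgeDiff, Pi.sub_apply]; ring
        rw [e1]
        refine (abs_sub _ _).trans ?_
        simp only at h2 h3
        linarith
    | append_singleton Q γ ih =>
      intro hproc hlen
      rw [List.length_append, List.length_singleton] at hlen
      obtain ⟨hproc', hγmem, hQ, hQ'⟩ := hproc.of_append
      obtain ⟨U, r, hadm, hr, hR⟩ := ih hproc' (by omega)
      rw [List.foldl_append, List.foldl_cons, List.foldl_nil, List.length_append,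
        List.length_singleton, List.map_append, List.prod_append, List.map_singleton,
        List.prod_singleton]
      set Φ := Q.foldl step Φ₀ with hΦ
      have hBnn : 0 ≤ A ^ Q.length * (M * b * (Q.map G).prod) := by
        have := hprodnn Q
        have : 0 ≤ A := by linarith
        have : 0 ≤ M := by linarith
        positivity
      have hlegpos : ∀ Q r R, (∀ h, 0 < r h) → (∀ h, 1 ≤ R h) → ∀ h, 0 < Γ.legScale F Q r R h := by
        intro Q r R hr hR h
        rw [legScale]; split_ifs
        · linarith [hR h]
        · exact hr h
      by_cases hγF : γ ∈ F
      · have hdead : ∀ h, Γ.IsDead F (Q ++ [γ]) h ↔ Γ.IsDead F Q h ∨ h ∈ Γ.legs γ := by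
          intro h
          simp only [IsDead, List.mem_append, List.mem_singleton]
          constructor
          · rintro ⟨c, hc | rfl, h1, h2⟩
            · exact Or.inl ⟨c, hc, h1, h2⟩
            · exact Or.inr h2
          · rintro (⟨c, hc, h1, h2⟩ | h2)
            · exact ⟨c, Or.inl hc, h1, h2⟩
            · exact ⟨γ, Or.inr rfl, hγF, h2⟩
        refine ⟨fun h => if h ∈ Γ.legs γ then Set.univ else U h, r, fun h => ⟨fun hdd => ?_,
          fun hdd => ?_⟩, hr, fun R hR1 => ?_⟩
        · by_cases hl : h ∈ Γ.legs γ
          · simp [hl]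
          · simp only [hl, if_false]
            exact (hadm h).1 (((hdead h).1 hdd).resolve_right hl)
        · rw [hdead, not_or] at hdd
          simp only [hdd.2, if_false]
          rcases (hadm h).2 hdd.1 with h1 | ⟨γ', h1, h2⟩
          · exact Or.inl h1
          · exact Or.inr ⟨γ', by simp [h1], h2⟩
        · have hout : ∀ h, h ∉ Γ.legs γ →
              Γ.legScale F (Q ++ [γ]) r R h = Γ.legScale F Q r R h := by
            intro h hl
            have : Γ.IsDead F (Q ++ [γ]) h ↔ Γ.IsDead F Q h := by rw [hdead]; tauto
            rw [legScale, legScale]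
            by_cases hd : Γ.IsDead F Q h
            · rw [if_pos hd, if_pos (this.2 hd)]
            · rw [if_neg hd, if_neg fun h' => hd (this.1 h')]
          have hstep : step Φ γ = fun y => -(fun y => Φ (freeze (Γ.legs γ ×ˢ Finset.univ)
              (fun a => z (Γ.firstVertex γ) a.2) y)) y := by
            simp only [step, if_pos hγF]
            funext y
            simp only [Pi.neg_apply, contract, moveLegs_eq_freeze]
          have hmaps : ∀ y ∈ boxRegion ρ κ z (fun h => if h ∈ Γ.legs γ then Set.univ else U h)
              (Γ.legScale F (Q ++ [γ]) r R), freeze (Γ.legs γ ×ˢ Finset.univ)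
                (fun a => z (Γ.firstVertex γ) a.2) y ∈ boxRegion ρ κ z U (Γ.legScale F Q r R) := by
            intro y hy
            refine freeze_mem_boxRegion hκ (hlegpos Q r R hr hR1)
              (fun h hl => hadm.firstVertex_mem hF hloop hFu hBr hγF hQ hQ' hl) fun h hl => ?_
            obtain ⟨u, hu, hui⟩ := hy h
            simp only [hl, if_false] at hu
            rw [hout h hl] at hui
            exact ⟨u, hu, hui⟩
          rw [hstep]
          refine ⟨((hR R hR1).1.comp_freeze hmaps).neg, DerivBound.neg ?_⟩
          have hs' := coordScale_pos (ρ := ρ) (d := d) (hlegpos (Q ++ [γ]) r R hr hR1)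
          have := DerivBound.comp_freeze (p := fun a => z (Γ.firstVertex γ) a.2) hs' hBnn
            (L := Γ.legs γ ×ˢ Finset.univ) (fun a ha => ?_) hmaps (hR R hR1).2
          · refine (this.mono_order (by omega)).mono_bound hs' ?_
            simp only [G, if_pos hγF, mul_one]
            refine mul_le_mul_of_nonneg_right (pow_le_pow_right₀ hA1 (Nat.le_succ _)) ?_
            have := hprodnn Q
            have : 0 ≤ M := by linarith
            positivity
          · have : a.1 ∉ Γ.legs γ := by simpa using ha
            rw [coordScale, coordScale, hout _ this]
      · have hγu : γ ∈ Fu := (Finset.mem_union.1 hγmem).resolve_left hγF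
        have hun := hFu γ hγu
        have hγne : γ ≠ Finset.univ := (mem_divergent.1 (hFudiv γ hγu)).1
        have hγdeg : Γ.subdegree ρ d γ ≤ 0 := (mem_divergent.1 (hFudiv γ hγu)).2.2
        have hdead : ∀ h, Γ.IsDead F (Q ++ [γ]) h ↔ Γ.IsDead F Q h := by
          intro h
          simp only [IsDead, List.mem_append, List.mem_singleton]
          constructor
          · rintro ⟨c, hc | rfl, h1, h2⟩
            · exact ⟨c, hc, h1, h2⟩
            · exact absurd h1 hγF
          · rintro ⟨c, hc, h1, h2⟩
            exact ⟨c, Or.inl hc, h1, h2⟩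
        set I := Γ.lowerNode T F γ with hI
        set J := Γ.upperNode T F γ with hJ
        obtain ⟨hJmem, hIJ, -, -⟩ := hun.upperNode_spec hF hloop hconn hγne
        have hImem : I ∈ T.inner := lowerNode_mem hun.block hF
        set g₁ : ℝ := radius n I / radius n J with hg₁
        have hg0 : 0 < g₁ := div_pos (radius_pos _ _) (radius_pos _ _)
        have hg1 : g₁ ≤ 1 := by
          rw [hg₁, div_le_one (radius_pos _ _)]
          exact radius_mono n hImem hJmem hIJ.1
        let act : E × Bool → Prop := fun h => h ∈ Γ.legs γ ∧ ¬ Γ.IsDead F Q h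
        set U' : E × Bool → Set V := fun h => if act h then (I : Set V) else U h with hU'
        set r' : E × Bool → ℝ := fun h => if act h then radius n I else r h with hr'
        have hr'pos : ∀ h, 0 < r' h := fun h => by
          simp only [hr']; split_ifs
          · exact radius_pos _ _
          · exact hr h
        have halive : ∀ h, act h → (I : Set V) ⊆ U h ∧ radius n J ≤ r h := fun h hh =>
          hadm.alive hF hloop hconn hFu hBr hγu hγne hQ hQ' hh.1 hh.2
        refine ⟨U', r', fun h => ⟨fun hdd => ?_, fun hdd => ?_⟩, hr'pos, fun R hR1 => ?_⟩
        · rw [hdead] at hdd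
          have : ¬ act h := fun h' => h'.2 hdd
          simp only [hU', this, if_false]
          exact (hadm h).1 hdd
        · rw [hdead] at hdd
          by_cases hact : act h
          · refine Or.inr ⟨γ, by simp, hγu, hact.1, ?_, ?_⟩
            · simp only [hU', hact, if_true, hI]
            · simp only [hr', hact, if_true, hI]
          · simp only [hU', hr', hact, if_false]
            rcases (hadm h).2 hdd with h1 | ⟨γ', h1, h2⟩
            · exact Or.inl h1
            · exact Or.inr ⟨γ', by simp [h1], h2⟩
        -- The previous bounds are used with dead legs of `γ` at scale `R / g₁`, so that these too
        -- shrink by the factor `g₁` and do not spoil the gain.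
        · set R₀ : E × Bool → ℝ := fun h => if h ∈ Γ.legs γ then R h / g₁ else R h with hR₀
          have hR₀1 : ∀ h, 1 ≤ R₀ h := fun h => by
            simp only [hR₀]; split_ifs
            · rw [le_div_iff₀ hg0]; linarith [hR1 h]
            · exact hR1 h
          obtain ⟨hsm, hbd⟩ := hR R₀ hR₀1
          have hrp := hlegpos Q r R₀ hr hR₀1
          have hrp' := hlegpos (Q ++ [γ]) r' R hr'pos hR1
          have hnew : ∀ h, Γ.legScale F (Q ++ [γ]) r' R h =
              if Γ.IsDead F Q h then R h else r' h := by
            intro h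
            rw [legScale]
            by_cases hdd : Γ.IsDead F Q h
            · rw [if_pos ((hdead h).2 hdd), if_pos hdd]
            · rw [if_neg fun h' => hdd ((hdead h).1 h'), if_neg hdd]
          have hout : ∀ h, h ∉ Γ.legs γ → Γ.legScale F (Q ++ [γ]) r' R h =
              Γ.legScale F Q r R₀ h ∧ U' h = U h := by
            intro h hl
            have : ¬ act h := fun h' => hl h'.1
            refine ⟨?_, by simp only [hU', this, if_false]⟩
            rw [hnew, legScale]
            simp only [hr', this, if_false, hR₀, hl]
          have hrg : ∀ h ∈ Γ.legs γ, Γ.legScale F (Q ++ [γ]) r' R h ≤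
              g₁ * Γ.legScale F Q r R₀ h := by
            intro h hl
            rw [hnew, legScale]
            by_cases hdd : Γ.IsDead F Q h
            · rw [if_pos hdd, if_pos hdd]
              simp only [hR₀, hl, if_true]
              rw [mul_div_cancel₀ _ hg0.ne']
            · rw [if_neg hdd, if_neg hdd]
              have hact : act h := ⟨hl, hdd⟩
              simp only [hr', hact, if_true]
              calc radius n I = g₁ * radius n J := by
                    rw [hg₁, div_mul_cancel₀ _ (radius_pos _ _).ne']
                _ ≤ g₁ * r h := mul_le_mul_of_nonneg_left (halive h hact).2 hg0.le
          have hUU : ∀ h ∈ Γ.legs γ, U' h ⊆ U h := by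
            intro h hl
            by_cases hact : act h
            · simp only [hU', hact, if_true]; exact (halive h hact).1
            · simp only [hU', hact, if_false]; exact subset_rfl
          have hvI : Γ.firstVertex γ ∈ I := quot_subset_lowerNode (firstVertex_mem_quot hun.block hF)
          have hv : ∀ h ∈ Γ.legs γ, Γ.firstVertex γ ∈ U h := by
            intro h hl
            by_cases hdd : Γ.IsDead F Q h
            · rw [(hadm h).1 hdd]; trivial
            · exact (halive h ⟨hl, hdd⟩).1 hvI
          -- For a live leg both vertices lie in the node `I`. For a dead one any vertex is allowed,
          -- and `R ≥ 1` exceeds all the radii.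
          have hclose : ∀ h ∈ Γ.legs γ, ∀ u ∈ U' h, ∀ i, |z u i - z (Γ.firstVertex γ) i| ≤
              (C * Γ.legScale F (Q ++ [γ]) r' R h) ^ scaling ρ d i := by
            intro h hl u hu i
            refine IsComparable_close hρ0 hC hz (hrp' h) (fun _ => ?_) i
            rw [hnew]
            by_cases hdd : Γ.IsDead F Q h
            · rw [if_pos hdd]
              exact (radius_le_one _ _).trans (hR1 h)
            · rw [if_neg hdd]
              have hact : act h := ⟨hl, hdd⟩
              simp only [hU', hact, if_true] at hu
              simp only [hr', hact, if_true]
              exact radius_mono n lca_mem hImem (lca_subset hImem hu hvI)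
          have hπ : ∀ y ∈ boxRegion ρ κ z U' (Γ.legScale F (Q ++ [γ]) r' R),
              freeze (Γ.legs γ ×ˢ Finset.univ) (fun a => z (Γ.firstVertex γ) a.2) y ∈
                boxRegion ρ κ z U (Γ.legScale F Q r R₀) := by
            intro y hy
            refine freeze_mem_boxRegion hκ hrp hv fun h hl => ?_
            obtain ⟨u, hu, hui⟩ := hy h
            rw [(hout h hl).1] at hui
            exact ⟨u, (hout h hl).2 ▸ hu, hui⟩
          have hDD : boxRegion ρ κ z U' (Γ.legScale F (Q ++ [γ]) r' R) ⊆
              boxRegion ρ κ z U (Γ.legScale F Q r R₀) := by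
            refine boxRegion_subset hρ0 hκ hrp' (fun h => ?_) (fun h => ?_)
            · by_cases hl : h ∈ Γ.legs γ
              · refine (hrg h hl).trans ?_
                have := hrp h
                nlinarith
              · exact (hout h hl).1.le
            · by_cases hl : h ∈ Γ.legs γ
              · exact hUU h hl
              · exact (hout h hl).2.subset
          have hstep : step Φ γ = Φ - Γ.taylorContract ρ z γ Φ := if_neg hγF
          rw [hstep, sub_taylorContract_eq hρ0 hρ2 hγdeg (hdeg γ hγu)]
          refine ⟨contDiffOn_taylorRem (isOpen_boxRegion _ _ _) hDD hπ hsm, ?_⟩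
          have key := hA (E × Bool) V (by rw [Fintype.card_prod, Fintype.card_bool]; omega) z U U'
            (Γ.legScale F Q r R₀) (Γ.legScale F (Q ++ [γ]) r' R) (Γ.legs γ) (Γ.firstVertex γ) g₁
            (Γ.hasLinearTerms ρ d γ) hg0 hg1 hrp' hrp hout hrg hUU hv hclose
            (fun h => by
              simp only [hasLinearTerms, decide_eq_true_eq] at h
              linarith [hdeg γ hγu]) (2 * (N - (Q.length + 1))) (by omega) _ hBnn Φ hsm
            (hbd.mono_order (by omega))
          refine key.mono_bound (coordScale_pos hrp') (le_of_eq ?_)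
          simp only [G, if_neg hγF, gain, gainExponent]
          rw [pow_succ]
          ring
  set l := (F ∪ Fu).toList.insertionSort (fun γ γ' => γ'.card ≤ γ.card) with hl
  have hperm : l.Perm (F ∪ Fu).toList := List.perm_insertionSort _ _
  have hmeml : ∀ γ, γ ∈ l ↔ γ ∈ F ∪ Fu := fun γ => by rw [hperm.mem_iff, Finset.mem_toList]
  have hproc : IsProcessed F Fu l := by
    refine ⟨hperm.nodup_iff.2 (Finset.nodup_toList _), ?_, fun q hq => (hmeml q).1 hq,
      fun q _ f hf _ => (hmeml f).2 hf⟩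
    have : Std.Total (fun γ γ' : Finset E => γ'.card ≤ γ.card) :=
      ⟨fun a b => le_total _ _⟩
    have : IsTrans (Finset E) (fun γ γ' : Finset E => γ'.card ≤ γ.card) :=
      ⟨fun a b c h1 h2 => le_trans h2 h1⟩
    exact List.pairwise_insertionSort _ _
  have hlen : l.length ≤ N := by
    rw [hperm.length_eq, Finset.length_toList]
    refine (Finset.card_le_univ _).trans ?_
    rw [Fintype.card_finset]
    exact Nat.pow_le_pow_right (by norm_num) hm
  obtain ⟨U, r, hadm, hr, hR⟩ := main l hproc hlen
  have hbd := (hR (fun _ => 1) (fun _ => le_rfl)).2.bound (fun a => z (Γ.attach a.1) a.2) (by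
    intro h
    refine ⟨Γ.attach h, hadm.attach_mem hF hloop hFu hBr
      (fun f hf => (hmeml f).2 (Finset.mem_union_left _ hf)) h, fun i => ?_⟩
    have : 0 < Γ.legScale F l r (fun _ => 1) h := by
      rw [legScale]; split_ifs
      · exact one_pos
      · exact hr h
    rw [sub_self, abs_zero]
    positivity)
  have hprod : (l.map G).prod = ∏ γ ∈ Fu, Γ.gain ρ d n F γ := by
    rw [(hperm.map G).prod_eq, Finset.prod_map_toList]
    have hdis : Disjoint F Fu := Finset.disjoint_left.2 fun γ h1 h2 => (hFu γ h2).notMem h1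
    rw [Finset.prod_union hdis, Finset.prod_eq_one fun γ hγ => if_pos hγ, one_mul]
    exact Finset.prod_congr rfl fun γ hγ => if_neg (hFu γ hγ).notMem
  rw [hprod] at hbd
  refine hbd.trans ?_
  have h1 : 0 ≤ ∏ γ ∈ Fu, Γ.gain ρ d n F γ := Finset.prod_nonneg fun γ _ => gain_nonneg _ _
  have h2 : A ^ l.length ≤ A ^ N := pow_le_pow_right₀ hA1 hlen
  have h3 : 0 ≤ M * b * ∏ γ ∈ Fu, Γ.gain ρ d n F γ := by
    have : 0 ≤ M := by linarith
    positivity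
  calc A ^ l.length * (M * b * ∏ γ ∈ Fu, Γ.gain ρ d n F γ)
      ≤ A ^ N * (M * b * ∏ γ ∈ Fu, Γ.gain ρ d n F γ) := mul_le_mul_of_nonneg_right h2 h3
    _ = A ^ N * M * (b * ∏ γ ∈ Fu, Γ.gain ρ d n F γ) := by ring

end FeynmanDiagram

end
noncomputable section

/-! ### Children in a forest and local decompositions -/

namespace FeynmanDiagram

open HeppTree

variable {V E : Type} [Fintype V] [LinearOrder V] [Fintype E] [DecidableEq E]
  {Γ : FeynmanDiagram V E} {F : Finset (Finset E)} {c f g γ : Finset E} {d : ℕ} {ρ : ℝ}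

/-- The maximal elements of `F` strictly contained in `c`. -/
def childrenIn (F : Finset (Finset E)) (c : Finset E) : Finset (Finset E) :=
  F.filter fun f => f ⊂ c ∧ ∀ g ∈ F, g ⊂ c → ¬ f ⊂ g

theorem mem_childrenIn : f ∈ childrenIn F c ↔ f ∈ F ∧ f ⊂ c ∧ ∀ g ∈ F, g ⊂ c → ¬ f ⊂ g := by
  simp [childrenIn]

theorem exists_mem_childrenIn (hf : f ∈ F) (hfc : f ⊂ c) : ∃ g ∈ childrenIn F c, f ⊆ g := by
  obtain ⟨g, hg, hmax⟩ := Finset.exists_max_image (F.filter fun g => f ⊆ g ∧ g ⊂ c) Finset.card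
    ⟨f, Finset.mem_filter.2 ⟨hf, subset_rfl, hfc⟩⟩
  obtain ⟨hg1, hg2, hg3⟩ := Finset.mem_filter.1 hg
  refine ⟨g, mem_childrenIn.2 ⟨hg1, hg3, fun g' hg' hg'c hlt => ?_⟩, hg2⟩
  have := hmax g' (Finset.mem_filter.2 ⟨hg', hg2.trans hlt.1, hg'c⟩)
  exact absurd (Finset.card_lt_card hlt) (not_lt.2 this)

theorem IsLaminar.disjoint_childrenIn (hF : Γ.IsLaminar F) (hf : f ∈ childrenIn F c)
    (hg : g ∈ childrenIn F c) (hne : f ≠ g) : Disjoint (Γ.vertices f) (Γ.vertices g) := by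
  obtain ⟨hf1, hf2, hf3⟩ := mem_childrenIn.1 hf
  obtain ⟨hg1, hg2, hg3⟩ := mem_childrenIn.1 hg
  rcases hF.compatible g hg1 f hf1 with h | h | h
  · exact absurd (Finset.ssubset_iff_subset_ne.2 ⟨h, hne⟩) (hf3 g hg1 hg2)
  · exact absurd (Finset.ssubset_iff_subset_ne.2 ⟨h, hne.symm⟩) (hg3 f hf1 hf2)
  · exact h

theorem IsLaminar.disjoint_edges (hdis : Disjoint (Γ.vertices f) (Γ.vertices g)) :
    Disjoint f g := Finset.disjoint_left.2 fun e h1 h2 =>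
  Finset.disjoint_left.1 hdis (src_mem_vertices h1) (src_mem_vertices h2)

theorem IsLaminar.sum_edges (hF : Γ.IsLaminar F) (c : Finset E) (w : E → ℝ) :
    ∑ e ∈ c, w e = ∑ e ∈ ownEdges F c, w e + ∑ f ∈ childrenIn F c, ∑ e ∈ f, w e := by
  classical
  rw [← Finset.sum_biUnion fun f hf g hg hne =>
    disjoint_edges (hF.disjoint_childrenIn hf hg hne), ← Finset.sum_union]
  · refine Finset.sum_congr ?_ fun _ _ => rfl
    ext e
    rw [Finset.mem_union, Finset.mem_biUnion, mem_ownEdges]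
    constructor
    · intro he
      by_cases h : ∀ f ∈ F, f ⊂ c → e ∉ f
      · exact Or.inl ⟨he, h⟩
      · push Not at h
        obtain ⟨f, hf, hfc, hef⟩ := h
        obtain ⟨g, hg, hfg⟩ := exists_mem_childrenIn hf hfc
        exact Or.inr ⟨g, hg, hfg hef⟩
    · rintro (h | ⟨f, hf, hef⟩)
      · exact h.1
      · exact (mem_childrenIn.1 hf).2.1.1 hef
  · refine Finset.disjoint_left.2 fun e he h => ?_
    obtain ⟨f, hf, hef⟩ := Finset.mem_biUnion.1 h
    obtain ⟨hf1, hf2, -⟩ := mem_childrenIn.1 hf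
    exact (mem_ownEdges.1 he).2 f hf1 hf2 hef

/-- A vertex of `c` is either a vertex of the quotient or a vertex, other than the first one, of
exactly one child. -/
theorem IsLaminar.sum_vertices (hF : Γ.IsLaminar F) (c : Finset E) (w : V → ℝ) :
    ∑ v ∈ Γ.vertices c, w v = ∑ v ∈ Γ.quot F c, w v +
      ∑ f ∈ childrenIn F c, (∑ v ∈ Γ.vertices f, w v - w (Γ.firstVertex f)) := by
  classical
  have h1 : ∀ f ∈ childrenIn F c, ∑ v ∈ Γ.vertices f, w v - w (Γ.firstVertex f) =
      ∑ v ∈ (Γ.vertices f).erase (Γ.firstVertex f), w v := fun f hf => by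
    rw [← Finset.sum_erase_add _ _ (hF.block f (mem_childrenIn.1 hf).1).firstVertex_mem]
    ring
  rw [Finset.sum_congr rfl h1, ← Finset.sum_biUnion fun f hf g hg hne => ?_, ← Finset.sum_union]
  · refine Finset.sum_congr ?_ fun _ _ => rfl
    ext v
    rw [Finset.mem_union, Finset.mem_biUnion]
    constructor
    · intro hv
      by_cases h : v ∈ Γ.quot F c
      · exact Or.inl h
      · rw [mem_quot] at h
        push Not at h
        obtain ⟨f, hf, hfc, hvf, hne⟩ := h hv
        obtain ⟨g, hg, hfg⟩ := exists_mem_childrenIn hf hfc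
        refine Or.inr ⟨g, hg, Finset.mem_erase.2 ⟨fun e => hne ?_, vertices_mono hfg hvf⟩⟩
        rw [e] at hvf ⊢
        exact firstVertex_eq (hF.block f hf) hfg hvf
    · rintro (h | ⟨f, hf, hvf⟩)
      · exact quot_subset h
      · exact vertices_mono (mem_childrenIn.1 hf).2.1.1 (Finset.mem_of_mem_erase hvf)
  · refine Finset.disjoint_left.2 fun v hv h => ?_
    obtain ⟨f, hf, hvf⟩ := Finset.mem_biUnion.1 h
    obtain ⟨hf1, hf2, -⟩ := mem_childrenIn.1 hf
    rw [Finset.mem_erase] at hvf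
    exact hvf.1 ((mem_quot.1 hv).2 f hf1 hf2 hvf.2)
  · exact (hF.disjoint_childrenIn hf hg hne).mono (Finset.erase_subset _ _)
      (Finset.erase_subset _ _)

/-- Degrees are additive under contraction: shrinking a child `f` to a point removes `|V_f| - 1`
vertices and `|f|` edges. -/
theorem IsLaminar.subdegree_decomposition (hF : Γ.IsLaminar F) (c : Finset E) :
    Γ.subdegree ρ d c = (ρ + d) * ((Γ.quot F c).card - 1) - d * (ownEdges F c).card +
      ∑ f ∈ childrenIn F c, Γ.subdegree ρ d f := by
  have h1 := hF.sum_edges c (fun _ => 1)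
  have h2 := hF.sum_vertices c (fun _ => 1)
  simp only [Finset.sum_const, nsmul_eq_mul, mul_one] at h1 h2
  have h3 : ∑ f ∈ childrenIn F c, Γ.subdegree ρ d f =
      (ρ + d) * ∑ f ∈ childrenIn F c, (((Γ.vertices f).card : ℝ) - 1) -
        d * ∑ f ∈ childrenIn F c, (f.card : ℝ) := by
    rw [Finset.mul_sum, Finset.mul_sum, ← Finset.sum_sub_distrib]
    exact Finset.sum_congr rfl fun f _ => subdegree_eq ρ d
  rw [h3, subdegree_eq, h1, h2]
  ring

theorem exists_parent (hu : Finset.univ ∉ F) (hf : f ∈ F) :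
    ∃ c ∈ insert Finset.univ F, f ∈ childrenIn F c := by
  obtain ⟨c, hc, hmin⟩ := Finset.exists_min_image
    ((insert Finset.univ F).filter fun g => f ⊂ g) Finset.card
    ⟨Finset.univ, Finset.mem_filter.2 ⟨Finset.mem_insert_self _ _,
      Finset.ssubset_univ_iff.2 fun e => hu (e ▸ hf)⟩⟩
  obtain ⟨hc1, hc2⟩ := Finset.mem_filter.1 hc
  refine ⟨c, hc1, mem_childrenIn.2 ⟨hf, hc2, fun g hg hgc hfg => ?_⟩⟩
  have := hmin g (Finset.mem_filter.2 ⟨Finset.mem_insert_of_mem hg, hfg⟩)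
  exact absurd (Finset.card_lt_card hgc) (not_lt.2 this)

/-- A subgraph has at most one immediate successor in `F ∪ {univ}`. -/
theorem IsLaminar.successor_unique (hF : Γ.IsLaminar F) (hu : Finset.univ ∉ F)
    (hf : (Γ.vertices f).Nonempty) {c c' : Finset E} (hc : c ∈ insert Finset.univ F)
    (hc' : c' ∈ insert Finset.univ F) (hfc : f ⊂ c) (hfc' : f ⊂ c')
    (h : ∀ g ∈ F, g ⊂ c → ¬ f ⊂ g) (h' : ∀ g ∈ F, g ⊂ c' → ¬ f ⊂ g) : c = c' := by
  have key : ∀ {c c' : Finset E}, c ∈ insert Finset.univ F → c' ∈ insert Finset.univ F →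
      f ⊂ c → f ⊂ c' → (∀ g ∈ F, g ⊂ c → ¬ f ⊂ g) → c ⊆ c' := by
    intro c c' hc hc' h1 h1' h2
    rcases Finset.mem_insert.1 hc' with rfl | hc'
    · exact Finset.subset_univ _
    have h4 : ¬ c' ⊂ c := fun h => h2 c' hc' h h1'
    rcases Finset.mem_insert.1 hc with rfl | hc
    · exact absurd (Finset.ssubset_univ_iff.2 fun e => hu (e ▸ hc')) h4
    · rcases hF.compatible c' hc' c hc with h | h | h
      · exact h
      · by_contra hn
        exact h4 ⟨h, hn⟩
      · obtain ⟨x, hx⟩ := hf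
        exact absurd (vertices_mono h1'.1 hx)
          (Finset.disjoint_left.1 h (vertices_mono h1.1 hx))
  exact Finset.Subset.antisymm (key hc hc' hfc hfc' h) (key hc' hc hfc' hfc h')

/-- Each element of `F` is the child of exactly one element of `F ∪ {univ}`. -/
theorem IsLaminar.sum_childrenIn (hF : Γ.IsLaminar F) (hu : Finset.univ ∉ F)
    (Y : Finset E → ℝ) :
    ∑ c ∈ insert Finset.univ F, ∑ f ∈ childrenIn F c, Y f = ∑ f ∈ F, Y f := by
  classical
  rw [← Finset.sum_biUnion]
  · refine Finset.sum_congr ?_ fun _ _ => rfl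
    ext f
    rw [Finset.mem_biUnion]
    constructor
    · rintro ⟨c, _, h⟩
      exact (mem_childrenIn.1 h).1
    · exact exists_parent hu
  · intro c hc c' hc' hne
    refine Finset.disjoint_left.2 fun f hf hf' => hne ?_
    obtain ⟨hf1, hf2, hf3⟩ := mem_childrenIn.1 hf
    obtain ⟨-, hf2', hf3'⟩ := mem_childrenIn.1 hf'
    exact hF.successor_unique hu (hF.block f hf1).vertices_nonempty hc hc' hf2 hf2' hf3 hf3'

theorem IsLaminar.rep_child (hF : Γ.IsLaminar F) (hf : f ∈ childrenIn F c) {v : V}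
    (hv : v ∈ Γ.vertices f) : Γ.rep F c v = Γ.firstVertex f := by
  obtain ⟨h1, h2, h3⟩ := mem_childrenIn.1 hf
  exact hF.rep_eq_firstVertex h1 h2 h3 hv

theorem IsLaminar.firstVertex_child_mem (hF : Γ.IsLaminar F) (hf : f ∈ childrenIn F c) :
    Γ.firstVertex f ∈ Γ.quot F c := by
  obtain ⟨h1, h2, h3⟩ := mem_childrenIn.1 hf
  have hv := (hF.block f h1).firstVertex_mem
  rw [← hF.rep_child hf hv]
  exact hF.rep_mem_quot (vertices_mono h2.1 hv)

theorem IsLaminar.rep_fiber (hF : Γ.IsLaminar F) {x y : V} (h : Γ.rep F c x = Γ.rep F c y) :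
    x = y ∨ ∃ m ∈ F, m ⊂ c ∧ x ∈ Γ.vertices m ∧ y ∈ Γ.vertices m := by
  rcases hF.rep_cases c x with ⟨h1, h2⟩ | ⟨m, hm, hmc, hum, h2, h3⟩ <;>
  rcases hF.rep_cases c y with ⟨h1', h2'⟩ | ⟨m', hm', hmc', hum', h2', h3'⟩
  · left; rw [← h2, h, h2']
  · rw [h2, h2'] at h
    exact absurd (h ▸ (hF.block m' hm').firstVertex_mem) (h1 m' hm' hmc')
  · rw [h2, h2'] at h
    exact absurd (h ▸ (hF.block m hm).firstVertex_mem) (h1' m hm hmc)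
  · rw [h2, h2'] at h
    right
    have e1 := (hF.block m hm).firstVertex_mem
    have e2 := (hF.block m' hm').firstVertex_mem
    rcases hF.compatible m hm m' hm' with h' | h' | h'
    · exact ⟨m, hm, hmc, hum, vertices_mono h' hum'⟩
    · exact ⟨m', hm', hmc', vertices_mono h' hum, hum'⟩
    · exact absurd (h ▸ e1) (Finset.disjoint_left.1 h' e2)

/-! ### Subgraphs induced by connected sets of quotient vertices -/

/-- The edges of `c` whose two ends are represented in `S`. -/
def subBlock (Γ : FeynmanDiagram V E) (F : Finset (Finset E)) (c : Finset E) (S : Finset V) :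
    Finset E :=
  c.filter fun e => Γ.rep F c (Γ.src e) ∈ S ∧ Γ.rep F c (Γ.tgt e) ∈ S

theorem mem_subBlock {S : Finset V} {e : E} : e ∈ Γ.subBlock F c S ↔
    e ∈ c ∧ ∀ b, Γ.rep F c (Γ.attach (e, b)) ∈ S := by
  simp [subBlock, attach]

/-- `S` is a connected set of vertices of the quotient of `c`, with at least two elements. -/
structure IsQuotConnected (Γ : FeynmanDiagram V E) (F : Finset (Finset E)) (c : Finset E)
    (S : Finset V) : Prop where
  subset : S ⊆ Γ.quot F c
  card : 1 < S.card
  crossing : ∀ S₁ ⊂ S, S₁.Nonempty → ∃ e ∈ ownEdges F c, ∃ b,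
    Γ.contractedAttach F (e, b) ∈ S₁ ∧ Γ.contractedAttach F (e, !b) ∈ S \ S₁

section SubBlock

variable {S : Finset V} (hF : Γ.IsLaminar F) (hc : Γ.IsBlock c) (hcc : Γ.IsCompatible F c)
  (hS : Γ.IsQuotConnected F c S)

include hF in
theorem subBlock_of_mem {m : Finset E} (hm : m ∈ F) (hmc : m ⊂ c) {x : V} (hx : x ∈ Γ.vertices m)
    (hxS : Γ.rep F c x ∈ S) : m ⊆ Γ.subBlock F c S := fun e he => by
  rw [mem_subBlock]
  refine ⟨hmc.1 he, fun b => ?_⟩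
  rwa [hF.rep_congr hm hmc (attach_mem_vertices he b) hx]

include hF hcc hS in
-- Vertices absorbed by an element of `F` come with that whole element. A vertex representing only
-- itself is the end of an own edge because `S` is connected and has another point.
theorem mem_vertices_subBlock {v : V} :
    v ∈ Γ.vertices (Γ.subBlock F c S) ↔ v ∈ Γ.vertices c ∧ Γ.rep F c v ∈ S := by
  constructor
  · intro hv
    refine ⟨vertices_mono (Finset.filter_subset _ _) hv, ?_⟩
    obtain ⟨e, he, h | h⟩ := mem_vertices.1 hv
    · rw [← h]; exact (mem_subBlock.1 he).2 false
    · rw [← h]; exact (mem_subBlock.1 he).2 true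
  · rintro ⟨hv, hvS⟩
    rcases hF.rep_cases c v with ⟨h1, h2⟩ | ⟨m, hm, hmc, hvm, -, -⟩
    · rw [h2] at hvS
      obtain ⟨e, he, b, h3, h4⟩ := hS.crossing {v} (by
        rw [Finset.ssubset_iff_subset_ne]
        refine ⟨Finset.singleton_subset_iff.2 hvS, fun e => ?_⟩
        have := hS.card
        rw [← e, Finset.card_singleton] at this
        omega) ⟨v, Finset.mem_singleton_self v⟩
      rw [Finset.mem_singleton, contractedAttach_own hcc he] at h3
      rw [contractedAttach_own hcc he] at h4
      have hev : Γ.attach (e, b) = v := by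
        rcases hF.rep_fiber (h3.trans h2.symm) with h | ⟨m, hm, hmc, _, h⟩
        · exact h
        · exact absurd h (h1 m hm hmc)
      rw [← hev]
      refine attach_mem_vertices (mem_subBlock.2 ⟨(mem_ownEdges.1 he).1, fun b' => ?_⟩) b
      by_cases hb : b' = b
      · rw [hb, h3]; exact hvS
      · rw [show b' = !b by cases b <;> cases b' <;> simp_all]
        exact (Finset.mem_sdiff.1 h4).1
    · exact vertices_mono (subBlock_of_mem hF hm hmc hvm hvS) hvm

theorem graph_mono (h : f ⊆ g) : Γ.graph f ≤ Γ.graph g := by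
  intro u v huv
  simp only [graph, SimpleGraph.fromRel_adj] at huv ⊢
  obtain ⟨hne, ⟨e, he, h'⟩ | ⟨e, he, h'⟩⟩ := huv
  · exact ⟨hne, Or.inl ⟨e, h he, h'⟩⟩
  · exact ⟨hne, Or.inr ⟨e, h he, h'⟩⟩

theorem reachable_attach {e : E} (he : e ∈ f) (b : Bool) :
    (Γ.graph f).Reachable (Γ.attach (e, b)) (Γ.attach (e, !b)) := by
  by_cases hne : Γ.attach (e, b) = Γ.attach (e, !b)
  · rw [hne]
  · refine SimpleGraph.Adj.reachable ?_
    simp only [graph, SimpleGraph.fromRel_adj]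
    refine ⟨hne, ?_⟩
    cases b
    · exact Or.inl ⟨e, he, rfl, rfl⟩
    · exact Or.inr ⟨e, he, rfl, rfl⟩

include hF hc hcc hS in
-- Paths in the connected set `S` of the quotient lift to the subgraph: two vertices with the same
-- representative coincide or are joined inside an element of `F`, which is connected and contained
-- in the subgraph.
theorem isBlock_subBlock : Γ.IsBlock (Γ.subBlock F c S) := by
  have hV := fun v => mem_vertices_subBlock (v := v) hF hcc hS
  refine ⟨⟨?_, fun u hu v hv => ?_⟩, fun e h1 h2 => ?_⟩
  · obtain ⟨w, hw⟩ : S.Nonempty := Finset.card_pos.1 (by have := hS.card; omega)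
    have := (hV w).2 ⟨quot_subset (hS.subset hw), by rwa [hF.rep_of_mem_quot (hS.subset hw)]⟩
    obtain ⟨e, he, _⟩ := mem_vertices.1 this
    exact ⟨e, he⟩
  · have hfib : ∀ x y, x ∈ Γ.vertices (Γ.subBlock F c S) → Γ.rep F c x = Γ.rep F c y →
        (Γ.graph (Γ.subBlock F c S)).Reachable x y := by
      intro x y hx hxy
      rcases hF.rep_fiber hxy with rfl | ⟨m, hm, hmc, h1, h2⟩
      · exact SimpleGraph.Reachable.refl _
      · exact ((hF.block m hm).connected.2 x h1 y h2).mono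
          (graph_mono (subBlock_of_mem hF hm hmc h1 ((hV x).1 hx).2))
    classical
    set S₁ : Finset V := S.filter fun w => ∃ x ∈ Γ.vertices (Γ.subBlock F c S),
      Γ.rep F c x = w ∧ (Γ.graph (Γ.subBlock F c S)).Reachable u x with hS₁
    have hS₁S : S₁ = S := by
      by_contra hne
      have hss : S₁ ⊂ S := Finset.ssubset_iff_subset_ne.2 ⟨Finset.filter_subset _ _, hne⟩
      obtain ⟨e, he, b, h1, h2⟩ := hS.crossing S₁ hss ⟨Γ.rep F c u, Finset.mem_filter.2
        ⟨((hV u).1 hu).2, u, hu, rfl, SimpleGraph.Reachable.refl _⟩⟩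
      rw [contractedAttach_own hcc he] at h1 h2
      rw [Finset.mem_sdiff] at h2
      obtain ⟨h1S, x, hx, hxe, hux⟩ := Finset.mem_filter.1 h1
      have heb : e ∈ Γ.subBlock F c S := by
        refine mem_subBlock.2 ⟨(mem_ownEdges.1 he).1, fun b' => ?_⟩
        by_cases hb : b' = b
        · rw [hb]; exact h1S
        · rw [show b' = !b by cases b <;> cases b' <;> simp_all]
          exact h2.1
      refine h2.2 (Finset.mem_filter.2 ⟨h2.1, _, attach_mem_vertices heb _, rfl, ?_⟩)
      exact (hux.trans (hfib x _ hx hxe)).trans (reachable_attach heb b)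
    have hvS := ((hV v).1 hv).2
    rw [← hS₁S] at hvS
    obtain ⟨_, x, hx, hxv, hux⟩ := Finset.mem_filter.1 hvS
    exact hux.trans (hfib x v hx hxv)
  · rw [hV] at h1 h2
    rw [mem_subBlock]
    refine ⟨hc.full e h1.1 h2.1, fun b => ?_⟩
    cases b
    · exact h1.2
    · exact h2.2

include hF hc hcc hS in
theorem isCompatible_subBlock : Γ.IsCompatible F (Γ.subBlock F c S) := by
  intro g hg
  have hsub : Γ.subBlock F c S ⊆ c := Finset.filter_subset _ _
  rcases hcc g hg with h | h | h
  · by_cases hgc : g = c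
    · exact Or.inr (Or.inl (hgc ▸ hsub))
    · have hss := Finset.ssubset_iff_subset_ne.2 ⟨h, hgc⟩
      by_cases hw : Γ.rep F c (Γ.firstVertex g) ∈ S
      · exact Or.inl (subBlock_of_mem hF hg hss (hF.block g hg).firstVertex_mem hw)
      · refine Or.inr (Or.inr (Finset.disjoint_left.2 fun v hv hv' => hw ?_))
        rw [hF.rep_congr hg hss (hF.block g hg).firstVertex_mem hv]
        exact ((mem_vertices_subBlock hF hcc hS).1 hv').2
  · exact Or.inr (Or.inl (hsub.trans h))
  · exact Or.inr (Or.inr (h.mono_right (vertices_mono hsub)))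

include hF hcc hS in
theorem not_subset_of_subBlock {m : Finset E} (hm : m ∈ F) (hmc : m ⊂ c) :
    ¬ Γ.subBlock F c S ⊆ m := by
  intro h
  obtain ⟨u, hu, v, hv, hne⟩ := Finset.one_lt_card.1 hS.card
  have hmem : ∀ w ∈ S, w ∈ Γ.vertices m := fun w hw => vertices_mono h
    ((mem_vertices_subBlock hF hcc hS).2 ⟨quot_subset (hS.subset hw), by
      rwa [hF.rep_of_mem_quot (hS.subset hw)]⟩)
  have := hF.rep_congr hm hmc (hmem u hu) (hmem v hv)
  rw [hF.rep_of_mem_quot (hS.subset hu), hF.rep_of_mem_quot (hS.subset hv)] at this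
  exact hne this

include hF hcc hS in
theorem subBlock_ssubset (hne : ¬ Γ.quot F c ⊆ S) : Γ.subBlock F c S ⊂ c := by
  refine Finset.ssubset_iff_subset_ne.2 ⟨Finset.filter_subset _ _, fun h => ?_⟩
  obtain ⟨w, hw, hwS⟩ := Finset.not_subset.1 hne
  have : w ∈ Γ.vertices (Γ.subBlock F c S) := h.symm ▸ quot_subset hw
  have := ((mem_vertices_subBlock hF hcc hS).1 this).2
  rw [hF.rep_of_mem_quot hw] at this
  exact hwS this

include hF hcc hS in
theorem ssubset_subBlock_iff (hne : ¬ Γ.quot F c ⊆ S) {m : Finset E} (hm : m ∈ F) :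
    m ⊂ Γ.subBlock F c S ↔ m ⊂ c ∧ ∃ x ∈ Γ.vertices m, Γ.rep F c x ∈ S := by
  have hss := subBlock_ssubset hF hcc hS hne
  constructor
  · intro h
    obtain ⟨x, hx⟩ := (hF.block m hm).vertices_nonempty
    exact ⟨h.trans hss, x, hx, ((mem_vertices_subBlock hF hcc hS).1 (vertices_mono h.1 hx)).2⟩
  · rintro ⟨hmc, x, hx, hxS⟩
    exact ⟨subBlock_of_mem hF hm hmc hx hxS, not_subset_of_subBlock hF hcc hS hm hmc⟩

include hF hcc hS in
theorem rep_subBlock (hne : ¬ Γ.quot F c ⊆ S) {v : V} (hv : v ∈ Γ.vertices (Γ.subBlock F c S)) :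
    Γ.rep F (Γ.subBlock F c S) v = Γ.rep F c v := by
  unfold rep
  have hvS := ((mem_vertices_subBlock hF hcc hS).1 hv).2
  have : ∀ f ∈ F, (f ⊂ Γ.subBlock F c S ∧ v ∈ Γ.vertices f) ↔ (f ⊂ c ∧ v ∈ Γ.vertices f) := by
    intro f hf
    rw [ssubset_subBlock_iff hF hcc hS hne hf]
    exact ⟨fun h => ⟨h.1.1, h.2⟩, fun h => ⟨⟨h.1, v, h.2, hvS⟩, h.2⟩⟩
  rw [Finset.filter_congr this]

include hF hcc hS in
theorem quot_subBlock (hne : ¬ Γ.quot F c ⊆ S) : Γ.quot F (Γ.subBlock F c S) = S := by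
  ext v
  have hiff : ∀ c, v ∈ Γ.quot F c ↔ v ∈ Γ.vertices c ∧ Γ.rep F c v = v := fun c =>
    ⟨fun h => ⟨quot_subset h, hF.rep_of_mem_quot h⟩, fun h => h.2 ▸ hF.rep_mem_quot h.1⟩
  rw [hiff]
  constructor
  · rintro ⟨h1, h2⟩
    rw [rep_subBlock hF hcc hS hne h1] at h2
    have := ((mem_vertices_subBlock hF hcc hS).1 h1).2
    rwa [h2] at this
  · intro hv
    have hq := (hiff c).1 (hS.subset hv)
    have h1 : v ∈ Γ.vertices (Γ.subBlock F c S) :=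
      (mem_vertices_subBlock hF hcc hS).2 ⟨hq.1, by rwa [hq.2]⟩
    exact ⟨h1, by rw [rep_subBlock hF hcc hS hne h1, hq.2]⟩

include hF hcc hS in
theorem mem_ownEdges_subBlock (hne : ¬ Γ.quot F c ⊆ S) {e : E} :
    e ∈ ownEdges F (Γ.subBlock F c S) ↔
      e ∈ ownEdges F c ∧ ∀ b, Γ.contractedAttach F (e, b) ∈ S := by
  constructor
  · intro h
    obtain ⟨h1, h2⟩ := mem_ownEdges.1 h
    obtain ⟨h3, h4⟩ := mem_subBlock.1 h1
    have hown : e ∈ ownEdges F c := mem_ownEdges.2 ⟨h3, fun f hf hfc hef =>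
      h2 f hf ((ssubset_subBlock_iff hF hcc hS hne hf).2
        ⟨hfc, _, attach_mem_vertices hef false, h4 false⟩) hef⟩
    exact ⟨hown, fun b => by rw [contractedAttach_own hcc hown]; exact h4 b⟩
  · rintro ⟨h1, h2⟩
    obtain ⟨h3, h4⟩ := mem_ownEdges.1 h1
    refine mem_ownEdges.2 ⟨mem_subBlock.2 ⟨h3, fun b => ?_⟩, fun f hf hfs =>
      h4 f hf (hfs.trans (subBlock_ssubset hF hcc hS hne))⟩
    rw [← contractedAttach_own hcc h1]; exact h2 b

include hF hcc hS in
theorem mem_childrenIn_subBlock (hne : ¬ Γ.quot F c ⊆ S) :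
    f ∈ childrenIn F (Γ.subBlock F c S) ↔ f ∈ childrenIn F c ∧ Γ.firstVertex f ∈ S := by
  have hiff := fun {m} (hm : m ∈ F) => ssubset_subBlock_iff hF hcc hS hne hm
  rw [mem_childrenIn, mem_childrenIn]
  constructor
  · rintro ⟨hf, hfs, hmax⟩
    obtain ⟨hfc, x, hx, hxS⟩ := (hiff hf).1 hfs
    have hmax' : ∀ g ∈ F, g ⊂ c → ¬ f ⊂ g := fun g hg hgc hfg =>
      hmax g hg ((hiff hg).2 ⟨hgc, x, vertices_mono hfg.1 hx, hxS⟩) hfg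
    refine ⟨⟨hf, hfc, hmax'⟩, ?_⟩
    rwa [← hF.rep_child (mem_childrenIn.2 ⟨hf, hfc, hmax'⟩) hx]
  · rintro ⟨⟨hf, hfc, hmax⟩, hfS⟩
    have hv := (hF.block f hf).firstVertex_mem
    refine ⟨hf, (hiff hf).2 ⟨hfc, _, hv, ?_⟩, fun g hg hgs =>
      hmax g hg (hgs.trans (subBlock_ssubset hF hcc hS hne))⟩
    rwa [hF.rep_child (mem_childrenIn.2 ⟨hf, hfc, hmax⟩) hv]

end SubBlock

end FeynmanDiagram

end
noncomputable section

/-! ### Power counting -/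

namespace FeynmanDiagram

open HeppTree

variable {V E : Type} [Fintype V] [LinearOrder V] [Fintype E] [DecidableEq E]
  {Γ : FeynmanDiagram V E} {F : Finset (Finset E)} {c f g γ : Finset E} {d : ℕ} {ρ θ : ℝ}
  {T : HeppTree V} {A : Finset V}

/-- The hypotheses under which power counting is carried out; `θ` is a lower bound for the nonzero
degrees that occur. -/
structure IsPowerCounting (ρ : ℝ) (d : ℕ) (Γ : FeynmanDiagram V E) (T : HeppTree V)
    (F : Finset (Finset E)) (θ : ℝ) : Prop where
  rho_pos : 0 < ρ
  gap_pos : 0 < θ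
  gap_le : θ ≤ ρ + d
  safe : Γ.IsSafeForest ρ d T F
  loop : ∀ e, Γ.src e ≠ Γ.tgt e
  conn : (Γ.graph Finset.univ).Connected
  nonempty : (Finset.univ : Finset E).Nonempty
  pos : ∀ γ : Finset E, 0 < Γ.subdegree ρ d γ → θ ≤ Γ.subdegree ρ d γ
  neg : ∀ γ : Finset E, Γ.subdegree ρ d γ < 0 → Γ.subdegree ρ d γ ≤ -θ
  gain : ∀ γ ∈ Γ.unsafePart ρ d T F, θ ≤ Γ.gainExponent ρ d γ + Γ.subdegree ρ d γ
  mono : ∀ γ γ', Γ.IsFullDivergent ρ d γ → Γ.IsFullDivergent ρ d γ' → γ ⊂ γ' →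
    Γ.subdegree ρ d γ < Γ.subdegree ρ d γ'

open Classical in
/-- The unsafe subdiagrams that are contained in `c` but in no smaller element of `F`, and whose
gain is effective at the node `A`. -/
def activeIn (ρ : ℝ) (d : ℕ) (Γ : FeynmanDiagram V E) (T : HeppTree V) (F : Finset (Finset E))
    (A : Finset V) (c : Finset E) : Finset (Finset E) :=
  (Γ.unsafePart ρ d T F).filter fun γ => γ ⊂ c ∧ (∀ f ∈ F, f ⊂ c → ¬ γ ⊂ f) ∧
    Γ.lowerNode T F γ ⊆ A ∧ ¬ Γ.upperNode T F γ ⊆ A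

/-- The contribution of a set `S` of vertices of the quotient of `c` to the power counting. -/
def partialCount (ρ : ℝ) (d : ℕ) (Γ : FeynmanDiagram V E) (T : HeppTree V)
    (F : Finset (Finset E)) (A : Finset V) (c : Finset E) (S : Finset V) : ℝ :=
  (ρ + d) * S.card
    - d * ∑ e ∈ ownEdges F c, (if ∀ b, Γ.contractedAttach F (e, b) ∈ S then 1 else 0)
    + ∑ γ ∈ Γ.activeIn ρ d T F A c, (if Γ.quot F γ ⊆ S then Γ.gainExponent ρ d γ else 0)
    + ∑ f ∈ childrenIn F c,
        (if Γ.quot F f ⊆ A ∧ Γ.firstVertex f ∈ S then Γ.subdegree ρ d f else 0)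

namespace IsPowerCounting

variable (h : Γ.IsPowerCounting ρ d T F θ)

include h

theorem isLaminar : Γ.IsLaminar F := h.safe.1.isLaminar

theorem univ_notMem : Finset.univ ∉ F := fun hu =>
  (mem_divergent.1 (h.safe.1.1.1 hu)).1 rfl

theorem block (hc : c ∈ insert Finset.univ F) : Γ.IsBlock c := by
  rcases Finset.mem_insert.1 hc with rfl | hc
  · exact isBlock_univ h.nonempty h.conn
  · exact h.isLaminar.block c hc

theorem compatible (hc : c ∈ insert Finset.univ F) : Γ.IsCompatible F c := by
  rcases Finset.mem_insert.1 hc with rfl | hc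
  · exact fun f _ => Or.inl (Finset.subset_univ _)
  · exact h.isLaminar.compatible c hc

theorem fullDivergent (hf : f ∈ F) : Γ.IsFullDivergent ρ d f := ⟨h.safe.1.1.1 hf, h.safe.1.2 f hf⟩

theorem subdegree_nonpos (hf : f ∈ F) : Γ.subdegree ρ d f ≤ 0 :=
  (mem_divergent.1 (h.safe.1.1.1 hf)).2.2

theorem edgeNode_subset_iff (hA : A ∈ T.inner) (e : E) :
    Γ.edgeNode T F e ⊆ A ↔ ∀ b, Γ.contractedAttach F (e, b) ∈ A := by
  constructor
  · intro hs b
    cases b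
    · exact hs left_mem_lca
    · exact hs right_mem_lca
  · exact fun hs => lca_subset hA (hs false) (hs true)

/-- A safe child all of whose quotient lies in `A` is linked to another vertex in `A`. -/
theorem exists_own_of_full_child (hc : c ∈ insert Finset.univ F) (hA : A ∈ T.inner)
    (hf : f ∈ childrenIn F c) (hfA : Γ.quot F f ⊆ A) : ∃ e ∈ ownEdges F c, ∃ b,
      Γ.contractedAttach F (e, b) = Γ.firstVertex f ∧ Γ.contractedAttach F (e, !b) ∈ A := by
  obtain ⟨hf1, hf2, hf3⟩ := mem_childrenIn.1 hf
  have hF := h.isLaminar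
  obtain ⟨e, he, e', he', hs⟩ := h.safe.2 f hf1
  simp only [boundaryEdges, Finset.mem_filter, Finset.mem_sdiff] at he
  obtain ⟨⟨hep, hef⟩, hadj⟩ := he
  have hec : e ∈ c := by
    rcases Finset.mem_insert.1 hc with rfl | hc
    · exact Finset.mem_univ e
    · rw [parentIn, Finset.mem_inf] at hep
      exact hep c (Finset.mem_filter.2 ⟨hc, hf2⟩)
  obtain ⟨b, hb⟩ : ∃ b, Γ.attach (e, b) ∈ Γ.vertices f := by
    rcases hadj with h' | h'
    · exact ⟨false, h'⟩
    · exact ⟨true, h'⟩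
  have hown : e ∈ ownEdges F c := by
    refine mem_ownEdges.2 ⟨hec, fun g hg hgc heg => ?_⟩
    rcases hF.compatible f hf1 g hg with h' | h' | h'
    · exact hef (h' heg)
    · by_cases hfg : f = g
      · exact hef (hfg ▸ heg)
      · exact hf3 g hg hgc (Finset.ssubset_iff_subset_ne.2 ⟨h', hfg⟩)
    · exact Finset.disjoint_left.1 h' (attach_mem_vertices heg b) hb
  refine ⟨e, hown, b, ?_, ?_⟩
  · rw [contractedAttach_own (h.compatible hc) hown, hF.rep_child hf hb]
  · have h1 : Γ.edgeNode T F e' ⊆ A :=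
      (edgeNode_subset_lowerNode hF (hF.compatible f hf1) (hF.block f hf1) he').trans
        (hull_subset hA hfA)
    exact (h.edgeNode_subset_iff hA e).1 (hs.trans h1) _

/-- The subgraph induced by a connected component of the part of the quotient lying in `A` is
either of positive degree or unsafe. -/
theorem subBlock_gain (hc : c ∈ insert Finset.univ F) (hA : A ∈ T.inner)
    (hcA : ¬ Γ.quot F c ⊆ A) {S : Finset V} (hSA : S ⊆ A)
    (hcl : ∀ e ∈ ownEdges F c, ∀ b, Γ.contractedAttach F (e, b) ∈ S →
      Γ.contractedAttach F (e, !b) ∈ A → Γ.contractedAttach F (e, !b) ∈ S)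
    (hS : Γ.IsQuotConnected F c S) :
    θ ≤ Γ.subdegree ρ d (Γ.subBlock F c S) + ∑ γ ∈ Γ.activeIn ρ d T F A c,
      (if Γ.quot F γ ⊆ S then Γ.gainExponent ρ d γ else 0) := by
  have hF := h.isLaminar
  have hcb := h.block hc
  have hcc := h.compatible hc
  have hne : ¬ Γ.quot F c ⊆ S := fun h' => hcA (h'.trans hSA)
  set γ := Γ.subBlock F c S with hγ
  have hterm : ∀ γ ∈ Γ.activeIn ρ d T F A c,
      0 ≤ if Γ.quot F γ ⊆ S then Γ.gainExponent ρ d γ else 0 := fun γ _ => by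
    split_ifs
    · exact (gainExponent_pos h.rho_pos γ).le
    · exact le_rfl
  -- A positive degree is at least the gap. Otherwise `γ` is shown to be an active element of the
  -- unsafe complement, whose gain exceeds its negative degree by the gap.
  by_cases hdeg : 0 < Γ.subdegree ρ d γ
  · have := h.pos γ hdeg
    have := Finset.sum_nonneg hterm
    linarith
  rw [not_lt] at hdeg
  have hγb : Γ.IsBlock γ := isBlock_subBlock hF hcb hcc hS
  have hγc : γ ⊂ c := subBlock_ssubset hF hcc hS hne
  have hγcomp : Γ.IsCompatible F γ := isCompatible_subBlock hF hcb hcc hS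
  have hγu : γ ≠ Finset.univ := fun e => by
    have := hγc
    rw [e] at this
    exact this.2 (Finset.subset_univ _)
  have hγF : γ ∉ F := fun hm => not_subset_of_subBlock hF hcc hS hm hγc subset_rfl
  have hdiv : γ ∈ Γ.divergent ρ d := mem_divergent.2 ⟨hγu, hγb.connected, hdeg⟩
  -- If the far end of an alive leg were in `A`, closedness of `S` would put it in `S`, and the edge
  -- would belong to `γ`.
  have hleg : ∀ {e b}, Γ.IsAliveLeg F γ (e, b) → Γ.contractedAttach F (e, !b) ∉ A := by
    intro e b hal hmem
    obtain ⟨h1, h2⟩ := mem_legs.1 hal.1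
    have hec : e ∈ c := by
      rcases Finset.mem_insert.1 hc with rfl | hc'
      · exact Finset.mem_univ e
      · exact hal.2 c hc' hγc
    obtain ⟨h3, h4⟩ := (mem_vertices_subBlock hF hcc hS).1 h2
    have hown : e ∈ ownEdges F c := mem_ownEdges.2 ⟨hec, fun g hg hgc heg =>
      h1 (subBlock_of_mem hF hg hgc (attach_mem_vertices heg b) h4 heg)⟩
    rw [← contractedAttach_own hcc hown] at h4
    have h5 := hcl e hown b h4 hmem
    have := (mem_ownEdges_subBlock hF hcc hS hne).2 ⟨hown, fun b' => by
      by_cases hb : b' = b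
      · rw [hb]; exact h4
      · rw [show b' = !b by cases b <;> cases b' <;> simp_all]; exact h5⟩
    exact h1 (mem_ownEdges.1 this).1
  have hquot : Γ.quot F γ = S := quot_subBlock hF hcc hS hne
  -- The own edges of `γ` have their nodes inside `A`, whereas every alive leg leaves `A`.
  have hnotSafe : ¬ Γ.IsSafeIn T (insert γ F) γ := by
    intro hs
    obtain ⟨e, b, hal, e', he', hmem⟩ := exists_alive_of_isSafeIn hγb hγcomp hγF hs
    exact hleg hal (((h.edgeNode_subset_iff hA e').2 fun b' =>
      hSA (((mem_ownEdges_subBlock hF hcc hS hne).1 he').2 b')) hmem)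
  have hforest : Γ.IsFullForest ρ d (insert γ F) := by
    refine ⟨⟨Finset.insert_subset hdiv h.safe.1.1.1, fun f hf g hg => ?_⟩, fun f hf => ?_⟩
    · rcases Finset.mem_insert.1 hf with rfl | hf <;> rcases Finset.mem_insert.1 hg with rfl | hg
      · exact Or.inl subset_rfl
      · rcases hγcomp g hg with h' | h' | h'
        · exact Or.inr (Or.inl h')
        · exact Or.inl h'
        · exact Or.inr (Or.inr h'.symm)
      · exact hγcomp f hf
      · exact h.safe.1.1.2 f hf g hg
    · rcases Finset.mem_insert.1 hf with rfl | hf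
      · exact hγb.full
      · exact h.safe.1.2 f hf
  have hmem : γ ∈ Γ.unsafePart ρ d T F := by
    simp only [unsafePart, Finset.mem_filter]
    exact ⟨hdiv, hforest, hnotSafe⟩
  have hact : γ ∈ Γ.activeIn ρ d T F A c := by
    refine Finset.mem_filter.2 ⟨hmem, hγc, fun f hf hfc hlt =>
      not_subset_of_subBlock hF hcc hS hf hfc hlt.1, ?_, fun hJ => ?_⟩
    · exact hull_subset hA (hquot ▸ hSA)
    · obtain ⟨-, -, ⟨e, b, hal, heq⟩, -⟩ := (isUnsafe_of_mem_unsafePart h.safe hmem).upperNode_spec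
        hF h.loop h.conn hγu
      rw [← heq] at hJ
      exact hleg hal ((h.edgeNode_subset_iff hA e).1 hJ _)
  have h1 := Finset.single_le_sum hterm hact
  rw [if_pos hquot.subset] at h1
  have := h.gain γ hmem
  linarith

/-- Induction on the size of `S`. A single vertex counts `ρ + d`. A connected `S` counts `ρ + d`
plus the degree and the gains of the subgraph it induces, hence an additional `θ`. A disconnected
`S` splits into closed parts on which the count is superadditive. -/
theorem le_partialCount (hc : c ∈ insert Finset.univ F) (hA : A ∈ T.inner)
    (hcA : ¬ Γ.quot F c ⊆ A) {S : Finset V} (hSq : S ⊆ Γ.quot F c) (hSA : S ⊆ A)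
    (hcl : ∀ e ∈ ownEdges F c, ∀ b, Γ.contractedAttach F (e, b) ∈ S →
      Γ.contractedAttach F (e, !b) ∈ A → Γ.contractedAttach F (e, !b) ∈ S) (hne : S.Nonempty) :
    ρ + d ≤ Γ.partialCount ρ d T F A c S ∧
      (1 < S.card → ρ + d + θ ≤ Γ.partialCount ρ d T F A c S) := by
  have hF := h.isLaminar
  have hcb := h.block hc
  have hcc := h.compatible hc
  have hθ := h.gap_pos
  have hθ' := h.gap_le
  have hflip : ∀ {e : E} {b : Bool} {X : Finset V}, Γ.contractedAttach F (e, b) ∈ X →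
      Γ.contractedAttach F (e, !b) ∈ X → ∀ b', Γ.contractedAttach F (e, b') ∈ X := by
    intro e b X h1 h2 b'
    by_cases hb : b' = b
    · rw [hb]; exact h1
    · rw [show b' = !b by cases b <;> cases b' <;> simp_all]; exact h2
  induction hk : S.card using Nat.strong_induction_on generalizing S with
  | _ k ih =>
    subst hk
    by_cases hcard : 1 < S.card
    · suffices hmain : ρ + d + θ ≤ Γ.partialCount ρ d T F A c S from
        ⟨by linarith, fun _ => hmain⟩
      by_cases hconn : Γ.IsQuotConnected F c S
      · have h1 := h.subBlock_gain hc hA hcA hSA hcl hconn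
        have hnq : ¬ Γ.quot F c ⊆ S := fun h' => hcA (h'.trans hSA)
        have h2 := hF.subdegree_decomposition (ρ := ρ) (d := d) (Γ.subBlock F c S)
        rw [quot_subBlock hF hcc hconn hnq] at h2
        have h3 : ((ownEdges F (Γ.subBlock F c S)).card : ℝ) =
            ∑ e ∈ ownEdges F c, (if ∀ b, Γ.contractedAttach F (e, b) ∈ S then 1 else 0) := by
          rw [← Finset.sum_filter, Finset.sum_const, nsmul_eq_mul, mul_one]
          congr 2
          ext e
          rw [mem_ownEdges_subBlock hF hcc hconn hnq, Finset.mem_filter]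
        -- The children whose quotient leaves `A` are absent from the right-hand side; their degrees
        -- are nonpositive.
        have h4 : ∑ f ∈ childrenIn F (Γ.subBlock F c S), Γ.subdegree ρ d f ≤
            ∑ f ∈ childrenIn F c,
              (if Γ.quot F f ⊆ A ∧ Γ.firstVertex f ∈ S then Γ.subdegree ρ d f else 0) := by
          have : childrenIn F (Γ.subBlock F c S) =
              (childrenIn F c).filter fun f => Γ.firstVertex f ∈ S := by
            ext f
            rw [mem_childrenIn_subBlock hF hcc hconn hnq, Finset.mem_filter]
          rw [this, Finset.sum_filter]
          refine Finset.sum_le_sum fun f hf => ?_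
          have := h.subdegree_nonpos (mem_childrenIn.1 hf).1
          split_ifs with h5 h6 h6
          · exact le_rfl
          · exact this
          · exact absurd h6.2 h5
          · exact le_rfl
        unfold partialCount
        rw [h3] at h2
        linarith
      -- No own edge joins `S₁` to the rest of `S`, so both parts inherit closedness. The total is
      -- at least `2 (ρ + d)`, and `θ ≤ ρ + d`.
      · obtain ⟨S₁, hS₁, hS₁ne, hno⟩ : ∃ S₁ ⊂ S, S₁.Nonempty ∧ ∀ e ∈ ownEdges F c, ∀ b,
            Γ.contractedAttach F (e, b) ∈ S₁ → Γ.contractedAttach F (e, !b) ∉ S \ S₁ := by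
          by_contra hcon
          refine hconn ⟨hSq, hcard, fun S₁ h1 h2 => ?_⟩
          by_contra hcon'
          refine hcon ⟨S₁, h1, h2, fun e he b h3 h4 => hcon' ⟨e, he, b, h3, h4⟩⟩
        set S₂ := S \ S₁ with hS₂
        have hS₂S : S₂ ⊆ S := Finset.sdiff_subset
        have hS₂ne : S₂.Nonempty := by
          obtain ⟨x, hx, hx'⟩ := Finset.exists_of_ssubset hS₁
          exact ⟨x, Finset.mem_sdiff.2 ⟨hx, hx'⟩⟩
        have hdis : Disjoint S₁ S₂ := Finset.disjoint_sdiff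
        have hunion : ∀ x ∈ S, x ∈ S₁ ∨ x ∈ S₂ := fun x hx => by
          by_cases hx1 : x ∈ S₁
          · exact Or.inl hx1
          · exact Or.inr (Finset.mem_sdiff.2 ⟨hx, hx1⟩)
        have hcadd : S₁.card + S₂.card = S.card := by
          rw [hS₂, add_comm, Finset.card_sdiff_add_card_eq_card hS₁.1]
        have c1 := hS₁ne.card_pos
        have c2 := hS₂ne.card_pos
        obtain ⟨b1, -⟩ := ih S₁.card (by omega) (hS₁.1.trans hSq) (hS₁.1.trans hSA)
          (fun e he b h1 h2 => (hunion _ (hcl e he b (hS₁.1 h1) h2)).resolve_right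
            (hno e he b h1)) hS₁ne rfl
        obtain ⟨b2, -⟩ := ih S₂.card (by omega) (hS₂S.trans hSq) (hS₂S.trans hSA)
          (fun e he b h1 h2 => (hunion _ (hcl e he b (hS₂S h1) h2)).resolve_left fun h3 => by
            have := hno e he (!b) h3
            rw [Bool.not_not] at this
            exact this h1) hS₂ne rfl
        have hsum : Γ.partialCount ρ d T F A c S₁ + Γ.partialCount ρ d T F A c S₂ ≤
            Γ.partialCount ρ d T F A c S := by
          have e1 : (S₁.card : ℝ) + S₂.card = S.card := by exact_mod_cast hcadd
          have e2 : ∑ e ∈ ownEdges F c, (if ∀ b, Γ.contractedAttach F (e, b) ∈ S then (1 : ℝ) else 0) ≤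
              ∑ e ∈ ownEdges F c, (if ∀ b, Γ.contractedAttach F (e, b) ∈ S₁ then (1 : ℝ) else 0) +
              ∑ e ∈ ownEdges F c, (if ∀ b, Γ.contractedAttach F (e, b) ∈ S₂ then (1 : ℝ) else 0) := by
            rw [← Finset.sum_add_distrib]
            refine Finset.sum_le_sum fun e he => ?_
            by_cases hall : ∀ b, Γ.contractedAttach F (e, b) ∈ S
            · rw [if_pos hall]
              rcases hunion _ (hall false) with h1 | h1
              · rcases hunion _ (hall true) with h2 | h2
                · rw [if_pos (hflip (b := false) h1 h2)]
                  split_ifs <;> norm_num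
                · exact absurd h2 (hno e he false h1)
              · rcases hunion _ (hall true) with h2 | h2
                · exact absurd h1 (hno e he true h2)
                · rw [if_pos (hflip (X := S₂) (b := false) h1 h2)]
                  split_ifs <;> norm_num
            · rw [if_neg hall]
              split_ifs <;> norm_num
          have e3 : ∑ γ ∈ Γ.activeIn ρ d T F A c,
                (if Γ.quot F γ ⊆ S₁ then Γ.gainExponent ρ d γ else 0) +
              ∑ γ ∈ Γ.activeIn ρ d T F A c,
                (if Γ.quot F γ ⊆ S₂ then Γ.gainExponent ρ d γ else 0) ≤
              ∑ γ ∈ Γ.activeIn ρ d T F A c,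
                (if Γ.quot F γ ⊆ S then Γ.gainExponent ρ d γ else 0) := by
            rw [← Finset.sum_add_distrib]
            refine Finset.sum_le_sum fun γ hγ => ?_
            have hg := (gainExponent_pos (d := d) (Γ := Γ) h.rho_pos γ).le
            have hb := (isUnsafe_of_mem_unsafePart h.safe (Finset.mem_filter.1 hγ).1).block
            have hm := firstVertex_mem_quot hb hF
            by_cases h1 : Γ.quot F γ ⊆ S₁
            · rw [if_pos h1, if_pos (h1.trans hS₁.1), if_neg, add_zero]
              exact fun h2 => Finset.disjoint_left.1 hdis (h1 hm) (h2 hm)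
            · rw [if_neg h1, zero_add]
              by_cases h2 : Γ.quot F γ ⊆ S₂
              · rw [if_pos h2, if_pos (h2.trans hS₂S)]
              · rw [if_neg h2]
                split_ifs
                · exact hg
                · exact le_rfl
          have e4 : ∑ f ∈ childrenIn F c, (if Γ.quot F f ⊆ A ∧ Γ.firstVertex f ∈ S₁ then
                Γ.subdegree ρ d f else 0) +
              ∑ f ∈ childrenIn F c, (if Γ.quot F f ⊆ A ∧ Γ.firstVertex f ∈ S₂ then
                Γ.subdegree ρ d f else 0) =
              ∑ f ∈ childrenIn F c, (if Γ.quot F f ⊆ A ∧ Γ.firstVertex f ∈ S then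
                Γ.subdegree ρ d f else 0) := by
            rw [← Finset.sum_add_distrib]
            refine Finset.sum_congr rfl fun f hf => ?_
            by_cases hfA : Γ.quot F f ⊆ A
            · simp only [hfA, true_and]
              by_cases h1 : Γ.firstVertex f ∈ S₁
              · rw [if_pos h1, if_pos (hS₁.1 h1), if_neg (Finset.disjoint_left.1 hdis h1), add_zero]
              · rw [if_neg h1, zero_add]
                by_cases h2 : Γ.firstVertex f ∈ S₂
                · rw [if_pos h2, if_pos (hS₂S h2)]
                · rw [if_neg h2, if_neg]
                  exact fun h3 => (hunion _ h3).elim h1 h2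
            · simp [hfA]
          have hd0 : (0 : ℝ) ≤ d := Nat.cast_nonneg d
          have e2' := mul_le_mul_of_nonneg_left e2 hd0
          rw [mul_add] at e2'
          have e1' : (ρ + d) * (S.card : ℝ) = (ρ + d) * S₁.card + (ρ + d) * S₂.card := by
            rw [← e1]; ring
          unfold partialCount
          linarith
        linarith
    · refine ⟨?_, fun h' => absurd h' hcard⟩
      obtain ⟨s, rfl⟩ := Finset.card_eq_one.1 (le_antisymm (not_lt.1 hcard) hne.card_pos)
      have e2 : ∑ e ∈ ownEdges F c,
          (if ∀ b, Γ.contractedAttach F (e, b) ∈ ({s} : Finset V) then (1 : ℝ) else 0) = 0 := by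
        refine Finset.sum_eq_zero fun e he => if_neg fun hall => ?_
        have h1 := contractedAttach_own_ne hF h.loop hcc he
        have h2 := hall false
        have h3 := hall true
        rw [Finset.mem_singleton] at h2 h3
        exact h1 (h2.trans h3.symm)
      have e3 : 0 ≤ ∑ γ ∈ Γ.activeIn ρ d T F A c,
          (if Γ.quot F γ ⊆ {s} then Γ.gainExponent ρ d γ else 0) :=
        Finset.sum_nonneg fun γ _ => by
          split_ifs
          · exact (gainExponent_pos h.rho_pos γ).le
          · exact le_rfl
      -- Here safety is essential: a child with quotient in `A` is linked inside `A` to a different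
      -- vertex, which by closedness would also belong to `{s}`.
      have e4 : ∑ f ∈ childrenIn F c, (if Γ.quot F f ⊆ A ∧ Γ.firstVertex f ∈ ({s} : Finset V) then
          Γ.subdegree ρ d f else 0) = 0 := by
        refine Finset.sum_eq_zero fun f hf => if_neg ?_
        rintro ⟨h1, h2⟩
        obtain ⟨e, he, b, h3, h4⟩ := h.exists_own_of_full_child hc hA hf h1
        have h5 := hcl e he b (by rw [h3]; exact h2) h4
        rw [← h3] at h2
        rw [Finset.mem_singleton] at h2 h5
        have h6 := contractedAttach_own_ne hF h.loop hcc he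
        cases b
        · exact h6 (h2.trans h5.symm)
        · exact h6 (h5.trans h2.symm)
      unfold partialCount
      rw [e2, e4, Finset.card_singleton]
      simp only [Nat.cast_one, mul_one, mul_zero, sub_zero, add_zero]
      linarith

end IsPowerCounting

end FeynmanDiagram

end
noncomputable section

/-! ### Global power counting -/

namespace FeynmanDiagram

open HeppTree

variable {V E : Type} [Fintype V] [LinearOrder V] [Fintype E] [DecidableEq E]
  {Γ : FeynmanDiagram V E} {F : Finset (Finset E)} {c f g γ : Finset E} {d : ℕ} {ρ θ : ℝ}
  {T : HeppTree V} {A : Finset V}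

open Classical in
/-- The exponent of the radius of the node `A` in the product of all the bounds. -/
def powerCount (ρ : ℝ) (d : ℕ) (Γ : FeynmanDiagram V E) (T : HeppTree V) (F : Finset (Finset E))
    (A : Finset V) : ℝ :=
  (ρ + d) * (T.inner.filter fun B => B ⊆ A).card
    - d * (Finset.univ.filter fun e => Γ.edgeNode T F e ⊆ A).card
    + ∑ γ ∈ (Γ.unsafePart ρ d T F).filter fun γ => Γ.lowerNode T F γ ⊆ A ∧ ¬ Γ.upperNode T F γ ⊆ A,
        Γ.gainExponent ρ d γ

/-- The contribution of `c` to the power counting at `A`, once the first vertex of `c` and the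
degree of `c` are attributed to its parent. -/
def excess (ρ : ℝ) (d : ℕ) (Γ : FeynmanDiagram V E) (T : HeppTree V) (F : Finset (Finset E))
    (A : Finset V) (c : Finset E) : ℝ :=
  Γ.partialCount ρ d T F A c (Γ.quot F c ∩ A)
    - (if Γ.quot F c ⊆ A then Γ.subdegree ρ d c else 0)
    - (if c ∈ F ∧ Γ.firstVertex c ∈ A then ρ + d else 0)

namespace IsPowerCounting

variable (h : Γ.IsPowerCounting ρ d T F θ)

include h

theorem quot_active_subset (hγ : γ ∈ Γ.activeIn ρ d T F A c) : Γ.quot F γ ⊆ Γ.quot F c := by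
  obtain ⟨h1, h2, h3, -⟩ := Finset.mem_filter.1 hγ
  have hu := isUnsafe_of_mem_unsafePart h.safe h1
  intro v hv
  obtain ⟨hv1, hv2⟩ := mem_quot.1 hv
  refine mem_quot.2 ⟨vertices_mono h2.1 hv1, fun f hf hfc hvf => ?_⟩
  rcases hu.compatible f hf with h' | h' | h'
  · exact hv2 f hf (Finset.ssubset_iff_subset_ne.2 ⟨h', fun e => hu.notMem (e ▸ hf)⟩) hvf
  · exact absurd (Finset.ssubset_iff_subset_ne.2 ⟨h', fun e => hu.notMem (e ▸ hf)⟩) (h3 f hf hfc)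
  · exact absurd hvf (Finset.disjoint_right.1 h' hv1)

theorem quot_active_subset_node (hγ : γ ∈ Γ.activeIn ρ d T F A c) :
    Γ.quot F γ ⊆ Γ.quot F c ∩ A :=
  Finset.subset_inter (h.quot_active_subset hγ)
    (quot_subset_lowerNode.trans (Finset.mem_filter.1 hγ).2.2.2.1)

theorem partialCount_eq (hc : c ∈ insert Finset.univ F) (hA : A ∈ T.inner) :
    Γ.partialCount ρ d T F A c (Γ.quot F c ∩ A) = (ρ + d) * (Γ.quot F c ∩ A).card
      - d * ∑ e ∈ ownEdges F c, (if Γ.edgeNode T F e ⊆ A then 1 else 0)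
      + ∑ γ ∈ Γ.activeIn ρ d T F A c, Γ.gainExponent ρ d γ
      + ∑ f ∈ childrenIn F c, (if Γ.quot F f ⊆ A then Γ.subdegree ρ d f else 0) := by
  have hF := h.isLaminar
  unfold partialCount
  congr 1
  · congr 1
    · congr 2
      refine Finset.sum_congr rfl fun e he => if_congr ?_ rfl rfl
      rw [h.edgeNode_subset_iff hA]
      exact forall_congr' fun b => Finset.mem_inter.trans (and_iff_right
        (contractedAttach_own_mem hF (h.compatible hc) he b))
    · exact Finset.sum_congr rfl fun γ hγ => if_pos (h.quot_active_subset_node hγ)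
  · refine Finset.sum_congr rfl fun f hf => if_congr (and_iff_left_of_imp fun hfA => ?_) rfl rfl
    have hfF := (mem_childrenIn.1 hf).1
    exact Finset.mem_inter.2 ⟨hF.firstVertex_child_mem hf,
      hfA (firstVertex_mem_quot (hF.block f hfF) hF)⟩

/-- A vertex of `A` appears in the quotient of the smallest element containing it, and once more for
each element of `F` of which it is the first vertex. -/
theorem sum_card_quot (A : Finset V) :
    ∑ c ∈ insert Finset.univ F, ((Γ.quot F c ∩ A).card : ℝ) =
      A.card + ∑ f ∈ F, (if Γ.firstVertex f ∈ A then 1 else 0) := by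
  have hF := h.isLaminar
  have hu := h.univ_notMem
  set w : V → ℝ := fun v => if v ∈ A then 1 else 0 with hw
  have h1 := Finset.sum_congr (rfl : insert Finset.univ F = insert Finset.univ F)
    fun c _ => hF.sum_vertices c w
  rw [Finset.sum_add_distrib, hF.sum_childrenIn hu, Finset.sum_insert hu,
    Finset.sum_sub_distrib, vertices_univ h.nonempty h.conn] at h1
  have h2 : ∀ S : Finset V, ∑ v ∈ S, w v = ((S ∩ A).card : ℝ) := fun S => by
    rw [hw, Finset.sum_ite_mem, Finset.sum_const, nsmul_eq_mul, mul_one]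
  simp only [h2, Finset.univ_inter] at h1
  have h3 : ∀ f, w (Γ.firstVertex f) = if Γ.firstVertex f ∈ A then (1 : ℝ) else 0 := fun f => rfl
  simp only [h3] at h1
  linarith

theorem sum_own (w : E → ℝ) :
    ∑ c ∈ insert Finset.univ F, ∑ e ∈ ownEdges F c, w e = ∑ e, w e := by
  have hF := h.isLaminar
  have hu := h.univ_notMem
  have h1 := Finset.sum_congr (rfl : insert Finset.univ F = insert Finset.univ F)
    fun c _ => hF.sum_edges c w
  rw [Finset.sum_add_distrib, hF.sum_childrenIn hu, Finset.sum_insert hu] at h1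
  linarith

theorem sum_active_le :
    ∑ c ∈ insert Finset.univ F, ∑ γ ∈ Γ.activeIn ρ d T F A c, Γ.gainExponent ρ d γ ≤
      ∑ γ ∈ (Γ.unsafePart ρ d T F).filter fun γ =>
        Γ.lowerNode T F γ ⊆ A ∧ ¬ Γ.upperNode T F γ ⊆ A, Γ.gainExponent ρ d γ := by
  classical
  have hF := h.isLaminar
  rw [← Finset.sum_biUnion]
  · refine Finset.sum_le_sum_of_subset_of_nonneg ?_ fun γ _ _ => (gainExponent_pos h.rho_pos γ).le
    intro γ hγ
    obtain ⟨c, -, hγ⟩ := Finset.mem_biUnion.1 hγ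
    obtain ⟨h1, -, -, h2⟩ := Finset.mem_filter.1 hγ
    exact Finset.mem_filter.2 ⟨h1, h2⟩
  · intro c hc c' hc' hne
    refine Finset.disjoint_left.2 fun γ hγ hγ' => hne ?_
    obtain ⟨h1, h2, h3, -⟩ := Finset.mem_filter.1 hγ
    obtain ⟨-, h2', h3', -⟩ := Finset.mem_filter.1 hγ'
    exact hF.successor_unique h.univ_notMem
      (isUnsafe_of_mem_unsafePart h.safe h1).block.vertices_nonempty hc hc' h2 h2' h3 h3'

theorem subdegree_univ : Γ.subdegree ρ d Finset.univ = Γ.degree ρ d := by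
  rw [subdegree_eq, degree_eq, vertices_univ h.nonempty h.conn, Finset.card_univ, Finset.card_univ]

/-- Summing over `F ∪ {univ}`, the degree of each element of `F` enters once through its parent and
is subtracted once by itself; the repeated first vertices cancel likewise. There remain `(ρ + d)
|A|`, compared with the inner nodes below `A`, and the degree of `Γ`, which is restored explicitly.
-/
theorem sum_excess_le (hA : A ∈ T.inner) :
    ∑ c ∈ insert Finset.univ F, Γ.excess ρ d T F A c +
      (if Γ.quot F Finset.univ ⊆ A then Γ.degree ρ d else 0) - (ρ + d) ≤
      Γ.powerCount ρ d T F A := by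
  classical
  have hF := h.isLaminar
  have hu := h.univ_notMem
  have hρd : 0 < ρ + d := add_pos_of_pos_of_nonneg h.rho_pos (Nat.cast_nonneg d)
  have h1 : ∑ c ∈ insert Finset.univ F, Γ.partialCount ρ d T F A c (Γ.quot F c ∩ A) =
      (ρ + d) * (A.card + ∑ f ∈ F, (if Γ.firstVertex f ∈ A then 1 else 0))
      - d * ∑ e, (if Γ.edgeNode T F e ⊆ A then 1 else 0)
      + ∑ c ∈ insert Finset.univ F, ∑ γ ∈ Γ.activeIn ρ d T F A c, Γ.gainExponent ρ d γ
      + ∑ f ∈ F, (if Γ.quot F f ⊆ A then Γ.subdegree ρ d f else 0) := by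
    rw [Finset.sum_congr rfl fun c hc => h.partialCount_eq hc hA, Finset.sum_add_distrib,
      Finset.sum_add_distrib, Finset.sum_sub_distrib, ← Finset.mul_sum, ← Finset.mul_sum,
      h.sum_card_quot, h.sum_own, hF.sum_childrenIn hu]
  have h2 : ∑ c ∈ insert Finset.univ F, (if Γ.quot F c ⊆ A then Γ.subdegree ρ d c else 0) =
      (if Γ.quot F Finset.univ ⊆ A then Γ.degree ρ d else 0) +
        ∑ f ∈ F, (if Γ.quot F f ⊆ A then Γ.subdegree ρ d f else 0) := by
    rw [Finset.sum_insert hu, h.subdegree_univ]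
  have h3 : ∑ c ∈ insert Finset.univ F, (if c ∈ F ∧ Γ.firstVertex c ∈ A then ρ + d else 0) =
      (ρ + d) * ∑ f ∈ F, (if Γ.firstVertex f ∈ A then 1 else 0) := by
    rw [Finset.sum_insert hu, if_neg fun h' => hu h'.1, zero_add, Finset.mul_sum]
    refine Finset.sum_congr rfl fun f hf => ?_
    simp [hf]
  have h4 : ∑ e, (if Γ.edgeNode T F e ⊆ A then (1 : ℝ) else 0) =
      (Finset.univ.filter fun e => Γ.edgeNode T F e ⊆ A).card := by
    rw [Finset.sum_boole]
  have h5 : (A.card : ℝ) ≤ (T.inner.filter fun B => B ⊆ A).card + 1 := by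
    exact_mod_cast card_le_card_inner hA
  have h6 := mul_le_mul_of_nonneg_left h5 hρd.le
  have h7 := h.sum_active_le (A := A)
  unfold excess powerCount
  rw [Finset.sum_sub_distrib, Finset.sum_sub_distrib, h1, h2, h3, h4]
  rw [mul_add] at h6 ⊢
  linarith

theorem closed (hc : c ∈ insert Finset.univ F) : ∀ e ∈ ownEdges F c, ∀ b,
    Γ.contractedAttach F (e, b) ∈ Γ.quot F c ∩ A → Γ.contractedAttach F (e, !b) ∈ A →
      Γ.contractedAttach F (e, !b) ∈ Γ.quot F c ∩ A := fun e he b _ h2 =>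
  Finset.mem_inter.2 ⟨contractedAttach_own_mem h.isLaminar (h.compatible hc) he _, h2⟩

theorem firstVertex_mem_inter (hc : c ∈ insert Finset.univ F) (hv : Γ.firstVertex c ∈ A) :
    Γ.firstVertex c ∈ Γ.quot F c ∩ A :=
  Finset.mem_inter.2 ⟨firstVertex_mem_quot (h.block hc) h.isLaminar, hv⟩

/-- The excess of a subdiagram whose quotient is not contained in the node. -/
theorem excess_of_not_subset (hc : c ∈ insert Finset.univ F) (hA : A ∈ T.inner)
    (hcA : ¬ Γ.quot F c ⊆ A) :
    0 ≤ Γ.excess ρ d T F A c ∧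
    (1 < (Γ.quot F c ∩ A).card → θ ≤ Γ.excess ρ d T F A c) ∧
    ((c ∈ F → Γ.firstVertex c ∉ A) → (Γ.quot F c ∩ A).Nonempty →
      ρ + d ≤ Γ.excess ρ d T F A c ∧
      (1 < (Γ.quot F c ∩ A).card → ρ + d + θ ≤ Γ.excess ρ d T F A c)) := by
  have hρd : 0 < ρ + d := add_pos_of_pos_of_nonneg h.rho_pos (Nat.cast_nonneg d)
  have hb := fun hne => h.le_partialCount hc hA hcA (S := Γ.quot F c ∩ A)
    Finset.inter_subset_left Finset.inter_subset_right (h.closed hc) hne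
  have hite : (if c ∈ F ∧ Γ.firstVertex c ∈ A then ρ + d else 0) ≤ ρ + d := by
    split_ifs
    · exact le_rfl
    · exact hρd.le
  unfold excess
  rw [if_neg hcA]
  refine ⟨?_, fun hcard => ?_, fun hv hne => ?_⟩
  · by_cases hne : (Γ.quot F c ∩ A).Nonempty
    · have := (hb hne).1
      linarith
    · have hv : Γ.firstVertex c ∉ A := fun hv => hne ⟨_, h.firstVertex_mem_inter hc hv⟩
      rw [if_neg fun h' => hv h'.2, Finset.not_nonempty_iff_eq_empty.1 hne]
      have e2 : ∑ γ ∈ Γ.activeIn ρ d T F A c,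
          (if Γ.quot F γ ⊆ ∅ then Γ.gainExponent ρ d γ else 0) = 0 :=
        Finset.sum_eq_zero fun γ hγ => if_neg fun h' => by
          have hbl := (isUnsafe_of_mem_unsafePart h.safe (Finset.mem_filter.1 hγ).1).block
          exact absurd (h' (firstVertex_mem_quot hbl h.isLaminar)) (Finset.notMem_empty _)
      unfold partialCount
      rw [e2]
      simp
  · have := (hb (Finset.card_pos.1 (by omega))).2 hcard
    linarith
  · rw [if_neg fun h' => hv h'.1 h'.2]
    have := hb hne
    exact ⟨by linarith [this.1], fun h' => by linarith [this.2 h']⟩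

/-- The excess of a subdiagram whose quotient is contained in the node. -/
theorem excess_of_subset (hc : c ∈ insert Finset.univ F) (hA : A ∈ T.inner)
    (hcA : Γ.quot F c ⊆ A) :
    (if c ∈ F then 0 else ρ + d) -
      ∑ f ∈ childrenIn F c, (if Γ.quot F f ⊆ A then 0 else Γ.subdegree ρ d f) ≤
      Γ.excess ρ d T F A c := by
  have hρd : 0 < ρ + d := add_pos_of_pos_of_nonneg h.rho_pos (Nat.cast_nonneg d)
  have hF := h.isLaminar
  have h1 := hF.subdegree_decomposition (ρ := ρ) (d := d) c
  have h2 : ∑ f ∈ childrenIn F c, Γ.subdegree ρ d f =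
      ∑ f ∈ childrenIn F c, (if Γ.quot F f ⊆ A then Γ.subdegree ρ d f else 0) +
      ∑ f ∈ childrenIn F c, (if Γ.quot F f ⊆ A then 0 else Γ.subdegree ρ d f) := by
    rw [← Finset.sum_add_distrib]
    refine Finset.sum_congr rfl fun f _ => ?_
    split_ifs <;> simp
  have h3 : ∑ e ∈ ownEdges F c, (if Γ.edgeNode T F e ⊆ A then (1 : ℝ) else 0) =
      (ownEdges F c).card := by
    rw [Finset.sum_congr rfl fun e he => if_pos ((edgeNode_subset_lowerNode hF (h.compatible hc)
      (h.block hc) he).trans (hull_subset hA hcA))]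
    simp
  have h4 : 0 ≤ ∑ γ ∈ Γ.activeIn ρ d T F A c, Γ.gainExponent ρ d γ :=
    Finset.sum_nonneg fun γ _ => (gainExponent_pos h.rho_pos γ).le
  have hv : Γ.firstVertex c ∈ A := hcA (firstVertex_mem_quot (h.block hc) hF)
  unfold excess
  rw [h.partialCount_eq hc hA, if_pos hcA, h3, Finset.inter_eq_left.2 hcA, h1, h2]
  simp only [hv, and_true]
  by_cases hcF : c ∈ F
  · simp only [hcF, if_true]
    linarith
  · simp only [hcF, if_false]
    linarith

theorem sum_nonfull_nonpos (G : Finset (Finset E)) (hG : G ⊆ childrenIn F c) :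
    ∑ f ∈ G, (if Γ.quot F f ⊆ A then 0 else Γ.subdegree ρ d f) ≤ 0 :=
  Finset.sum_nonpos fun f hf => by
    split_ifs
    · exact le_rfl
    · exact h.subdegree_nonpos (mem_childrenIn.1 (hG hf)).1

theorem excess_nonneg (hc : c ∈ insert Finset.univ F) (hA : A ∈ T.inner) :
    0 ≤ Γ.excess ρ d T F A c := by
  have hρd : 0 < ρ + d := add_pos_of_pos_of_nonneg h.rho_pos (Nat.cast_nonneg d)
  by_cases hcA : Γ.quot F c ⊆ A
  · have h1 := h.excess_of_subset hc hA hcA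
    have h2 := h.sum_nonfull_nonpos (A := A) (c := c) _ subset_rfl
    have h3 : (0 : ℝ) ≤ if c ∈ F then 0 else ρ + d := by
      split_ifs
      · exact le_rfl
      · exact hρd.le
    linarith
  · exact (h.excess_of_not_subset hc hA hcA).1

/-- A child whose degree is negative and whose quotient is not contained in `A`, while that of its
parent is, improves the excess of the parent. -/
theorem excess_of_child (hc : c ∈ insert Finset.univ F) (hA : A ∈ T.inner)
    (hcA : Γ.quot F c ⊆ A) (hf : f ∈ childrenIn F c) (hfA : ¬ Γ.quot F f ⊆ A)
    (hdeg : Γ.subdegree ρ d f < 0) :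
    (if c ∈ F then 0 else ρ + d) + θ ≤ Γ.excess ρ d T F A c := by
  have h1 := h.excess_of_subset hc hA hcA
  have h2 := h.sum_nonfull_nonpos (A := A) _ (Finset.erase_subset f (childrenIn F c))
  rw [← Finset.sum_erase_add _ _ hf, if_neg hfA] at h1
  have := h.neg f hdeg
  linarith

/-- The parent of a subdiagram whose quotient is contained in `A`. -/
theorem one_lt_card_of_full_child (hc : c ∈ insert Finset.univ F) (hA : A ∈ T.inner)
    (hf : f ∈ childrenIn F c) (hfA : Γ.quot F f ⊆ A) : 1 < (Γ.quot F c ∩ A).card := by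
  obtain ⟨e, he, b, h1, h2⟩ := h.exists_own_of_full_child hc hA hf hfA
  have hF := h.isLaminar
  have hm := contractedAttach_own_mem hF (h.compatible hc) he
  have h3 : Γ.contractedAttach F (e, b) ∈ A := by
    rw [h1]
    exact hfA (firstVertex_mem_quot (hF.block f (mem_childrenIn.1 hf).1) hF)
  refine Finset.one_lt_card.2 ⟨_, Finset.mem_inter.2 ⟨hm b, h3⟩, _,
    Finset.mem_inter.2 ⟨hm (!b), h2⟩, ?_⟩
  have := contractedAttach_own_ne hF h.loop (h.compatible hc) he
  cases b
  · exact this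
  · exact this.symm

/-- Climbing from a subdiagram whose quotient is contained in `A` to an ancestor for which this
fails. -/
theorem exists_excess_of_full (hc : c ∈ insert Finset.univ F) (hA : A ∈ T.inner)
    (hcA : ¬ Γ.quot F c ⊆ A) (hf : f ∈ F) (hfc : f ⊂ c) (hfA : Γ.quot F f ⊆ A) :
    ∃ p ∈ insert Finset.univ F, p ⊆ c ∧ 1 < (Γ.quot F p ∩ A).card ∧
      θ ≤ Γ.excess ρ d T F A p := by
  have hF := h.isLaminar
  obtain ⟨g, hg, hmax⟩ := Finset.exists_max_image
    (F.filter fun g => f ⊆ g ∧ g ⊂ c ∧ Γ.quot F g ⊆ A) Finset.card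
    ⟨f, Finset.mem_filter.2 ⟨hf, subset_rfl, hfc, hfA⟩⟩
  obtain ⟨hgF, hfg, hgc, hgA⟩ := Finset.mem_filter.1 hg
  obtain ⟨p, hp, hgp⟩ := exists_parent h.univ_notMem hgF
  obtain ⟨-, hgp', hgp''⟩ := mem_childrenIn.1 hgp
  have hpc : p ⊆ c := by
    by_contra hn
    rcases Finset.mem_insert.1 hc with rfl | hcF
    · exact hn (Finset.subset_univ _)
    have hcp : c ⊆ p := by
      rcases h.compatible hp c hcF with h' | h' | h'
      · exact h'
      · exact absurd h' hn
      · obtain ⟨x, hx⟩ := (hF.block g hgF).vertices_nonempty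
        exact absurd (vertices_mono hgc.1 hx)
          (Finset.disjoint_right.1 h' (vertices_mono hgp'.1 hx))
    exact hgp'' c hcF ⟨hcp, hn⟩ hgc
  have hpA : ¬ Γ.quot F p ⊆ A := by
    intro hpA
    have hne : p ≠ c := fun e => hcA (e ▸ hpA)
    have hpc' := Finset.ssubset_iff_subset_ne.2 ⟨hpc, hne⟩
    have hpF : p ∈ F := (Finset.mem_insert.1 hp).resolve_left fun e =>
      hpc'.2 (e ▸ Finset.subset_univ _)
    have := hmax p (Finset.mem_filter.2 ⟨hpF, hfg.trans hgp'.1, hpc', hpA⟩)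
    exact absurd (Finset.card_lt_card hgp') (not_lt.2 this)
  have hcard := h.one_lt_card_of_full_child hp hA hgp hgA
  exact ⟨p, hp, hpc, hcard, (h.excess_of_not_subset hp hA hpA).2.1 hcard⟩

/-- Power counting at a node that does not contain the quotient of the whole diagram. -/
theorem le_powerCount_of_not_subset (hA : A ∈ T.inner) (hu : ¬ Γ.quot F Finset.univ ⊆ A) :
    θ ≤ Γ.powerCount ρ d T F A := by
  have hF := h.isLaminar
  have hnu := h.univ_notMem
  have hθ := h.gap_pos
  have hθ' := h.gap_le
  have hsum := h.sum_excess_le hA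
  rw [if_neg hu, add_zero] at hsum
  suffices hmain : ρ + d + θ ≤ ∑ c ∈ insert Finset.univ F, Γ.excess ρ d T F A c by linarith
  have hnn : ∀ c ∈ insert Finset.univ F, 0 ≤ Γ.excess ρ d T F A c := fun c hc =>
    h.excess_nonneg hc hA
  have hAcard := one_lt_card_of_mem hA
  -- Number of vertices of `A` attributed to `c`, a first vertex being left to the parent. The total
  -- is `|A| ≥ 2`.
  set s : Finset E → ℝ := fun c => ((Γ.quot F c ∩ A).card : ℝ) -
    if c ∈ F ∧ Γ.firstVertex c ∈ A then 1 else 0 with hs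
  have hssum : ∑ c ∈ insert Finset.univ F, s c = A.card := by
    have h1 := h.sum_card_quot A
    have h2 : ∑ c ∈ insert Finset.univ F, (if c ∈ F ∧ Γ.firstVertex c ∈ A then (1 : ℝ) else 0) =
        ∑ f ∈ F, (if Γ.firstVertex f ∈ A then 1 else 0) := by
      rw [Finset.sum_insert hnu, if_neg fun h' => hnu h'.1, zero_add]
      exact Finset.sum_congr rfl fun f hf => by simp [hf]
    rw [hs, Finset.sum_sub_distrib, h1, h2]
    ring
  -- An element of maximal size whose quotient meets `A`. It provides the `ρ + d` that compensates
  -- the term subtracted in `sum_excess_le`.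
  obtain ⟨c₀, hc₀, hmax⟩ := Finset.exists_max_image
    ((insert Finset.univ F).filter fun c => (Γ.quot F c ∩ A).Nonempty) Finset.card (by
      by_contra hne
      have : ∑ c ∈ insert Finset.univ F, s c ≤ 0 := Finset.sum_nonpos fun c hc => by
        have h1 : ¬ (Γ.quot F c ∩ A).Nonempty := fun h' => hne ⟨c, Finset.mem_filter.2 ⟨hc, h'⟩⟩
        simp only [hs]
        rw [Finset.not_nonempty_iff_eq_empty.1 h1, Finset.card_empty]
        split_ifs <;> norm_num
      rw [hssum] at this
      have h2 : (0 : ℝ) < A.card := by exact_mod_cast (by omega : 0 < A.card)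
      linarith)
  obtain ⟨hc₀F, hc₀ne⟩ := Finset.mem_filter.1 hc₀
  -- A first vertex in `A` would make the quotient of the larger parent meet `A`.
  have hv₀ : c₀ ∈ F → Γ.firstVertex c₀ ∉ A := by
    intro hm hv
    obtain ⟨p, hp, hcp⟩ := exists_parent hnu hm
    have := hmax p (Finset.mem_filter.2 ⟨hp, _,
      Finset.mem_inter.2 ⟨hF.firstVertex_child_mem hcp, hv⟩⟩)
    exact absurd (Finset.card_lt_card (mem_childrenIn.1 hcp).2.1) (not_lt.2 this)
  have hc₀A : ¬ Γ.quot F c₀ ⊆ A := by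
    rcases Finset.mem_insert.1 hc₀F with rfl | hm
    · exact hu
    · exact fun h' => hv₀ hm (h' (firstVertex_mem_quot (h.block hc₀F) hF))
  obtain ⟨b1, b2⟩ := (h.excess_of_not_subset hc₀F hA hc₀A).2.2 hv₀ hc₀ne
  by_cases hcard : 1 < (Γ.quot F c₀ ∩ A).card
  · exact (b2 hcard).trans (Finset.single_le_sum hnn hc₀F)
  have hcard1 : (Γ.quot F c₀ ∩ A).card = 1 := by
    have := hc₀ne.card_pos
    omega
  have hpair : ∀ p ∈ insert Finset.univ F, p ≠ c₀ → θ ≤ Γ.excess ρ d T F A p →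
      ρ + d + θ ≤ ∑ c ∈ insert Finset.univ F, Γ.excess ρ d T F A c := by
    intro p hp hne hle
    rw [← Finset.add_sum_erase _ _ hc₀F]
    have := Finset.single_le_sum (f := fun c => Γ.excess ρ d T F A c)
      (fun c hc => hnn c (Finset.mem_of_mem_erase hc)) (Finset.mem_erase.2 ⟨hne, hp⟩)
    linarith
  -- Since `c₀` accounts for at most one vertex of `A`, another element accounts for a second one
  -- and supplies the missing `θ`, directly or through one of its ancestors.
  obtain ⟨c₁, hc₁, hne, hs₁⟩ : ∃ c₁ ∈ insert Finset.univ F, c₁ ≠ c₀ ∧ 0 < s c₁ := by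
    by_contra! hcon
    have h1 := hssum
    rw [← Finset.add_sum_erase _ _ hc₀F] at h1
    have h2 : ∑ c ∈ (insert Finset.univ F).erase c₀, s c ≤ 0 := Finset.sum_nonpos fun c hc =>
      hcon c (Finset.mem_of_mem_erase hc) (Finset.ne_of_mem_erase hc)
    have h3 : s c₀ ≤ 1 := by
      simp only [hs]
      rw [hcard1]
      split_ifs <;> norm_num
    have h4 : (1 : ℝ) < A.card := by exact_mod_cast hAcard
    linarith
  by_cases hc₁A : Γ.quot F c₁ ⊆ A
  · have hne_univ : c₁ ≠ Finset.univ := fun e => hu (e ▸ hc₁A)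
    have hc₁F := (Finset.mem_insert.1 hc₁).resolve_left hne_univ
    obtain ⟨p, hp, -, hpc, hpe⟩ := h.exists_excess_of_full (Finset.mem_insert_self _ _) hA hu hc₁F
      (Finset.ssubset_univ_iff.2 hne_univ) hc₁A
    exact hpair p hp (fun e => hcard (e ▸ hpc)) hpe
  · have hb := h.excess_of_not_subset hc₁ hA hc₁A
    refine hpair c₁ hc₁ hne ?_
    by_cases hv : c₁ ∈ F ∧ Γ.firstVertex c₁ ∈ A
    · refine hb.2.1 ?_
      simp only [hs] at hs₁
      rw [if_pos hv] at hs₁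
      have : (1 : ℝ) < (Γ.quot F c₁ ∩ A).card := by linarith
      exact_mod_cast this
    · refine hθ'.trans (hb.2.2 (fun hm h' => hv ⟨hm, h'⟩) ?_).1
      simp only [hs] at hs₁
      rw [if_neg hv, sub_zero] at hs₁
      exact Finset.card_pos.1 (by exact_mod_cast hs₁)

theorem add_le_sum_excess (hA : A ∈ T.inner) (hu : Γ.quot F Finset.univ ⊆ A) :
    ρ + d ≤ Γ.excess ρ d T F A Finset.univ := by
  have h1 := h.excess_of_subset (Finset.mem_insert_self _ _) hA hu
  have h2 := h.sum_nonfull_nonpos (A := A) (c := Finset.univ) _ subset_rfl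
  rw [if_neg h.univ_notMem] at h1
  linarith

theorem degree_le_powerCount (hA : A ∈ T.inner) (hu : Γ.quot F Finset.univ ⊆ A) :
    Γ.degree ρ d ≤ Γ.powerCount ρ d T F A := by
  have hsum := h.sum_excess_le hA
  have h1 := h.add_le_sum_excess hA hu
  have h2 := Finset.single_le_sum (f := fun c => Γ.excess ρ d T F A c)
    (fun c hc => h.excess_nonneg hc hA) (Finset.mem_insert_self Finset.univ F)
  rw [if_pos hu] at hsum
  linarith

/-- The smallest element of `F ∪ {univ}` containing a given vertex. -/
theorem exists_mem_quot (x : V) : ∃ c ∈ insert Finset.univ F, x ∈ Γ.quot F c ∧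
    ∀ g ∈ F, x ∈ Γ.vertices g → c ⊆ g := by
  have hF := h.isLaminar
  obtain ⟨c, hc, hmin⟩ := Finset.exists_min_image
    ((insert Finset.univ F).filter fun c => x ∈ Γ.vertices c) Finset.card
    ⟨Finset.univ, Finset.mem_filter.2 ⟨Finset.mem_insert_self _ _, by
      rw [vertices_univ h.nonempty h.conn]; exact Finset.mem_univ x⟩⟩
  obtain ⟨hcF, hxc⟩ := Finset.mem_filter.1 hc
  have hno : ∀ g ∈ F, x ∈ Γ.vertices g → ¬ g ⊂ c := fun g hg hxg hgc =>
    absurd (Finset.card_lt_card hgc)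
      (not_lt.2 (hmin g (Finset.mem_filter.2 ⟨Finset.mem_insert_of_mem hg, hxg⟩)))
  refine ⟨c, hcF, mem_quot.2 ⟨hxc, fun g hg hgc hxg => absurd hgc (hno g hg hxg)⟩,
    fun g hg hxg => ?_⟩
  rcases h.compatible hcF g hg with h' | h' | h'
  · by_contra hn
    exact hno g hg hxg ⟨h', hn⟩
  · exact h'
  · exact absurd hxg (Finset.disjoint_right.1 h' hxc)

/-- Power counting at a node that contains the quotient of the whole diagram: a vertex outside
of the node gives a gain, except possibly if it lies in a maximal element of degree zero. -/
theorem exists_child_of_powerCount_lt (hA : A ∈ T.inner) (hu : Γ.quot F Finset.univ ⊆ A)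
    (hlt : Γ.powerCount ρ d T F A < Γ.degree ρ d + θ) {x : V} (hx : x ∉ A) :
    ∃ c ∈ childrenIn F Finset.univ, Γ.subdegree ρ d c = 0 ∧ x ∈ Γ.vertices c ∧
      Γ.vertices c ∩ A = {Γ.firstVertex c} := by
  have hF := h.isLaminar
  have hnu := h.univ_notMem
  have hθ := h.gap_pos
  have hsum := h.sum_excess_le hA
  rw [if_pos hu] at hsum
  have hnn : ∀ c ∈ insert Finset.univ F, 0 ≤ Γ.excess ρ d T F A c := fun c hc =>
    h.excess_nonneg hc hA
  have hsum' := hsum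
  rw [Finset.sum_insert hnu] at hsum'
  have hroot := h.add_le_sum_excess hA hu
  -- The whole diagram already contributes `ρ + d`, so an excess `θ` anywhere else contradicts
  -- `hlt`.
  have hrest : ∀ p ∈ F, ¬ θ ≤ Γ.excess ρ d T F A p := by
    intro p hp hle
    have := Finset.single_le_sum (f := fun c => Γ.excess ρ d T F A c)
      (fun c hc => hnn c (Finset.mem_insert_of_mem hc)) hp
    linarith
  have hrest0 : 0 ≤ ∑ c ∈ F, Γ.excess ρ d T F A c :=
    Finset.sum_nonneg fun c hc => hnn c (Finset.mem_insert_of_mem hc)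
  obtain ⟨c', hc', hxc', -⟩ := h.exists_mem_quot x
  have hc'A : ¬ Γ.quot F c' ⊆ A := fun h' => hx (h' hxc')
  -- Largest ancestor of `c'` whose quotient is not contained in `A`; the quotient of its parent is
  -- then contained in `A`.
  obtain ⟨c, hc, hmax⟩ := Finset.exists_max_image
    ((insert Finset.univ F).filter fun c => c' ⊆ c ∧ ¬ Γ.quot F c ⊆ A) Finset.card
    ⟨c', Finset.mem_filter.2 ⟨hc', subset_rfl, hc'A⟩⟩
  obtain ⟨hcF', hcc', hcA⟩ := Finset.mem_filter.1 hc
  have hcF : c ∈ F := (Finset.mem_insert.1 hcF').resolve_left fun e => hcA (e ▸ hu)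
  obtain ⟨p, hp, hcp⟩ := exists_parent hnu hcF
  have hcp' := (mem_childrenIn.1 hcp).2.1
  have hpA : Γ.quot F p ⊆ A := by
    by_contra hn
    exact absurd (Finset.card_lt_card hcp')
      (not_lt.2 (hmax p (Finset.mem_filter.2 ⟨hp, hcc'.trans hcp'.1, hn⟩)))
  -- A parent in `F` has nonpositive degree, so by strict monotonicity `c` would have negative
  -- degree and give `p` an excess `θ`. The same mechanism at the whole diagram then forces `deg c =
  -- 0`.
  have hp_univ : p = Finset.univ := by
    by_contra hne
    have hpF := (Finset.mem_insert.1 hp).resolve_left hne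
    have h1 := h.mono c p (h.fullDivergent hcF) (h.fullDivergent hpF) hcp'
    have h2 := h.excess_of_child hp hA hpA hcp hcA (h1.trans_le (h.subdegree_nonpos hpF))
    rw [if_pos hpF, zero_add] at h2
    exact hrest p hpF h2
  subst hp_univ
  have hdeg : Γ.subdegree ρ d c = 0 := by
    refine le_antisymm (h.subdegree_nonpos hcF) (not_lt.1 fun hlt' => ?_)
    have h2 := h.excess_of_child hp hA hpA hcp hcA hlt'
    rw [if_neg hnu] at h2
    linarith
  refine ⟨c, hcp, hdeg, vertices_mono hcc' (quot_subset hxc'), ?_⟩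
  have hvA : Γ.firstVertex c ∈ A := hu (hF.firstVertex_child_mem hcp)
  refine Finset.eq_singleton_iff_unique_mem.2
    ⟨Finset.mem_inter.2 ⟨(hF.block c hcF).firstVertex_mem, hvA⟩, fun y hy => ?_⟩
  obtain ⟨hyc, hyA⟩ := Finset.mem_inter.1 hy
  -- A second vertex `y` of `c` in `A` is followed to the largest `f ⊆ c` in whose quotient it
  -- appears. It is not the first vertex of `f`, so `f`, or an ancestor of `f` within `c`, has
  -- excess at least `θ`.
  by_contra hyne
  obtain ⟨f₀, hf₀, hyf₀, hf₀min⟩ := h.exists_mem_quot y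
  have hf₀F : f₀ ∈ F := (Finset.mem_insert.1 hf₀).resolve_left fun e =>
    hcp'.2 (e ▸ hf₀min c hcF hyc)
  obtain ⟨f, hf, hfmax⟩ := Finset.exists_max_image
    (F.filter fun f => f ⊆ c ∧ y ∈ Γ.quot F f) Finset.card
    ⟨f₀, Finset.mem_filter.2 ⟨hf₀F, hf₀min c hcF hyc, hyf₀⟩⟩
  obtain ⟨hfF, hfc, hyf⟩ := Finset.mem_filter.1 hf
  have hyv : y ≠ Γ.firstVertex f := by
    intro e
    have hne : f ≠ c := fun e' => hyne (by rw [e, e'])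
    obtain ⟨q, hq, hfq⟩ := exists_parent hnu hfF
    obtain ⟨-, hfq', hfq''⟩ := mem_childrenIn.1 hfq
    have hqc : q ⊆ c := by
      rcases h.compatible hq c hcF with h' | h' | h'
      · by_contra hn
        exact hfq'' c hcF ⟨h', hn⟩ (Finset.ssubset_iff_subset_ne.2 ⟨hfc, hne⟩)
      · exact h'
      · exact absurd hyc (Finset.disjoint_right.1 h' (vertices_mono hfq'.1 (quot_subset hyf)))
    have hqF : q ∈ F := (Finset.mem_insert.1 hq).resolve_left fun e' =>
      hcp'.2 (e' ▸ hqc)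
    have := hfmax q (Finset.mem_filter.2 ⟨hqF, hqc, by
      rw [e]; exact hF.firstVertex_child_mem hfq⟩)
    exact absurd (Finset.card_lt_card hfq') (not_lt.2 this)
  by_cases hfA : Γ.quot F f ⊆ A
  · have hfc' : f ⊂ c := Finset.ssubset_iff_subset_ne.2 ⟨hfc, fun e => hcA (e ▸ hfA)⟩
    obtain ⟨q, hq, hqc, -, hqe⟩ := h.exists_excess_of_full hcF' hA hcA hfF hfc' hfA
    exact hrest q ((Finset.mem_insert.1 hq).resolve_left fun e => hcp'.2 (e ▸ hqc)) hqe
  · have hfF' : f ∈ insert Finset.univ F := Finset.mem_insert_of_mem hfF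
    have hb := h.excess_of_not_subset hfF' hA hfA
    have hym : y ∈ Γ.quot F f ∩ A := Finset.mem_inter.2 ⟨hyf, hyA⟩
    by_cases hv : Γ.firstVertex f ∈ A
    · exact hrest f hfF (hb.2.1 (Finset.one_lt_card.2
        ⟨y, hym, _, h.firstVertex_mem_inter hfF' hv, hyv⟩))
    · exact hrest f hfF (h.gap_le.trans (hb.2.2 (fun _ => hv) ⟨y, hym⟩).1)

end IsPowerCounting

end FeynmanDiagram

end
noncomputable section

/-! ### Geometric sums -/

/-- Any finite set of families is contained in the product of its projections, where the sum of
products factorises. -/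
theorem ENNReal.tsum_prod_le_prod_tsum {ι : Type*} [Fintype ι] [DecidableEq ι]
    (f : ι → ℕ → ENNReal) : ∑' p : ι → ℕ, ∏ i, f i (p i) ≤ ∏ i, ∑' k, f i k := by
  rw [ENNReal.tsum_eq_iSup_sum]
  refine iSup_le fun s => ?_
  calc ∑ p ∈ s, ∏ i, f i (p i)
      ≤ ∑ p ∈ Fintype.piFinset fun i => s.image fun p => p i, ∏ i, f i (p i) :=
        Finset.sum_le_sum_of_subset fun p hp => Fintype.mem_piFinset.2 fun i =>
          Finset.mem_image_of_mem _ hp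
    _ = ∏ i, ∑ k ∈ s.image fun p => p i, f i k := (Finset.prod_univ_sum _ _).symm
    _ ≤ ∏ i, ∑' k, f i k := Finset.prod_le_prod' fun i _ => ENNReal.sum_le_tsum _

/-- The sum of the geometric series of ratio `2^{-θ}`. -/
def geometricSum (θ : ℝ) : ℝ := (1 - (2 : ℝ) ^ (-θ))⁻¹

theorem two_rpow_neg_lt_one {θ : ℝ} (hθ : 0 < θ) : (2 : ℝ) ^ (-θ) < 1 :=
  Real.rpow_lt_one_of_one_lt_of_neg one_lt_two (neg_lt_zero.2 hθ)

theorem one_le_geometricSum {θ : ℝ} (hθ : 0 < θ) : 1 ≤ geometricSum θ := by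
  have h1 := two_rpow_neg_lt_one hθ
  have h2 : (0 : ℝ) < 2 ^ (-θ) := Real.rpow_pos_of_pos two_pos _
  exact (one_le_inv₀ (by linarith)).2 (by linarith)

theorem tsum_two_rpow {θ : ℝ} (hθ : 0 < θ) :
    ∑' k : ℕ, ENNReal.ofReal (2 ^ (-θ * k)) = ENNReal.ofReal (geometricSum θ) := by
  have h2 : (0 : ℝ) ≤ 2 ^ (-θ) := (Real.rpow_pos_of_pos two_pos _).le
  have h3 : ∀ k : ℕ, (2 : ℝ) ^ (-θ * k) = (2 ^ (-θ)) ^ k := fun k => by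
    rw [Real.rpow_mul two_pos.le, Real.rpow_natCast]
  simp only [h3]
  rw [← ENNReal.ofReal_tsum_of_nonneg (fun k => pow_nonneg h2 k)
    (summable_geometric_of_lt_one h2 (two_rpow_neg_lt_one hθ)),
    tsum_geometric_of_lt_one h2 (two_rpow_neg_lt_one hθ), geometricSum]

theorem tsum_tail_le {θ N : ℝ} (hθ : 0 < θ) {φ : ℕ → ℝ}
    (hφ : ∀ k : ℕ, N ≤ k → k - N ≤ φ k) :
    ∑' k : ℕ, ENNReal.ofReal (2 ^ (-θ * φ (k + (⌊N⌋₊ + 1)))) ≤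
      ENNReal.ofReal (geometricSum θ) := by
  rw [← tsum_two_rpow hθ]
  refine ENNReal.tsum_le_tsum fun k => ENNReal.ofReal_le_ofReal
    (Real.rpow_le_rpow_of_exponent_le one_le_two ?_)
  have h1 := (Nat.lt_floor_add_one N).le
  have h2 := hφ (k + (⌊N⌋₊ + 1)) (by push_cast; linarith [(Nat.cast_nonneg k : (0 : ℝ) ≤ k)])
  push_cast at h2
  have h3 : (k : ℝ) ≤ φ (k + (⌊N⌋₊ + 1)) := by linarith
  nlinarith

/-- At most `N + 1` terms equal to one, followed by a geometric tail. Each logarithm of the final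
estimate comes from such a sum. -/
theorem tsum_plateau_le {θ N : ℝ} (hθ : 0 < θ) (hN : 0 ≤ N) :
    ∑' k : ℕ, ENNReal.ofReal (2 ^ (-θ * max 0 (k - N))) ≤
      ENNReal.ofReal (2 * geometricSum θ * (N + 1)) := by
  have hc := one_le_geometricSum hθ
  rw [← Summable.sum_add_tsum_nat_add' (k := ⌊N⌋₊ + 1) ENNReal.summable]
  have h1 : ∑ k ∈ Finset.range (⌊N⌋₊ + 1), ENNReal.ofReal (2 ^ (-θ * max 0 ((k : ℝ) - N))) ≤
      ENNReal.ofReal (N + 1) := by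
    calc _ ≤ ∑ k ∈ Finset.range (⌊N⌋₊ + 1), (1 : ENNReal) := Finset.sum_le_sum fun k _ => by
          rw [← ENNReal.ofReal_one]
          refine ENNReal.ofReal_le_ofReal (Real.rpow_le_one_of_one_le_of_nonpos one_le_two ?_)
          nlinarith [le_max_left 0 ((k : ℝ) - N)]
      _ = ENNReal.ofReal (⌊N⌋₊ + 1) := by
          rw [Finset.sum_const, Finset.card_range, nsmul_eq_mul, mul_one,
            ← ENNReal.ofReal_natCast]
          push_cast
          rfl
      _ ≤ _ := ENNReal.ofReal_le_ofReal (by linarith [Nat.floor_le hN])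
  have h2 := tsum_tail_le (N := N) hθ (φ := fun k => max 0 ((k : ℝ) - N)) fun k _ => le_max_right _ _
  refine (add_le_add h1 h2).trans ?_
  rw [← ENNReal.ofReal_add (by linarith) (by linarith)]
  exact ENNReal.ofReal_le_ofReal (by nlinarith)

theorem tsum_peak_le {θ N : ℝ} (hθ : 0 < θ) (hN : 0 ≤ N) :
    ∑' k : ℕ, ENNReal.ofReal (2 ^ (-θ * |(k : ℝ) - N|)) ≤
      ENNReal.ofReal (2 * geometricSum θ) := by
  have hc := one_le_geometricSum hθ
  rw [← Summable.sum_add_tsum_nat_add' (k := ⌊N⌋₊ + 1) ENNReal.summable]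
  have h1 : ∑ k ∈ Finset.range (⌊N⌋₊ + 1), ENNReal.ofReal (2 ^ (-θ * |(k : ℝ) - N|)) ≤
      ENNReal.ofReal (geometricSum θ) := by
    rw [← tsum_two_rpow hθ]
    refine le_trans ?_ (ENNReal.sum_le_tsum (Finset.range (⌊N⌋₊ + 1)))
    rw [← Finset.sum_range_reflect]
    refine Finset.sum_le_sum fun k hk => ENNReal.ofReal_le_ofReal
      (Real.rpow_le_rpow_of_exponent_le one_le_two ?_)
    have hk' : k ≤ ⌊N⌋₊ := by have := Finset.mem_range.1 hk; omega
    have h3 : ((⌊N⌋₊ + 1 - 1 - k : ℕ) : ℝ) = ⌊N⌋₊ - k := by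
      rw [Nat.add_sub_cancel, Nat.cast_sub hk']
    rw [h3]
    have h4 := Nat.floor_le hN
    have h5 := neg_le_abs ((⌊N⌋₊ : ℝ) - k - N)
    nlinarith
  have h2 := tsum_tail_le (N := N) hθ (φ := fun k => |(k : ℝ) - N|) fun k _ => le_abs_self _
  refine (add_le_add h1 h2).trans ?_
  rw [← ENNReal.ofReal_add (by linarith) (by linarith)]
  exact ENNReal.ofReal_le_ofReal (by linarith)

/-! ### The exponent of a scale assignment -/

namespace HeppTree

variable {V : Type} [Fintype V] [DecidableEq V] {T : HeppTree V}

/-- Summation by parts: scales are telescoped into increments and the two sums exchanged, so that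
each increment collects the weights of the nodes below it. -/
theorem sum_mul_scale {ι : Type*} (n : T.Scales) (S : Finset ι) (g : ι → Finset V)
    (hg : ∀ i ∈ S, g i ∈ T.inner) (w : ι → ℝ) :
    ∑ i ∈ S, w i * (scale n (g i) : ℝ) =
      ∑ B ∈ T.inner, (increment n B : ℝ) * ∑ i ∈ S.filter (fun i => g i ⊆ B), w i := by
  have h1 : ∀ i ∈ S, w i * (scale n (g i) : ℝ) =
      ∑ B ∈ T.inner, if g i ⊆ B then (increment n B : ℝ) * w i else 0 := fun i hi => by
    rw [scale_eq_sum_increment n (hg i hi), Nat.cast_sum, Finset.sum_filter, Finset.mul_sum]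
    refine Finset.sum_congr rfl fun B _ => ?_
    split_ifs <;> ring
  rw [Finset.sum_congr rfl h1, Finset.sum_comm]
  refine Finset.sum_congr rfl fun B _ => ?_
  rw [Finset.mul_sum, Finset.sum_filter]

/-- Coordinates on the scale assignments: the scale of the node `S`, and the increments of the
scale at all the nodes other than the root. -/
def coordinate (S : Finset V) (n : T.Scales) (A : {A // A ∈ T.inner}) : ℕ :=
  if A.1 = Finset.univ then scale n S else increment n A.1

/-- The increment at the root is recovered from the scale of `S` by removing the other increments
along the path from the root to `S`, and then all the scales are determined. -/
theorem coordinate_injective {S : Finset V} (hS : S ∈ T.inner) :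
    Function.Injective (coordinate (T := T) S) := by
  intro n n' heq
  have hinc : ∀ A ∈ T.inner, A ≠ Finset.univ → increment n A = increment n' A := fun A hA hne => by
    have := congrFun heq ⟨A, hA⟩
    simpa [coordinate, hne] using this
  have hS' : scale n S = scale n' S := by
    have := congrFun heq ⟨Finset.univ, T.root_mem⟩
    simpa [coordinate] using this
  have hsum : ∀ (n : T.Scales) A, A ∈ T.inner → scale n A = increment n Finset.univ +
      ∑ B ∈ (T.inner.filter fun B => A ⊆ B).erase Finset.univ, increment n B := fun n A hA => by
    rw [scale_eq_sum_increment n hA, Finset.add_sum_erase _ _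
      (Finset.mem_filter.2 ⟨T.root_mem, Finset.subset_univ _⟩)]
  have hrest : ∀ A, ∑ B ∈ (T.inner.filter fun B => A ⊆ B).erase Finset.univ, increment n B =
      ∑ B ∈ (T.inner.filter fun B => A ⊆ B).erase Finset.univ, increment n' B := fun A =>
    Finset.sum_congr rfl fun B hB => hinc B (Finset.mem_filter.1 (Finset.mem_of_mem_erase hB)).1
      (Finset.ne_of_mem_erase hB)
  have hroot : increment n Finset.univ = increment n' Finset.univ := by
    rw [hsum n S hS, hsum n' S hS, hrest] at hS'
    omega
  refine Subtype.ext (funext fun A => ?_)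
  rw [← scale_of_mem n A.2, ← scale_of_mem n' A.2, hsum n A.1 A.2, hsum n' A.1 A.2, hrest, hroot]

end HeppTree

namespace FeynmanDiagram

open HeppTree

variable {V E : Type} [Fintype V] [LinearOrder V] [Fintype E] [DecidableEq E]
  {Γ : FeynmanDiagram V E} {F : Finset (Finset E)} {c f g γ : Finset E} {d : ℕ} {ρ θ : ℝ}
  {T : HeppTree V} {A : Finset V}

theorem edgeBound_le_two_rpow {ε N : ℝ} (hε : ε = 2 ^ (-N)) (k : ℕ) (t : EdgeType) :
    edgeBound d ε (2 ^ (-(k : ℝ))) t ≤ 2 ^ (d * (k : ℝ)) ∧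
    (t = .mollified → edgeBound d ε (2 ^ (-(k : ℝ))) t ≤ 2 ^ (d * N)) := by
  have h1 : ∀ x : ℝ, ((2 : ℝ) ^ (-x)) ^ (-(d : ℝ)) = 2 ^ (d * x) := fun x => by
    rw [← Real.rpow_mul two_pos.le]
    ring_nf
  cases t
  · exact ⟨(h1 _).le, fun h => by cases h⟩
  · rw [hε]
    exact ⟨(min_le_left _ _).trans (h1 _).le, fun _ => (min_le_right _ _).trans (h1 _).le⟩

/-- The bound of the integrand times the volume of the Hepp sector. -/
def sectorBound (ρ : ℝ) (d : ℕ) (Γ : FeynmanDiagram V E) {T : HeppTree V}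
    (F : Finset (Finset E)) (ε : ℝ) (n : T.Scales) : ℝ :=
  ((∏ e, edgeBound d ε (radius n (Γ.edgeNode T F e)) (Γ.type e)) *
    ∏ γ ∈ Γ.unsafePart ρ d T F, Γ.gain ρ d n F γ) *
  ∏ A : {A // A ∈ T.inner}, (2 : ℝ) ^ (-(ρ + d) * (n.1 A : ℝ))

/-- The set `M` selects the mollified edges for which the bound `ε ^ (-d)` is used; the choice may
depend on the scales. -/
theorem sectorBound_le {ε N : ℝ} (hε0 : 0 < ε) (hε : ε = 2 ^ (-N)) (n : T.Scales) (M : Finset E)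
    (hM : ∀ e ∈ M, Γ.type e = .mollified) :
    Γ.sectorBound ρ d F ε n ≤ 2 ^ (∑ e, d * (scale n (Γ.edgeNode T F e) : ℝ)
      + ∑ e ∈ M, d * (N - scale n (Γ.edgeNode T F e))
      - ∑ γ ∈ Γ.unsafePart ρ d T F, Γ.gainExponent ρ d γ *
          ((scale n (Γ.lowerNode T F γ) : ℝ) - scale n (Γ.upperNode T F γ))
      - ∑ A ∈ T.inner, (ρ + d) * (scale n A : ℝ)) := by
  have h1 : ∏ e, edgeBound d ε (radius n (Γ.edgeNode T F e)) (Γ.type e) ≤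
      2 ^ (∑ e, d * (scale n (Γ.edgeNode T F e) : ℝ) +
        ∑ e ∈ M, d * (N - scale n (Γ.edgeNode T F e))) := by
    rw [← Finset.univ_inter M, ← Finset.sum_ite_mem, ← Finset.sum_add_distrib,
      Real.rpow_sum_of_pos two_pos]
    refine Finset.prod_le_prod (fun e _ => edgeBound_nonneg hε0 (radius_pos _ _) _) fun e _ => ?_
    have := edgeBound_le_two_rpow (d := d) hε (scale n (Γ.edgeNode T F e)) (Γ.type e)
    unfold radius
    split_ifs with he
    · refine (this.2 (hM e he)).trans_eq ?_
      ring_nf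
    · rw [add_zero]
      exact this.1
  have h2 : ∏ γ ∈ Γ.unsafePart ρ d T F, Γ.gain ρ d n F γ =
      2 ^ (-∑ γ ∈ Γ.unsafePart ρ d T F, Γ.gainExponent ρ d γ *
          ((scale n (Γ.lowerNode T F γ) : ℝ) - scale n (Γ.upperNode T F γ))) := by
    rw [← Finset.sum_neg_distrib, Real.rpow_sum_of_pos two_pos]
    refine Finset.prod_congr rfl fun γ _ => ?_
    unfold gain radius
    rw [← Real.rpow_sub two_pos, ← Real.rpow_mul two_pos.le]
    ring_nf
  have h3 : ∏ A : {A // A ∈ T.inner}, (2 : ℝ) ^ (-(ρ + d) * (n.1 A : ℝ)) =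
      2 ^ (-∑ A ∈ T.inner, (ρ + d) * (scale n A : ℝ)) := by
    rw [← Finset.sum_neg_distrib, ← Finset.sum_coe_sort, Real.rpow_sum_of_pos two_pos]
    refine Finset.prod_congr rfl fun A _ => ?_
    rw [scale_of_mem n A.2, neg_mul]
  rw [sub_eq_add_neg, sub_eq_add_neg, Real.rpow_add two_pos, Real.rpow_add two_pos, ← h2, ← h3]
  unfold sectorBound
  refine mul_le_mul_of_nonneg_right (mul_le_mul_of_nonneg_right h1 ?_) ?_
  · rw [h2]; exact (Real.rpow_pos_of_pos two_pos _).le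
  · rw [h3]; exact (Real.rpow_pos_of_pos two_pos _).le

/-- The nodes other than the root at which power counting fails to improve on the degree of the
whole diagram. -/
def exceptional (ρ : ℝ) (d : ℕ) (Γ : FeynmanDiagram V E) (T : HeppTree V)
    (F : Finset (Finset E)) (θ : ℝ) : Finset (Finset V) :=
  (T.inner.erase Finset.univ).filter fun A => Γ.quot F Finset.univ ⊆ A ∧
    Γ.powerCount ρ d T F A < Γ.degree ρ d + θ

open Classical in
/-- The mollified edges that belong to no element of `F`. -/
def outerMollified (Γ : FeynmanDiagram V E) (F : Finset (Finset E)) :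
    Finset E :=
  (ownEdges F Finset.univ).filter fun e => Γ.type e = .mollified

namespace IsPowerCounting

variable (h : Γ.IsPowerCounting ρ d T F θ)

include h

/-- The gains collected by the increment at `B` are those of lower nodes inside `B` minus those of
upper nodes inside `B`, that is, of the unsafe subdiagrams whose scale interval straddles `B`. -/
theorem sum_scales_eq (n : T.Scales) :
    ∑ e, d * (scale n (Γ.edgeNode T F e) : ℝ)
      - ∑ γ ∈ Γ.unsafePart ρ d T F, Γ.gainExponent ρ d γ *
          ((scale n (Γ.lowerNode T F γ) : ℝ) - scale n (Γ.upperNode T F γ))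
      - ∑ A ∈ T.inner, (ρ + d) * (scale n A : ℝ) =
    -∑ B ∈ T.inner, (increment n B : ℝ) * Γ.powerCount ρ d T F B := by
  classical
  have hF := h.isLaminar
  have hspec := fun (γ : Finset E) (hγ : γ ∈ Γ.unsafePart ρ d T F) => (isUnsafe_of_mem_unsafePart h.safe hγ).upperNode_spec hF h.loop h.conn
    (mem_divergent.1 (Finset.mem_filter.1 hγ).1).1
  have h1 := sum_mul_scale n Finset.univ (fun e => Γ.edgeNode T F e) (fun e _ => lca_mem)
    fun _ => (d : ℝ)
  have h2 := sum_mul_scale n (Γ.unsafePart ρ d T F) (fun γ => Γ.lowerNode T F γ)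
    (fun γ hγ => lowerNode_mem (isUnsafe_of_mem_unsafePart h.safe hγ).block hF)
    (Γ.gainExponent ρ d)
  have h3 := sum_mul_scale n (Γ.unsafePart ρ d T F) (fun γ => Γ.upperNode T F γ)
    (fun γ hγ => (hspec γ hγ).1) (Γ.gainExponent ρ d)
  have h4 := sum_mul_scale n T.inner id (fun A hA => hA) fun _ => ρ + d
  simp only [mul_sub, Finset.sum_sub_distrib]
  simp only [id] at h4
  rw [h1, h2, h3, h4, ← Finset.sum_sub_distrib, ← Finset.sum_sub_distrib,
    ← Finset.sum_sub_distrib, ← Finset.sum_neg_distrib]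
  refine Finset.sum_congr rfl fun B _ => ?_
  have h5 : ∑ γ ∈ (Γ.unsafePart ρ d T F).filter (fun γ => Γ.lowerNode T F γ ⊆ B),
      Γ.gainExponent ρ d γ =
      ∑ γ ∈ (Γ.unsafePart ρ d T F).filter (fun γ => Γ.upperNode T F γ ⊆ B),
        Γ.gainExponent ρ d γ +
      ∑ γ ∈ (Γ.unsafePart ρ d T F).filter (fun γ => Γ.lowerNode T F γ ⊆ B ∧
        ¬ Γ.upperNode T F γ ⊆ B), Γ.gainExponent ρ d γ := by
    rw [← Finset.sum_filter_add_sum_filter_not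
      ((Γ.unsafePart ρ d T F).filter fun γ => Γ.lowerNode T F γ ⊆ B)
      (fun γ => Γ.upperNode T F γ ⊆ B), Finset.filter_filter, Finset.filter_filter]
    congr 1
    refine Finset.sum_congr (Finset.filter_congr fun γ hγ => ?_) fun _ _ => rfl
    exact and_iff_right_of_imp fun h' => (hspec γ hγ).2.1.1.trans h'
  rw [h5]
  unfold powerCount
  simp only [Finset.sum_const, nsmul_eq_mul]
  ring

/-- A vertex missing from an exceptional node lies in a child of degree zero, unique as `ζ ≤ 1`. The
node is then the complement of that child together with its first vertex, so there is at most one.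
-/
theorem card_exceptional_le (hz : Γ.zeta ρ d F ≤ 1) :
    (Γ.exceptional ρ d T F θ).card ≤ Γ.zeta ρ d F := by
  have hmax : ∀ c ∈ childrenIn F Finset.univ, Γ.subdegree ρ d c = 0 →
      c ∈ {γ : Finset E | γ ∈ F ∧ (∀ γ' ∈ F, ¬ γ ⊂ γ') ∧ Γ.subdegree ρ d γ = 0} := by
    intro c hc h0
    obtain ⟨h1, h2, h3⟩ := mem_childrenIn.1 hc
    exact ⟨h1, fun g hg => h3 g hg (Finset.ssubset_univ_iff.2 fun e => h.univ_notMem (e ▸ hg)), h0⟩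
  have hmem : ∀ {B}, B ∈ Γ.exceptional ρ d T F θ → ∀ x ∉ B, ∃ c ∈ childrenIn F Finset.univ,
      Γ.subdegree ρ d c = 0 ∧ x ∈ Γ.vertices c ∧ Γ.vertices c ∩ B = {Γ.firstVertex c} := by
    intro B hB x hx
    obtain ⟨h1, h2, h3⟩ := Finset.mem_filter.1 hB
    exact h.exists_child_of_powerCount_lt (Finset.mem_of_mem_erase h1) h2 h3 hx
  have hout : ∀ {B}, B ∈ Γ.exceptional ρ d T F θ → ∃ x, x ∉ B := fun {B} hB => by
    have := Finset.ne_of_mem_erase (Finset.mem_filter.1 hB).1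
    by_contra! hcon
    exact this (Finset.eq_univ_iff_forall.2 hcon)
  by_cases hne : Γ.zeta ρ d F = 0
  · rw [hne, Nat.le_zero, Finset.card_eq_zero]
    refine Finset.eq_empty_of_forall_notMem fun B hB => ?_
    obtain ⟨x, hx⟩ := hout hB
    obtain ⟨c, hc, h0, -⟩ := hmem hB x hx
    rw [zeta, Set.ncard_eq_zero (Set.toFinite _)] at hne
    exact (hne ▸ hmax c hc h0 : c ∈ (∅ : Set (Finset E)))
  · rw [show Γ.zeta ρ d F = 1 by omega, Finset.card_le_one]
    rw [zeta, Set.ncard_le_one (Set.toFinite _)] at hz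
    intro B hB B' hB'
    obtain ⟨x, hx⟩ := hout hB
    obtain ⟨c, hc, h0, -⟩ := hmem hB x hx
    have key : ∀ {B}, B ∈ Γ.exceptional ρ d T F θ → ∀ y, y ∈ B ↔
        y ∉ Γ.vertices c ∨ y = Γ.firstVertex c := by
      intro B hB y
      have hmem' : ∀ x ∉ B, x ∈ Γ.vertices c ∧ Γ.vertices c ∩ B = {Γ.firstVertex c} := by
        intro x hx
        obtain ⟨c', hc', h0', h1, h2⟩ := hmem hB x hx
        rw [hz c (hmax c hc h0) c' (hmax c' hc' h0')]
        exact ⟨h1, h2⟩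
      obtain ⟨x, hx⟩ := hout hB
      have hint := (hmem' x hx).2
      constructor
      · intro hy
        by_cases hyc : y ∈ Γ.vertices c
        · exact Or.inr (Finset.mem_singleton.1 (hint ▸ Finset.mem_inter.2 ⟨hyc, hy⟩))
        · exact Or.inl hyc
      · rintro (hy | rfl)
        · by_contra hyB
          exact hy (hmem' y hyB).1
        · have : Γ.firstVertex c ∈ Γ.vertices c ∩ B := by
            rw [hint]; exact Finset.mem_singleton_self _
          exact (Finset.mem_inter.1 this).2
    ext y
    rw [key hB, key hB']

/-- The increments at the nodes above the quotient of `Γ` add up to its scale, and each carries at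
least `deg Γ`. All the other nodes, and the nonexceptional ones except the root, carry an additional
`θ`. -/
theorem sum_powerCount_le (n : T.Scales) :
    -∑ B ∈ T.inner, (increment n B : ℝ) * Γ.powerCount ρ d T F B ≤
      -Γ.degree ρ d * scale n (Γ.lowerNode T F Finset.univ)
      - θ * ∑ B ∈ T.inner.erase Finset.univ \ Γ.exceptional ρ d T F θ, (increment n B : ℝ) := by
  classical
  have hA := lowerNode_mem (T := T) (h.block (Finset.mem_insert_self _ _)) h.isLaminar
  rw [scale_eq_sum_increment n hA, Nat.cast_sum, Finset.sum_filter, Finset.mul_sum,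
    Finset.mul_sum]
  have h1 : ∑ B ∈ T.inner.erase Finset.univ \ Γ.exceptional ρ d T F θ, θ * (increment n B : ℝ) =
      ∑ B ∈ T.inner, if B ∈ T.inner.erase Finset.univ \ Γ.exceptional ρ d T F θ then
        θ * (increment n B : ℝ) else 0 := by
    rw [Finset.sum_ite_mem, Finset.inter_eq_right.2
      (Finset.sdiff_subset.trans (Finset.erase_subset _ _))]
  rw [h1, ← Finset.sum_sub_distrib, ← Finset.sum_neg_distrib]
  refine Finset.sum_le_sum fun B hB => ?_
  have ha : (0 : ℝ) ≤ increment n B := Nat.cast_nonneg _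
  have hfull : Γ.lowerNode T F Finset.univ ⊆ B ↔ Γ.quot F Finset.univ ⊆ B :=
    ⟨fun h' => quot_subset_lowerNode.trans h', fun h' => hull_subset hB h'⟩
  by_cases hf : Γ.quot F Finset.univ ⊆ B
  · rw [if_pos (hfull.2 hf)]
    split_ifs with hm
    · obtain ⟨hm1, hm2⟩ := Finset.mem_sdiff.1 hm
      have : Γ.degree ρ d + θ ≤ Γ.powerCount ρ d T F B := by
        by_contra hlt
        exact hm2 (Finset.mem_filter.2 ⟨hm1, hf, not_le.1 hlt⟩)
      nlinarith
    · have := h.degree_le_powerCount hB hf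
      nlinarith
  · rw [if_neg fun h' => hf (hfull.1 h')]
    have h2 := h.le_powerCount_of_not_subset hB hf
    rw [if_pos]
    · nlinarith
    · refine Finset.mem_sdiff.2 ⟨Finset.mem_erase.2 ⟨fun e => hf (e ▸ Finset.subset_univ _), hB⟩,
        fun h' => hf (Finset.mem_filter.1 h').2.1⟩

/-- Mollified edges outside the elements of `F` have nodes inside the hull of the quotient of `Γ`,
so their scales are at least that of the hull. Their cut-off is used only when this scale exceeds
`N`. -/
theorem sectorBound_le_of_lowerNode {ε N : ℝ} (hε0 : 0 < ε) (hε : ε = 2 ^ (-N)) (n : T.Scales) :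
    Γ.sectorBound ρ d F ε n ≤
      2 ^ (-Γ.degree ρ d * scale n (Γ.lowerNode T F Finset.univ)
        + d * (Γ.outerMollified F).card * min 0 (N - scale n (Γ.lowerNode T F Finset.univ))
        - θ * ∑ B ∈ T.inner.erase Finset.univ \ Γ.exceptional ρ d T F θ, (increment n B : ℝ)) := by
  classical
  have hF := h.isLaminar
  have huniv := Finset.mem_insert_self (Finset.univ : Finset E) F
  have hblock := h.block huniv
  have hA := lowerNode_mem (T := T) hblock hF
  have h1 := h.sum_powerCount_le n
  have h2 := h.sum_scales_eq n
  have hd0 : (0 : ℝ) ≤ d := Nat.cast_nonneg d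
  have h3 := sectorBound_le (ρ := ρ) (d := d) (Γ := Γ) (F := F) hε0 hε n ∅ (by simp)
  have h4 := sectorBound_le (ρ := ρ) (d := d) (Γ := Γ) (F := F) hε0 hε n (Γ.outerMollified F)
    fun e he => (Finset.mem_filter.1 he).2
  have h5 : ∑ e ∈ Γ.outerMollified F, d * (N - scale n (Γ.edgeNode T F e)) ≤
      d * (Γ.outerMollified F).card * (N - scale n (Γ.lowerNode T F Finset.univ)) := by
    have : ∀ e ∈ Γ.outerMollified F, d * (N - scale n (Γ.edgeNode T F e)) ≤
        d * (N - scale n (Γ.lowerNode T F Finset.univ)) := fun e he => by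
      have h6 := scale_anti n lca_mem hA (edgeNode_subset_lowerNode (T := T) hF
        (h.compatible huniv) hblock (Finset.mem_filter.1 he).1)
      have h7 : (scale n (Γ.lowerNode T F Finset.univ) : ℝ) ≤ scale n (Γ.edgeNode T F e) := by
        exact_mod_cast h6
      exact mul_le_mul_of_nonneg_left (by linarith) hd0
    refine (Finset.sum_le_sum this).trans_eq ?_
    rw [Finset.sum_const, nsmul_eq_mul]
    ring
  rcases min_choice 0 (N - scale n (Γ.lowerNode T F Finset.univ)) with hm | hm
  · rw [hm]
    refine h3.trans (Real.rpow_le_rpow_of_exponent_le one_le_two ?_)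
    rw [Finset.sum_empty]
    linarith
  · rw [hm]
    refine h4.trans (Real.rpow_le_rpow_of_exponent_le one_le_two ?_)
    linarith

end IsPowerCounting

end FeynmanDiagram

end
noncomputable section

/-! ### Summation over the scale assignments -/

namespace FeynmanDiagram

open HeppTree

variable {V E : Type} [Fintype V] [LinearOrder V] [Fintype E] [DecidableEq E]
  {Γ : FeynmanDiagram V E} {F : Finset (Finset E)} {d : ℕ} {ρ θ : ℝ} {T : HeppTree V}

open Classical in
/-- The rate of decay in the coordinate associated with the node `A`, where `2^{-N}` is the size of
the mollifier. -/
def decayRate (ρ : ℝ) (d : ℕ) (Γ : FeynmanDiagram V E) (T : HeppTree V) (F : Finset (Finset E))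
    (θ N : ℝ) (A : Finset V) (k : ℕ) : ℝ :=
  if A = Finset.univ then (if Γ.degree ρ d = 0 then max 0 (k - N) else |k - N|)
  else if A ∈ Γ.exceptional ρ d T F θ then max 0 (k - N) else k

/-- A concave broken line in `x` with slope `D` before `N` and `D - m ≤ -θ` after: it peaks at `N`,
or has a plateau up to `N` when `D = 0`. -/
theorem le_two_scales {D m θ N x : ℝ} (hm : θ ≤ m - D) (hθ : 0 < θ) (hD : D = 0 ∨ θ ≤ D) :
    D * x + m * min 0 (N - x) ≤ D * N - θ * (if D = 0 then max 0 (x - N) else |x - N|) := by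
  rcases le_total x N with hx | hx
  · rw [min_eq_left (by linarith), max_eq_left (by linarith), abs_of_nonpos (by linarith)]
    split_ifs with h0
    · rw [h0]; linarith
    · have := hD.resolve_left h0
      nlinarith
  · rw [min_eq_right (by linarith), max_eq_right (by linarith), abs_of_nonneg (by linarith), ite_self]
    nlinarith

namespace IsPowerCounting

variable (h : Γ.IsPowerCounting ρ d T F θ) (hz : Γ.zeta ρ d F ≤ 1)
  (hneg : Γ.degree ρ d = 0 ∨ θ ≤ -Γ.degree ρ d)
  (hpos : θ ≤ Γ.degree ρ d + d * (Γ.outerMollified F).card)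

include h hz hneg hpos

/-- Half of the decay in the scale of the hull is kept for its own coordinate. The other half pays
for the exceptional node, whose increment never exceeds this scale. The bound thereby factorises
over the coordinates. -/
theorem sectorBound_le_prod {ε N : ℝ} (hε0 : 0 < ε) (hε : ε = 2 ^ (-N)) (n : T.Scales) :
    Γ.sectorBound ρ d F ε n ≤ 2 ^ (-Γ.degree ρ d * N) * ∏ A : {A // A ∈ T.inner},
      (2 : ℝ) ^ (-(θ / 2) * Γ.decayRate ρ d T F θ N A.1
        (coordinate (Γ.lowerNode T F Finset.univ) n A)) := by
  classical
  have hF := h.isLaminar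
  have hS := lowerNode_mem (T := T) (h.block (Finset.mem_insert_self _ _)) hF
  set S := Γ.lowerNode T F Finset.univ with hSdef
  set X := Γ.exceptional ρ d T F θ with hX
  set x : ℝ := ((scale n S : ℕ) : ℝ) with hx
  set ψ : ℝ := if Γ.degree ρ d = 0 then max 0 (x - N) else |x - N| with hψ
  have hθ := h.gap_pos
  have hXsub : X ⊆ T.inner.erase Finset.univ := Finset.filter_subset _ _
  have h1 := h.sectorBound_le_of_lowerNode hε0 hε n
  have h2 := le_two_scales (D := -Γ.degree ρ d) (m := d * (Γ.outerMollified F).card) (θ := θ)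
    (N := N) (x := x) (by linarith) hθ (hneg.imp_left fun e => by rw [e, neg_zero])
  simp only [neg_eq_zero] at h2
  have hψ0 : max 0 (x - N) ≤ ψ := by
    rw [hψ]
    split_ifs
    · exact le_rfl
    · exact max_le (abs_nonneg _) (le_abs_self _)
  have h3 : ∑ B ∈ X, max 0 ((increment n B : ℝ) - N) ≤ ψ := by
    have hb : ∀ B ∈ X, max 0 ((increment n B : ℝ) - N) ≤ ψ := fun B hB => by
      refine le_trans (max_le_max le_rfl ?_) hψ0
      have hB1 := Finset.mem_of_mem_erase (hXsub hB)
      have hB2 : S ⊆ B := hull_subset hB1 (Finset.mem_filter.1 hB).2.1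
      have : increment n B ≤ scale n S := by
        rw [scale_eq_sum_increment n hS]
        exact Finset.single_le_sum (f := fun B => increment n B) (fun _ _ => Nat.zero_le _)
          (Finset.mem_filter.2 ⟨hB1, hB2⟩)
      have : (increment n B : ℝ) ≤ x := Nat.cast_le.2 this
      linarith
    refine (Finset.sum_le_card_nsmul _ _ _ hb).trans ?_
    rw [nsmul_eq_mul]
    have : (X.card : ℝ) ≤ 1 := by exact_mod_cast (h.card_exceptional_le hz).trans hz
    have := (le_max_left 0 (x - N)).trans hψ0
    nlinarith
  have h4 : ∑ A : {A // A ∈ T.inner}, Γ.decayRate ρ d T F θ N A.1 (coordinate S n A) =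
      ψ + (∑ B ∈ X, max 0 ((increment n B : ℝ) - N) +
        ∑ B ∈ T.inner.erase Finset.univ \ X, (increment n B : ℝ)) := by
    set u : Finset V → ℝ := fun A => if A = Finset.univ then ψ else
      if A ∈ X then max 0 ((increment n A : ℝ) - N) else increment n A with hu
    have e1 : ∀ A : {A // A ∈ T.inner}, Γ.decayRate ρ d T F θ N A.1 (coordinate S n A) =
        u A.1 := fun A => by
      unfold decayRate coordinate
      rw [hu]
      by_cases hA : A.1 = Finset.univ
      · simp only [hA, if_true]
        rfl
      · simp only [hA, if_false]
        rfl
    rw [Finset.sum_congr rfl fun A _ => e1 A, Finset.sum_coe_sort T.inner u,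
      ← Finset.add_sum_erase _ _ T.root_mem, ← Finset.sum_sdiff hXsub]
    simp only [hu, if_true]
    congr 1
    rw [add_comm]
    congr 1
    · refine Finset.sum_congr rfl fun B hB => ?_
      rw [if_neg (Finset.ne_of_mem_erase (hXsub hB)), if_pos hB]
    · refine Finset.sum_congr rfl fun B hB => ?_
      obtain ⟨hB1, hB2⟩ := Finset.mem_sdiff.1 hB
      rw [if_neg (Finset.ne_of_mem_erase hB1), if_neg hB2]
  refine h1.trans ?_
  rw [← Real.rpow_sum_of_pos two_pos, ← Real.rpow_add two_pos, ← Finset.mul_sum, h4]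
  refine Real.rpow_le_rpow_of_exponent_le one_le_two ?_
  have h5 : (0 : ℝ) ≤ ∑ B ∈ T.inner.erase Finset.univ \ X, (increment n B : ℝ) :=
    Finset.sum_nonneg fun _ _ => Nat.cast_nonneg _
  have h6 := mul_le_mul_of_nonneg_left h3 (half_pos hθ).le
  have h7 := mul_nonneg (half_pos hθ).le h5
  have h8 : θ * ψ = θ / 2 * ψ + θ / 2 * ψ := by ring
  have h9 : θ * ∑ B ∈ T.inner.erase Finset.univ \ X, (increment n B : ℝ) =
    θ / 2 * ∑ B ∈ T.inner.erase Finset.univ \ X, (increment n B : ℝ) +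
    θ / 2 * ∑ B ∈ T.inner.erase Finset.univ \ X, (increment n B : ℝ) := by ring
  rw [← hψ] at h2
  rw [mul_add, mul_add, h9]
  linarith

theorem tsum_sectorBound_le {ε N : ℝ} (hε0 : 0 < ε) (hε : ε = 2 ^ (-N)) (hN : 0 ≤ N) :
    ∑' n : T.Scales, ENNReal.ofReal (Γ.sectorBound ρ d F ε n) ≤
      ENNReal.ofReal (2 ^ (-Γ.degree ρ d * N) * ((2 * geometricSum (θ / 2)) ^ T.inner.card *
        ((N + 1) ^ Γ.zeta ρ d F * if Γ.degree ρ d = 0 then N + 1 else 1))) := by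
  classical
  have hθ := half_pos h.gap_pos
  have hg := one_le_geometricSum hθ
  have hS := lowerNode_mem (T := T) (h.block (Finset.mem_insert_self _ _)) h.isLaminar
  have h2D : (0 : ℝ) ≤ 2 ^ (-Γ.degree ρ d * N) := (Real.rpow_pos_of_pos two_pos _).le
  set X := Γ.exceptional ρ d T F θ with hX
  have hXsub : X ⊆ T.inner.erase Finset.univ := Finset.filter_subset _ _
  set v : {A // A ∈ T.inner} → ℕ → ENNReal := fun A k =>
    ENNReal.ofReal (2 ^ (-(θ / 2) * Γ.decayRate ρ d T F θ N A.1 k)) with hv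
  set y : Finset V → ℝ := fun A => if A = Finset.univ then (if Γ.degree ρ d = 0 then N + 1 else 1)
    else if A ∈ X then N + 1 else 1 with hy
  have hy0 : ∀ A, 0 ≤ y A := fun A => by
    simp only [hy]
    split_ifs <;> linarith
  have hvy : ∀ A, ∑' k, v A k ≤ ENNReal.ofReal (2 * geometricSum (θ / 2) * y A.1) := fun A => by
    have hgeo : ∑' k : ℕ, ENNReal.ofReal (2 ^ (-(θ / 2) * k)) ≤
        ENNReal.ofReal (2 * geometricSum (θ / 2) * 1) := by
      rw [tsum_two_rpow hθ]
      exact ENNReal.ofReal_le_ofReal (by linarith)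
    simp only [hv, hy, decayRate]
    split_ifs
    · exact tsum_plateau_le hθ hN
    · rw [mul_one]
      exact tsum_peak_le hθ hN
    · exact tsum_plateau_le hθ hN
    · exact hgeo
  have hyprod : ∏ A : {A // A ∈ T.inner}, (2 * geometricSum (θ / 2) * y A.1) ≤
      (2 * geometricSum (θ / 2)) ^ T.inner.card *
        ((N + 1) ^ Γ.zeta ρ d F * if Γ.degree ρ d = 0 then N + 1 else 1) := by
    rw [Finset.prod_mul_distrib, Finset.prod_const, Finset.card_univ, Fintype.card_coe,
      Finset.prod_coe_sort T.inner y, ← Finset.mul_prod_erase _ _ T.root_mem,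
      ← Finset.prod_sdiff hXsub]
    have e1 : ∏ B ∈ T.inner.erase Finset.univ \ X, y B = 1 := Finset.prod_eq_one fun B hB => by
      obtain ⟨hB1, hB2⟩ := Finset.mem_sdiff.1 hB
      simp only [hy]
      rw [if_neg (Finset.ne_of_mem_erase hB1), if_neg hB2]
    have e2 : ∏ B ∈ X, y B = (N + 1) ^ X.card := by
      rw [← Finset.prod_const]
      refine Finset.prod_congr rfl fun B hB => ?_
      simp only [hy]
      rw [if_neg (Finset.ne_of_mem_erase (hXsub hB)), if_pos hB]
    have e3 : (N + 1) ^ X.card ≤ (N + 1) ^ Γ.zeta ρ d F :=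
      pow_le_pow_right₀ (by linarith) (h.card_exceptional_le hz)
    have e4 : y Finset.univ = if Γ.degree ρ d = 0 then N + 1 else 1 := by
      simp only [hy, if_true]
    rw [e1, e2, one_mul, mul_comm (y _), ← e4]
    exact mul_le_mul_of_nonneg_left (mul_le_mul_of_nonneg_right e3 (hy0 _))
      (pow_nonneg (by linarith) _)
  calc ∑' n : T.Scales, ENNReal.ofReal (Γ.sectorBound ρ d F ε n)
      ≤ ∑' n : T.Scales, ENNReal.ofReal (2 ^ (-Γ.degree ρ d * N)) *
          ∏ A, v A (coordinate (Γ.lowerNode T F Finset.univ) n A) := by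
        refine ENNReal.tsum_le_tsum fun n => ?_
        refine (ENNReal.ofReal_le_ofReal
          (h.sectorBound_le_prod hz hneg hpos hε0 hε n)).trans_eq ?_
        rw [ENNReal.ofReal_mul h2D,
          ENNReal.ofReal_prod_of_nonneg fun A _ => (Real.rpow_pos_of_pos two_pos _).le]
    _ ≤ ENNReal.ofReal (2 ^ (-Γ.degree ρ d * N)) * ∑' p : {A // A ∈ T.inner} → ℕ,
          ∏ A, v A (p A) := by
        rw [ENNReal.tsum_mul_left]
        exact mul_le_mul_right (ENNReal.tsum_comp_le_tsum_of_injective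
          (coordinate_injective hS) fun p => ∏ A, v A (p A)) _
    _ ≤ ENNReal.ofReal (2 ^ (-Γ.degree ρ d * N)) *
          ∏ A : {A // A ∈ T.inner}, ENNReal.ofReal (2 * geometricSum (θ / 2) * y A.1) :=
        mul_le_mul_right ((ENNReal.tsum_prod_le_prod_tsum v).trans
          (Finset.prod_le_prod' fun A _ => hvy A)) _
    _ ≤ _ := by
        rw [← ENNReal.ofReal_prod_of_nonneg fun A _ => mul_nonneg (by linarith) (hy0 _),
          ← ENNReal.ofReal_mul h2D]
        exact ENNReal.ofReal_le_ofReal (mul_le_mul_of_nonneg_left hyprod h2D)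

theorem heppSum_le {Λ : Set (Spacetime d)} {C ε N B : ℝ} (hε0 : 0 < ε) (hε : ε = 2 ^ (-N))
    (hN : 0 ≤ N) (hB : 0 ≤ B) (H : HeppAssignment ρ Λ C V) (W : (V → Spacetime d) → ℝ)
    (hW : ∀ n, ∀ z ∈ H.sector T n, |W z| ≤
      B * ((∏ e, edgeBound d ε (radius n (Γ.edgeNode T F e)) (Γ.type e)) *
          ∏ γ ∈ Γ.unsafePart ρ d T F, Γ.gain ρ d n F γ)) :
    heppSum H T W ≤ ENNReal.ofReal (B * (2 ^ (-Γ.degree ρ d * N) *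
      ((2 * geometricSum (θ / 2)) ^ T.inner.card *
        ((N + 1) ^ Γ.zeta ρ d F * if Γ.degree ρ d = 0 then N + 1 else 1)))) := by
  rw [ENNReal.ofReal_mul hB]
  refine le_trans ?_ (mul_le_mul_right (h.tsum_sectorBound_le hz hneg hpos hε0 hε hN) _)
  rw [← ENNReal.tsum_mul_left]
  refine ENNReal.tsum_le_tsum fun n => ?_
  have hP : 0 ≤ (∏ e, edgeBound d ε (radius n (Γ.edgeNode T F e)) (Γ.type e)) *
      ∏ γ ∈ Γ.unsafePart ρ d T F, Γ.gain ρ d n F γ :=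
    mul_nonneg (Finset.prod_nonneg fun e _ => edgeBound_nonneg hε0 (radius_pos _ _) _)
      (Finset.prod_nonneg fun γ _ => gain_nonneg _ _)
  unfold sectorBound
  rw [ENNReal.ofReal_mul hP, ← mul_assoc, ← ENNReal.ofReal_mul hB]
  exact mul_le_mul_left (iSup₂_le fun z hz' => ENNReal.ofReal_le_ofReal (hW n z hz')) _

end IsPowerCounting

end FeynmanDiagram

/-! ### Uniform gap between the degrees -/

/-- Finitely many reals have a smallest positive element. -/
theorem exists_gap (S : Finset ℝ) : ∃ θ : ℝ, 0 < θ ∧ ∀ x ∈ S, 0 < x → θ ≤ x := by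
  obtain ⟨θ, hθ, hmin⟩ := Finset.exists_min_image (insert 1 (S.filter fun x => 0 < x)) id
    ⟨1, Finset.mem_insert_self _ _⟩
  refine ⟨θ, ?_, fun x hx h0 => hmin x (Finset.mem_insert_of_mem (Finset.mem_filter.2 ⟨hx, h0⟩))⟩
  rcases Finset.mem_insert.1 hθ with rfl | h
  · exact one_pos
  · exact (Finset.mem_filter.1 h).2

/-- A lower bound for the positive values of the combinations of degrees that occur in diagrams
with a bounded number of edges. -/
theorem exists_degree_gap (ρ : ℝ) (d m : ℕ) : ∃ θ : ℝ, 0 < θ ∧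
    ∀ a b : ℕ, a ≤ 2 * m → b ≤ m → ∀ x : ℝ,
      (x = (ρ + d) * (a - 1) - d * b ∨ x = -((ρ + d) * (a - 1) - d * b) ∨
        x = ρ + ((ρ + d) * (a - 1) - d * b) ∨ x = min 1 ρ + ((ρ + d) * (a - 1) - d * b)) →
      0 < x → θ ≤ x := by
  classical
  set g : ℕ × ℕ → ℝ := fun p => (ρ + d) * (p.1 - 1) - d * p.2 with hg
  obtain ⟨θ, hθ, hmin⟩ := exists_gap
    ((Finset.range (2 * m + 1) ×ˢ Finset.range (m + 1)).biUnion fun p =>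
      {g p, -g p, ρ + g p, min 1 ρ + g p})
  refine ⟨θ, hθ, fun a b ha hb x hx h0 => hmin x (Finset.mem_biUnion.2 ⟨(a, b), ?_, ?_⟩) h0⟩
  · rw [Finset.mem_product, Finset.mem_range, Finset.mem_range]
    exact ⟨by simp only; omega, by simp only; omega⟩
  · simp only [Finset.mem_insert, Finset.mem_singleton]
    exact hx

end
-- Uniform constants and conclusion.
namespace FeynmanDiagram

variable {V E : Type} [Fintype V] [LinearOrder V] [Fintype E] [DecidableEq E]
  {Γ : FeynmanDiagram V E} {F : Finset (Finset E)} {d m : ℕ} {ρ θ : ℝ} {T : HeppTree V}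

theorem card_vertices_le (Γ : FeynmanDiagram V E) (γ : Finset E) :
    (Γ.vertices γ).card ≤ 2 * γ.card := by
  have h1 := Finset.card_union_le (γ.image Γ.src) (γ.image Γ.tgt)
  have h2 := Finset.card_image_le (s := γ) (f := Γ.src)
  have h3 := Finset.card_image_le (s := γ) (f := Γ.tgt)
  unfold vertices
  omega

/-- The hypotheses of power counting hold with a uniform gap. -/
theorem isPowerCounting_of_gap (hρ0 : 0 < ρ) (hθ : 0 < θ) (hθ' : θ ≤ ρ + d)
    (hgap : ∀ a b : ℕ, a ≤ 2 * m → b ≤ m → ∀ x : ℝ,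
      (x = (ρ + d) * (a - 1) - d * b ∨ x = -((ρ + d) * (a - 1) - d * b) ∨
        x = ρ + ((ρ + d) * (a - 1) - d * b) ∨ x = min 1 ρ + ((ρ + d) * (a - 1) - d * b)) →
      0 < x → θ ≤ x)
    (hm : Fintype.card E ≤ m) (hsafe : Γ.IsSafeForest ρ d T F) (hloop : ∀ e, Γ.src e ≠ Γ.tgt e)
    (hconn : (Γ.graph Finset.univ).Connected) (hE : (Finset.univ : Finset E).Nonempty)
    (hdeg : ∀ γ ∈ Γ.unsafePart ρ d T F, -ρ < Γ.subdegree ρ d γ)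
    (hmono : ∀ γ γ', Γ.IsFullDivergent ρ d γ → Γ.IsFullDivergent ρ d γ' → γ ⊂ γ' →
      Γ.subdegree ρ d γ < Γ.subdegree ρ d γ') : Γ.IsPowerCounting ρ d T F θ := by
  have hcard : ∀ γ : Finset E, γ.card ≤ m ∧ (Γ.vertices γ).card ≤ 2 * m := fun γ => by
    have h1 := γ.card_le_univ
    have h2 := Γ.card_vertices_le γ
    omega
  refine ⟨hρ0, hθ, hθ', hsafe, hloop, hconn, hE, fun γ hγ => ?_, fun γ hγ => ?_, fun γ hγ => ?_,
    hmono⟩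
  · exact hgap _ _ (hcard γ).2 (hcard γ).1 _ (Or.inl (subdegree_eq ρ d)) hγ
  · have := hgap _ _ (hcard γ).2 (hcard γ).1 (-Γ.subdegree ρ d γ)
      (Or.inr (Or.inl (by rw [subdegree_eq]))) (by linarith)
    linarith
  · refine hgap _ _ (hcard γ).2 (hcard γ).1 _ ?_ (gainExponent_add_pos (hdeg γ hγ))
    rw [subdegree_eq]
    unfold gainExponent
    split_ifs
    · exact Or.inr (Or.inr (Or.inl rfl))
    · exact Or.inr (Or.inr (Or.inr rfl))

end FeynmanDiagram

/-- `C` is arbitrary, but a positive distance bounded on both sides forces `C ≥ 1`, so that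
replacing it by `max C 1` changes nothing. -/
theorem HeppAssignment.isComparable {d : ℕ} {ρ : ℝ} (hρ : 0 < ρ) {Λ : Set (Spacetime d)} {C : ℝ}
    {V : Type} [Fintype V] [DecidableEq V] (H : HeppAssignment ρ Λ C V) {T : HeppTree V}
    {n : T.Scales} {z : V → Spacetime d} (hz : z ∈ H.sector T n) :
    HeppTree.IsComparable n ρ (max C 1) z := by
  obtain ⟨h1, h2, h3⟩ := hz
  intro u v huv
  have h4 := H.comparable z h1 h2 u v huv
  rw [h3] at h4
  have h5 : 0 < scaledNorm ρ (z u - z v) := scaledNorm_pos hρ (sub_ne_zero.2 (h2.ne huv))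
  have hr := HeppTree.radius_pos n (T.lca u v)
  have h4' : C⁻¹ * HeppTree.radius n (T.lca u v) ≤ scaledNorm ρ (z u - z v) ∧
    scaledNorm ρ (z u - z v) ≤ C * HeppTree.radius n (T.lca u v) := h4
  have hC0 : 0 < C := pos_of_mul_pos_left (h5.trans_le h4'.2) hr.le
  have hC : 1 ≤ C := by
    by_contra hlt
    have h6 : 1 < C⁻¹ := (one_lt_inv₀ hC0).2 (not_le.1 hlt)
    have h7 : C⁻¹ ≤ C := le_of_mul_le_mul_right (h4'.1.trans h4'.2) hr
    linarith
  rw [max_eq_left hC]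
  exact h4'

theorem HeppTree.card_inner_le {V : Type} [Fintype V] [DecidableEq V] (T : HeppTree V) :
    T.inner.card ≤ 2 ^ Fintype.card V := by
  rw [← Fintype.card_finset]
  exact T.inner.card_le_univ

namespace SymbolTree.Pairing

variable {N : Type} {τ : SymbolTree N}

theorem exists_ne_root (P : τ.Pairing) : ∃ w, w ≠ τ.root := by
  by_cases h : τ.IsLeaf τ.root
  · exact ⟨_, (P.mate_ne_iff τ.root).2 h⟩
  · obtain ⟨w, hw⟩ := Set.nonempty_iff_ne_empty.2 h
    exact ⟨w, hw.1⟩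

variable [Fintype N] [DecidableEq N] {P : τ.Pairing} [LinearOrder P.Vertex] {ρ : ℝ} {d : ℕ}
  (hρ0 : 0 < ρ) (hρc : (d : ℝ) / 3 < ρ) (hconn : P.diagram.IsTwoConnected)

include hρ0 hρc hconn

/-- With at least one edge, four times the degree is at least `2ρ - 2d`, which exceeds `-4ρ` exactly
because `3ρ > d`. -/
theorem neg_rho_lt_subdegree (hτ : τ.IsFull ∨ τ.IsAlmostFull) {γ : Finset {w : N // w ≠ τ.root}}
    (hγ : P.diagram.IsFullDivergent ρ d γ) : -ρ < P.diagram.subdegree ρ d γ := by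
  have h1 := four_mul_subdegree hρ0 hρc hconn hτ hγ
  have h2 : (1 : ℝ) ≤ γ.card := by exact_mod_cast hγ.nonempty.card_pos
  nlinarith

theorem subdegree_strictMono (hτ : τ.IsFull ∨ τ.IsAlmostFull)
    {γ γ' : Finset {w : N // w ≠ τ.root}} (hγ : P.diagram.IsFullDivergent ρ d γ)
    (hγ' : P.diagram.IsFullDivergent ρ d γ') (hlt : γ ⊂ γ') :
    P.diagram.subdegree ρ d γ < P.diagram.subdegree ρ d γ' := by
  have h1 := four_mul_subdegree hρ0 hρc hconn hτ hγ
  have h2 := four_mul_subdegree hρ0 hρc hconn hτ hγ'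
  have h3 : (γ.card : ℝ) < γ'.card := by exact_mod_cast Finset.card_lt_card hlt
  nlinarith

end SymbolTree.Pairing

theorem proposition6p1 (d : ℕ) (hd : 1 ≤ d) (ρ : ℝ) (hρ0 : 0 < ρ) (hρ2 : ρ ≤ 2)
    (hρc : (d : ℝ) / 3 < ρ)
    (K : Spacetime d → ℝ) (hK : IsSingularKernel ρ (-(d : ℝ)) K)
    (ϱ : Spacetime d → ℝ) (hϱ : IsMollifier ϱ)
    (Λ : Set (Spacetime d)) (hΛ : Bornology.IsBounded Λ) (C : ℝ)
    (ε₀ : ℝ) (hε₀ : ε₀ < 1) :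
    ∃ K₁ : ℝ, 0 < K₁ ∧
      ∀ (N : Type) [Fintype N] [DecidableEq N] (τ : SymbolTree N) (P : τ.Pairing)
        [LinearOrder P.Vertex],
        (τ.IsFull ∨ τ.IsAlmostFull) → P.diagram.IsTwoConnected → P.diagram.degree ρ d ≤ 0 →
        ∀ (H : HeppAssignment ρ Λ C P.Vertex) (T : HeppTree P.Vertex)
          (Fs : Finset (Finset {w : N // w ≠ τ.root})),
          P.diagram.IsSafeForest ρ d T Fs →
          P.diagram.zeta ρ d Fs ≤ 1 ∧
          ∀ ε : ℝ, 0 < ε → ε ≤ ε₀ →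
            (P.diagram.degree ρ d < 0 →
              heppSum H T (P.diagram.renormalisedIntegrand ρ (EdgeType.kernel ρ ε ϱ K) Fs
                  (P.diagram.unsafePart ρ d T Fs)) ≤
                ENNReal.ofReal (K₁ ^ Fintype.card {w : N // w ≠ τ.root} *
                  ε ^ P.diagram.degree ρ d *
                  Real.log ε⁻¹ ^ P.diagram.zeta ρ d Fs)) ∧
            (P.diagram.degree ρ d = 0 →
              heppSum H T (P.diagram.renormalisedIntegrand ρ (EdgeType.kernel ρ ε ϱ K) Fs
                  (P.diagram.unsafePart ρ d T Fs)) ≤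
                ENNReal.ofReal (K₁ ^ Fintype.card {w : N // w ≠ τ.root} *
                  Real.log ε⁻¹ ^ (1 + P.diagram.zeta ρ d Fs))) := by
  classical
  -- Bound on the number of edges of all the diagrams considered. As `|E| ≥ 1`, a uniform constant
  -- `K₁ ≥ 1` is then bounded by `K₁ ^ |E|`.
  set m : ℕ := ⌊2 * (ρ + d) / (3 * ρ - d)⌋₊ with hm
  obtain ⟨B, hB, hbound⟩ := FeynmanDiagram.exists_pointwise_bound hρ0 hρ2 hd hK hϱ
    (le_max_right C 1) m
  obtain ⟨θ₀, hθ₀, hgap₀⟩ := exists_degree_gap ρ d m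
  have hρd : 0 < ρ + d := add_pos_of_pos_of_nonneg hρ0 (Nat.cast_nonneg d)
  set θ : ℝ := min θ₀ (ρ + d) with hθdef
  have hθ : 0 < θ := lt_min hθ₀ hρd
  have hgap : ∀ a b : ℕ, a ≤ 2 * m → b ≤ m → ∀ x : ℝ,
      (x = (ρ + d) * (a - 1) - d * b ∨ x = -((ρ + d) * (a - 1) - d * b) ∨
        x = ρ + ((ρ + d) * (a - 1) - d * b) ∨ x = min 1 ρ + ((ρ + d) * (a - 1) - d * b)) →
      0 < x → θ ≤ x := fun a b ha hb x hx h0 => (min_le_left _ _).trans (hgap₀ a b ha hb x hx h0)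
  have hG : 1 ≤ 2 * geometricSum (θ / 2) := by
    have := one_le_geometricSum (half_pos hθ)
    linarith
  -- One factor per inner node of the tree: there are at most `2 ^ |V|` of them, and `|V| ≤ 2 * m`.
  set G : ℝ := (2 * geometricSum (θ / 2)) ^ 2 ^ (2 * m) with hGdef
  have hG1 : 1 ≤ G := one_le_pow₀ hG
  -- Converts `log₂ ε⁻¹ + 1` into a multiple of `log ε⁻¹`. The second summand absorbs the `1`, which
  -- is where `ε ≤ ε₀ < 1` is used. It enters squared in `K₁`, as there are at most two logarithms.
  set κ : ℝ := max 1 ((Real.log 2)⁻¹ + (Real.log ε₀⁻¹)⁻¹) with hκdef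
  have hκ : 1 ≤ κ := le_max_left _ _
  have hκ2 : κ ≤ κ ^ 2 := by nlinarith
  set K₁ : ℝ := B * G * κ ^ 2 with hK₁def
  have hBG : 1 ≤ B * G := by nlinarith
  have hK₁ : 1 ≤ K₁ := by
    have : 1 ≤ κ ^ 2 := one_le_pow₀ hκ
    rw [hK₁def]; nlinarith
  refine ⟨K₁, by linarith, ?_⟩
  intro N _ _ τ P _ hτ hconn hdeg H T Fs hFs
  have hz := SymbolTree.Pairing.zeta_le_one hρ0 hρc hconn hτ hdeg hFs.1
  refine ⟨hz, fun ε hε hεε₀ => ?_⟩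
  have hcardE : Fintype.card {w : N // w ≠ τ.root} ≤ m :=
    Nat.le_floor (SymbolTree.Pairing.card_edges_le hρ0 hρc hτ hdeg)
  obtain ⟨w₀, hw₀⟩ := P.exists_ne_root
  have hE : (Finset.univ : Finset {w : N // w ≠ τ.root}).Nonempty := ⟨⟨w₀, hw₀⟩, Finset.mem_univ _⟩
  have hdegUnsafe : ∀ γ ∈ P.diagram.unsafePart ρ d T Fs, -ρ < P.diagram.subdegree ρ d γ := by
    intro γ hγ
    have hu := FeynmanDiagram.isUnsafe_of_mem_unsafePart hFs hγ
    exact SymbolTree.Pairing.neg_rho_lt_subdegree hρ0 hρc hconn hτ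
      ⟨(Finset.mem_filter.1 hγ).1, hu.block.full⟩
  have hloop := SymbolTree.Pairing.src_ne_tgt P
  have h := FeynmanDiagram.isPowerCounting_of_gap hρ0 hθ (min_le_right _ _) hgap hcardE hFs hloop
    hconn.1 hE hdegUnsafe fun γ γ' h1 h2 h3 =>
      SymbolTree.Pairing.subdegree_strictMono hρ0 hρc hconn hτ h1 h2 h3
  have hV : Fintype.card P.Vertex ≤ 2 * m := by
    have := P.diagram.card_vertices_le Finset.univ
    rw [FeynmanDiagram.vertices_univ hE hconn.1, Finset.card_univ, Finset.card_univ] at this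
    omega
  have hneg : P.diagram.degree ρ d = 0 ∨ θ ≤ -P.diagram.degree ρ d := by
    rcases hdeg.lt_or_eq with h0 | h0
    · refine Or.inr (hgap _ _ hV hcardE _ (Or.inr (Or.inl ?_)) (by linarith))
      rw [FeynmanDiagram.degree_eq]
    · exact Or.inl h0
  have hpos : θ ≤ P.diagram.degree ρ d + d * (P.diagram.outerMollified Fs).card := by
    have h1 := SymbolTree.Pairing.degree_add_mollified_pos hρ0 hρc hconn hd hρ2 hτ
      (F := FeynmanDiagram.childrenIn Fs Finset.univ)
      (fun γ hγ => h.fullDivergent (FeynmanDiagram.mem_childrenIn.1 hγ).1)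
      (fun γ hγ γ' hγ' hne => h.isLaminar.disjoint_childrenIn hγ hγ' hne)
    have h2 : (Finset.univ.filter fun e : {w : N // w ≠ τ.root} => P.diagram.type e = .mollified ∧
        ∀ γ ∈ FeynmanDiagram.childrenIn Fs Finset.univ, e ∉ γ) = P.diagram.outerMollified Fs := by
      ext e
      rw [FeynmanDiagram.outerMollified, Finset.mem_filter, Finset.mem_filter,
        FeynmanDiagram.mem_ownEdges]
      constructor
      · rintro ⟨-, h3, h4⟩
        refine ⟨⟨Finset.mem_univ e, fun f hf hfu hef => ?_⟩, h3⟩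
        obtain ⟨g, hg, hfg⟩ := FeynmanDiagram.exists_mem_childrenIn hf hfu
        exact h4 g hg (hfg hef)
      · rintro ⟨⟨-, h3⟩, h4⟩
        refine ⟨Finset.mem_univ e, h4, fun γ hγ => ?_⟩
        obtain ⟨h5, h6, -⟩ := FeynmanDiagram.mem_childrenIn.1 hγ
        exact h3 γ h5 h6
    rw [h2] at h1
    have h3 : (P.diagram.outerMollified Fs).card ≤ Fintype.card {w : N // w ≠ τ.root} :=
      Finset.card_le_univ _
    -- Adding `d` for each outer mollified edge amounts to deleting these edges in the formula for
    -- the degree, so the value is among the finitely many to which the gap applies.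
    refine hgap (Fintype.card P.Vertex) (Fintype.card {w : N // w ≠ τ.root} -
      (P.diagram.outerMollified Fs).card) hV (by omega) _ (Or.inl ?_) h1
    rw [FeynmanDiagram.degree_eq, Nat.cast_sub h3]
    ring
  have hε1 : ε < 1 := hεε₀.trans_lt hε₀
  have hε₀0 : 0 < ε₀ := hε.trans_le hεε₀
  have hlog2 : 0 < Real.log 2 := Real.log_pos one_lt_two
  set L : ℝ := Real.log ε⁻¹ with hL
  have hL0 : 0 < L := Real.log_pos ((one_lt_inv₀ hε).2 hε1)
  have hℓ : 0 < Real.log ε₀⁻¹ := Real.log_pos ((one_lt_inv₀ hε₀0).2 hε₀)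
  have hℓL : Real.log ε₀⁻¹ ≤ L := Real.log_le_log (inv_pos.2 hε₀0) (inv_anti₀ hε hεε₀)
  set M : ℝ := L / Real.log 2 with hM
  have hM0 : 0 ≤ M := by positivity
  have hεM : ε = 2 ^ (-M) := by
    rw [Real.rpow_def_of_pos two_pos, hM, hL, Real.log_inv]
    rw [show Real.log 2 * -(-Real.log ε / Real.log 2) = Real.log ε by field_simp]
    exact (Real.exp_log hε).symm
  have hML : M + 1 ≤ κ * L := by
    have h1 : 1 ≤ (Real.log ε₀⁻¹)⁻¹ * L := by
      rw [inv_mul_eq_div, le_div_iff₀ hℓ, one_mul]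
      exact hℓL
    have h2 : (Real.log 2)⁻¹ * L = M := by rw [hM]; ring
    have h3 := mul_le_mul_of_nonneg_right (le_max_right 1 ((Real.log 2)⁻¹ + (Real.log ε₀⁻¹)⁻¹)) hL0.le
    rw [add_mul, h2] at h3
    linarith
  have hmain := h.heppSum_le hz hneg hpos hε hεM hM0 (by linarith : 0 ≤ B) H _
    fun n z hzn => hbound _ _ P.diagram hcardE hloop hconn.1 T Fs hFs hdegUnsafe n z
      (H.isComparable hρ0 hzn) ε hε
  have hεdeg : (2 : ℝ) ^ (-P.diagram.degree ρ d * M) = ε ^ P.diagram.degree ρ d := by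
    rw [hεM, ← Real.rpow_mul two_pos.le]
    ring_nf
  have hGle : (2 * geometricSum (θ / 2)) ^ T.inner.card ≤ G :=
    pow_le_pow_right₀ hG (T.card_inner_le.trans (Nat.pow_le_pow_right two_pos hV))
  have hK₁pow : K₁ ≤ K₁ ^ Fintype.card {w : N // w ≠ τ.root} :=
    le_self_pow₀ hK₁ (by rw [← Finset.card_univ]; exact hE.card_pos.ne')
  have hzpow : (M + 1) ^ P.diagram.zeta ρ d Fs ≤ κ * L ^ P.diagram.zeta ρ d Fs := by
    rcases Nat.le_one_iff_eq_zero_or_eq_one.1 hz with h0 | h0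
    · rw [h0, pow_zero, pow_zero, mul_one]
      exact hκ
    · rw [h0, pow_one, pow_one]
      exact hML
  rw [hεdeg] at hmain
  have hD0 : 0 ≤ ε ^ P.diagram.degree ρ d := Real.rpow_nonneg hε.le _
  have hLz : 0 ≤ L ^ P.diagram.zeta ρ d Fs := pow_nonneg hL0.le _
  have hMz : 0 ≤ (M + 1) ^ P.diagram.zeta ρ d Fs := pow_nonneg (by linarith) _
  have hBG0 : 0 ≤ B * G := by linarith
  refine ⟨fun hlt => ?_, fun h0 => ?_⟩
  · rw [if_neg hlt.ne, mul_one] at hmain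
    refine hmain.trans (ENNReal.ofReal_le_ofReal ?_)
    calc B * (ε ^ P.diagram.degree ρ d * ((2 * geometricSum (θ / 2)) ^ T.inner.card *
          (M + 1) ^ P.diagram.zeta ρ d Fs))
        ≤ B * (ε ^ P.diagram.degree ρ d * (G * (κ ^ 2 * L ^ P.diagram.zeta ρ d Fs))) := by
          refine mul_le_mul_of_nonneg_left (mul_le_mul_of_nonneg_left (mul_le_mul hGle
            (hzpow.trans (mul_le_mul_of_nonneg_right hκ2 hLz)) hMz (by linarith)) hD0) (by linarith)
      _ = K₁ * (ε ^ P.diagram.degree ρ d * L ^ P.diagram.zeta ρ d Fs) := by rw [hK₁def]; ring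
      _ ≤ _ := by
          rw [mul_assoc (K₁ ^ _)]
          exact mul_le_mul_of_nonneg_right hK₁pow (mul_nonneg hD0 hLz)
  · rw [if_pos h0, h0, Real.rpow_zero, one_mul] at hmain
    refine hmain.trans (ENNReal.ofReal_le_ofReal ?_)
    calc B * ((2 * geometricSum (θ / 2)) ^ T.inner.card *
          ((M + 1) ^ P.diagram.zeta ρ d Fs * (M + 1)))
        ≤ B * (G * ((κ * L ^ P.diagram.zeta ρ d Fs) * (κ * L))) := by
          refine mul_le_mul_of_nonneg_left (mul_le_mul hGle
            (mul_le_mul hzpow hML (by linarith) (mul_nonneg (by linarith) hLz))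
            (mul_nonneg hMz (by linarith)) (by linarith)) (by linarith)
      _ = K₁ * L ^ (1 + P.diagram.zeta ρ d Fs) := by rw [hK₁def]; ring
      _ ≤ _ := mul_le_mul_of_nonneg_right hK₁pow (pow_nonneg hL0.le _)
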